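/- All squares are closed and axis-aligned with side length 1; $\square p$ is the unit square centred at $p\in\mathbb{R}^2$. Algorithms are programs for a real RAM: copying, adding, subtracting and comparing real numbers, indirect memory access, comparing integers and changing an integer by a fixed constant, tests, and procedure calls each take one step (there is no floor operation). **Theorem.** (a) There is an algorithm which, given an integer $\Delta\ge 1$ and $\Delta+1$ finite point sets $P_0,\dots,P_\Delta\subset\mathbb{R}^2$, decides whether for all $(p_0,p_\Delta)\in P_0\times P_\Delta$ there exists $(p_1,\dots,p_{\Delta-1})\in P_1\times\cdots\times P_{\Delta-1}$ such that $\square p_i$ intersects $\square p_{i+1}$ for all $i\in\{0,\dots,\Delta-1\}$. There is an absolute constant $C$ such that, for all $\Delta\ge1$ and all inputs of total size $n=\sum_i|P_i|\ge 3$, its running time is at most $$n\,2^{\,C\sqrt{\Delta^3\,\log n\,\log\log n}}.$$ In particular, its running time is $O^*(n)$, that is, $n^{1+o(1)}$ as $n\to\infty$ (with $o(1)$ uniform over all inputs of total size $n$), for every constant $\Delta\ge1$, and more generally for every $\Delta=\Delta(n)\ge1$ with $\Delta(n)=o\bigl(\log^{1/3} n/\log^{1/3}\log n\bigr)$. (b)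 Consequently, there is an algorithm which, given $\Delta\ge 1$ and the centres of $n$ unit squares in the plane, decides whether the intersection graph of the squares (one vertex per square; two distinct vertices are adjacent iff their squares intersect) has diameter at most $\Delta$ (a disconnected graph has infinite diameter), and whose running time is $O^*(n)=n^{1+o(1)}$ for every constant $\Delta\ge1$. -/

import Mathlib

open Filter Topology Asymptotics

/-! ### Unit squares -/

/-- The (closed) axis-aligned unit square centred at `p`. -/
def unitSquare (p : ℝ × ℝ) : Set (ℝ × ℝ) :=
  Set.Icc (p.1 - 1 / 2) (p.1 + 1 / 2) ×ˢ Set.Icc (p.2 - 1 / 2) (p.2 + 1 / 2)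

/-- The unit squares centred at `p` and at `q` intersect. -/
def SquaresMeet (p q : ℝ × ℝ) : Prop :=
  (unitSquare p ∩ unitSquare q).Nonempty

/-- Every `p₀ ∈ P₀` and `p_Δ ∈ P_Δ` are joined by a chain `p₀, p₁, …, p_Δ` with `pᵢ ∈ Pᵢ` in which
consecutive unit squares intersect.  The finite point sets are listed as the input lists them. -/
def AllChained {Δ : ℕ} (P : Fin (Δ + 1) → List (ℝ × ℝ)) : Prop :=
  ∀ a ∈ P 0, ∀ b ∈ P (Fin.last Δ), ∃ p : Fin (Δ + 1) → ℝ × ℝ,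
    p 0 = a ∧ p (Fin.last Δ) = b ∧ (∀ i, p i ∈ P i) ∧
      ∀ i : Fin Δ, SquaresMeet (p i.castSucc) (p i.succ)

/-- The total size of a family of point sets. -/
def totalSize {Δ : ℕ} (P : Fin (Δ + 1) → List (ℝ × ℝ)) : ℕ :=
  ∑ i, (P i).length

/-- The intersection graph of the unit squares centred at `c 0, …, c (n - 1)`. -/
def unitSquareGraph {n : ℕ} (c : Fin n → ℝ × ℝ) : SimpleGraph (Fin n) where
  Adj i j := i ≠ j ∧ SquaresMeet (c i) (c j)
  symm := ⟨fun i j h => ⟨h.1.symm, by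
    have h2 := h.2
    unfold SquaresMeet at h2 ⊢
    rwa [Set.inter_comm]⟩⟩
  loopless := ⟨fun _ h => h.1 rfl⟩

/-! ### The real RAM

A random access machine with integer registers and memory cells (addresses and counters) and real
registers and memory cells.  Reals can be copied, added, subtracted and compared, exactly and in
one step; there is no rounding (floor) operation and no conversion of reals to integers.
Integers are only compared, and changed by fixed constants, so that every integer occurring in a
run is at most linear in the input integers plus the number of steps: integers are machine words
of logarithmically many bits. -/

namespace RealRAM

/-- A state of the machine: integer and real registers, integer and real memory. -/
structure State where
  ireg : ℕ → ℕ
  rreg : ℕ → ℝ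
  imem : ℕ → ℕ
  rmem : ℕ → ℝ

/-- Basic instructions.  The numbers `d a b s` are names of registers; the `k` are constants. -/
inductive Instr where
  /-- `I[d] := k` -/
  | iconst (d k : ℕ)
  /-- `I[d] := I[a] + k` -/
  | iadd (d a k : ℕ)
  /-- `I[d] := max (I[a] - k) 0` -/
  | isub (d a k : ℕ)
  /-- `I[d] := imem[I[a] + I[b]]` -/
  | iload (d a b : ℕ)
  /-- `imem[I[a] + I[b]] := I[s]` -/
  | istore (s a b : ℕ)
  /-- `R[d] := 1` -/
  | rone (d : ℕ)
  /-- `R[d] := R[a]` -/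
  | rcopy (d a : ℕ)
  /-- `R[d] := R[a] + R[b]` -/
  | radd (d a b : ℕ)
  /-- `R[d] := R[a] - R[b]` -/
  | rsub (d a b : ℕ)
  /-- `R[d] := rmem[I[a] + I[b]]` -/
  | rload (d a b : ℕ)
  /-- `rmem[I[a] + I[b]] := R[s]` -/
  | rstore (s a b : ℕ)

/-- The effect of a basic instruction. -/
noncomputable def Instr.apply (σ : State) : Instr → State
  | iconst d k => { σ with ireg := Function.update σ.ireg d k }
  | iadd d a k => { σ with ireg := Function.update σ.ireg d (σ.ireg a + k) }
  | isub d a k => { σ with ireg := Function.update σ.ireg d (σ.ireg a - k) }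
  | iload d a b =>
      { σ with ireg := Function.update σ.ireg d (σ.imem (σ.ireg a + σ.ireg b)) }
  | istore s a b =>
      { σ with imem := Function.update σ.imem (σ.ireg a + σ.ireg b) (σ.ireg s) }
  | rone d => { σ with rreg := Function.update σ.rreg d 1 }
  | rcopy d a => { σ with rreg := Function.update σ.rreg d (σ.rreg a) }
  | radd d a b => { σ with rreg := Function.update σ.rreg d (σ.rreg a + σ.rreg b) }
  | rsub d a b => { σ with rreg := Function.update σ.rreg d (σ.rreg a - σ.rreg b) }
  | rload d a b =>
      { σ with rreg := Function.update σ.rreg d (σ.rmem (σ.ireg a + σ.ireg b)) }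
  | rstore s a b =>
      { σ with rmem := Function.update σ.rmem (σ.ireg a + σ.ireg b) (σ.rreg s) }

/-- Tests: `I[a] < I[b]` and `R[a] < R[b]`. -/
inductive Test where
  | ilt (a b : ℕ)
  | rlt (a b : ℕ)

def Test.Holds (σ : State) : Test → Prop
  | ilt a b => σ.ireg a < σ.ireg b
  | rlt a b => σ.rreg a < σ.rreg b

/-- Commands.  `call p` calls the procedure number `p` of the program. -/
inductive Cmd where
  | skip
  | instr (i : Instr)
  | seq (c d : Cmd)
  | ite (b : Test) (c d : Cmd)
  | loop (b : Test) (c : Cmd)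
  | call (p : ℕ)

/-- A program is a finite list of (possibly recursive) procedures; procedure `0` is the main
program. -/
abbrev Program := List Cmd

/-- The state after a call that was made in state `σ` and whose body ended in state `τ`: the memory
is shared, the caller's registers are restored, and the callee's integer register `0` and real
register `0` are handed over as its results. -/
def State.afterCall (σ τ : State) : State where
  ireg := Function.update σ.ireg 0 (τ.ireg 0)
  rreg := Function.update σ.rreg 0 (τ.rreg 0)
  imem := τ.imem
  rmem := τ.rmem

/-- `Exec A c σ t τ`: in the program `A`, the command `c` started in the state `σ` halts after
exactly `t` steps in the state `τ`.  Every basic instruction, every evaluation of a test and every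
call costs one step.  A called procedure works on a copy of the caller's registers; as a fixed
program names only finitely many registers, this is a constant amount of work. -/
inductive Exec (A : Program) : Cmd → State → ℕ → State → Prop where
  | skip (σ : State) : Exec A .skip σ 1 σ
  | instr (i : Instr) (σ : State) : Exec A (.instr i) σ 1 (i.apply σ)
  | seq {c d : Cmd} {σ τ υ : State} {t u : ℕ} (hc : Exec A c σ t τ) (hd : Exec A d τ u υ) :
      Exec A (.seq c d) σ (t + u) υ
  | iteTrue {b : Test} {c d : Cmd} {σ τ : State} {t : ℕ} (hb : b.Holds σ)
      (hc : Exec A c σ t τ) : Exec A (.ite b c d) σ (1 + t) τ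
  | iteFalse {b : Test} {c d : Cmd} {σ τ : State} {t : ℕ} (hb : ¬ b.Holds σ)
      (hd : Exec A d σ t τ) : Exec A (.ite b c d) σ (1 + t) τ
  | loopTrue {b : Test} {c : Cmd} {σ τ υ : State} {t u : ℕ} (hb : b.Holds σ)
      (hc : Exec A c σ t τ) (hl : Exec A (.loop b c) τ u υ) :
      Exec A (.loop b c) σ (1 + t + u) υ
  | loopFalse {b : Test} {c : Cmd} {σ : State} (hb : ¬ b.Holds σ) :
      Exec A (.loop b c) σ 1 σ
  | call {p : ℕ} {σ τ : State} {t : ℕ} (hp : Exec A (A.getD p .skip) σ t τ) :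
      Exec A (.call p) σ (1 + t) (σ.afterCall τ)

/-- Runs are deterministic: the result and the number of steps are determined by the start. -/
theorem Exec.deterministic {A : Program} {c : Cmd} {σ τ τ' : State} {t t' : ℕ}
    (h : Exec A c σ t τ) (h' : Exec A c σ t' τ') : t = t' ∧ τ = τ' := by
  induction h generalizing t' τ' with
  | skip σ => cases h'; exact ⟨rfl, rfl⟩
  | instr i σ => cases h'; exact ⟨rfl, rfl⟩
  | seq _ _ ih1 ih2 =>
    cases h' with
    | seq k1 k2 =>
      obtain ⟨rfl, rfl⟩ := ih1 k1
      obtain ⟨rfl, rfl⟩ := ih2 k2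
      exact ⟨rfl, rfl⟩
  | iteTrue hb _ ih =>
    cases h' with
    | iteTrue _ k => obtain ⟨rfl, rfl⟩ := ih k; exact ⟨rfl, rfl⟩
    | iteFalse hb' _ => exact absurd hb hb'
  | iteFalse hb _ ih =>
    cases h' with
    | iteTrue hb' _ => exact absurd hb' hb
    | iteFalse _ k => obtain ⟨rfl, rfl⟩ := ih k; exact ⟨rfl, rfl⟩
  | loopTrue hb _ _ ih1 ih2 =>
    cases h' with
    | loopTrue _ k1 k2 =>
      obtain ⟨rfl, rfl⟩ := ih1 k1
      obtain ⟨rfl, rfl⟩ := ih2 k2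
      exact ⟨rfl, rfl⟩
    | loopFalse hb' => exact absurd hb hb'
  | loopFalse hb =>
    cases h' with
    | loopTrue hb' _ _ => exact absurd hb' hb
    | loopFalse _ => exact ⟨rfl, rfl⟩
  | call _ ih =>
    cases h' with
    | call k => obtain ⟨rfl, rfl⟩ := ih k; exact ⟨rfl, rfl⟩

/-- The initial state: all registers are `0`, and the memory holds the input, padded with `0`. -/
def initial (ints : List ℕ) (reals : List ℝ) : State where
  ireg := fun _ => 0
  rreg := fun _ => 0
  imem := fun k => ints.getD k 0
  rmem := fun k => reals.getD k 0

/-- Started in the state `σ`, the program halts and answers, in integer register `0`, whether `Q`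
holds (`1` for yes, `0` for no). -/
def Decides (A : Program) (σ : State) (Q : Prop) : Prop :=
  ∃ t τ, Exec A (.call 0) σ t τ ∧ (Q → τ.ireg 0 = 1) ∧ (¬ Q → τ.ireg 0 = 0)

/-- Started in the state `σ`, the program halts after at most `T` steps. -/
def HaltsWithin (A : Program) (σ : State) (T : ℝ) : Prop :=
  ∃ t τ, Exec A (.call 0) σ t τ ∧ (t : ℝ) ≤ T

/-- The coordinates `x₁, y₁, x₂, y₂, …` of a list of points. -/
def coords (L : List (ℝ × ℝ)) : List ℝ :=
  L.flatMap fun p => [p.1, p.2]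

/-- The input consisting of the point sets `P₀, …, P_Δ`: the integers are `Δ, |P₀|, …, |P_Δ|`, the
reals are the coordinates of the points of `P₀`, then those of `P₁`, and so on. -/
def pointSetsInput {Δ : ℕ} (P : Fin (Δ + 1) → List (ℝ × ℝ)) : State :=
  initial (Δ :: List.ofFn fun i => (P i).length) (coords (List.ofFn P).flatten)

/-- The input consisting of the number `Δ` and the centres of `n` unit squares: the integers are
`Δ, n`, the reals are the coordinates of the centres. -/
def squaresInput (Δ : ℕ) {n : ℕ} (c : Fin n → ℝ × ℝ) : State :=
  initial [Δ, n] (coords (List.ofFn c))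

end RealRAM

/-! Reduction to a grid. Fix a point `c` of `P₀`. If the answer is yes and `P_Δ` is not empty, then
in each coordinate all points of `P₀` are within `2Δ` of `c`, and all points of a chain within `3Δ`.
So a point of `P₀` or `P_Δ` outside the window of side `6Δ` around `c` means no; otherwise all
points outside the window can be dropped without changing the answer (`unchained_windowItems`). A
remaining point consists of a cell of the unit grid, found with `O(Δ)` additions and comparisons,
and two fractional parts. Two coordinates differ by at most 1 iff the cells are equal, or they are
neighbours and the fractional part in the upper cell is at most the one in the lower cell
(`abs_sub_le_one_iff`). Hence only the order of the fractional parts matters. Sorting, with ties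
broken in favour of the higher cell, replaces them by pairwise distinct ranks, which are bit strings
of length `O(log n)` (`IsRanking.le_iff`).

Search for a pair without a chain. The first ranks are cut into `D` chunks of `k` bits, and a node
of the search tree consists of the points with a common prefix of chunks. Let `a` lie in the child
with chunk `c`. A chain from `a` to `b` in the node either stays in the child or has a first link `p
q` that leaves it (`con_split`). For such a link the comparison of the first ranks is decided by the
chunks of `p` and `q`, and that of `p` is `c`. So once the layer and the cell of `p` are fixed, the
condition on the first coordinate concerns `q` alone, and what remains is one comparison of second
ranks, in one of two directions. For each of these `O(Δ³)` tests (layer, cell, direction) let `F a`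
be the largest value of a `p` that `a` reaches inside the child, and `G b` the smallest value of an
admissible `q` that reaches `b` in the node. The test finds a link iff `F a > G b`
(`Good.exists_test`, `Good.linked_of_test`). Thus `a` and `b` are not joined iff the vector of `a`
is dominated by the vector of `b` and there is no chain inside the child (`Good.not_con_iff`). If
`b` is outside the child, the second condition is automatic and a dominance query finds the pair; if
`b` is inside, the search goes on in the child and carries the vectors along (`Good.badPair_iff`).
At depth `D` all ranks of a node agree, and no pair is left. The vectors themselves come from
propagating maxima from layer to layer, which is again dominance, with four keys (`propV_spec`).

Cost. Dominance for `N` vectors with `h` keys of `w` bits takes about `N (w + 2) ^ h` steps, by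
branching on bits (`ev_dom`). The vectors have `O(Δ³ D)` keys of `O(log n)` bits, and a node spends
this much per record for each of its at most `2 ^ (k + 1)` columns. The total is `n 2 ^ O(k + Δ³ D
log log n)` with `k` about `log n / D`, and `D` about `√(log n / (Δ³ log log n))` balances the two
terms. If this `D` rounds to 0, then `n` is so small compared with `2 ^ √(Δ³ log n log log n)` that
quadratic brute force is within the bound (`costSearch_le`).

Machine. The algorithm is written in a small first-order functional language with a cost semantics,
and compiled to the real RAM with a loss of a factor 20 (`Eval.correct`). The lemmas `ev_…` show
that a procedure computes the intended function within an explicit cost.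

Diameter. For part (b) all `Δ + 1` point sets are the set of centres. Every square meets itself, so
chains are the same as walks of length at most `Δ` (`chained_replicate_iff`), and the factor `Δ + 1`
in the size is absorbed into the exponent (`exists_timeBound_mul`). -/

namespace RealRAM


/-! ### A first-order functional language on the real RAM

Values are trees with natural numbers and reals at the leaves.  They are stored in a heap that only
grows; the integer cell `0` holds the first free address. -/

/-- Values of the functional language. -/
inductive Val where
  | nat (k : ℕ)
  | real (x : ℝ)
  | pair (a b : Val)

/-- Expressions.  `v j` is the `j`-th variable of the environment, `ix k` the `k`-th from its end;
`letE` appends one variable, and the body of `fold` sees the accumulator and then the current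
element of the list appended. -/
inductive Ex where
  | v (j : ℕ)
  | ix (k : ℕ)
  | nat (k : ℕ)
  | succ (e : Ex)
  | pred (e : Ex)
  | lt (a b : Ex)
  | cons (a b : Ex)
  | car (e : Ex)
  | cdr (e : Ex)
  | ifz (c a b : Ex)
  | letE (a b : Ex)
  | fold (l i b : Ex)
  | call (p : ℕ) (xs : List ℕ)
  | one
  | add (a b : Ex)
  | sub (a b : Ex)
  | rlt (a b : Ex)
  | inI (e : Ex)
  | inR (e : Ex)

/-- A procedure: the number of its arguments and its body. -/
structure Proc where
  arity : ℕ
  body : Ex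

/-- The read-only part of the memory. -/
structure Input where
  ints : ℕ → ℕ
  reals : ℕ → ℝ
  nInts : ℕ
  nReals : ℕ

/-- The empty list is the number 0, and a pair never has address 0, so `ifz` also serves as the test
for emptiness. -/
def Val.ofList : List Val → Val
  | [] => .nat 0
  | a :: l => .pair a (ofList l)

/-- Which branch `ifz` takes. -/
def Val.isZero : Val → Option Bool
  | .nat k => some (k == 0)
  | .pair _ _ => some false
  -- A real may be stored at address 0, so its word does not determine a branch.
  | .real _ => none

/-- Big-step semantics with costs. -/
inductive Eval (P : List Proc) (I : Input) : List Val → Ex → Val → ℕ → Prop where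
  | v {env j x} (h : env[j]? = some x) : Eval P I env (.v j) x 1
  -- Counting from the end lets the derived forms refer to the variables of the body of a fold,
  -- whatever the length of the environment.
  | ix {env k x} (hk : k < env.length) (h : env[env.length - 1 - k]? = some x) :
      Eval P I env (.ix k) x 1
  | nat {env} (k) : Eval P I env (.nat k) (.nat k) 1
  | succ {env e k t} (h : Eval P I env e (.nat k) t) : Eval P I env (.succ e) (.nat (k + 1)) (t + 1)
  | pred {env e k t} (h : Eval P I env e (.nat k) t) : Eval P I env (.pred e) (.nat (k - 1)) (t + 1)
  | lt {env a b k l t u} (ha : Eval P I env a (.nat k) t) (hb : Eval P I env b (.nat l) u) :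
      Eval P I env (.lt a b) (.nat (if k < l then 1 else 0)) (t + u + 1)
  | cons {env a b x y t u} (ha : Eval P I env a x t) (hb : Eval P I env b y u) :
      Eval P I env (.cons a b) (.pair x y) (t + u + 1)
  | car {env e x y t} (h : Eval P I env e (.pair x y) t) : Eval P I env (.car e) x (t + 1)
  | cdr {env e x y t} (h : Eval P I env e (.pair x y) t) : Eval P I env (.cdr e) y (t + 1)
  | ifzT {env c a b x y t u} (hc : Eval P I env c x t) (hx : x.isZero = some true)
      (ha : Eval P I env a y u) : Eval P I env (.ifz c a b) y (t + u + 1)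
  | ifzF {env c a b x y t u} (hc : Eval P I env c x t) (hx : x.isZero = some false)
      (hb : Eval P I env b y u) : Eval P I env (.ifz c a b) y (t + u + 1)
  | letE {env a b x y t u} (ha : Eval P I env a x t) (hb : Eval P I (env ++ [x]) b y u) :
      Eval P I env (.letE a b) y (t + u + 1)
  -- Accumulators and costs are functions of the position. This makes the premise on the body a
  -- plain universally quantified one, instead of a second relation defined by recursion on lists.
  | fold {env l i b t u} (xs : List Val) (acc : ℕ → Val) (c : ℕ → ℕ)
      (hl : Eval P I env l (.ofList xs) t) (hi : Eval P I env i (acc 0) u)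
      (hb : ∀ (k : ℕ) (x : Val), xs[k]? = some x →
        Eval P I (env ++ [acc k, x]) b (acc (k + 1)) (c k)) :
      Eval P I env (.fold l i b) (acc xs.length)
        (t + u + (∑ k ∈ Finset.range xs.length, (c k + 1)) + 1)
  | call {env p xs pr vals y t} (hp : P[p]? = some pr) (hl : xs.length = pr.arity)
      (hv : xs.map (fun j => env[j]?) = vals.map some) (hb : Eval P I vals pr.body y t) :
      Eval P I env (.call p xs) y (t + xs.length + 1)
  | one {env} : Eval P I env .one (.real 1) 1
  | add {env a b x y t u} (ha : Eval P I env a (.real x) t) (hb : Eval P I env b (.real y) u) :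
      Eval P I env (.add a b) (.real (x + y)) (t + u + 1)
  | sub {env a b x y t u} (ha : Eval P I env a (.real x) t) (hb : Eval P I env b (.real y) u) :
      Eval P I env (.sub a b) (.real (x - y)) (t + u + 1)
  | rlt {env a b x y t u} (z : ℕ) (ha : Eval P I env a (.real x) t)
      (hb : Eval P I env b (.real y) u) (h1 : x < y → z = 1) (h0 : ¬ x < y → z = 0) :
      Eval P I env (.rlt a b) (.nat z) (t + u + 1)
  -- The integer cell 0 is excluded because at run time it holds the heap pointer.
  | inI {env e k t} (h : Eval P I env e (.nat k) t) (h0 : 0 < k) (h1 : k < I.nInts) :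
      Eval P I env (.inI e) (.nat (I.ints k)) (t + 1)
  | inR {env e k t} (h : Eval P I env e (.nat k) t) (h1 : k < I.nReals) :
      Eval P I env (.inR e) (.real (I.reals k)) (t + 1)

/-! #### Compilation -/

/-- The register of an environment variable, of a temporary value, of an argument. -/
def regE (j : ℕ) : ℕ := 3 * j + 1
def regT (j : ℕ) : ℕ := 3 * j + 2
def regA (j : ℕ) : ℕ := 3 * j + 3

/-- Basic instructions followed by a command. -/
def code (is : List Instr) (c : Cmd) : Cmd := is.foldr (fun i c => .seq (.instr i) c) c

/-- Basic instructions. -/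
def block (is : List Instr) : Cmd := code is .skip

/-- Allocate a pair whose components are in the temporaries `s` and `s + 1`. -/
def allocPair (s : ℕ) : Cmd :=
  block [.iconst (regT (s + 2)) 0, .iload 0 (regT (s + 2)) (regT (s + 2)),
    .istore (regT s) 0 (regT (s + 2)), .iconst (regT (s + 2)) 1,
    .istore (regT (s + 1)) 0 (regT (s + 2)), .iadd (regT s) 0 2, .iconst (regT (s + 2)) 0,
    .istore (regT s) (regT (s + 2)) (regT (s + 2))]

/-- Allocate a cell for the real in the real register `0`. -/
def allocReal (s : ℕ) : Cmd :=
  block [.iconst (regT (s + 2)) 0, .iload 0 (regT (s + 2)) (regT (s + 2)),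
    .rstore 0 0 (regT (s + 2)), .iadd (regT s) 0 1,
    .istore (regT s) (regT (s + 2)) (regT (s + 2))]

/-- Load the reals at the addresses in temporary `s` and in register `0`. -/
def loadReals (s : ℕ) (c : Cmd) : Cmd :=
  code [.iconst (regT (s + 1)) 0, .rload 0 (regT s) (regT (s + 1)), .rload 1 0 (regT (s + 1))] c

/-- The loop of `fold`. -/
def foldLoop (d s : ℕ) (body : Cmd) : Cmd :=
  .loop (.ilt (regT (s + 1)) (regT s))
    (code [.iload (regE (d + 1)) (regT s) (regT (s + 1)), .iconst (regT (s + 2)) 1,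
        .iload (regT s) (regT s) (regT (s + 2))]
      (.seq body (block [.iadd (regE d) 0 0])))

/-- Compile an expression: `d` variables are in use, and `s` temporaries.  The result is left in
the integer register `0`. -/
def comp (d s : ℕ) : Ex → Cmd
  | .v j => block [.iadd 0 (regE j) 0]
  | .ix k => block [.iadd 0 (regE (d - 1 - k)) 0]
  | .nat k => block [.iconst 0 k]
  | .succ e => .seq (comp d s e) (block [.iadd 0 0 1])
  | .pred e => .seq (comp d s e) (block [.isub 0 0 1])
  | .lt a b => .seq (comp d s a) (.seq (block [.iadd (regT s) 0 0]) (.seq (comp d (s + 1) b)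
      (.ite (.ilt (regT s) 0) (block [.iconst 0 1]) (block [.iconst 0 0]))))
  | .cons a b => .seq (comp d s a) (.seq (block [.iadd (regT s) 0 0]) (.seq (comp d (s + 1) b)
      (.seq (block [.iadd (regT (s + 1)) 0 0]) (allocPair s))))
  | .car e => .seq (comp d s e) (block [.iconst (regT s) 0, .iload 0 0 (regT s)])
  | .cdr e => .seq (comp d s e) (block [.iconst (regT s) 1, .iload 0 0 (regT s)])
  | .ifz c a b => .seq (comp d s c) (.seq (block [.iconst (regT s) 1])
      (.ite (.ilt 0 (regT s)) (comp d s a) (comp d s b)))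
  | .letE a b => .seq (comp d s a) (.seq (block [.iadd (regE d) 0 0]) (comp (d + 1) s b))
  | .fold l i b => .seq (comp d s l) (.seq (block [.iadd (regT s) 0 0]) (.seq (comp d (s + 1) i)
      (.seq (block [.iadd (regE d) 0 0, .iconst (regT (s + 1)) 0])
        (.seq (foldLoop d s (comp (d + 2) (s + 2) b)) (block [.iadd 0 (regE d) 0])))))
  -- Arguments pass through registers of their own. The callee starts with a copy of the caller's
  -- registers, and moving arguments directly into the variables might overwrite one that is still
  -- to be read. The shift by one leaves number 0 to the main program.
  | .call p xs => .seq (block (xs.zipIdx.map fun y => .iadd (regA y.2) (regE y.1) 0)) (.call (p + 1))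
  | .one => .seq (block [.rone 0]) (allocReal s)
  | .add a b => .seq (comp d s a) (.seq (block [.iadd (regT s) 0 0]) (.seq (comp d (s + 1) b)
      (.seq (loadReals s (block [.radd 0 0 1])) (allocReal s))))
  | .sub a b => .seq (comp d s a) (.seq (block [.iadd (regT s) 0 0]) (.seq (comp d (s + 1) b)
      (.seq (loadReals s (block [.rsub 0 0 1])) (allocReal s))))
  | .rlt a b => .seq (comp d s a) (.seq (block [.iadd (regT s) 0 0]) (.seq (comp d (s + 1) b)
      (loadReals s (.ite (.rlt 0 1) (block [.iconst 0 1]) (block [.iconst 0 0])))))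
  | .inI e => .seq (comp d s e) (block [.iconst (regT s) 0, .iload 0 0 (regT s)])
  -- A real is represented by its address and the input is in place, so the index is already the
  -- result.
  | .inR e => comp d s e

/-- Compile a procedure. -/
def Proc.comp (pr : Proc) : Cmd :=
  .seq (block ((List.range pr.arity).map fun j => .iadd (regE j) (regA j) 0))
    (RealRAM.comp pr.arity 0 pr.body)

/-! #### Correctness of the compilation -/

/-- The word `w` represents the value in the state `σ`. -/
def Rep (σ : State) : Val → ℕ → Prop
  | .nat k, w => w = k
  | .real x, w => w < σ.imem 0 ∧ σ.rmem w = x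
  | .pair a b, w => 0 < w ∧ w + 1 < σ.imem 0 ∧ Rep σ a (σ.imem w) ∧ Rep σ b (σ.imem (w + 1))

/-- The heap of `τ` extends that of `σ`. -/
def Ext (σ τ : State) : Prop :=
  σ.imem 0 ≤ τ.imem 0 ∧ (∀ a, 0 < a → a < σ.imem 0 → τ.imem a = σ.imem a) ∧
    ∀ a, a < σ.imem 0 → τ.rmem a = σ.rmem a

theorem Ext.refl (σ : State) : Ext σ σ := ⟨le_rfl, fun _ _ _ => rfl, fun _ _ => rfl⟩

theorem Ext.trans {σ τ υ : State} (h : Ext σ τ) (k : Ext τ υ) : Ext σ υ :=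
  ⟨h.1.trans k.1, fun a h0 h1 => (k.2.1 a h0 (h1.trans_le h.1)).trans (h.2.1 a h0 h1),
    fun a h1 => (k.2.2 a (h1.trans_le h.1)).trans (h.2.2 a h1)⟩

/-- Everything reachable from a represented value lies below the heap pointer, where an extension
overwrites nothing. So representations survive any further computation. -/
theorem Rep.ext {σ τ : State} (h : Ext σ τ) : ∀ {x : Val} {w : ℕ}, Rep σ x w → Rep τ x w
  | .nat _, _, hr => hr
  | .real _, w, hr => ⟨hr.1.trans_le h.1, (h.2.2 w hr.1).trans hr.2⟩
  | .pair a b, w, hr => by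
    obtain ⟨h0, h1, ha, hb⟩ := hr
    refine ⟨h0, h1.trans_le h.1, ?_, ?_⟩
    · rw [h.2.1 w h0 (by omega)]; exact Rep.ext h ha
    · rw [h.2.1 (w + 1) (by omega) h1]; exact Rep.ext h hb

/-- The heap pointer is valid and the input is in place. -/
structure Input.Valid (I : Input) (σ : State) : Prop where
  pos : 0 < σ.imem 0
  nInts : I.nInts ≤ σ.imem 0
  nReals : I.nReals ≤ σ.imem 0
  ints : ∀ a, 0 < a → a < I.nInts → σ.imem a = I.ints a
  reals : ∀ a, a < I.nReals → σ.rmem a = I.reals a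

theorem Input.Valid.ext {I : Input} {σ τ : State} (h : I.Valid σ) (e : Ext σ τ) : I.Valid τ where
  pos := h.pos.trans_le e.1
  nInts := h.nInts.trans e.1
  nReals := h.nReals.trans e.1
  ints a h0 h1 := (e.2.1 a h0 (h1.trans_le h.nInts)).trans (h.ints a h0 h1)
  reals a h1 := (e.2.2 a (h1.trans_le h.nReals)).trans (h.reals a h1)

/-- The environment is in its registers. -/
def EnvRep (σ : State) (env : List Val) : Prop :=
  ∀ (j : ℕ) (x : Val), env[j]? = some x → Rep σ x (σ.ireg (regE j))

/-- `τ` comes from `σ` by extending the heap and leaving `d` variables and `s` temporaries alone. -/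
structure Frame (d s : ℕ) (σ τ : State) : Prop where
  ext : Ext σ τ
  env : ∀ j, j < d → τ.ireg (regE j) = σ.ireg (regE j)
  tmp : ∀ j, j < s → τ.ireg (regT j) = σ.ireg (regT j)

theorem Frame.trans {d s : ℕ} {σ τ υ : State} (h : Frame d s σ τ) (k : Frame d s τ υ) :
    Frame d s σ υ :=
  ⟨h.ext.trans k.ext, fun j hj => (k.env j hj).trans (h.env j hj),
    fun j hj => (k.tmp j hj).trans (h.tmp j hj)⟩

theorem Frame.mono {d s d' s' : ℕ} {σ τ : State} (h : Frame d s σ τ) (hd : d' ≤ d) (hs : s' ≤ s) :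
    Frame d' s' σ τ :=
  ⟨h.ext, fun j hj => h.env j (hj.trans_le hd), fun j hj => h.tmp j (hj.trans_le hs)⟩

theorem EnvRep.frame {d s : ℕ} {σ τ : State} {env : List Val} (h : EnvRep σ env)
    (hf : Frame d s σ τ) (hd : env.length ≤ d) : EnvRep τ env := by
  intro j x hj
  rw [hf.env j (((List.getElem?_eq_some_iff.1 hj).1).trans_le hd)]
  exact (h j x hj).ext hf.ext

theorem EnvRep.snoc {σ : State} {env : List Val} {x : Val} (h : EnvRep σ env)
    (hx : Rep σ x (σ.ireg (regE env.length))) : EnvRep σ (env ++ [x]) := by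
  intro j y hj
  rcases lt_trichotomy j env.length with hl | rfl | hl
  · rw [List.getElem?_append_left hl] at hj; exact h j y hj
  · simp at hj; exact hj ▸ hx
  · rw [List.getElem?_eq_none (by simp; omega)] at hj; simp at hj

/-- Set an integer register. -/
def State.set (σ : State) (r w : ℕ) : State := { σ with ireg := Function.update σ.ireg r w }

@[simp] theorem State.set_imem (σ : State) (r w : ℕ) : (σ.set r w).imem = σ.imem := rfl
@[simp] theorem State.set_rmem (σ : State) (r w : ℕ) : (σ.set r w).rmem = σ.rmem := rfl
@[simp] theorem State.set_ireg_self (σ : State) (r w : ℕ) : (σ.set r w).ireg r = w := by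
  simp [State.set]
theorem State.set_ireg_ne (σ : State) {r q : ℕ} (w : ℕ) (h : q ≠ r) :
    (σ.set r w).ireg q = σ.ireg q := by
  simp [State.set, h]

theorem Frame.set {d s : ℕ} (σ : State) {r : ℕ} (w : ℕ) (hd : ∀ j, j < d → r ≠ regE j)
    (hs : ∀ j, j < s → r ≠ regT j) : Frame d s σ (σ.set r w) :=
  ⟨Ext.refl σ, fun j hj => σ.set_ireg_ne w (hd j hj).symm,
    fun j hj => σ.set_ireg_ne w (hs j hj).symm⟩

theorem Frame.refl (d s : ℕ) (σ : State) : Frame d s σ σ :=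
  ⟨Ext.refl σ, fun _ _ => rfl, fun _ _ => rfl⟩

theorem exec_code {A : Program} {c : Cmd} {t : ℕ} {τ : State} :
    ∀ (is : List Instr) (σ : State), Exec A c (is.foldl Instr.apply σ) t τ →
      Exec A (code is c) σ (is.length + t) τ
  | [], σ, h => by simpa [code] using h
  | i :: is, σ, h => by
    have := Exec.seq (Exec.instr (A := A) i σ) (exec_code is (i.apply σ) h)
    rw [List.length_cons, Nat.add_right_comm, Nat.add_comm]
    simpa [code, Nat.add_comm, Nat.add_assoc, Nat.add_left_comm] using this

theorem exec_block {A : Program} (is : List Instr) (σ : State) :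
    Exec A (block is) σ (is.length + 1) (is.foldl Instr.apply σ) :=
  exec_code is σ (.skip _)

theorem exec_iadd {A : Program} (d a k : ℕ) (σ : State) :
    Exec A (block [.iadd d a k]) σ 2 (σ.set d (σ.ireg a + k)) :=
  exec_block _ σ

theorem exec_iconst {A : Program} (d k : ℕ) (σ : State) :
    Exec A (block [.iconst d k]) σ 2 (σ.set d k) :=
  exec_block _ σ

theorem exec_allocPair {A : Program} (d s : ℕ) (σ : State) (h0 : 0 < σ.imem 0) :
    ∃ τ, Exec A (allocPair s) σ 9 τ ∧ Frame d s σ τ ∧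
      ∀ a b, Rep σ a (σ.ireg (regT s)) → Rep σ b (σ.ireg (regT (s + 1))) →
        Rep τ (.pair a b) (τ.ireg 0) := by
  refine ⟨_, exec_block _ σ, ?_, ?_⟩
  · refine ⟨⟨?_, ?_, ?_⟩, ?_, ?_⟩
    · simp [Instr.apply, regT]
    · intro a ha hl
      have : a ≠ σ.imem 0 := by omega
      have : a ≠ σ.imem 0 + 1 := by omega
      simp [Instr.apply, regT, *, ha.ne']
    · intro a _; simp [Instr.apply]
    · intro j _
      have : 3 * j ≠ 3 * s + 1 := by omega
      have : 3 * j ≠ 3 * (s + 2) + 1 := by omega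
      simp [Instr.apply, regT, regE, *]
    · intro j _
      have : ¬ (j = s + 2) := by omega
      have : ¬ (j = s) := by omega
      simp [Instr.apply, regT, *]
  · intro a b ha hb
    set τ := List.foldl Instr.apply σ _ with hτ
    have e : Ext σ τ := by
      refine ⟨?_, ?_, ?_⟩
      · simp [hτ, Instr.apply, regT]
      · intro a ha hl
        have : a ≠ σ.imem 0 := by omega
        have : a ≠ σ.imem 0 + 1 := by omega
        simp [Instr.apply, regT, *, ha.ne']
      · intro a _; simp [hτ, Instr.apply]
    have h1 : τ.ireg 0 = σ.imem 0 := by simp [hτ, Instr.apply, regT]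
    have h2 : τ.imem 0 = σ.imem 0 + 2 := by
      simp [hτ, Instr.apply, regT]
    have h3 : τ.imem (σ.imem 0) = σ.ireg (regT s) := by
      simp [hτ, Instr.apply, regT, h0.ne']
    have h4 : τ.imem (σ.imem 0 + 1) = σ.ireg (regT (s + 1)) := by
      simp [hτ, Instr.apply, regT, h0.ne']
    refine ⟨by rw [h1]; exact h0, by rw [h1, h2]; omega, ?_, ?_⟩
    · rw [h1, h3]; exact ha.ext e
    · rw [h1, h4]; exact hb.ext e

theorem exec_allocReal {A : Program} (d s : ℕ) (σ : State) :
    ∃ τ, Exec A (allocReal s) σ 6 τ ∧ Frame d s σ τ ∧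
      Rep τ (.real (σ.rreg 0)) (τ.ireg 0) := by
  refine ⟨_, exec_block _ σ, ?_, ?_⟩
  · refine ⟨⟨?_, ?_, ?_⟩, ?_, ?_⟩
    · simp [Instr.apply, regT]
    · intro a ha hl
      simp [Instr.apply, regT, ha.ne']
    · intro a hl
      have : a ≠ σ.imem 0 := by omega
      simp [Instr.apply, regT, *]
    · intro j _
      have : 3 * j ≠ 3 * s + 1 := by omega
      have : 3 * j ≠ 3 * (s + 2) + 1 := by omega
      simp [Instr.apply, regT, regE, *]
    · intro j _
      have : ¬ (j = s + 2) := by omega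
      have : ¬ (j = s) := by omega
      simp [Instr.apply, regT, *]
  · refine ⟨?_, ?_⟩ <;> simp [Instr.apply, regT]

/-- The program `A` contains the compiled procedures, numbered from `1`. -/
def Implements (A : Program) (P : List Proc) : Prop :=
  ∀ p pr, P[p]? = some pr → A.getD (p + 1) .skip = pr.comp

/-- What a compiled expression achieves. -/
def Correct (A : Program) (I : Input) (env : List Val) (c : Cmd) (s : ℕ) (x : Val) (t : ℕ) : Prop :=
  ∀ σ, I.Valid σ → EnvRep σ env → ∃ t' τ, Exec A c σ t' τ ∧ t' ≤ 20 * t ∧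
    Rep τ x (τ.ireg 0) ∧ Frame env.length s σ τ

theorem regT_ne_regE (i j : ℕ) : regT i ≠ regE j := by simp [regT, regE]; omega
theorem regT_ne_regT {i j : ℕ} (h : i ≠ j) : regT i ≠ regT j := by simp [regT]; omega
theorem regE_ne_regE {i j : ℕ} (h : i ≠ j) : regE i ≠ regE j := by simp [regE]; omega
theorem zero_ne_regT (j : ℕ) : 0 ≠ regT j := by simp [regT]
theorem zero_ne_regE (j : ℕ) : 0 ≠ regE j := by simp [regE]

theorem frame_set_zero (d s : ℕ) (σ : State) (w : ℕ) : Frame d s σ (σ.set 0 w) :=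
  Frame.set σ w (fun j _ => zero_ne_regE j) fun j _ => zero_ne_regT j

theorem frame_set_regT {d s k : ℕ} (hk : s ≤ k) (σ : State) (w : ℕ) :
    Frame d s σ (σ.set (regT k) w) :=
  Frame.set σ w (fun j _ => regT_ne_regE k j) fun j hj => regT_ne_regT (by omega)

theorem frame_set_regE {d s k : ℕ} (hk : d ≤ k) (σ : State) (w : ℕ) :
    Frame d s σ (σ.set (regE k) w) :=
  Frame.set σ w (fun j hj => regE_ne_regE (by omega)) fun j _ => (regT_ne_regE j k).symm

/-- Evaluating two operands: the first result is kept in a temporary. -/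
theorem Correct.two {A : Program} {I : Input} {env : List Val} {a b : Cmd} {s t u : ℕ} {x y : Val}
    (ha : Correct A I env a s x t) (hb : Correct A I env b (s + 1) y u) (σ : State)
    (hI : I.Valid σ) (hE : EnvRep σ env) :
    ∃ t' τ, (∀ (c : Cmd) (t'' : ℕ) (υ : State), Exec A c τ t'' υ →
        Exec A (.seq a (.seq (block [.iadd (regT s) 0 0]) (.seq b c))) σ (t' + t'') υ) ∧
      t' ≤ 20 * (t + u) + 2 ∧ Rep τ x (τ.ireg (regT s)) ∧ Rep τ y (τ.ireg 0) ∧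
      Frame env.length s σ τ := by
  obtain ⟨t1, τ1, e1, h1, r1, f1⟩ := ha σ hI hE
  have f2 : Frame env.length s τ1 (τ1.set (regT s) (τ1.ireg 0)) := frame_set_regT le_rfl _ _
  have f12 := f1.trans f2
  obtain ⟨t2, τ2, e2, h2, r2, f3⟩ := hb _ (hI.ext f12.ext) (hE.frame f12 le_rfl)
  refine ⟨t1 + (2 + t2), τ2, ?_, by omega, ?_, r2, f12.trans (f3.mono le_rfl (by omega))⟩
  · intro c t'' υ hc
    have := Exec.seq e1 (Exec.seq (exec_iadd (A := A) (regT s) 0 0 τ1) (Exec.seq e2 hc))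
    simpa [Nat.add_assoc] using this
  · rw [f3.tmp s (by omega), State.set_ireg_self]
    exact (r1.ext f2.ext).ext f3.ext

theorem copy_args (xs : List ℕ) : ∀ (n : ℕ) (σ : State),
    ∃ τ, (((xs.zipIdx n).map fun y => Instr.iadd (regA y.2) (regE y.1) 0).foldl Instr.apply σ) = τ ∧
      τ.imem = σ.imem ∧ τ.rmem = σ.rmem ∧ (∀ r, (∀ j, n ≤ j → r ≠ regA j) → τ.ireg r = σ.ireg r) ∧
      ∀ i x, xs[i]? = some x → τ.ireg (regA (n + i)) = σ.ireg (regE x) := by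
  induction xs with
  | nil => intro n σ; exact ⟨σ, rfl, rfl, rfl, fun _ _ => rfl, by simp⟩
  | cons a xs ih =>
    intro n σ
    obtain ⟨τ, h1, h2, h3, h4, h5⟩ := ih (n + 1) (σ.set (regA n) (σ.ireg (regE a)))
    refine ⟨τ, ?_, h2, h3, ?_, ?_⟩
    · rw [← h1]; rfl
    · intro r hr
      rw [h4 r (fun j hj => hr j (by omega)), State.set_ireg_ne _ _ (hr n le_rfl)]
    · intro i x hx
      cases i with
      | zero =>
        simp at hx; subst hx
        rw [Nat.add_zero, h4 (regA n) (fun j hj => by simp [regA]; omega), State.set_ireg_self]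
      | succ i =>
        simp at hx
        rw [← Nat.add_assoc, Nat.add_right_comm, h5 i x hx,
          State.set_ireg_ne _ _ (by simp [regA, regE]; omega)]

theorem copy_prologue (m : ℕ) (σ : State) :
    ∃ τ, (((List.range m).map fun j => Instr.iadd (regE j) (regA j) 0).foldl Instr.apply σ) = τ ∧
      τ.imem = σ.imem ∧ τ.rmem = σ.rmem ∧ (∀ j, τ.ireg (regA j) = σ.ireg (regA j)) ∧
      ∀ j, j < m → τ.ireg (regE j) = σ.ireg (regA j) := by
  induction m with
  | zero => exact ⟨σ, rfl, rfl, rfl, fun _ => rfl, by simp⟩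
  | succ m ih =>
    obtain ⟨τ, h1, h2, h3, h4, h5⟩ := ih
    refine ⟨τ.set (regE m) (τ.ireg (regA m)), ?_, h2, h3, ?_, ?_⟩
    · rw [List.range_succ, List.map_append, List.foldl_append, h1]; rfl
    · intro j
      rw [State.set_ireg_ne _ _ (by simp [regA, regE]; omega), h4]
    · intro j hj
      rcases Nat.lt_succ_iff_lt_or_eq.1 hj with hj | rfl
      · rw [State.set_ireg_ne _ _ (regE_ne_regE hj.ne), h5 j hj]
      · rw [State.set_ireg_self, h4]

/-- Induction on the number `n` of elements still to come. Temporary `s` holds the rest of the list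
and the variable `env.length` the accumulator. Temporary `s + 1` holds 0, which serves both as the
address offset of a head and as the mark for the end of the list. -/
theorem exec_foldLoop {A : Program} {I : Input} {env : List Val} {s : ℕ} {body : Cmd}
    (xs : List Val) (acc : ℕ → Val) (c : ℕ → ℕ)
    (hb : ∀ k x, xs[k]? = some x →
      Correct A I (env ++ [acc k, x]) body (s + 2) (acc (k + 1)) (c k)) :
    ∀ (n k : ℕ), k + n = xs.length → ∀ σ, I.Valid σ → EnvRep σ env →
      Rep σ (.ofList (xs.drop k)) (σ.ireg (regT s)) → σ.ireg (regT (s + 1)) = 0 →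
      Rep σ (acc k) (σ.ireg (regE env.length)) →
      ∃ t' τ, Exec A (foldLoop env.length s body) σ t' τ ∧
        t' ≤ 20 * (∑ i ∈ Finset.range n, (c (k + i) + 1)) + 1 ∧
        Rep τ (acc xs.length) (τ.ireg (regE env.length)) ∧ Frame env.length s σ τ := by
  intro n
  induction n with
  | zero =>
    intro k hk σ hI hE hl h0 ha
    rw [Nat.add_zero] at hk
    subst hk
    refine ⟨1, σ, .loopFalse ?_, by simp, ha, Frame.refl _ _ _⟩
    rw [List.drop_length] at hl
    have hl' : σ.ireg (regT s) = 0 := hl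
    show ¬ σ.ireg (regT (s + 1)) < σ.ireg (regT s)
    rw [h0, hl']; exact lt_irrefl 0
  | succ n ih =>
    intro k hk σ hI hE hl h0 ha
    have hlt : k < xs.length := by omega
    rw [List.drop_eq_getElem_cons hlt] at hl
    obtain ⟨p0, p1, hx, hr⟩ : Rep σ (.pair xs[k] (.ofList (xs.drop (k + 1)))) _ := hl
    set d := env.length
    -- the three instructions at the start of the body
    set σ1 := (σ.set (regE (d + 1)) (σ.imem (σ.ireg (regT s)))) with hσ1
    set σ2 := (σ1.set (regT (s + 2)) 1) with hσ2
    set σ3 := (σ2.set (regT s) (σ.imem (σ.ireg (regT s) + 1))) with hσ3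
    have e3 : [Instr.iload (regE (d + 1)) (regT s) (regT (s + 1)), .iconst (regT (s + 2)) 1,
        .iload (regT s) (regT s) (regT (s + 2))].foldl Instr.apply σ = σ3 := by
      have a1 : Instr.apply σ (.iload (regE (d + 1)) (regT s) (regT (s + 1))) = σ1 := by
        simp [Instr.apply, hσ1, State.set, h0]
      have a2 : σ2.ireg (regT s) = σ.ireg (regT s) := by
        rw [hσ2, State.set_ireg_ne _ _ (regT_ne_regT (by omega)), hσ1,
          State.set_ireg_ne _ _ (regT_ne_regE _ _)]
      have a3 : σ2.ireg (regT (s + 2)) = 1 := by rw [hσ2, State.set_ireg_self]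
      have a4 : Instr.apply σ2 (.iload (regT s) (regT s) (regT (s + 2))) = σ3 := by
        simp only [Instr.apply, a2, a3, hσ3]; rfl
      simp only [List.foldl_cons, List.foldl_nil, a1]
      exact a4
    have f3 : Frame (d + 1) s σ σ3 :=
      ((frame_set_regE (by omega) _ _).trans (frame_set_regT (by omega) _ _)).trans
        (frame_set_regT le_rfl _ _)
    have x3 : Rep σ3 xs[k] (σ3.ireg (regE (d + 1))) := by
      rw [hσ3, State.set_ireg_ne _ _ (regT_ne_regE _ _).symm, hσ2,
        State.set_ireg_ne _ _ (regT_ne_regE _ _).symm, hσ1, State.set_ireg_self]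
      exact hx.ext f3.ext
    have E3 : EnvRep σ3 (env ++ [acc k, xs[k]]) := by
      have h := (hE.frame f3 (by omega)).snoc (x := acc k)
        (by rw [f3.env _ (by omega)]; exact ha.ext f3.ext)
      have := h.snoc (x := xs[k]) (by simpa using x3)
      simpa using this
    have T3 : σ3.ireg (regT (s + 1)) = 0 := by
      rw [hσ3, State.set_ireg_ne _ _ (regT_ne_regT (by omega)), hσ2,
        State.set_ireg_ne _ _ (regT_ne_regT (by omega)), hσ1,
        State.set_ireg_ne _ _ (regT_ne_regE _ _), h0]
    obtain ⟨t4, σ4, e4, h4, r4, f4⟩ := hb k xs[k] (List.getElem?_eq_getElem hlt) σ3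
      (hI.ext f3.ext) E3
    rw [show (env ++ [acc k, xs[k]]).length = d + 2 by simp [d]] at f4
    set σ5 := σ4.set (regE d) (σ4.ireg 0) with hσ5
    have f5 : Frame d (s + 2) σ4 σ5 := frame_set_regE le_rfl _ _
    have f35 : Frame d (s + 2) σ3 σ5 := (f4.mono (by omega) le_rfl).trans f5
    have f05 : Frame d s σ σ5 := (f3.mono (by omega) le_rfl).trans (f35.mono le_rfl (by omega))
    obtain ⟨t6, τ, e6, h6, r6, f6⟩ := ih (k + 1) (by omega) σ5 (hI.ext f05.ext)
      (hE.frame f05 le_rfl)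
      (by
        rw [f35.tmp s (by omega), hσ3, State.set_ireg_self]
        exact hr.ext f05.ext)
      (by rw [f35.tmp _ (by omega), T3])
      (by rw [hσ5, State.set_ireg_self]; exact r4.ext f5.ext)
    refine ⟨_, τ, Exec.loopTrue (show Test.Holds σ _ by simpa [Test.Holds, h0] using p0)
      (exec_code _ σ (by rw [e3]; exact Exec.seq e4 (exec_iadd _ _ _ _))) e6, ?_, r6, f05.trans f6⟩
    rw [Finset.sum_range_succ']
    simp only [Nat.add_zero, List.length_cons, List.length_nil]
    have : ∑ i ∈ Finset.range n, (c (k + (i + 1)) + 1) =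
        ∑ i ∈ Finset.range n, (c (k + 1 + i) + 1) :=
      Finset.sum_congr rfl fun i _ => by rw [show k + (i + 1) = k + 1 + i by omega]
    omega

theorem exec_loadReals {A : Program} {c : Cmd} {s t : ℕ} {σ τ : State} {x y : ℝ}
    (hx : Rep σ (.real x) (σ.ireg (regT s))) (hy : Rep σ (.real y) (σ.ireg 0))
    (h : Exec A c { σ.set (regT (s + 1)) 0 with
        rreg := Function.update (Function.update σ.rreg 0 x) 1 y } t τ) :
    Exec A (loadReals s c) σ (3 + t) τ := by
  refine exec_code _ σ ?_
  have h1 : (0 : ℕ) ≠ regT (s + 1) := zero_ne_regT _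
  have h2 : regT s ≠ regT (s + 1) := regT_ne_regT (by omega)
  convert h using 1
  simp [Instr.apply, State.set, h1, h2, hx.2, hy.2]

theorem frame_rreg (d s : ℕ) (σ : State) (f : ℕ → ℝ) :
    Frame d s σ { σ with rreg := f } :=
  ⟨⟨le_rfl, fun _ _ _ => rfl, fun _ _ => rfl⟩, fun _ _ => rfl, fun _ _ => rfl⟩

theorem exec_load {A : Program} (s k : ℕ) (σ : State) :
    Exec A (block [.iconst (regT s) k, .iload 0 0 (regT s)]) σ 3
      ((σ.set (regT s) k).set 0 (σ.imem (σ.ireg 0 + k))) := by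
  have h := exec_block (A := A) [.iconst (regT s) k, .iload 0 0 (regT s)] σ
  have : (0 : ℕ) ≠ regT s := zero_ne_regT s
  simpa [Instr.apply, State.set, this] using h

theorem frame_load (d s k w : ℕ) (σ : State) : Frame d s σ ((σ.set (regT s) k).set 0 w) :=
  (frame_set_regT le_rfl σ k).trans (frame_set_zero _ _ _ _)

/-- Compiled expressions compute what the semantics says, within twenty times the cost. -/
theorem Eval.correct {A : Program} {P : List Proc} {I : Input} (hA : Implements A P)
    {env : List Val} {e : Ex} {x : Val} {t : ℕ} (h : Eval P I env e x t) :
    ∀ s, Correct A I env (comp env.length s e) s x t := by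
  induction h with
  | @v env j x h =>
    intro s σ hI hE
    refine ⟨2, _, exec_iadd _ _ _ _, by omega, ?_, frame_set_zero _ _ _ _⟩
    rw [State.set_ireg_self]
    exact (hE j x h).ext (frame_set_zero 0 0 _ _).ext
  | @ix env k x hk h =>
    intro s σ hI hE
    refine ⟨2, _, exec_iadd _ _ _ _, by omega, ?_, frame_set_zero _ _ _ _⟩
    rw [State.set_ireg_self]
    exact (hE _ x h).ext (frame_set_zero 0 0 _ _).ext
  | nat k =>
    intro s σ hI hE
    exact ⟨2, _, exec_iconst _ _ _, by omega, by rw [State.set_ireg_self]; rfl,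
      frame_set_zero _ _ _ _⟩
  | succ _ ih =>
    intro s σ hI hE
    obtain ⟨t1, τ1, e1, h1, r1, f1⟩ := ih s σ hI hE
    refine ⟨_, _, .seq e1 (exec_iadd _ _ _ _), by omega, ?_, f1.trans (frame_set_zero _ _ _ _)⟩
    have r1' : τ1.ireg 0 = _ := r1
    rw [State.set_ireg_self, r1']; rfl
  | pred _ ih =>
    intro s σ hI hE
    obtain ⟨t1, τ1, e1, h1, r1, f1⟩ := ih s σ hI hE
    refine ⟨_, _, .seq e1 (exec_block [.isub 0 0 1] _), by simp; omega, ?_,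
      f1.trans (frame_set_zero _ _ _ (τ1.ireg 0 - 1))⟩
    have r1' : τ1.ireg 0 = _ := r1
    simp [Instr.apply, Rep, r1']
  | @lt env a b k l t u _ _ iha ihb =>
    intro s σ hI hE
    obtain ⟨t1, τ, e1, h1, ra, rb, f1⟩ := (iha s).two (ihb (s + 1)) σ hI hE
    have ra' : τ.ireg (regT s) = k := ra
    have rb' : τ.ireg 0 = l := rb
    by_cases hkl : k < l
    · refine ⟨_, _, e1 _ _ _ (.iteTrue (by simpa [Test.Holds, ra', rb'] using hkl)
        (exec_iconst _ _ _)), by omega, ?_, f1.trans (frame_set_zero _ _ _ _)⟩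
      rw [State.set_ireg_self, if_pos hkl]; rfl
    · refine ⟨_, _, e1 _ _ _ (.iteFalse (by simpa [Test.Holds, ra', rb'] using hkl)
        (exec_iconst _ _ _)), by omega, ?_, f1.trans (frame_set_zero _ _ _ _)⟩
      rw [State.set_ireg_self, if_neg hkl]; rfl
  | @cons env a b x y t u _ _ iha ihb =>
    intro s σ hI hE
    obtain ⟨t1, τ, e1, h1, ra, rb, f1⟩ := (iha s).two (ihb (s + 1)) σ hI hE
    have f2 : Frame env.length (s + 1) τ (τ.set (regT (s + 1)) (τ.ireg 0)) :=
      frame_set_regT le_rfl _ _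
    obtain ⟨υ, e3, f3, r3⟩ := exec_allocPair (A := A) env.length s
      (τ.set (regT (s + 1)) (τ.ireg 0)) ((hI.ext f1.ext).ext f2.ext).pos
    refine ⟨_, υ, e1 _ _ _ (.seq (exec_iadd _ _ _ _) e3), by omega, r3 x y ?_ ?_,
      (f1.trans (f2.mono le_rfl (by omega))).trans f3⟩
    · rw [f2.tmp s (by omega)]; exact ra.ext f2.ext
    · rw [State.set_ireg_self]; exact rb.ext f2.ext
  | car _ ih =>
    intro s σ hI hE
    obtain ⟨t1, τ, e1, h1, ⟨_, _, rx, ry⟩, f1⟩ := ih s σ hI hE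
    refine ⟨_, _, .seq e1 (exec_load s 0 τ), by omega, ?_, f1.trans (frame_load _ _ _ _ _)⟩
    rw [State.set_ireg_self]
    exact rx.ext (frame_load 0 s 0 _ τ).ext
  | cdr _ ih =>
    intro s σ hI hE
    obtain ⟨t1, τ, e1, h1, ⟨_, _, rx, ry⟩, f1⟩ := ih s σ hI hE
    refine ⟨_, _, .seq e1 (exec_load s 1 τ), by omega, ?_, f1.trans (frame_load _ _ _ _ _)⟩
    rw [State.set_ireg_self]
    exact ry.ext (frame_load 0 s 1 _ τ).ext
  | @ifzT env c a b x y t u _ hx _ ihc iha =>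
    intro s σ hI hE
    obtain ⟨t1, τ, e1, h1, r1, f1⟩ := ihc s σ hI hE
    have f2 : Frame env.length s τ (τ.set (regT s) 1) := frame_set_regT le_rfl _ _
    obtain ⟨t3, υ, e3, h3, r3, f3⟩ := iha s _ ((hI.ext f1.ext).ext f2.ext)
      (hE.frame (f1.trans f2) le_rfl)
    refine ⟨_, υ, .seq e1 (.seq (exec_iconst _ _ _) (.iteTrue ?_ e3)), by omega, r3,
      (f1.trans f2).trans f3⟩
    match x, hx, r1 with
    | .nat k, hx, r1 =>
      have r1' : τ.ireg 0 = k := r1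
      have hk : k = 0 := by simpa [Val.isZero] using hx
      simp [Test.Holds, State.set_ireg_ne _ _ (zero_ne_regT s), r1', hk]
  | @ifzF env c a b x y t u _ hx _ ihc iha =>
    intro s σ hI hE
    obtain ⟨t1, τ, e1, h1, r1, f1⟩ := ihc s σ hI hE
    have f2 : Frame env.length s τ (τ.set (regT s) 1) := frame_set_regT le_rfl _ _
    obtain ⟨t3, υ, e3, h3, r3, f3⟩ := iha s _ ((hI.ext f1.ext).ext f2.ext)
      (hE.frame (f1.trans f2) le_rfl)
    refine ⟨_, υ, .seq e1 (.seq (exec_iconst _ _ _) (.iteFalse ?_ e3)), by omega, r3,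
      (f1.trans f2).trans f3⟩
    match x, hx, r1 with
    | .nat k, hx, r1 =>
      have r1' : τ.ireg 0 = k := r1
      have hk : k ≠ 0 := by simpa [Val.isZero] using hx
      simp [Test.Holds, State.set_ireg_ne _ _ (zero_ne_regT s), r1', hk]
    | .pair _ _, _, r1 =>
      have : τ.ireg 0 ≠ 0 := r1.1.ne'
      simp [Test.Holds, State.set_ireg_ne _ _ (zero_ne_regT s), this]
  | @letE env a b x y t u _ _ iha ihb =>
    intro s σ hI hE
    obtain ⟨t1, τ, e1, h1, r1, f1⟩ := iha s σ hI hE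
    have f2 : Frame env.length s τ (τ.set (regE env.length) (τ.ireg 0)) :=
      frame_set_regE le_rfl _ _
    obtain ⟨t3, υ, e3, h3, r3, f3⟩ := ihb s _ ((hI.ext f1.ext).ext f2.ext)
      ((hE.frame (f1.trans f2) le_rfl).snoc (by
        rw [State.set_ireg_self]; exact r1.ext f2.ext))
    rw [show (env ++ [x]).length = env.length + 1 by simp] at e3 f3
    exact ⟨_, υ, .seq e1 (.seq (exec_iadd _ _ _ _) e3), by omega, r3,
      (f1.trans f2).trans (f3.mono (by omega) le_rfl)⟩
  | @fold env l i b t u xs acc c _ _ _ ihl ihi ihb =>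
    intro s σ hI hE
    obtain ⟨t1, τ, e1, h1, rl, ri, f1⟩ := (ihl s).two (ihi (s + 1)) σ hI hE
    have f2 : Frame env.length (s + 1) τ (τ.set (regE env.length) (τ.ireg 0)) :=
      frame_set_regE le_rfl _ _
    have f3 : Frame (env.length + 1) (s + 1) (τ.set (regE env.length) (τ.ireg 0))
        ((τ.set (regE env.length) (τ.ireg 0)).set (regT (s + 1)) 0) :=
      frame_set_regT le_rfl _ _
    set τ3 := (τ.set (regE env.length) (τ.ireg 0)).set (regT (s + 1)) 0 with hτ3
    have f23 : Frame env.length (s + 1) τ τ3 := f2.trans (f3.mono (by omega) le_rfl)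
    have f13 : Frame env.length s σ τ3 := f1.trans (f23.mono le_rfl (by omega))
    obtain ⟨t4, υ, e4, h4, r4, f4⟩ := exec_foldLoop (A := A) (I := I) (env := env) (s := s)
      (body := comp (env.length + 2) (s + 2) b) xs acc c
      (fun k x hk => by simpa using ihb k x hk (s + 2)) xs.length 0 (by omega) τ3
      (hI.ext f13.ext) (hE.frame f13 le_rfl)
      (by rw [List.drop_zero, f23.tmp s (by omega)]; exact rl.ext f23.ext)
      (by rw [hτ3, State.set_ireg_self])
      (by
        rw [f3.env _ (by omega), State.set_ireg_self]
        exact ri.ext f23.ext)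
    refine ⟨_, _, e1 _ _ _ (.seq (exec_block [.iadd (regE env.length) 0 0,
      .iconst (regT (s + 1)) 0] τ) (.seq e4 (exec_iadd _ _ _ _))), ?_, ?_,
      (f13.trans f4).trans (frame_set_zero _ _ _ _)⟩
    · simp only [Nat.zero_add] at h4
      simp only [List.length_cons, List.length_nil]
      omega
    · rw [State.set_ireg_self]
      exact r4.ext (frame_set_zero 0 0 _ _).ext
  | @call env p xs pr vals y t hp hl hv _ ih =>
    intro s σ hI hE
    obtain ⟨τ, h1, h2, h3, h4, h5⟩ := copy_args xs 0 σ
    obtain ⟨τ', k1, k2, k3, k4, k5⟩ := copy_prologue pr.arity τ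
    have f1 : Frame env.length s σ τ :=
      ⟨⟨by rw [h2], fun _ _ _ => by rw [h2], fun _ _ => by rw [h3]⟩,
        fun j _ => h4 _ fun i _ => by simp [regE, regA]; omega,
        fun j _ => h4 _ fun i _ => by simp [regT, regA]; omega⟩
    have x1 : Ext σ τ' := f1.ext.trans ⟨by rw [k2], fun _ _ _ => by rw [k2], fun _ _ => by rw [k3]⟩
    have hlen : vals.length = pr.arity := by
      have := congrArg List.length hv; simp at this; omega
    have hE' : EnvRep τ' vals := by
      intro j z hj
      have hj' : j < vals.length := (List.getElem?_eq_some_iff.1 hj).1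
      have hjx : j < xs.length := by omega
      have e1 := congrArg (fun l => l[j]?) hv
      simp only [List.getElem?_map, hj, Option.map_some, List.getElem?_eq_getElem hjx] at e1
      rw [k5 j (by omega)]
      have := h5 j xs[j] (List.getElem?_eq_getElem hjx)
      rw [Nat.zero_add] at this
      rw [this]
      exact (hE _ z (by simpa using e1)).ext x1
    obtain ⟨t2, υ, e2, g2, r2, f2⟩ := ih 0 τ' (hI.ext x1) hE'
    have ex : Exec A (A.getD (p + 1) .skip) τ (pr.arity + 1 + t2) υ := by
      rw [hA p pr hp]
      have h := exec_block (A := A) ((List.range pr.arity).map fun j => .iadd (regE j) (regA j) 0) τ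
      rw [k1, List.length_map, List.length_range] at h
      refine Exec.seq h ?_
      rw [← hlen]
      exact e2
    have xx : Ext τ υ := Ext.trans ⟨by rw [k2], fun _ _ _ => by rw [k2], fun _ _ => by rw [k3]⟩ f2.ext
    refine ⟨_, _, .seq (exec_block _ _) (.call (by
      show Exec A _ (List.foldl _ _ (List.map _ (xs.zipIdx 0))) _ _
      rw [h1]; exact ex)), ?_, ?_, ?_⟩
    · simp; omega
    · have : Ext υ (State.afterCall τ υ) := ⟨le_rfl, fun _ _ _ => rfl, fun _ _ => rfl⟩
      rw [h1]
      have := r2.ext this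
      simpa [State.afterCall] using this
    · rw [h1]
      -- The call restores all registers of the caller except register 0, so only the heap changes.
      refine f1.trans ⟨xx.trans ⟨le_rfl, fun _ _ _ => rfl, fun _ _ => rfl⟩, ?_, ?_⟩
      · intro j _
        simp [State.afterCall, regE]
      · intro j _
        simp [State.afterCall, regT]
  | @one env =>
    intro s σ hI hE
    have f1 : Frame env.length s σ (Instr.apply σ (.rone 0)) := frame_rreg _ _ _ _
    obtain ⟨τ, e1, f2, r⟩ := exec_allocReal (A := A) env.length s (Instr.apply σ (.rone 0))
    refine ⟨_, τ, .seq (exec_block _ _) e1, by simp, ?_, f1.trans f2⟩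
    simpa [Instr.apply] using r
  | @add env a b x y t u _ _ iha ihb =>
    intro s σ hI hE
    obtain ⟨t1, τ, e1, h1, ra, rb, f1⟩ := (iha s).two (ihb (s + 1)) σ hI hE
    set υ : State := { τ.set (regT (s + 1)) 0 with
        rreg := Function.update (Function.update τ.rreg 0 x) 1 y } with hυ
    have f2 : Frame env.length s τ (Instr.apply υ (.radd 0 0 1)) :=
      ((frame_set_regT (k := s + 1) (by omega) τ 0).trans (frame_rreg _ _ _ _)).trans
        (frame_rreg _ _ _ _)
    obtain ⟨ω, e2, f3, r⟩ := exec_allocReal (A := A) env.length s (Instr.apply υ (.radd 0 0 1))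
    refine ⟨_, ω, e1 _ _ _ (.seq (exec_loadReals ra rb (exec_block [.radd 0 0 1] υ)) e2), ?_, ?_,
      (f1.trans f2).trans f3⟩
    · simp only [List.length_cons, List.length_nil]; omega
    · simpa [Instr.apply, hυ] using r
  | @sub env a b x y t u _ _ iha ihb =>
    intro s σ hI hE
    obtain ⟨t1, τ, e1, h1, ra, rb, f1⟩ := (iha s).two (ihb (s + 1)) σ hI hE
    set υ : State := { τ.set (regT (s + 1)) 0 with
        rreg := Function.update (Function.update τ.rreg 0 x) 1 y } with hυ
    have f2 : Frame env.length s τ (Instr.apply υ (.rsub 0 0 1)) :=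
      ((frame_set_regT (k := s + 1) (by omega) τ 0).trans (frame_rreg _ _ _ _)).trans
        (frame_rreg _ _ _ _)
    obtain ⟨ω, e2, f3, r⟩ := exec_allocReal (A := A) env.length s (Instr.apply υ (.rsub 0 0 1))
    refine ⟨_, ω, e1 _ _ _ (.seq (exec_loadReals ra rb (exec_block [.rsub 0 0 1] υ)) e2), ?_, ?_,
      (f1.trans f2).trans f3⟩
    · simp only [List.length_cons, List.length_nil]; omega
    · simpa [Instr.apply, hυ] using r
  | @rlt env a b x y t u z _ _ hz1 hz0 iha ihb =>
    intro s σ hI hE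
    obtain ⟨t1, τ, e1, h1, ra, rb, f1⟩ := (iha s).two (ihb (s + 1)) σ hI hE
    set υ : State := { τ.set (regT (s + 1)) 0 with
        rreg := Function.update (Function.update τ.rreg 0 x) 1 y } with hυ
    have f2 : Frame env.length s τ υ :=
      (frame_set_regT (k := s + 1) (by omega) τ 0).trans (frame_rreg _ _ _ _)
    refine ⟨_, υ.set 0 z, e1 _ _ _ (exec_loadReals (t := 1 + 2) ra rb ?_), ?_, ?_,
      (f1.trans f2).trans (frame_set_zero _ _ _ _)⟩
    · by_cases hxy : x < y
      · rw [hz1 hxy]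
        exact .iteTrue (by simpa [Test.Holds] using hxy) (exec_iconst _ _ _)
      · rw [hz0 hxy]
        exact .iteFalse (by simpa [Test.Holds] using hxy) (exec_iconst _ _ _)
    · omega
    · rw [State.set_ireg_self]; rfl
  | @inI env e k t _ h0 h1' ih =>
    intro s σ hI hE
    obtain ⟨t1, τ, e1, h1, r1, f1⟩ := ih s σ hI hE
    have r1' : τ.ireg 0 = k := r1
    refine ⟨_, _, .seq e1 (exec_load s 0 τ), by omega, ?_, f1.trans (frame_load _ _ _ _ _)⟩
    rw [State.set_ireg_self, r1']
    exact (hI.ext f1.ext).ints k h0 h1'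
  | @inR env e k t _ h1' ih =>
    intro s σ hI hE
    obtain ⟨t1, τ, e1, h1, r1, f1⟩ := ih s σ hI hE
    have r1' : τ.ireg 0 = k := r1
    have hv := hI.ext f1.ext
    exact ⟨_, τ, e1, by omega, ⟨by rw [r1']; exact h1'.trans_le hv.nReals,
      by rw [r1']; exact hv.reals k h1'⟩, f1⟩

/-! ### Encodings and derived rules -/

/-- Types whose elements are represented by values. -/
class Enc (α : Type) where
  enc : α → Val

open Enc (enc)

instance : Enc ℕ := ⟨.nat⟩
instance : Enc Bool := ⟨fun b => .nat (if b then 1 else 0)⟩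
noncomputable instance : Enc ℝ := ⟨.real⟩
instance {α β : Type} [Enc α] [Enc β] : Enc (α × β) := ⟨fun x => .pair (enc x.1) (enc x.2)⟩
instance {α : Type} [Enc α] : Enc (List α) := ⟨fun l => .ofList (l.map enc)⟩

/-- Evaluation within a given cost. -/
def Ev (P : List Proc) (I : Input) (env : List Val) (e : Ex) (x : Val) (T : ℕ) : Prop :=
  ∃ t ≤ T, Eval P I env e x t

section rules

variable {P : List Proc} {I : Input} {env : List Val} {α β γ : Type} [Enc α] [Enc β] [Enc γ]

theorem Ev.mono {e : Ex} {x : Val} {T T' : ℕ} (h : Ev P I env e x T) (hT : T ≤ T') :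
    Ev P I env e x T' :=
  let ⟨t, ht, h⟩ := h; ⟨t, ht.trans hT, h⟩

theorem Ev.v {j : ℕ} {x : Val} (h : env[j]? = some x) : Ev P I env (.v j) x 1 :=
  ⟨1, le_rfl, .v h⟩

theorem Ev.ix0 {a x : Val} : Ev P I (env ++ [a, x]) (.ix 0) x 1 :=
  ⟨1, le_rfl, .ix (by simp) (by simp)⟩

theorem Ev.ix1 {a x : Val} : Ev P I (env ++ [a, x]) (.ix 1) a 1 :=
  ⟨1, le_rfl, .ix (by simp) (by simp)⟩

theorem Ev.nat (k : ℕ) : Ev P I env (.nat k) (enc k) 1 := ⟨1, le_rfl, .nat k⟩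

theorem Ev.tt : Ev P I env (.nat 1) (enc true) 1 := ⟨1, le_rfl, .nat 1⟩

theorem Ev.ff : Ev P I env (.nat 0) (enc false) 1 := ⟨1, le_rfl, .nat 0⟩

theorem Ev.nil : Ev P I env (.nat 0) (enc ([] : List α)) 1 := ⟨1, le_rfl, .nat 0⟩

theorem Ev.succ {e : Ex} {k T : ℕ} (h : Ev P I env e (enc k) T) :
    Ev P I env (.succ e) (enc (k + 1)) (T + 1) :=
  let ⟨t, ht, h⟩ := h; ⟨t + 1, by omega, .succ h⟩

theorem Ev.pred {e : Ex} {k T : ℕ} (h : Ev P I env e (enc k) T) :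
    Ev P I env (.pred e) (enc (k - 1)) (T + 1) :=
  let ⟨t, ht, h⟩ := h; ⟨t + 1, by omega, .pred h⟩

theorem Ev.lt {a b : Ex} {k l T U : ℕ} (ha : Ev P I env a (enc k) T) (hb : Ev P I env b (enc l) U) :
    Ev P I env (.lt a b) (enc (decide (k < l))) (T + U + 1) := by
  obtain ⟨t, ht, ha⟩ := ha
  obtain ⟨u, hu, hb⟩ := hb
  refine ⟨t + u + 1, by omega, ?_⟩
  have := Eval.lt ha hb
  simpa [enc] using this

theorem Ev.pair {a b : Ex} {x y : Val} {T U : ℕ} (ha : Ev P I env a x T) (hb : Ev P I env b y U) :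
    Ev P I env (.cons a b) (.pair x y) (T + U + 1) :=
  let ⟨t, ht, ha⟩ := ha; let ⟨u, hu, hb⟩ := hb; ⟨t + u + 1, by omega, .cons ha hb⟩

theorem Ev.prod {a b : Ex} {x : α} {y : β} {T U : ℕ} (ha : Ev P I env a (enc x) T)
    (hb : Ev P I env b (enc y) U) : Ev P I env (.cons a b) (enc (x, y)) (T + U + 1) := ha.pair hb

theorem Ev.cons {a b : Ex} {x : α} {y : List α} {T U : ℕ} (ha : Ev P I env a (enc x) T)
    (hb : Ev P I env b (enc y) U) : Ev P I env (.cons a b) (enc (x :: y)) (T + U + 1) := ha.pair hb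

theorem Ev.car {e : Ex} {x y : Val} {T : ℕ} (h : Ev P I env e (.pair x y) T) :
    Ev P I env (.car e) x (T + 1) :=
  let ⟨t, ht, h⟩ := h; ⟨t + 1, by omega, .car h⟩

theorem Ev.cdr {e : Ex} {x y : Val} {T : ℕ} (h : Ev P I env e (.pair x y) T) :
    Ev P I env (.cdr e) y (T + 1) :=
  let ⟨t, ht, h⟩ := h; ⟨t + 1, by omega, .cdr h⟩

theorem Ev.fst {e : Ex} {x : α × β} {T : ℕ} (h : Ev P I env e (enc x) T) :
    Ev P I env (.car e) (enc x.1) (T + 1) := Ev.car (y := enc x.2) h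

theorem Ev.snd {e : Ex} {x : α × β} {T : ℕ} (h : Ev P I env e (enc x) T) :
    Ev P I env (.cdr e) (enc x.2) (T + 1) := Ev.cdr (x := enc x.1) h

theorem Ev.head {e : Ex} {x : α} {l : List α} {T : ℕ} (h : Ev P I env e (enc (x :: l)) T) :
    Ev P I env (.car e) (enc x) (T + 1) := Ev.car (y := enc l) h

theorem Ev.tail {e : Ex} {x : α} {l : List α} {T : ℕ} (h : Ev P I env e (enc (x :: l)) T) :
    Ev P I env (.cdr e) (enc l) (T + 1) := Ev.cdr (x := enc x) h

theorem Ev.ifz {c a b : Ex} {x y : Val} {z : Bool} {T U : ℕ} (hc : Ev P I env c x T)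
    (hx : x.isZero = some z) (ha : z = true → Ev P I env a y U)
    (hb : z = false → Ev P I env b y U) : Ev P I env (.ifz c a b) y (T + U + 1) := by
  obtain ⟨t, ht, hc⟩ := hc
  cases z with
  | true =>
    obtain ⟨u, hu, ha⟩ := ha rfl
    exact ⟨t + u + 1, by omega, .ifzT hc hx ha⟩
  | false =>
    obtain ⟨u, hu, hb⟩ := hb rfl
    exact ⟨t + u + 1, by omega, .ifzF hc hx hb⟩

theorem Ev.ifB {c a b : Ex} {y : Val} {z : Bool} {T U : ℕ} (hc : Ev P I env c (enc z) T)
    (ha : z = false → Ev P I env a y U) (hb : z = true → Ev P I env b y U) :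
    Ev P I env (.ifz c a b) y (T + U + 1) :=
  hc.ifz (z := !z) (by cases z <;> rfl) (by simpa using ha) (by simpa using hb)

theorem Ev.ifN {c a b : Ex} {y : Val} {k T U : ℕ} (hc : Ev P I env c (enc k) T)
    (ha : k = 0 → Ev P I env a y U) (hb : k ≠ 0 → Ev P I env b y U) :
    Ev P I env (.ifz c a b) y (T + U + 1) :=
  hc.ifz (z := k == 0) rfl (by simpa using ha) (by simpa using hb)

theorem Ev.ifL {c a b : Ex} {y : Val} {l : List α} {T U : ℕ} (hc : Ev P I env c (enc l) T)
    (ha : l = [] → Ev P I env a y U) (hb : ∀ x l', l = x :: l' → Ev P I env b y U) :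
    Ev P I env (.ifz c a b) y (T + U + 1) :=
  hc.ifz (z := l.isEmpty) (by cases l <;> rfl) (by simpa using ha)
    (by cases l with
      | nil => simp
      | cons x l => exact fun _ => hb x l rfl)

theorem Ev.letE {a b : Ex} {x y : Val} {T U : ℕ} (ha : Ev P I env a x T)
    (hb : Ev P I (env ++ [x]) b y U) : Ev P I env (.letE a b) y (T + U + 1) :=
  let ⟨t, ht, ha⟩ := ha; let ⟨u, hu, hb⟩ := hb; ⟨t + u + 1, by omega, .letE ha hb⟩

theorem Ev.call {p : ℕ} {xs : List ℕ} {pr : Proc} {vals : List Val} {y : Val} {T : ℕ}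
    (hp : P[p]? = some pr) (hl : xs.length = pr.arity)
    (hv : xs.map (fun j => env[j]?) = vals.map some) (hb : Ev P I vals pr.body y T) :
    Ev P I env (.call p xs) y (T + xs.length + 1) :=
  let ⟨t, ht, hb⟩ := hb; ⟨t + xs.length + 1, by omega, .call hp hl hv hb⟩

theorem Ev.one : Ev P I env .one (enc (1 : ℝ)) 1 := ⟨1, le_rfl, .one⟩

theorem Ev.add {a b : Ex} {x y : ℝ} {T U : ℕ} (ha : Ev P I env a (enc x) T)
    (hb : Ev P I env b (enc y) U) : Ev P I env (.add a b) (enc (x + y)) (T + U + 1) :=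
  let ⟨t, ht, ha⟩ := ha; let ⟨u, hu, hb⟩ := hb; ⟨t + u + 1, by omega, .add ha hb⟩

theorem Ev.sub {a b : Ex} {x y : ℝ} {T U : ℕ} (ha : Ev P I env a (enc x) T)
    (hb : Ev P I env b (enc y) U) : Ev P I env (.sub a b) (enc (x - y)) (T + U + 1) :=
  let ⟨t, ht, ha⟩ := ha; let ⟨u, hu, hb⟩ := hb; ⟨t + u + 1, by omega, .sub ha hb⟩

theorem Ev.rlt {a b : Ex} {x y : ℝ} {T U : ℕ} (ha : Ev P I env a (enc x) T)
    (hb : Ev P I env b (enc y) U) : Ev P I env (.rlt a b) (enc (decide (x < y))) (T + U + 1) :=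
  let ⟨t, ht, ha⟩ := ha
  let ⟨u, hu, hb⟩ := hb
  ⟨t + u + 1, by omega, .rlt _ ha hb (fun h => by simp [h]) fun h => by simp [h]⟩

theorem Ev.inI {e : Ex} {k T : ℕ} (h : Ev P I env e (enc k) T) (h0 : 0 < k) (h1 : k < I.nInts) :
    Ev P I env (.inI e) (enc (I.ints k)) (T + 1) :=
  let ⟨t, ht, h⟩ := h; ⟨t + 1, by omega, .inI h h0 h1⟩

theorem Ev.inR {e : Ex} {k T : ℕ} (h : Ev P I env e (enc k) T) (h1 : k < I.nReals) :
    Ev P I env (.inR e) (enc (I.reals k)) (T + 1) :=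
  let ⟨t, ht, h⟩ := h; ⟨t + 1, by omega, .inR h h1⟩

/-- Folds, with the accumulator described as a function of the list prefix. -/
theorem Ev.foldP {e i b : Ex} {l : List α} {T U : ℕ} (S : List α → Val) (c : α → ℕ)
    (hl : Ev P I env e (enc l) T) (hi : Ev P I env i (S []) U)
    (hb : ∀ l₁ x l₂, l = l₁ ++ x :: l₂ →
      Ev P I (env ++ [S l₁, enc x]) b (S (l₁ ++ [x])) (c x)) :
    Ev P I env (.fold e i b) (S l) (T + U + (l.map fun x => c x + 1).sum + 1) := by
  obtain ⟨t, ht, hl⟩ := hl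
  obtain ⟨u, hu, hi⟩ := hi
  -- The function `c` only bounds the costs of the steps. The actual costs are chosen position by
  -- position, with an arbitrary value beyond the end of the list.
  have hb' : ∀ k : ℕ, ∃ s, ∀ x, l[k]? = some x → s ≤ c x ∧
      Eval P I (env ++ [S (l.take k), enc x]) b (S (l.take (k + 1))) s := by
    intro k
    rcases hk : l[k]? with _ | x
    · exact ⟨0, by simp⟩
    · obtain ⟨hk', rfl⟩ := List.getElem?_eq_some_iff.1 hk
      obtain ⟨s, hs, h⟩ := hb (l.take k) l[k] (l.drop (k + 1)) (by simp)
      refine ⟨s, fun x hx => ?_⟩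
      cases hx
      rw [List.take_succ_eq_append_getElem hk']
      exact ⟨hs, h⟩
  choose s hs using hb'
  refine ⟨t + u + (∑ k ∈ Finset.range l.length, (s k + 1)) + 1, ?_, ?_⟩
  rotate_left
  · have := Eval.fold (P := P) (I := I) (env := env) (l := e) (i := i) (b := b) (l.map enc)
      (fun k => S (l.take k)) s hl (by simpa using hi) (by
        intro k x hx
        rw [List.getElem?_map, Option.map_eq_some_iff] at hx
        obtain ⟨x, hx, rfl⟩ := hx
        exact (hs k x hx).2)
    simpa using this
  · have : ∑ k ∈ Finset.range l.length, (s k + 1) ≤ (l.map fun x => c x + 1).sum := by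
      have h2 : (l.map fun x => c x + 1).sum =
          ∑ k ∈ Finset.range l.length, if h : k < l.length then c l[k] + 1 else 0 := by
        rw [← Fin.sum_univ_getElem, Finset.sum_range]
        simp
        exact Fin.sum_congr' (fun x : Fin l.length => c l[x] + 1) (by simp)
      rw [h2]
      refine Finset.sum_le_sum fun k hk => ?_
      have hk := Finset.mem_range.1 hk
      rw [dif_pos hk]
      have := (hs k l[k] (by simp [hk])).1
      omega
    omega

theorem Ev.fold {e i b : Ex} {l : List α} {T U : ℕ} (g : β → α → β) (b₀ : β) (c : α → ℕ)
    (hl : Ev P I env e (enc l) T) (hi : Ev P I env i (enc b₀) U)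
    (hb : ∀ acc, ∀ x ∈ l, Ev P I (env ++ [enc acc, enc x]) b (enc (g acc x)) (c x)) :
    Ev P I env (.fold e i b) (enc (l.foldl g b₀)) (T + U + (l.map fun x => c x + 1).sum + 1) :=
  Ev.foldP (fun l => enc (l.foldl g b₀)) c hl hi fun l₁ x l₂ h => by
    rw [List.foldl_append]
    exact hb _ x (by simp [h])

theorem sum_map_const {δ : Type} (l : List δ) (c : ℕ) : (l.map fun _ => c).sum = l.length * c := by
  simp

/-- Folds with a uniform cost of the steps. -/
theorem Ev.foldU {e i b : Ex} {l : List α} {T U : ℕ} (g : β → α → β) (b₀ : β) (c : ℕ)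
    (hl : Ev P I env e (enc l) T) (hi : Ev P I env i (enc b₀) U)
    (hb : ∀ acc, ∀ x ∈ l, Ev P I (env ++ [enc acc, enc x]) b (enc (g acc x)) c) :
    Ev P I env (.fold e i b) (enc (l.foldl g b₀)) (T + U + l.length * (c + 1) + 1) :=
  (Ev.fold g b₀ (fun _ => c) hl hi hb).mono (by simp)

/-! #### Derived forms -/

end rules

def revE (e : Ex) : Ex := .fold e (.nat 0) (.cons (.ix 0) (.ix 1))
-- A fold builds its result backwards, whence the final reversal.
def mapE (e b : Ex) : Ex := revE (.fold e (.nat 0) (.cons b (.ix 1)))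
def filterE (e b : Ex) : Ex := revE (.fold e (.nat 0) (.ifz b (.ix 1) (.cons (.ix 0) (.ix 1))))
/-- The body sees the current elements as `ix 0` and `zipY`. -/
def zipY : Ex := .car (.car (.ix 1))
-- The accumulator is the unread rest of the second list together with the result so far.
def zipE (e₁ e₂ b : Ex) : Ex := revE (.cdr (.fold e₁ (.cons e₂ (.nat 0))
  (.cons (.cdr (.car (.ix 1))) (.cons b (.cdr (.ix 1))))))
def notE (e : Ex) : Ex := .ifz e (.nat 1) (.nat 0)
def andE (a b : Ex) : Ex := .ifz a (.nat 0) b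
def orE (a b : Ex) : Ex := .ifz a b (.nat 1)
def eqE (a b : Ex) : Ex := andE (notE (.lt a b)) (notE (.lt b a))
def appendE (a b : Ex) : Ex := .fold (revE a) b (.cons (.ix 0) (.ix 1))
def complE (e : Ex) : Ex := mapE e (notE (.ix 0))

section rules

variable {P : List Proc} {I : Input} {env : List Val} {α β γ : Type} [Enc α] [Enc β] [Enc γ]

theorem Ev.rev {e : Ex} {l : List α} {T : ℕ} (h : Ev P I env e (enc l) T) :
    Ev P I env (revE e) (enc l.reverse) (T + 4 * l.length + 2) := by
  have := Ev.foldU (fun acc x => x :: acc) ([] : List α) 3 h Ev.nil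
    (b := .cons (.ix 0) (.ix 1)) fun acc x _ => Ev.ix0.cons Ev.ix1
  rw [List.foldl_flip_cons_eq_append'] at this
  simp only [List.append_nil] at this
  exact this.mono (by omega)

theorem Ev.map {e b : Ex} {l : List α} {T : ℕ} (f : α → β) (c : ℕ)
    (h : Ev P I env e (enc l) T)
    (hb : ∀ acc, ∀ x ∈ l, Ev P I (env ++ [acc, enc x]) b (enc (f x)) c) :
    Ev P I env (mapE e b) (enc (l.map f)) (T + l.length * (c + 7) + 4) := by
  have := (Ev.foldU (fun acc x => f x :: acc) ([] : List β) (c + 2) h Ev.nil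
    (b := .cons b (.ix 1)) fun acc x hx => (hb _ x hx).cons Ev.ix1).rev
  have h2 : ∀ l' : List β, l.foldl (fun acc x => f x :: acc) l' = (l.map f).reverse ++ l' := by
    clear this h hb
    induction l with
    | nil => simp
    | cons x l ih => intro l'; simp [ih]
  rw [h2, List.append_nil, List.reverse_reverse] at this
  refine this.mono ?_
  simp only [List.length_reverse, List.length_map]
  ring_nf
  omega

theorem Ev.filter {e b : Ex} {l : List α} {T : ℕ} (f : α → Bool) (c : ℕ)
    (h : Ev P I env e (enc l) T)
    (hb : ∀ acc, ∀ x ∈ l, Ev P I (env ++ [acc, enc x]) b (enc (f x)) c) :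
    Ev P I env (filterE e b) (enc (l.filter f)) (T + l.length * (c + 9) + 4) := by
  have := (Ev.foldU (fun acc x => if f x then x :: acc else acc) ([] : List α) (c + 4) h Ev.nil
    (b := .ifz b (.ix 1) (.cons (.ix 0) (.ix 1))) fun acc x hx =>
      (Ev.ifB (U := 3) (hb _ x hx) (fun h => by simpa [h] using Ev.ix1.mono (by omega))
        (fun h => by simpa [h] using Ev.ix0.cons Ev.ix1)).mono (by omega)).rev
  have h2 : ∀ l' : List α, l.foldl (fun acc x => if f x then x :: acc else acc) l' =
      (l.filter f).reverse ++ l' := by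
    clear this h hb
    induction l with
    | nil => simp
    | cons x l ih => intro l'; by_cases hx : f x <;> simp [ih, hx]
  rw [h2, List.append_nil, List.reverse_reverse] at this
  refine this.mono ?_
  have := List.length_filter_le f l
  simp only [List.length_reverse]
  nlinarith

theorem Ev.zip {e₁ e₂ b : Ex} {l₁ : List α} {l₂ : List β} {T U : ℕ} (f : α → β → γ) (c : ℕ)
    (h₁ : Ev P I env e₁ (enc l₁) T) (h₂ : Ev P I env e₂ (enc l₂) U)
    (hl : l₁.length = l₂.length)
    (hb : ∀ acc, ∀ x ∈ l₁, ∀ y ∈ l₂, ∀ (l' : List β),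
      Ev P I (env ++ [.pair (enc (y :: l')) acc, enc x]) b (enc (f x y)) c) :
    Ev P I env (zipE e₁ e₂ b) (enc (List.zipWith f l₁ l₂)) (T + U + l₁.length * (c + 12) + 8) := by
  have := (Ev.foldP (P := P) (I := I) (env := env) (i := .cons e₂ (.nat 0))
    (b := .cons (.cdr (.car (.ix 1))) (.cons b (.cdr (.ix 1))))
    (fun l => enc ((l₂.drop l.length, (List.zipWith f l l₂).reverse) : List β × List γ))
    (fun _ => c + 7) h₁ (by simpa using h₂.prod (Ev.nil (α := γ))) (by
      intro a x a' h
      have hlt : a.length < l₂.length := by rw [← hl, h]; simp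
      have e1 := List.drop_eq_getElem_cons hlt
      have e2 : List.zipWith f (a ++ [x]) l₂ = List.zipWith f a l₂ ++ [f x l₂[a.length]] := by
        conv_lhs => rw [← List.take_append_drop a.length l₂]
        rw [List.zipWith_append (by simp; omega), e1]
        congr 1
        · nth_rw 2 [← List.take_append_drop a.length l₂]
          rw [← List.append_nil a, List.zipWith_append (by simp; omega)]
          simp
      rw [e2, e1]
      simp only [List.length_append, List.length_singleton, List.reverse_append,
        List.reverse_singleton, List.singleton_append]
      have hx : x ∈ l₁ := by simp [h]
      set p : List β × List γ :=
        (l₂[a.length] :: l₂.drop (a.length + 1), (List.zipWith f a l₂).reverse) with hp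
      have k1 : Ev P I (env ++ [enc p, enc x]) _ _ _ :=
        Ev.tail (x := l₂[a.length]) (l := l₂.drop (a.length + 1)) (Ev.fst (x := p) Ev.ix1)
      have k2 : Ev P I (env ++ [enc p, enc x]) _ _ _ := Ev.snd (x := p) Ev.ix1
      have k3 := hb (enc p.2) x hx _ (List.getElem_mem hlt) (l₂.drop (a.length + 1))
      exact (k1.prod (k3.cons k2)).mono (by omega))).snd.rev
  simp only [List.reverse_reverse] at this
  refine this.mono ?_
  have := min_le_left l₁.length l₂.length
  simp only [List.length_reverse, sum_map_const, List.length_zipWith]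
  nlinarith

theorem Ev.not {e : Ex} {z : Bool} {T : ℕ} (h : Ev P I env e (enc z) T) :
    Ev P I env (notE e) (enc (!z)) (T + 2) :=
  h.ifB (fun h => by simpa [h] using Ev.tt) (fun h => by simpa [h] using Ev.ff)

theorem Ev.and {a b : Ex} {x y : Bool} {T U : ℕ} (ha : Ev P I env a (enc x) T)
    (hb : Ev P I env b (enc y) U) : Ev P I env (andE a b) (enc (x && y)) (T + U + 2) :=
  (ha.ifB (U := U + 1) (fun h => by simpa [h] using Ev.ff.mono (by omega))
    (fun h => by simpa [h] using hb.mono (by omega))).mono (by omega)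

theorem Ev.or {a b : Ex} {x y : Bool} {T U : ℕ} (ha : Ev P I env a (enc x) T)
    (hb : Ev P I env b (enc y) U) : Ev P I env (orE a b) (enc (x || y)) (T + U + 2) :=
  (ha.ifB (U := U + 1) (fun h => by simpa [h] using hb.mono (by omega))
    (fun h => by simpa [h] using Ev.tt.mono (by omega))).mono (by omega)

theorem Ev.eq {a b : Ex} {x y : ℕ} {T U : ℕ} (ha : Ev P I env a (enc x) T)
    (hb : Ev P I env b (enc y) U) :
    Ev P I env (eqE a b) (enc (decide (x = y))) (2 * T + 2 * U + 8) := by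
  have := (ha.lt hb).not.and (hb.lt ha).not
  have h2 : (!decide (x < y) && !decide (y < x)) = decide (x = y) := by
    rw [Bool.eq_iff_iff]; simp; omega
  rw [h2] at this
  exact this.mono (by omega)

theorem Ev.append {a b : Ex} {x y : List α} {T U : ℕ} (ha : Ev P I env a (enc x) T)
    (hb : Ev P I env b (enc y) U) :
    Ev P I env (appendE a b) (enc (x ++ y)) (T + U + 8 * x.length + 3) := by
  have := Ev.foldU (fun acc x => x :: acc) y 3 ha.rev hb
    (b := .cons (.ix 0) (.ix 1)) fun acc x _ => Ev.ix0.cons Ev.ix1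
  rw [List.foldl_flip_cons_eq_append', List.reverse_reverse] at this
  refine this.mono ?_
  simp only [List.length_reverse]
  omega

/-- Bit strings. -/
abbrev Bits := List Bool

/-- The complementary bit string. -/
def compl (u : Bits) : Bits := u.map not

theorem Ev.compl {e : Ex} {u : Bits} {T : ℕ} (h : Ev P I env e (enc u) T) :
    Ev P I env (complE e) (enc (compl u)) (T + 10 * u.length + 4) := by
  have := h.map Bool.not 3 (b := notE (.ix 0)) fun _ _ _ => Ev.ix0.not
  exact this.mono (by omega)

end rules

/-! ### The program -/

/-- A point, reduced to its cell, the chunks of the rank of its first fractional part, the rank of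
its second fractional part, and its keys as a query and as a datum. -/
structure Rec where
  X : ℕ
  Y : ℕ
  xs : List Bits
  y : Bits
  qk : List Bits
  dk : List Bits

instance : Enc Rec := ⟨fun r => enc (r.X, r.Y, r.xs, r.y, r.qk, r.dk)⟩

def rX (e : Ex) : Ex := .car e
def rY (e : Ex) : Ex := .car (.cdr e)
def rxs (e : Ex) : Ex := .car (.cdr (.cdr e))
def ry (e : Ex) : Ex := .car (.cdr (.cdr (.cdr e)))
def rqk (e : Ex) : Ex := .car (.cdr (.cdr (.cdr (.cdr e))))
def rdk (e : Ex) : Ex := .cdr (.cdr (.cdr (.cdr (.cdr e))))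

/-- Consecutive local definitions. -/
def lets (es : List Ex) (e : Ex) : Ex := es.foldr .letE e

/-- Procedures call themselves and each other by their positions in `procs`; these are the
positions. -/
def iLtB : ℕ := 0
def iMaxB : ℕ := 1
def iDom : ℕ := 2
def iProp : ℕ := 3
def iDrop : ℕ := 4
def iTake : ℕ := 5
def iRevTake : ℕ := 6
def iCol : ℕ := 7
def iColEq : ℕ := 8
def iQual : ℕ := 9
def iTestF : ℕ := 10
def iTestG : ℕ := 11
def iKeep : ℕ := 12
def iOmit : ℕ := 13
def iCheck : ℕ := 14
def iTree : ℕ := 15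
def iBrute : ℕ := 16
def iAdd : ℕ := 17
def iMul : ℕ := 18
def iHalf : ℕ := 19
def iLg : ℕ := 20
def iIota : ℕ := 21
def iFindD : ℕ := 22
def iFindK : ℕ := 23
def iZeros : ℕ := 24
def iUnary : ℕ := 25
def iAxis : ℕ := 26
def iChunk : ℕ := 27
def iMkRec : ℕ := 28
def iInc : ℕ := 29
def iAssign : ℕ := 30
def iMerge : ℕ := 31
def iSort : ℕ := 32
def iRecs : ℕ := 33
def iLays : ℕ := 34
def iTests : ℕ := 35
def iInside : ℕ := 36
def iFl : ℕ := 37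
def iItem : ℕ := 38
def iItems : ℕ := 39
def iAnyOut : ℕ := 40
def iAddR : ℕ := 41
def iSubR : ℕ := 42
def iDecide : ℕ := 43
def iSolve : ℕ := 44
def iAdv : ℕ := 45
def iTotal : ℕ := 46
def iRead : ℕ := 47
def iReadAll : ℕ := 48
def iRepeat : ℕ := 49
def iKeepRec : ℕ := 50

/-- Strict lexicographic comparison of bit strings. -/
def pLtB : Proc := ⟨2, .ifz (.v 1) (.nat 0) (.ifz (.v 0) (.nat 1)
  (.ifz (.lt (.car (.v 0)) (.car (.v 1)))
    (.ifz (.lt (.car (.v 1)) (.car (.v 0)))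
      (lets [.cdr (.v 0), .cdr (.v 1)] (.call iLtB [2, 3])) (.nat 0)) (.nat 1)))⟩

/-- The maximum of two bit strings. -/
def pMaxB : Proc := ⟨2, .letE (.call iLtB [0, 1]) (.ifz (.v 2) (.v 0) (.v 1))⟩

/-- For every query the maximal value of the data that are dominated by it in every key. -/
def pDom : Proc := ⟨2, .ifz (.v 0) (.nat 0) (.ifz (.v 1) (mapE (.v 0) (.nat 0))
  (.ifz (.car (.v 0))
    (.letE (.fold (.v 1) (.nat 0) (.letE (.cdr (.v 3)) (.call iMaxB [2, 4]))) (mapE (.v 0) (.v 2)))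
  (.ifz (.car (.car (.v 0)))
    (lets [mapE (.v 0) (.cdr (.ix 0)),
      mapE (.v 1) (.cons (.cdr (.car (.ix 0))) (.cdr (.ix 0)))] (.call iDom [2, 3]))
  (lets [mapE (filterE (.v 0) (notE (.car (.car (.ix 0)))))
        (.cons (.cdr (.car (.ix 0))) (.cdr (.ix 0))),
      mapE (filterE (.v 0) (.car (.car (.ix 0)))) (.cons (.cdr (.car (.ix 0))) (.cdr (.ix 0))),
      mapE (filterE (.v 0) (.car (.car (.ix 0)))) (.cdr (.ix 0)),
      mapE (filterE (.v 1) (notE (.car (.car (.car (.ix 0))))))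
        (.cons (.cons (.cdr (.car (.car (.ix 0)))) (.cdr (.car (.ix 0)))) (.cdr (.ix 0))),
      mapE (filterE (.v 1) (.car (.car (.car (.ix 0)))))
        (.cons (.cons (.cdr (.car (.car (.ix 0)))) (.cdr (.car (.ix 0)))) (.cdr (.ix 0))),
      mapE (filterE (.v 1) (notE (.car (.car (.car (.ix 0))))))
        (.cons (.cdr (.car (.ix 0))) (.cdr (.ix 0))),
      .call iDom [2, 5], .call iDom [3, 6], .call iDom [4, 7],
      zipE (.v 9) (.v 10) (lets [zipY, .v 12] (.call iMaxB [14, 13]))]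
    -- Variables 8 and 11 hold the answers to the queries whose first bit is 0 and 1. They are
    -- merged back into the order of the queries.
    (revE (.car (.fold (.v 0) (.cons (.nat 0) (.cons (.v 8) (.v 11)))
      (.ifz (.car (.car (.ix 0)))
        (.cons (.cons (.car (.car (.cdr (.ix 1)))) (.car (.ix 1)))
          (.cons (.cdr (.car (.cdr (.ix 1)))) (.cdr (.cdr (.ix 1)))))
        (.cons (.cons (.car (.cdr (.cdr (.ix 1)))) (.car (.ix 1)))
          (.cons (.car (.cdr (.ix 1))) (.cdr (.cdr (.cdr (.ix 1)))))))))))))) ⟩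

/-- Propagate values along the layers. -/
def pProp : Proc := ⟨2, .fold (.v 1) (.v 0)
  (lets [mapE (.v 3) (rqk (.ix 0)), mapE (.v 2) (.cons (rdk (.car (.ix 0))) (.cdr (.ix 0))),
    .call iDom [4, 5]] (zipE (.v 3) (.v 6) (.cons (.ix 0) zipY)))⟩

def pDrop : Proc := ⟨2, .ifz (.v 0) (.v 1) (.ifz (.v 1) (.nat 0)
  (lets [.pred (.v 0), .cdr (.v 1)] (.call iDrop [2, 3])))⟩

def pTake : Proc := ⟨2, .ifz (.v 0) (.nat 0) (.ifz (.v 1) (.nat 0)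
  (lets [.pred (.v 0), .cdr (.v 1), .call iTake [2, 3]] (.cons (.car (.v 1)) (.v 4))))⟩

def pRevTake : Proc := ⟨2, .letE (.call iTake [0, 1]) (revE (.v 2))⟩

/-- The chunk number `l` of a record. -/
def pCol : Proc := ⟨2, lets [rxs (.v 1), .call iDrop [0, 2]] (.car (.v 3))⟩

def pColEq : Proc := ⟨3, lets [.call iCol [1, 2], .call iLtB [3, 0], .call iLtB [0, 3]]
  (andE (notE (.v 4)) (notE (.v 5)))⟩

/-- Does a record qualify for a test?  The arguments are the record, the test, the chunk of the
child node and the level. -/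
def pQual : Proc := ⟨4, lets [.call iCol [3, 0], .call iLtB [4, 2], .call iLtB [2, 4],
    rX (.v 0), rY (.v 0), .car (.cdr (.v 1)), .car (.cdr (.cdr (.v 1))), .cdr (.cdr (.cdr (.v 1)))]
  (andE (notE (.lt (.succ (.v 9)) (.v 7))) (andE (notE (.lt (.succ (.v 7)) (.v 9)))
  (andE (orE (notE (.lt (.v 9) (.v 7))) (.v 5)) (andE (orE (notE (.lt (.v 7) (.v 9))) (.v 6))
  (andE (notE (.lt (.succ (.v 10)) (.v 8))) (andE (notE (.lt (.succ (.v 8)) (.v 10)))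
  (andE (orE (notE (.lt (.v 10) (.v 8))) (.v 11))
    (orE (notE (.lt (.v 8) (.v 10))) (notE (.v 11)))))))))) ⟩

/-- Extend the vectors of the records of the first layer; arguments: test, child node, zero string,
records with vectors. -/
def pTestF : Proc := ⟨4, lets [.succ (.car (.v 0)), .call iRevTake [4, 1],
    .car (.cdr (.v 0)), .car (.cdr (.cdr (.v 0))), .cdr (.cdr (.cdr (.v 0))),
    mapE (.car (.v 5)) (.cons (.ix 0) (.ifz (andE (eqE (rX (.ix 0)) (.v 6))
      (eqE (rY (.ix 0)) (.v 7))) (.nat 0) (.ifz (.v 8) (complE (ry (.ix 0))) (ry (.ix 0))))),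
    .cdr (.v 5), .call iProp [9, 10]]
  (zipE (.v 3) (.v 11) (.cons (.car (.ix 0))
    (.cons (.ifz (.cdr zipY) (.v 2) (.cdr zipY)) (.cdr (.ix 0)))))⟩

/-- Extend the vectors of the records of the last layer; arguments: test, node, chunk of the child,
level, zero string, records with vectors. -/
def pTestG : Proc := ⟨6, lets [.succ (.car (.v 0)), .call iDrop [6, 1], .cdr (.cdr (.cdr (.v 0))),
    mapE (.car (.v 7)) (.cons (.ix 0) (.letE (.call iQual [10, 0, 2, 3])
      (.ifz (.v 11) (.nat 0) (.ifz (.v 8) (ry (.v 10)) (complE (ry (.v 10))))))),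
    .cdr (.v 7), .call iProp [9, 10]]
  (zipE (.v 5) (.v 11) (.cons (.car (.ix 0))
    (.cons (complE (.ifz (.cdr zipY) (.v 4) (.cdr zipY))) (.cdr (.ix 0)))))⟩

/-- Keep the records in the column `c` of level `l` (arguments `c`, `l`, list). -/
def pKeep : Proc := ⟨3, filterE (.v 2) (.letE (.car (.v 4)) (.call iColEq [0, 1, 5]))⟩
def pOmit : Proc := ⟨3, filterE (.v 2) (notE (.letE (.car (.v 4)) (.call iColEq [0, 1, 5])))⟩
def pKeepRec : Proc := ⟨3, filterE (.v 2) (.call iColEq [0, 1, 4])⟩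

/-- Is there a pair whose vectors are in the dominance relation? -/
def pCheck : Proc := ⟨2, lets [mapE (.v 1) (.cdr (.ix 0)),
    mapE (.v 0) (.cons (.cdr (.ix 0)) (.cons (.nat 1) (.nat 0))), .call iDom [2, 3]]
  (.fold (.v 4) (.nat 0) (.ifz (.ix 0) (.ix 1) (.nat 1)))⟩

/-- Search for a pair without a chain; arguments: level, node, first and last layer with vectors,
number of levels, tests, zero string. -/
def pTree : Proc := ⟨7, .ifz (.v 2) (.nat 0) (.ifz (.lt (.v 0) (.v 4)) (.nat 0)
  -- Variables 7 to 15: the first record still to be treated; its column; the records of the first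
  -- layer inside and outside this column; the child node; the first of these two lists with
  -- extended vectors; the last layer with extended vectors; its part outside the column; the answer
  -- of the dominance check. If neither the check nor the child has a bad pair, the other columns
  -- are treated by a call for the same node.
  (lets [.car (.car (.v 2)), .call iCol [0, 7], .call iKeep [8, 0, 2], .call iOmit [8, 0, 2],
      mapE (.v 1) (.call iKeepRec [8, 0, 12]),
      .fold (.v 5) (.v 9) (.call iTestF [13, 11, 6, 12]),
      .fold (.v 5) (.v 3) (.call iTestG [14, 1, 8, 0, 6, 13]),
      .call iOmit [8, 0, 13], .call iCheck [12, 14]]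
    (.ifz (.v 15)
      (lets [.call iKeep [8, 0, 13], .succ (.v 0), .call iTree [17, 11, 12, 16, 4, 5, 6]]
        (.ifz (.v 18) (.call iTree [0, 1, 10, 3, 4, 5, 6]) (.nat 1)))
      (.nat 1))))⟩

/-- Search for a pair without a chain, record by record. -/
def pBrute : Proc := ⟨2, .fold (.v 0) (.nat 0) (.ifz (.v 2)
  (lets [.cons (.cons (.v 3) (.cons (.nat 1) (.nat 0))) (.nat 0), .call iProp [4, 1]]
    (.fold (.v 5) (.nat 0) (.ifz (.cdr (.ix 0)) (.nat 1) (.ix 1)))) (.nat 1))⟩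

def pAdd : Proc := ⟨2, .ifz (.v 1) (.v 0)
  (lets [.succ (.v 0), .pred (.v 1)] (.call iAdd [2, 3]))⟩

def pMul : Proc := ⟨2, .ifz (.v 1) (.nat 0)
  (lets [.pred (.v 1), .call iMul [0, 2]] (.call iAdd [3, 0]))⟩

/-- Every other element. -/
def pHalf : Proc := ⟨1, .ifz (.v 0) (.nat 0) (.ifz (.cdr (.v 0)) (.v 0)
  (lets [.cdr (.cdr (.v 0)), .call iHalf [1]] (.cons (.car (.v 0)) (.v 2))))⟩

/-- One plus the logarithm of the length. -/
def pLg : Proc := ⟨1, .ifz (.v 0) (.nat 1) (.ifz (.cdr (.v 0)) (.nat 1)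
  (lets [.call iHalf [0], .call iLg [1]] (.succ (.v 2))))⟩

def pIota : Proc := ⟨1, .ifz (.v 0) (.nat 0)
  (lets [.pred (.v 0), .call iIota [1]] (.cons (.v 1) (.v 2)))⟩

/-- The largest `d` with `d ^ 2 * q ≤ L`. -/
def pFindD : Proc := ⟨3, lets [.succ (.v 0), .call iMul [3, 3], .call iMul [4, 1]]
  (.ifz (.lt (.v 2) (.v 5)) (.call iFindD [3, 1, 2]) (.v 0))⟩

/-- The least `k` with `L ≤ d * k`. -/
def pFindK : Proc := ⟨3, lets [.call iMul [1, 0]] (.ifz (.lt (.v 3) (.v 2)) (.v 0)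
  (.letE (.succ (.v 0)) (.call iFindK [4, 1, 2])))⟩

def pZeros : Proc := ⟨1, .ifz (.v 0) (.nat 0)
  (lets [.pred (.v 0), .call iZeros [1]] (.cons (.nat 0) (.v 2)))⟩

/-- The string of length `m` that starts with `X` ones. -/
def pUnary : Proc := ⟨2, .ifz (.v 0) (.nat 0)
  (lets [.pred (.v 0), .pred (.v 1), .call iUnary [2, 3]]
    (.cons (.ifz (.v 1) (.nat 0) (.nat 1)) (.v 4)))⟩

/-- The keys of one axis. -/
def pAxis : Proc := ⟨3, lets [.succ (.v 1), .succ (.v 3), .call iUnary [0, 3],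
    appendE (.v 5) (.v 2), .call iUnary [0, 4], appendE (.v 7) (.v 2), .call iUnary [0, 1],
    appendE (.v 9) (.v 2)]
  (.cons (.cons (.v 8) (complE (.v 10))) (.cons (.v 6) (complE (.v 6))))⟩

def pChunk : Proc := ⟨3, .ifz (.v 0) (.nat 0)
  (lets [.pred (.v 0), .call iDrop [1, 2], .call iChunk [3, 1, 4], .call iTake [1, 2]]
    (.cons (.v 6) (.v 5)))⟩

/-- The record of an item, with its layer. -/
def pMkRec : Proc := ⟨4, lets [.car (.v 0), .car (.cdr (.v 4)), .cdr (.cdr (.v 4)),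
    .car (.cdr (.car (.v 6))), .cdr (.v 6), .cdr (.v 0), .call iAxis [3, 7, 8], .call iAxis [3, 5, 9],
    .call iChunk [1, 2, 8]]
  (.cons (.car (.cdr (.cdr (.car (.v 6))))) (.cons (.v 7) (.cons (.v 5) (.cons (.v 12) (.cons (.v 9)
    (.cons
      (.cons (.car (.car (.v 10))) (.cons (.cdr (.car (.v 10)))
        (.cons (.car (.car (.v 11))) (.cons (.cdr (.car (.v 11))) (.nat 0)))))
      (.cons (.car (.cdr (.v 10))) (.cons (.cdr (.cdr (.v 10)))
        (.cons (.car (.cdr (.v 11))) (.cons (.cdr (.cdr (.v 11))) (.nat 0)))))))))))⟩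

/-- The successor of a bit string, preceded by the overflow bit. -/
def pInc : Proc := ⟨1, .ifz (.v 0) (.cons (.nat 1) (.nat 0))
  (lets [.cdr (.v 0), .call iInc [1]] (.ifz (.car (.v 2))
    (.cons (.nat 0) (.cons (.car (.v 0)) (.cdr (.v 2))))
    (.ifz (.car (.v 0)) (.cons (.nat 0) (.cons (.nat 1) (.cdr (.v 2))))
      (.cons (.nat 1) (.cons (.nat 0) (.cdr (.v 2)))))))⟩

/-- Pair the elements of a list with increasing bit strings. -/
def pAssign : Proc := ⟨2, .cdr (.fold (.v 0) (.cons (.v 1) (.nat 0))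
  (lets [.car (.v 2), .call iInc [4]]
    (.cons (.cdr (.v 5)) (.cons (.cons (.v 3) (.v 4)) (.cdr (.v 2))))))⟩

/-- Items are compared by their real component first, and then by their integer component in the
opposite order. -/
def leE (a b : Ex) : Ex := andE (notE (.rlt (.car b) (.car a)))
  (orE (.rlt (.car a) (.car b)) (notE (.lt (.car (.cdr a)) (.car (.cdr b)))))

def pMerge : Proc := ⟨2, .ifz (.v 0) (.v 1) (.ifz (.v 1) (.v 0)
  (.ifz (leE (.car (.v 0)) (.car (.v 1)))
    (lets [.cdr (.v 1), .call iMerge [0, 2]] (.cons (.car (.v 1)) (.v 3)))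
    (lets [.cdr (.v 0), .call iMerge [2, 1]] (.cons (.car (.v 0)) (.v 3)))))⟩

def pSort : Proc := ⟨1, .ifz (.v 0) (.nat 0) (.ifz (.cdr (.v 0)) (.v 0)
  (lets [.call iHalf [0], .cdr (.v 0), .call iHalf [2], .call iSort [1], .call iSort [3]]
    (.call iMerge [4, 5])))⟩

/-- The records of the items; further arguments: number and length of chunks, length of ranks,
length of the unary codes of cells. -/
def pRecs : Proc := ⟨5, lets [.call iZeros [3], .call iSort [0], .call iAssign [6, 5],
    mapE (.v 7) (.cons (.cdr (.cdr (.cdr (.cdr (.car (.ix 0))))))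
      (.cons (.car (.cdr (.cdr (.cdr (.car (.ix 0)))))) (.ix 0))),
    .call iSort [8], .call iAssign [9, 5]]
  (mapE (.v 10) (.call iMkRec [12, 1, 2, 4]))⟩

def pLays : Proc := ⟨2, .letE (.call iIota [1]) (.fold (.v 2) (.nat 0)
  (.cons (mapE (filterE (.v 0) (eqE (.car (.ix 0)) (.v 4))) (.cdr (.ix 0))) (.v 3)))⟩

/-- All tests: a layer, a cell and a direction. -/
def pTests : Proc := ⟨2, lets [.call iIota [0], .call iIota [1]]
  (.fold (.v 2) (.nat 0) (.fold (.v 3) (.v 4) (.fold (.v 3) (.v 6)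
    (.cons (.cons (.v 5) (.cons (.v 7) (.cons (.v 9) (.nat 1))))
      (.cons (.cons (.v 5) (.cons (.v 7) (.cons (.v 9) (.nat 0)))) (.v 8))))))⟩

/-- Is a point in the window `[lx, hx] × [ly, hy]`? -/
def pInside : Proc := ⟨5, andE (notE (.rlt (.car (.v 0)) (.v 1)))
  (andE (notE (.rlt (.v 2) (.car (.v 0)))) (andE (notE (.rlt (.cdr (.v 0)) (.v 3)))
    (notE (.rlt (.v 4) (.cdr (.v 0))))))⟩

/-- Fractional and integral part of `x - l`, plus `X`. -/
def pFl : Proc := ⟨3, .ifz (.rlt (.v 0) (.add (.v 1) .one))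
  (lets [.add (.v 1) .one, .succ (.v 2)] (.call iFl [0, 3, 4]))
  (.cons (.sub (.v 0) (.v 1)) (.v 2))⟩

def pItem : Proc := ⟨4, lets [.car (.v 1), .cdr (.v 1), .nat 0, .call iFl [4, 2, 6],
    .call iFl [5, 3, 6]]
  (.cons (.car (.v 7)) (.cons (.cdr (.v 7)) (.cons (.v 0) (.cons (.cdr (.v 8)) (.car (.v 8))))))⟩

def pItems : Proc := ⟨5, .cdr (.fold (.v 0) (.cons (.nat 0) (.nat 0))
  (.cons (.succ (.car (.v 5))) (.fold (.v 6) (.cdr (.v 5))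
    (.letE (.call iInside [8, 1, 2, 3, 4]) (.ifz (.v 9) (.v 7)
      (lets [.car (.v 5), .call iItem [10, 8, 1, 3]] (.cons (.v 11) (.v 7))))))))⟩

def pAnyOut : Proc := ⟨5, .fold (.v 0) (.nat 0)
  (.letE (.call iInside [6, 1, 2, 3, 4]) (.ifz (.v 7) (.nat 1) (.v 5)))⟩

def pAddR : Proc := ⟨2, .ifz (.v 0) (.v 1)
  (lets [.pred (.v 0), .add (.v 1) .one] (.call iAddR [2, 3]))⟩

def pSubR : Proc := ⟨2, .ifz (.v 0) (.v 1)
  (lets [.pred (.v 0), .sub (.v 1) .one] (.call iSubR [2, 3]))⟩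

/-- Is there a pair without a chain?  Arguments: `Δ`, `6 * Δ`, items. -/
def pDecide : Proc := ⟨3, lets [.call iLg [2], .call iIota [3], .call iLg [4], .call iMul [0, 0],
    .call iMul [6, 0], .call iMul [7, 5], .nat 0, .call iFindD [9, 8, 3],
    .ifz (.v 10) (.nat 1) (.v 10), .call iFindK [9, 11, 3], .call iMul [11, 12],
    .succ (.succ (.v 1)), .call iRecs [2, 11, 12, 13, 14], .succ (.v 0), .call iLays [15, 16],
    .car (.v 17), .cdr (.v 17)]
  -- Variables 3 to 19: `log N` (rounded up, plus one), a list of that length, `log log N` obtained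
  -- from this list, `Δ²`, `Δ³`, `Δ³ log log N`, the number 0, the number of levels, the same number
  -- but at least 1, the length of the chunks, the length of the ranks, `6Δ + 2`, the records tagged
  -- with layers, `Δ + 1`, all layers, the first layer, the other layers.
  (.ifz (.v 10) (.call iBrute [18, 19])
    (lets [.fold (.v 17) (.nat 0) (.ix 0), mapE (.v 18) (.cons (.ix 0) (.nat 0)),
        mapE (.v 20) (.cons (.ix 0) (.nat 0)), .succ (.v 1), .call iTests [0, 23],
        .call iZeros [13]]
      (.call iTree [9, 17, 21, 22, 10, 24, 25])))⟩

/-- The chain problem; arguments: `Δ` and the list of point sets. -/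
def pSolve : Proc := ⟨2, lets [.car (.v 1), .fold (.v 1) (.nat 0) (.ix 0)]
  (.ifz (.v 2) (.nat 1) (.ifz (.v 3) (.nat 1)
    (lets [.car (.v 2), .call iAdd [0, 0], .call iAdd [5, 0], .call iAdd [6, 6], .car (.v 4),
        .cdr (.v 4), .call iAddR [6, 8], .call iSubR [6, 8], .call iAddR [6, 9],
        .call iSubR [6, 9], .call iAnyOut [2, 11, 10, 13, 12], .call iAnyOut [3, 11, 10, 13, 12]]
      -- Variables 2 to 15: first and last layer, the centre of the window, `2Δ`, `3Δ`, `6Δ`, the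
      -- two coordinates of the centre, upper and lower bound of the window in the first and then in
      -- the second coordinate, and whether some point of the first or last layer is outside.
      (.ifz (.v 14) (.ifz (.v 15)
        (lets [.call iItems [1, 11, 10, 13, 12], .call iDecide [0, 7, 16]] (notE (.v 17)))
        (.nat 0)) (.nat 0)))))⟩

/-- `a + 2 * m`, for the arguments `m`, `a`. -/
def pAdv : Proc := ⟨2, .ifz (.v 0) (.v 1)
  (lets [.pred (.v 0), .succ (.succ (.v 1))] (.call iAdv [2, 3]))⟩

/-- Add twice the sizes of `c` point sets, starting at address `j`, to `a`. -/
def pTotal : Proc := ⟨3, .ifz (.v 0) (.v 2)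
  (lets [.pred (.v 0), .succ (.v 1), .inI (.v 1), .call iAdv [5, 2]] (.call iTotal [3, 4, 6]))⟩

/-- Read `m` points from the address `a` on. -/
def pRead : Proc := ⟨2, .ifz (.v 0) (.nat 0)
  (lets [.pred (.v 0), .succ (.succ (.v 1)), .call iRead [2, 3]]
    (.cons (.cons (.inR (.v 1)) (.inR (.succ (.v 1)))) (.v 4)))⟩

/-- Read `c` point sets; the sizes start at the address `j`, the points at the address `a`. -/
def pReadAll : Proc := ⟨3, .ifz (.v 0) (.nat 0)
  (lets [.pred (.v 0), .succ (.v 1), .inI (.v 1), .call iAdv [5, 2], .call iReadAll [3, 4, 6],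
    .call iRead [5, 2]] (.cons (.v 8) (.v 7)))⟩

def pRepeat : Proc := ⟨2, .ifz (.v 0) (.nat 0)
  (lets [.pred (.v 0), .call iRepeat [2, 1]] (.cons (.v 1) (.v 3)))⟩

/-- All procedures. -/
def procs : List Proc := [pLtB, pMaxB, pDom, pProp, pDrop, pTake, pRevTake, pCol, pColEq, pQual,
  pTestF, pTestG, pKeep, pOmit, pCheck, pTree, pBrute, pAdd, pMul, pHalf, pLg, pIota, pFindD,
  pFindK, pZeros, pUnary, pAxis, pChunk, pMkRec, pInc, pAssign, pMerge, pSort, pRecs, pLays,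
  pTests, pInside, pFl, pItem, pItems, pAnyOut, pAddR, pSubR, pDecide, pSolve, pAdv, pTotal,
  pRead, pReadAll, pRepeat, pKeepRec]

/-! ### Evaluation of the procedures -/

section procedures

variable {I : Input}

theorem Ev.ltBool {P : List Proc} {env : List Val} {a b : Ex} {k l : Bool} {T U : ℕ}
    (ha : Ev P I env a (enc k) T) (hb : Ev P I env b (enc l) U) :
    Ev P I env (.lt a b) (enc (decide (k < l))) (T + U + 1) := by
  obtain ⟨t, ht, ha⟩ := ha
  obtain ⟨u, hu, hb⟩ := hb
  refine ⟨t + u + 1, by omega, ?_⟩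
  have := Eval.lt ha hb
  cases k <;> cases l <;> exact this

theorem ev_ltB (u v : Bits) :
    Ev procs I [enc u, enc v] pLtB.body (enc (decide (u < v))) (30 * u.length + 30) := by
  induction u generalizing v with
  | nil =>
    refine (Ev.ifL (Ev.v (x := enc v) rfl) (fun h => ?_) (fun b v' h => ?_)).mono
      (T := 1 + (1 + 1 + 1) + 1) (by simp)
    · subst h; exact Ev.ff.mono (by omega)
    · subst h
      exact Ev.ifL (Ev.v (x := enc ([] : Bits)) rfl) (fun _ => by simpa using Ev.tt) (by simp)
  | cons a u ih =>
    cases v with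
    | nil =>
      exact ((Ev.ifL (Ev.v (x := enc ([] : Bits)) rfl) (fun _ => by simpa using Ev.ff)
        (by simp)).mono (by simp))
    | cons b v =>
      have hu : Ev procs I [enc (a :: u), enc (b :: v)] (.v 0) (enc (a :: u)) 1 := Ev.v rfl
      have hv : Ev procs I [enc (a :: u), enc (b :: v)] (.v 1) (enc (b :: v)) 1 := Ev.v rfl
      have hc := Ev.letE hu.tail (Ev.letE (Ev.tail (x := b) (l := v) (Ev.v (j := 1) rfl))
        (Ev.call (p := iLtB) (xs := [2, 3]) rfl rfl rfl (ih v)))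
      refine (Ev.ifL hv (by simp) fun _ _ _ => Ev.ifL hu (by simp) fun _ _ _ =>
        Ev.ifB (hu.head.ltBool hv.head) (fun h1 => Ev.ifB (hv.head.ltBool hu.head) (fun h2 => ?_)
          (fun h2 => ?_)) (fun h1 => ?_)).mono
        (T := 1 + (1 + (5 + (5 + (30 * u.length + 30 + 11) + 1) + 1) + 1) + 1)
          (by simp; omega)
      · have : a = b := by
          simp at h1 h2
          exact le_antisymm h2 h1
        have h3 : decide (a :: u < b :: v) = decide (u < v) := by
          subst this
          simp
        rw [h3]
        exact hc.mono (by simp; omega)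
      · have h3 : decide (a :: u < b :: v) = false := by
          simp only [decide_eq_true_eq] at h2
          exact decide_eq_false (not_lt_of_gt (List.cons_lt_cons_iff.2 (Or.inl h2)))
        rw [h3]
        exact Ev.ff.mono (by omega)
      · have h3 : decide (a :: u < b :: v) = true := by
          simp only [decide_eq_true_eq] at h1 ⊢
          rw [List.cons_lt_cons_iff]
          exact Or.inl h1
        rw [h3]
        exact Ev.tt.mono (by omega)

theorem ev_maxB (u v : Bits) :
    Ev procs I [enc u, enc v] pMaxB.body (enc (max u v)) (30 * u.length + 40) := by
  refine (Ev.letE (Ev.call (p := iLtB) (xs := [0, 1]) rfl rfl rfl (ev_ltB u v))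
    (Ev.ifB (U := 1) (Ev.v rfl) (fun h => ?_) (fun h => ?_))).mono (by simp)
  · rw [max_eq_left (by simpa using h)]; exact Ev.v rfl
  · rw [max_eq_right (by simp at h; exact h.le)]; exact Ev.v rfl

theorem ev_drop {α : Type} [Enc α] (k : ℕ) (l : List α) :
    Ev procs I [enc k, enc l] pDrop.body (enc (l.drop k)) (15 * k + 10) := by
  induction k generalizing l with
  | zero =>
    exact (Ev.ifN (U := 1) (Ev.v (x := enc 0) rfl) (fun _ => Ev.v rfl) (by simp)).mono (by simp)
  | succ k ih =>
    refine (Ev.ifN (Ev.v (x := enc (k + 1)) rfl) (by simp) fun _ =>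
      Ev.ifL (Ev.v (x := enc l) rfl) (fun h => ?_) fun a l' h => ?_).mono
        (T := 1 + (1 + (15 * k + 20) + 1) + 1) (by omega)
    · subst h; simpa using Ev.nil.mono (by omega)
    · subst h
      exact (Ev.letE (Ev.pred (Ev.v (x := enc (k + 1)) rfl)) (Ev.letE
        (Ev.tail (x := a) (l := l') (Ev.v rfl))
        (Ev.call (p := iDrop) (xs := [2, 3]) rfl rfl rfl (ih l')))).mono (by simp; omega)

theorem ev_take {α : Type} [Enc α] (k : ℕ) (l : List α) :
    Ev procs I [enc k, enc l] pTake.body (enc (l.take k)) (20 * k + 10) := by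
  induction k generalizing l with
  | zero =>
    exact (Ev.ifN (U := 1) (Ev.v (x := enc 0) rfl) (fun _ => Ev.nil) (by simp)).mono (by simp)
  | succ k ih =>
    refine (Ev.ifN (Ev.v (x := enc (k + 1)) rfl) (by simp) fun _ =>
      Ev.ifL (Ev.v (x := enc l) rfl) (fun h => ?_) fun a l' h => ?_).mono
        (T := 1 + (1 + (20 * k + 25) + 1) + 1) (by omega)
    · subst h; simpa using Ev.nil.mono (by omega)
    · subst h
      exact (Ev.letE (Ev.pred (Ev.v (x := enc (k + 1)) rfl)) (Ev.letE
        (Ev.tail (x := a) (l := l') (Ev.v rfl))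
        (Ev.letE (Ev.call (p := iTake) (xs := [2, 3]) rfl rfl rfl (ih l'))
          (Ev.cons (Ev.head (x := a) (l := l') (Ev.v rfl)) (Ev.v rfl))))).mono (by simp; omega)

theorem ev_revTake {α : Type} [Enc α] (k : ℕ) (l : List α) :
    Ev procs I [enc k, enc l] pRevTake.body (enc (l.take k).reverse) (24 * k + 17) := by
  refine (Ev.letE (Ev.call (p := iTake) (xs := [0, 1]) rfl rfl rfl (ev_take k l))
    (Ev.rev (Ev.v rfl))).mono ?_
  have := List.length_take_le k l
  simp only [List.length_cons, List.length_nil]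
  omega

theorem ev_add (a b : ℕ) :
    Ev procs I [enc a, enc b] pAdd.body (enc (a + b)) (15 * b + 10) := by
  induction b generalizing a with
  | zero =>
    exact (Ev.ifN (U := 1) (Ev.v (x := enc 0) rfl) (fun _ => Ev.v rfl) (by simp)).mono (by simp)
  | succ b ih =>
    have h := ih (a + 1)
    rw [Nat.add_right_comm] at h
    exact (Ev.ifN (Ev.v (x := enc (b + 1)) rfl) (by simp) fun _ =>
      Ev.letE (Ev.succ (Ev.v (x := enc a) rfl)) (Ev.letE (Ev.pred (Ev.v (x := enc (b + 1)) rfl))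
        (Ev.call (p := iAdd) (xs := [2, 3]) rfl rfl rfl h))).mono (by simp; omega)

theorem ev_mul (a b : ℕ) :
    Ev procs I [enc a, enc b] pMul.body (enc (a * b)) (15 * (a * b) + 35 * b + 10) := by
  induction b with
  | zero =>
    exact (Ev.ifN (U := 1) (Ev.v (x := enc 0) rfl) (fun _ => Ev.nat 0) (by simp)).mono (by simp)
  | succ b ih =>
    have h := ev_add (I := I) (a * b) a
    rw [← Nat.mul_succ] at h
    exact (Ev.ifN (Ev.v (x := enc (b + 1)) rfl) (by simp) fun _ =>
      Ev.letE (Ev.pred (Ev.v (x := enc (b + 1)) rfl))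
        (Ev.letE (Ev.call (p := iMul) (xs := [0, 2]) rfl rfl rfl ih)
        (Ev.call (p := iAdd) (xs := [3, 0]) rfl rfl rfl h))).mono
          (by simp; rw [Nat.mul_succ]; omega)

end procedures

/-! ### Sorting, logarithms, the search for the parameters, unary codes, chunks, and counting with
bit strings. -/

section procedures

variable {I : Input}

/-- Every other element of a list. -/
def half {α : Type} : List α → List α
  | [] => []
  | [a] => [a]
  | a :: _ :: l => a :: half l

theorem length_half {α : Type} : ∀ l : List α, (half l).length = (l.length + 1) / 2
  | [] => by simp [half]
  | [_] => by simp [half]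
  | _ :: _ :: l => by
    simp only [half, List.length_cons, length_half l]
    omega

theorem half_perm {α : Type} : ∀ l : List α, (half l ++ half l.tail).Perm l
  | [] => by simp [half]
  | [a] => by simp [half]
  | [a, b] => by simp [half]
  | a :: b :: c :: l => by
    have := half_perm (c :: l)
    simp only [half, List.tail_cons, List.cons_append] at this ⊢
    refine List.Perm.cons a ?_
    exact List.perm_middle.trans (this.cons b)

theorem ev_half {α : Type} [Enc α] : ∀ l : List α,
    Ev procs I [enc l] pHalf.body (enc (half l)) (15 * l.length + 10)
  | [] => (Ev.ifL (U := 1) (Ev.v (x := enc ([] : List α)) rfl) (fun _ => Ev.nil)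
      (by simp)).mono (by simp)
  | [a] => (Ev.ifL (l := [a]) (Ev.v rfl) (by simp) fun _ _ _ =>
      (Ev.ifL (U := 1) (Ev.tail (x := a) (l := ([] : List α)) (Ev.v rfl))
        (fun _ => Ev.v rfl) (by simp))).mono (by simp)
  | a :: b :: l => by
    have h : Ev procs I [enc (a :: b :: l)] (.v 0) (enc (a :: b :: l)) 1 := Ev.v rfl
    exact (Ev.ifL h (by simp) fun _ _ _ => (Ev.ifL h.tail (by simp) fun _ _ _ =>
      Ev.letE h.tail.tail (Ev.letE (Ev.call (p := iHalf) (xs := [1]) rfl rfl rfl (ev_half l))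
        (Ev.cons (Ev.head (x := a) (l := b :: l) (Ev.v rfl)) (Ev.v rfl))))).mono
          (by simp; omega)

theorem ev_lg {α : Type} [Enc α] (n : ℕ) : ∀ l : List α, l.length = n →
    Ev procs I [enc l] pLg.body (enc (Nat.clog 2 l.length + 1)) (80 * n + 10) := by
  induction n using Nat.strong_induction_on with
  | _ n ih =>
    intro l hn
    match l, hn with
    | [], hn =>
      exact (Ev.ifL (U := 1) (Ev.v (x := enc ([] : List α)) rfl) (fun _ => Ev.nat 1)
        (by simp)).mono (by simp)
    | [a], hn =>
      exact (Ev.ifL (l := [a]) (Ev.v rfl) (by simp) fun _ _ _ =>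
        (Ev.ifL (U := 1) (Ev.tail (x := a) (l := ([] : List α)) (Ev.v rfl))
        (fun _ => by simpa using Ev.nat 1) (by simp))).mono (by simp)
    | a :: b :: l, hn =>
      have h : Ev procs I [enc (a :: b :: l)] (.v 0) (enc (a :: b :: l)) 1 := Ev.v rfl
      have hl := length_half (a :: b :: l)
      simp only [List.length_cons] at hn hl
      have := ih _ (by omega) (half (a :: b :: l)) hl
      have hc : Nat.clog 2 (l.length + 1 + 1) = Nat.clog 2 ((l.length + 1 + 1 + 1) / 2) + 1 :=
        Nat.clog_of_two_le (by norm_num) (by omega)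
      rw [hl, ← hc] at this
      exact (Ev.ifL h (by simp) fun _ _ _ => (Ev.ifL h.tail (by simp) fun _ _ _ =>
        Ev.letE (Ev.call (p := iHalf) (xs := [0]) rfl rfl rfl (ev_half _))
          (Ev.letE (Ev.call (p := iLg) (xs := [1]) rfl rfl rfl this)
            (Ev.succ (Ev.v rfl))))).mono (by simp; omega)

theorem ev_iota (n : ℕ) :
    Ev procs I [enc n] pIota.body (enc (List.range n).reverse) (20 * n + 10) := by
  induction n with
  | zero =>
    exact (Ev.ifN (U := 1) (Ev.v (x := enc 0) rfl) (fun _ => Ev.nil) (by simp)).mono (by simp)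
  | succ n ih =>
    have h1 : (List.range (n + 1)).reverse = n :: (List.range n).reverse := by
      rw [List.range_succ]; simp
    rw [h1]
    exact (Ev.ifN (Ev.v (x := enc (n + 1)) rfl) (by simp) fun _ =>
      Ev.letE (Ev.pred (Ev.v (x := enc (n + 1)) rfl))
        (Ev.letE (Ev.call (p := iIota) (xs := [1]) rfl rfl rfl ih)
          (Ev.cons (x := n) (Ev.v rfl) (Ev.v rfl)))).mono (by simp; omega)

theorem ev_zeros (n : ℕ) :
    Ev procs I [enc n] pZeros.body (enc (List.replicate n false)) (20 * n + 10) := by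
  induction n with
  | zero =>
    exact (Ev.ifN (U := 1) (Ev.v (x := enc 0) rfl) (fun _ => Ev.nil) (by simp)).mono (by simp)
  | succ n ih =>
    exact (Ev.ifN (Ev.v (x := enc (n + 1)) rfl) (by simp) fun _ =>
      Ev.letE (Ev.pred (Ev.v (x := enc (n + 1)) rfl))
        (Ev.letE (Ev.call (p := iZeros) (xs := [1]) rfl rfl rfl ih)
          (Ev.cons Ev.ff (Ev.v rfl)))).mono (by simp; omega)

/-- Linear search is cheap enough, because the products that are formed stay small: if `d ^ 2 * q ≤
L` and `d ≥ 1`, then `(d + 1) ^ 2 * q ≤ 4 * L`. -/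
theorem ev_findD (d q L : ℕ) (hq : 0 < q) (hd : d ≤ Nat.sqrt (L / q)) :
    Ev procs I [enc d, enc q, enc L] pFindD.body (enc (Nat.sqrt (L / q)))
      ((Nat.sqrt (L / q) + 1 - d) * (300 * L + 100 * q + 300)) := by
  obtain ⟨m, hm⟩ : ∃ m, m = Nat.sqrt (L / q) - d := ⟨_, rfl⟩
  have key : ∀ e, e ≤ Nat.sqrt (L / q) ↔ e * e * q ≤ L := fun e => by
    rw [Nat.le_sqrt, Nat.le_div_iff_mul_le hq]
  set D := Nat.sqrt (L / q) with hD
  have cost : (d + 1) * (d + 1) * q ≤ 4 * L + q := by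
    have h1 := (key d).1 hd
    rcases Nat.eq_zero_or_pos d with rfl | h0
    · omega
    · have h2 : (d + 1) * (d + 1) ≤ 4 * (d * d) := by nlinarith
      calc _ ≤ 4 * (d * d) * q := Nat.mul_le_mul_right q h2
        _ = 4 * (d * d * q) := by ring
        _ ≤ _ := by omega
  have cost2 : (d + 1) * (d + 1) ≤ 4 * L + q := le_trans (Nat.le_mul_of_pos_right _ hq) cost
  have cost3 : d + 1 ≤ (d + 1) * (d + 1) := Nat.le_mul_of_pos_right _ (by omega)
  induction m generalizing d with
  | zero =>
    have hdD : d = D := by omega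
    have hlt : decide (L < (d + 1) * (d + 1) * q) = true := by
      have := (key (d + 1)).not.1 (by omega)
      simpa using this
    refine (Ev.letE (Ev.succ (Ev.v (x := enc d) rfl))
      (Ev.letE (Ev.call (p := iMul) (xs := [3, 3]) rfl rfl rfl (ev_mul (d + 1) (d + 1)))
      (Ev.letE (Ev.call (p := iMul) (xs := [4, 1]) rfl rfl rfl (ev_mul ((d + 1) * (d + 1)) q))
      (Ev.ifB (U := 1) (Ev.lt (Ev.v (x := enc L) rfl) (Ev.v rfl))
        (fun h => absurd h (by rw [hlt]; simp)) (fun _ => Ev.v (by rw [← hdD]; rfl)))))).mono ?_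
    have : D + 1 - d = 1 := by omega
    rw [this]
    simp only [List.length_cons, List.length_nil]
    omega
  | succ m ih =>
    have hlt : decide (L < (d + 1) * (d + 1) * q) = false := by
      have := (key (d + 1)).1 (by omega)
      simpa using this
    have c1 : (d + 1 + 1) * (d + 1 + 1) * q ≤ 4 * L + q := by
      have h1 := (key (d + 1)).1 (by omega)
      have h2 : (d + 1 + 1) * (d + 1 + 1) ≤ 4 * ((d + 1) * (d + 1)) := by nlinarith
      calc _ ≤ 4 * ((d + 1) * (d + 1)) * q := Nat.mul_le_mul_right q h2
        _ = 4 * ((d + 1) * (d + 1) * q) := by ring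
        _ ≤ _ := by omega
    have hrec := ih (d + 1) (by omega) (by omega) c1 (le_trans (Nat.le_mul_of_pos_right _ hq) c1)
      (Nat.le_mul_of_pos_right _ (by omega))
    refine (Ev.letE (Ev.succ (Ev.v (x := enc d) rfl))
      (Ev.letE (Ev.call (p := iMul) (xs := [3, 3]) rfl rfl rfl (ev_mul (d + 1) (d + 1)))
      (Ev.letE (Ev.call (p := iMul) (xs := [4, 1]) rfl rfl rfl (ev_mul ((d + 1) * (d + 1)) q))
      (Ev.ifB (Ev.lt (Ev.v (x := enc L) rfl) (Ev.v rfl))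
        (fun _ => Ev.call (p := iFindD) (xs := [3, 1, 2]) rfl rfl rfl hrec)
        (fun h => absurd h (by rw [hlt]; simp)))))).mono ?_
    have : D + 1 - d = D + 1 - (d + 1) + 1 := by omega
    rw [this, Nat.add_mul (D + 1 - (d + 1)) 1]
    simp only [List.length_cons, List.length_nil]
    omega

theorem ev_findK (k d L K : ℕ) (hK : ∀ j, K ≤ j ↔ L ≤ d * j) (hk : k ≤ K) :
    Ev procs I [enc k, enc d, enc L] pFindK.body (enc K)
      ((K + 1 - k) * (15 * (d * K) + 35 * K + 100)) := by
  obtain ⟨m, hm⟩ : ∃ m, m = K - k := ⟨_, rfl⟩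
  induction m generalizing k with
  | zero =>
    have hkK : k = K := by omega
    subst hkK
    have hlt : decide (d * k < L) = false := by simpa using (hK k).1 le_rfl
    refine (Ev.letE (Ev.call (p := iMul) (xs := [1, 0]) rfl rfl rfl (ev_mul d k))
      (Ev.ifB (U := 1) (Ev.lt (Ev.v rfl) (Ev.v (x := enc L) rfl)) (fun _ => Ev.v rfl)
        (fun h => absurd h (by rw [hlt]; simp)))).mono ?_
    have : k + 1 - k = 1 := by omega
    rw [this]
    simp only [List.length_cons, List.length_nil]
    omega
  | succ m ih =>
    have hlt : decide (d * k < L) = true := by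
      have := (hK k).not.1 (by omega)
      simpa using this
    refine (Ev.letE (Ev.call (p := iMul) (xs := [1, 0]) rfl rfl rfl (ev_mul d k))
      (Ev.ifB (Ev.lt (Ev.v rfl) (Ev.v (x := enc L) rfl))
        (fun h => absurd h (by rw [hlt]; simp))
        (fun _ => Ev.letE (Ev.succ (Ev.v (x := enc k) rfl))
          (Ev.call (p := iFindK) (xs := [4, 1, 2]) rfl rfl rfl
            (ih (k + 1) (by omega) (by omega)))))).mono ?_
    have h1 : K + 1 - k = K + 1 - (k + 1) + 1 := by omega
    have h2 : d * k ≤ d * K := Nat.mul_le_mul_left d hk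
    rw [h1, Nat.add_mul (K + 1 - (k + 1)) 1]
    simp only [List.length_cons, List.length_nil]
    omega

/-- The string of length `m` that starts with `X` ones. -/
def unary : ℕ → ℕ → Bits
  | 0, _ => []
  | m + 1, X => decide (X ≠ 0) :: unary m (X - 1)

theorem length_unary (m X : ℕ) : (unary m X).length = m := by
  induction m generalizing X with
  | zero => rfl
  | succ m ih => simp [unary, ih]

theorem ev_unary (m X : ℕ) :
    Ev procs I [enc m, enc X] pUnary.body (enc (unary m X)) (30 * m + 10) := by
  induction m generalizing X with
  | zero =>
    exact (Ev.ifN (U := 1) (Ev.v (x := enc 0) rfl) (fun _ => Ev.nil) (by simp)).mono (by simp)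
  | succ m ih =>
    refine (Ev.ifN (Ev.v (x := enc (m + 1)) rfl) (by simp) fun _ =>
      Ev.letE (Ev.pred (Ev.v (x := enc (m + 1)) rfl))
        (Ev.letE (Ev.pred (Ev.v (x := enc X) rfl))
        (Ev.letE (Ev.call (p := iUnary) (xs := [2, 3]) rfl rfl rfl (ih (X - 1)))
          (Ev.cons (Ev.ifN (U := 1) (Ev.v (x := enc X) rfl) (fun h => ?_) (fun h => ?_))
            (Ev.v rfl))))).mono (by simp; omega)
    · simpa [h] using Ev.ff
    · simpa [h] using Ev.tt

/-- Cut a string into `D` chunks of length `k`. -/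
def chunk : ℕ → ℕ → Bits → List Bits
  | 0, _, _ => []
  | D + 1, k, u => u.take k :: chunk D k (u.drop k)

theorem ev_chunk (D k : ℕ) (u : Bits) :
    Ev procs I [enc D, enc k, enc u] pChunk.body (enc (chunk D k u))
      (D * (35 * k + 60) + 10) := by
  induction D generalizing u with
  | zero =>
    exact (Ev.ifN (U := 1) (Ev.v (x := enc 0) rfl) (fun _ => Ev.nil) (by simp)).mono (by simp)
  | succ D ih =>
    refine (Ev.ifN (Ev.v (x := enc (D + 1)) rfl) (by simp) fun _ =>
      Ev.letE (Ev.pred (Ev.v (x := enc (D + 1)) rfl))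
        (Ev.letE (Ev.call (p := iDrop) (xs := [1, 2]) rfl rfl rfl (ev_drop k u))
        (Ev.letE (Ev.call (p := iChunk) (xs := [3, 1, 4]) rfl rfl rfl (ih (u.drop k)))
        (Ev.letE (Ev.call (p := iTake) (xs := [1, 2]) rfl rfl rfl (ev_take k u))
          (Ev.cons (Ev.v rfl) (Ev.v rfl)))))).mono ?_
    simp only [List.length_cons, List.length_nil, Nat.add_mul]
    omega

/-- The successor of a bit string, preceded by the overflow bit. -/
def inc : Bits → Bool × Bits
  | [] => (true, [])
  | b :: u => if (inc u).1 then (b, (!b) :: (inc u).2) else (false, b :: (inc u).2)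

theorem length_inc (u : Bits) : (inc u).2.length = u.length := by
  induction u with
  | nil => rfl
  | cons b u ih => simp only [inc]; split <;> simp [ih]

theorem ev_inc (u : Bits) :
    Ev procs I [enc u] pInc.body (enc (inc u)) (30 * u.length + 10) := by
  induction u with
  | nil =>
    exact (Ev.ifL (U := 3) (Ev.v (x := enc ([] : Bits)) rfl) (fun _ => Ev.tt.prod Ev.nil)
      (by simp)).mono (by simp)
  | cons b u ih =>
    have h : Ev procs I [enc (b :: u)] (.v 0) (enc (b :: u)) 1 := Ev.v rfl
    have hr : Ev procs I ([enc (b :: u)] ++ [enc u] ++ [enc (inc u)]) (.v 2) (enc (inc u)) 1 :=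
      Ev.v rfl
    have h0 : Ev procs I ([enc (b :: u)] ++ [enc u] ++ [enc (inc u)]) (.v 0) (enc (b :: u)) 1 :=
      Ev.v rfl
    refine (Ev.ifL h (by simp) fun _ _ _ => Ev.letE h.tail
      (Ev.letE (Ev.call (p := iInc) (xs := [1]) rfl rfl rfl ih)
        (Ev.ifB (U := 12) hr.fst (fun h1 => ?_) fun h1 =>
          (Ev.ifB (U := 8) h0.head (fun h2 => ?_) fun h2 => ?_).mono (by omega)))).mono
            (by simp; omega)
    · have : inc (b :: u) = (false, b :: (inc u).2) := by simp [inc, h1]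
      rw [this]
      exact (Ev.ff.prod (h0.head.cons hr.snd)).mono (by omega)
    · have : inc (b :: u) = (false, true :: (inc u).2) := by simp [inc, h1, h2]
      rw [this]
      exact (Ev.ff.prod (Ev.tt.cons hr.snd)).mono (by omega)
    · have : inc (b :: u) = (true, false :: (inc u).2) := by simp [inc, h1, h2]
      rw [this]
      exact (Ev.tt.prod (Ev.ff.cons hr.snd)).mono (by omega)

/-- Pair the elements of a list with increasing bit strings. -/
def assign {α : Type} : List α → Bits → List (α × Bits)
  | [], _ => []
  | a :: l, u => (a, u) :: assign l (inc u).2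

/-- The list comes out reversed and stays so, because `IsRanking` does not depend on the order. -/
theorem ev_assign {α : Type} [Enc α] (l : List α) (u : Bits) :
    Ev procs I [enc l, enc u] pAssign.body (enc (assign l u).reverse)
      (l.length * (30 * u.length + 50) + 20) := by
  have key : ∀ (l₁ l₂ : List α), ∃ v : Bits, v.length = u.length ∧
      assign (l₁ ++ l₂) u = assign l₁ u ++ assign l₂ v ∧
      ∀ l₃, l₁.foldl (fun (s : Bits × List (α × Bits)) x => ((inc s.1).2, (x, s.1) :: s.2)) (u, l₃)
        = (v, (assign l₁ u).reverse ++ l₃) := by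
    intro l₁
    induction l₁ generalizing u with
    | nil => intro l₂; exact ⟨u, rfl, rfl, fun _ => rfl⟩
    | cons a l₁ ih =>
      intro l₂
      obtain ⟨v, h1, h2, h3⟩ := ih (inc u).2 l₂
      refine ⟨v, h1.trans (length_inc u), by simp [assign, h2], fun l₃ => ?_⟩
      simp [assign, h3]
  have h := Ev.foldP (P := procs) (I := I) (env := [enc l, enc u]) (e := .v 0)
    (i := .cons (.v 1) (.nat 0)) (l := l) (b := lets [.car (.v 2), .call iInc [4]]
    (.cons (.cdr (.v 5)) (.cons (.cons (.v 3) (.v 4)) (.cdr (.v 2)))))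
    (fun l₁ => enc (l₁.foldl (fun (s : Bits × List (α × Bits)) x => ((inc s.1).2, (x, s.1) :: s.2))
      (u, []))) (fun _ => 30 * u.length + 40) (Ev.v rfl)
    (Ev.prod (x := u) (y := ([] : List (α × Bits))) (Ev.v rfl) Ev.nil) (by
      intro l₁ x l₂ _
      obtain ⟨v, h1, -, h3⟩ := key l₁ []
      rw [List.foldl_append, h3]
      set s : Bits × List (α × Bits) := (v, (assign l₁ u).reverse ++ []) with hs
      exact ((Ev.letE (Ev.fst (x := s) (Ev.v rfl)) (Ev.letE
        (Ev.call (p := iInc) (xs := [4]) rfl rfl rfl (ev_inc v))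
        ((Ev.snd (x := inc v) (Ev.v rfl)).prod (((Ev.prod (x := x) (y := v) (Ev.v rfl)
          (Ev.v rfl))).cons (Ev.snd (x := s) (Ev.v rfl))))))).mono (by simp; omega))
  obtain ⟨v, -, -, h3⟩ := key l []
  rw [h3, List.append_nil] at h
  refine (Ev.snd h).mono ?_
  rw [sum_map_const]
  simp only [Nat.mul_add]
  omega

/-- The order of items: by the real component, and then against the integer component. -/
noncomputable def itemLe {π : Type} (a b : ℝ × ℕ × π) : Bool :=
  !decide (b.1 < a.1) && (decide (a.1 < b.1) || !decide (a.2.1 < b.2.1))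

theorem itemLe_iff {π : Type} (a b : ℝ × ℕ × π) :
    itemLe a b = true ↔ a.1 < b.1 ∨ a.1 = b.1 ∧ b.2.1 ≤ a.2.1 := by
  simp only [itemLe, Bool.and_eq_true, Bool.not_eq_true', decide_eq_false_iff_not, not_lt,
    Bool.or_eq_true, decide_eq_true_eq]
  constructor
  · rintro ⟨h1, h2 | h2⟩
    · exact Or.inl h2
    · rcases h1.lt_or_eq with h | h
      · exact Or.inl h
      · exact Or.inr ⟨h, h2⟩
  · rintro (h | ⟨h1, h2⟩)
    · exact ⟨h.le, Or.inl h⟩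
    · exact ⟨h1.le, Or.inr h2⟩

theorem ev_merge {π : Type} [Enc π] : ∀ a b : List (ℝ × ℕ × π),
    Ev procs I [enc a, enc b] pMerge.body (enc (a.merge b itemLe))
      (50 * (a.length + b.length) + 10)
  | [], b => by
    rw [List.nil_merge]
    exact (Ev.ifL (U := 1) (Ev.v (x := enc ([] : List (ℝ × ℕ × π))) rfl) (fun _ => Ev.v rfl)
      (by simp)).mono (by simp)
  | a :: l, [] => by
    rw [List.merge_right]
    exact (Ev.ifL (Ev.v (x := enc (a :: l)) rfl) (by simp) fun _ _ _ =>
      Ev.ifL (U := 1) (Ev.v (x := enc ([] : List (ℝ × ℕ × π))) rfl) (fun _ => Ev.v rfl)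
      (by simp)).mono (by simp)
  | a :: l, b :: r => by
    have ha : Ev procs I [enc (a :: l), enc (b :: r)] (.v 0) (enc (a :: l)) 1 := Ev.v rfl
    have hb : Ev procs I [enc (a :: l), enc (b :: r)] (.v 1) (enc (b :: r)) 1 := Ev.v rfl
    have hle : Ev procs I [enc (a :: l), enc (b :: r)] (leE (.car (.v 0)) (.car (.v 1)))
        (enc (itemLe a b)) _ :=
      (hb.head.fst.rlt ha.head.fst).not.and ((ha.head.fst.rlt hb.head.fst).or
        (ha.head.snd.fst.lt hb.head.snd.fst).not)
    rw [List.cons_merge_cons]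
    refine (Ev.ifL ha (by simp) fun _ _ _ => Ev.ifL hb (by simp) fun _ _ _ =>
      Ev.ifB (U := 50 * (l.length + r.length + 1) + 21) hle (fun h => ?_) (fun h => ?_)).mono
        (by simp; omega)
    · rw [h]
      exact (Ev.letE hb.tail (Ev.letE (Ev.call (p := iMerge) (xs := [0, 2]) rfl rfl rfl
        (ev_merge (a :: l) r)) (Ev.cons (Ev.head (x := b) (l := r) (Ev.v rfl)) (Ev.v rfl)))).mono
          (by simp; omega)
    · rw [h]
      exact (Ev.letE ha.tail (Ev.letE (Ev.call (p := iMerge) (xs := [2, 1]) rfl rfl rfl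
        (ev_merge l (b :: r))) (Ev.cons (Ev.head (x := a) (l := l) (Ev.v rfl)) (Ev.v rfl)))).mono
          (by simp; omega)
termination_by a b => a.length + b.length

/-- Merge sort. The two halves are the elements in even and in odd positions (`half_perm`), which a
single pass over a linked list can separate. -/
theorem ev_sort {π : Type} [Enc π] (n : ℕ) : ∀ l : List (ℝ × ℕ × π), l.length = n →
    ∃ l' : List (ℝ × ℕ × π), l'.Perm l ∧ l'.Pairwise (fun a b => itemLe a b = true) ∧
      Ev procs I [enc l] pSort.body (enc l') (150 * n * (Nat.clog 2 n + 1) + 10) := by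
  induction n using Nat.strong_induction_on with
  | _ n ih =>
    intro l hn
    match l, hn with
    | [], hn =>
      exact ⟨[], .refl _, .nil, (Ev.ifL (U := 1) (Ev.v (x := enc ([] : List (ℝ × ℕ × π))) rfl)
        (fun _ => Ev.nil) (by simp)).mono (by simp)⟩
    | [a], hn =>
      refine ⟨[a], .refl _, by simp, (Ev.ifL (l := [a]) (Ev.v rfl) (by simp) fun _ _ _ =>
        (Ev.ifL (U := 1) (Ev.tail (x := a) (l := ([] : List (ℝ × ℕ × π))) (Ev.v rfl))
        (fun _ => Ev.v rfl) (by simp))).mono (by simp)⟩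
    | a :: b :: l, hn =>
      have h : Ev procs I [enc (a :: b :: l)] (.v 0) (enc (a :: b :: l)) 1 := Ev.v rfl
      have hl1 := length_half (a :: b :: l)
      have hl2 := length_half (b :: l)
      simp only [List.length_cons] at hn hl1 hl2
      obtain ⟨l1, p1, s1, e1⟩ := ih _ (by omega) (half (a :: b :: l)) hl1
      obtain ⟨l2, p2, s2, e2⟩ := ih _ (by omega) (half (b :: l)) hl2
      refine ⟨l1.merge l2 itemLe, ?_, ?_, ?_⟩
      · exact (List.merge_perm_append _).trans ((p1.append p2).trans (half_perm (a :: b :: l)))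
      · refine List.pairwise_merge ?_ ?_ l1 l2 s1 s2
        · intro a b c
          simp only [itemLe_iff]
          rintro (h | ⟨h1, h2⟩) (k | ⟨k1, k2⟩)
          · exact Or.inl (h.trans k)
          · exact Or.inl (k1 ▸ h)
          · exact Or.inl (h1 ▸ k)
          · exact Or.inr ⟨h1.trans k1, k2.trans h2⟩
        · intro a b
          rw [Bool.or_eq_true, itemLe_iff, itemLe_iff]
          rcases lt_trichotomy a.1 b.1 with h | h | h
          · exact Or.inl (Or.inl h)
          · rcases le_total a.2.1 b.2.1 with k | k
            · exact Or.inr (Or.inr ⟨h.symm, k⟩)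
            · exact Or.inl (Or.inr ⟨h, k⟩)
          · exact Or.inr (Or.inl h)
      · refine (Ev.ifL h (by simp) fun _ _ _ => (Ev.ifL h.tail (by simp) fun _ _ _ =>
          Ev.letE (Ev.call (p := iHalf) (xs := [0]) rfl rfl rfl (ev_half (a :: b :: l)))
          (Ev.letE (Ev.tail (x := a) (l := b :: l) (Ev.v rfl))
          (Ev.letE (Ev.call (p := iHalf) (xs := [2]) rfl rfl rfl (ev_half (b :: l)))
          (Ev.letE (Ev.call (p := iSort) (xs := [1]) rfl rfl rfl e1)
          (Ev.letE (Ev.call (p := iSort) (xs := [3]) rfl rfl rfl e2)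
          (Ev.call (p := iMerge) (xs := [4, 5]) rfl rfl rfl (ev_merge l1 l2)))))))).mono ?_
        have hp1 := p1.length_eq
        have hp2 := p2.length_eq
        rw [hl1] at hp1
        rw [hl2] at hp2
        have hc : Nat.clog 2 n = Nat.clog 2 ((n + 1) / 2) + 1 :=
          Nat.clog_of_two_le (by norm_num) (by omega)
        have hc2 : Nat.clog 2 ((l.length + 1 + 1) / 2) ≤ Nat.clog 2 ((n + 1) / 2) :=
          Nat.clog_mono_right 2 (by omega)
        have hn1 : l.length + 1 + 1 + 1 = n + 1 := by omega
        rw [hn1, hp1, hp2, hn1, hc]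
        set c := Nat.clog 2 ((n + 1) / 2)
        simp only [List.length_cons, List.length_nil]
        have m1 : 150 * ((l.length + 1 + 1) / 2) * (Nat.clog 2 ((l.length + 1 + 1) / 2) + 1) ≤
            150 * ((l.length + 1 + 1) / 2) * (c + 1) := Nat.mul_le_mul_left _ (by omega)
        have m2 : 150 * ((n + 1) / 2) * (c + 1) + 150 * ((l.length + 1 + 1) / 2) * (c + 1) =
            150 * n * (c + 1) := by
          rw [← Nat.add_mul]; congr 1; omega
        have m3 : 150 * n * (c + 1 + 1) = 150 * n * (c + 1) + 150 * n := by ring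
        omega

end procedures

/-! ### Dominance -/

/-- Comparison of lists of keys in every component. -/
def keysLE : List Bits → List Bits → Bool
  | [], [] => true
  | u :: us, v :: vs => decide (u ≤ v) && keysLE us vs
  | _, _ => false

/-- The largest string of a list. -/
def maxS (l : List Bits) : Bits := l.foldl max []

theorem nil_le_bits (u : Bits) : ([] : Bits) ≤ u := by
  rw [← not_lt]; exact List.not_lt_nil u

theorem cons_le_cons_bits (a b : Bool) (u v : Bits) :
    a :: u ≤ b :: v ↔ a < b ∨ a = b ∧ u ≤ v := by
  rw [← not_lt, List.cons_lt_cons_iff, ← not_lt]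
  cases a <;> cases b <;> simp

theorem foldl_max_le_iff (l : List Bits) (v u : Bits) :
    l.foldl max v ≤ u ↔ v ≤ u ∧ ∀ x ∈ l, x ≤ u := by
  induction l generalizing v with
  | nil => simp
  | cons a l ih => simp [ih, and_assoc]

/-- The empty string is below all strings, so it plays the part of minus infinity, the maximum of no
values. -/
theorem maxS_le_iff (l : List Bits) (u : Bits) : maxS l ≤ u ↔ ∀ x ∈ l, x ≤ u := by
  rw [maxS, foldl_max_le_iff]
  simp [nil_le_bits]

theorem maxS_mem (l : List Bits) : maxS l = [] ∨ maxS l ∈ l := by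
  have : ∀ v : Bits, l.foldl max v = v ∨ l.foldl max v ∈ l := by
    induction l with
    | nil => simp
    | cons a l ih =>
      intro v
      simp only [List.foldl_cons, List.mem_cons]
      rcases ih (max v a) with h | h
      · rcases max_choice v a with h2 | h2 <;> rw [h, h2] <;> simp
      · exact Or.inr (Or.inr h)
  exact this []

/-- The largest value of the data that are dominated by `q`. -/
def domV (D : List (List Bits × Bits)) (q : List Bits) : Bits :=
  maxS ((D.filter fun d => keysLE d.1 q).map Prod.snd)

/-- A maximum is determined by its upper bounds. The identities behind the recursion on bits are
proved by comparing upper bounds. -/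
theorem domV_le_iff (D : List (List Bits × Bits)) (q : List Bits) (u : Bits) :
    domV D q ≤ u ↔ ∀ d ∈ D, keysLE d.1 q = true → d.2 ≤ u := by
  simp only [domV, maxS_le_iff, List.mem_map, List.mem_filter]
  grind

theorem domV_mem (D : List (List Bits × Bits)) (q : List Bits) :
    domV D q = [] ∨ ∃ d ∈ D, keysLE d.1 q = true ∧ domV D q = d.2 := by
  rcases maxS_mem ((D.filter fun d => keysLE d.1 q).map Prod.snd) with h | h
  · exact Or.inl h
  · right
    simp only [List.mem_map, List.mem_filter] at h
    obtain ⟨d, ⟨h1, h2⟩, h3⟩ := h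
    exact ⟨d, h1, h2, h3.symm⟩

/-- The first bit of the first key. -/
def bit : List Bits → Bool
  | (b :: _) :: _ => b
  | _ => false

/-- Remove the first bit of the first key. -/
def strip : List Bits → List Bits
  | (_ :: u) :: us => u :: us
  | l => l

/-- The number of recursive calls for keys of the given widths. -/
def domG : List ℕ → ℕ
  | [] => 1
  | w :: ws => (w + 1) * (domG ws + 1)

/-- This is the reason for three recursive calls. Equal first bits can be dropped; bit 0 of a datum
against bit 1 of a query settles the first key, which then disappears altogether; in the remaining
case there is no dominance. -/
theorem keysLE_cons_cons (a b : Bool) (u v : Bits) (us vs : List Bits) :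
    keysLE ((a :: u) :: us) ((b :: v) :: vs) = 
      if a = b then keysLE (u :: us) (v :: vs) else !a && keysLE us vs := by
  have : (a :: u ≤ b :: v) ↔ (a < b ∨ a = b ∧ u ≤ v) := cons_le_cons_bits a b u v
  cases a <;> cases b <;> simp [keysLE, this]

theorem shape_cons {q : List Bits} {w : ℕ} {ws : List ℕ} (h : q.map List.length = w :: ws) :
    ∃ u us, q = u :: us ∧ u.length = w ∧ us.map List.length = ws := by
  cases q with
  | nil => simp at h
  | cons u us => exact ⟨u, us, rfl, by simpa using h⟩

theorem shape_succ {q : List Bits} {w : ℕ} {ws : List ℕ} (h : q.map List.length = (w + 1) :: ws) :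
    ∃ b u us, q = (b :: u) :: us ∧ u.length = w ∧ us.map List.length = ws := by
  obtain ⟨u, us, rfl, h1, h2⟩ := shape_cons h
  cases u with
  | nil => simp at h1
  | cons b u => exact ⟨b, u, us, rfl, by simpa using h1, h2⟩

theorem shape_zero {q : List Bits} {ws : List ℕ} (h : q.map List.length = 0 :: ws) :
    ∃ us, q = [] :: us ∧ us.map List.length = ws := by
  obtain ⟨u, us, rfl, h1, h2⟩ := shape_cons h
  exact ⟨us, by rw [List.length_eq_zero_iff.1 h1], h2⟩

theorem domV_nil_keys (D : List (List Bits × Bits)) (hD : ∀ d ∈ D, d.1.map List.length = []) :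
    domV D [] = D.foldl (fun m d => max m d.2) [] := by
  have : D.filter (fun d => keysLE d.1 []) = D := by
    rw [List.filter_eq_self]
    intro d hd
    have := hD d hd
    rw [List.map_eq_nil_iff.1 this]
    rfl
  rw [domV, this, maxS, List.foldl_map]

theorem domV_nil_bits (D : List (List Bits × Bits)) (ws : List ℕ)
    (hD : ∀ d ∈ D, d.1.map List.length = 0 :: ws) (qs : List Bits) :
    domV D ([] :: qs) = domV (D.map fun d => (d.1.tail, d.2)) qs := by
  refine eq_of_forall_ge_iff fun u => ?_
  simp only [domV_le_iff, List.forall_mem_map]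
  refine forall₂_congr fun d hd => ?_
  obtain ⟨us, h1, -⟩ := shape_zero (hD d hd)
  simp [h1, keysLE]

theorem domV_false (D : List (List Bits × Bits)) (w : ℕ) (ws : List ℕ)
    (hD : ∀ d ∈ D, d.1.map List.length = (w + 1) :: ws) (v : Bits) (qs : List Bits) :
    domV D ((false :: v) :: qs) =
      domV ((D.filter fun d => !bit d.1).map fun d => (strip d.1, d.2)) (v :: qs) := by
  refine eq_of_forall_ge_iff fun u => ?_
  simp only [domV_le_iff, List.forall_mem_map, List.mem_filter, and_imp]
  refine forall₂_congr fun d hd => ?_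
  obtain ⟨b, x, us, h1, -⟩ := shape_succ (hD d hd)
  rw [h1, keysLE_cons_cons]
  cases b <;> simp [bit, strip]

theorem domV_true (D : List (List Bits × Bits)) (w : ℕ) (ws : List ℕ)
    (hD : ∀ d ∈ D, d.1.map List.length = (w + 1) :: ws) (v : Bits) (qs : List Bits) :
    domV D ((true :: v) :: qs) =
      max (domV ((D.filter fun d => bit d.1).map fun d => (strip d.1, d.2)) (v :: qs))
        (domV ((D.filter fun d => !bit d.1).map fun d => (d.1.tail, d.2)) qs) := by
  refine eq_of_forall_ge_iff fun u => ?_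
  simp only [max_le_iff, domV_le_iff, List.forall_mem_map, List.mem_filter, and_imp]
  rw [← forall₂_and]
  refine forall₂_congr fun d hd => ?_
  obtain ⟨b, x, us, h1, -⟩ := shape_succ (hD d hd)
  rw [h1, keysLE_cons_cons]
  cases b <;> simp [bit, strip]

/-! ### Dominance by branching on bits: evaluation and cost. -/

section procedures

variable {I : Input}

theorem domV_length (D : List (List Bits × Bits)) (q : List Bits) (V : ℕ)
    (hD : ∀ d ∈ D, d.2.length ≤ V) : (domV D q).length ≤ V := by
  rcases domV_mem D q with h | ⟨d, hd, -, h⟩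
  · simp [h]
  · rw [h]; exact hD d hd

theorem ev_dom_nil_right (Q : List (List Bits)) :
    Ev procs I [enc Q, enc ([] : List (List Bits × Bits))] pDom.body (enc (Q.map (domV [])))
      (8 * Q.length + 20) := by
  refine (Ev.ifL (Ev.v (x := enc Q) rfl) (fun h => ?_) fun _ _ _ =>
    Ev.ifL (Ev.v (x := enc ([] : List (List Bits × Bits))) rfl) (fun _ =>
      Ev.map (domV []) 1 (Ev.v (x := enc Q) rfl) fun acc x _ => Ev.nil)
      (by simp)).mono (by simp; omega)
  subst h
  exact Ev.nil.mono (by omega)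

theorem ev_dom_nil_left (D : List (List Bits × Bits)) :
    Ev procs I [enc ([] : List (List Bits)), enc D] pDom.body (enc ([] : List Bits)) 20 :=
  (Ev.ifL (U := 1) (Ev.v (x := enc ([] : List (List Bits))) rfl) (fun _ => Ev.nil)
    (by simp)).mono (by omega)

theorem ev_dom_no_keys (V : ℕ) (q : List Bits) (Q : List (List Bits)) (d : List Bits × Bits)
    (D : List (List Bits × Bits)) (hQ : ∀ x ∈ q :: Q, x.map List.length = [])
    (hD : ∀ x ∈ d :: D, x.1.map List.length = []) (hV : ∀ x ∈ d :: D, x.2.length ≤ V) :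
    Ev procs I [enc (q :: Q), enc (d :: D)] pDom.body (enc ((q :: Q).map (domV (d :: D))))
      (100 * (V + 1) * ((q :: Q).length + (d :: D).length)) := by
  have hf := Ev.foldP (P := procs) (I := I) (env := [enc (q :: Q), enc (d :: D)]) (e := .v 1)
    (i := .nat 0) (l := d :: D) (b := .letE (.cdr (.v 3)) (.call iMaxB [2, 4]))
    (fun l₁ => enc (l₁.foldl (fun m d => max m d.2) ([] : Bits))) (fun _ => 30 * V + 46) (Ev.v rfl)
    Ev.nil (by
      intro l₁ x l₂ h
      rw [List.foldl_append]
      have h1 : (l₁.foldl (fun m d => max m d.2) ([] : Bits)).length ≤ V := by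
        have : l₁.foldl (fun m d => max m d.2) ([] : Bits) = maxS (l₁.map Prod.snd) := by
          rw [maxS, List.foldl_map]
        rw [this]
        rcases maxS_mem (l₁.map Prod.snd) with h2 | h2
        · simp [h2]
        · obtain ⟨y, hy, h3⟩ := List.mem_map.1 h2
          rw [← h3]
          exact hV y (by rw [h]; simp [hy])
      exact (Ev.letE (Ev.snd (x := x) (Ev.v rfl)) (Ev.call (p := iMaxB) (xs := [2, 4]) rfl rfl rfl
        (ev_maxB _ x.2))).mono (by simp; omega))
  rw [← domV_nil_keys _ hD] at hf
  have hm : (q :: Q).map (domV (d :: D)) = (q :: Q).map fun _ => domV (d :: D) [] := by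
    refine List.map_congr_left fun x hx => ?_
    rw [List.map_eq_nil_iff.1 (hQ x hx)]
  rw [hm]
  have hq : q = [] := List.map_eq_nil_iff.1 (hQ q (by simp))
  refine (Ev.ifL (Ev.v (x := enc (q :: Q)) rfl) (by simp) fun _ _ _ =>
    Ev.ifL (Ev.v (x := enc (d :: D)) rfl) (by simp) fun _ _ _ =>
      Ev.ifL (l := q) (Ev.head (x := q) (l := Q) (Ev.v rfl)) (fun _ => Ev.letE hf
        (Ev.map (fun _ => domV (d :: D) []) 1 (Ev.v (x := enc (q :: Q)) rfl)
          fun acc x _ => Ev.v rfl)) (by simp [hq])).mono ?_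
  rw [sum_map_const]
  simp only [List.length_cons]
  nlinarith [Nat.zero_le (V * D.length), Nat.zero_le (V * Q.length)]

theorem ev_dom_no_bits (q : List Bits) (Q : List (List Bits)) (d : List Bits × Bits)
    (D : List (List Bits × Bits)) (ws : List ℕ) (T : ℕ)
    (hQ : ∀ x ∈ q :: Q, x.map List.length = 0 :: ws)
    (hD : ∀ x ∈ d :: D, x.1.map List.length = 0 :: ws)
    (ih : Ev procs I [enc ((q :: Q).map List.tail), enc ((d :: D).map fun d => (d.1.tail, d.2))]
      pDom.body (enc (((q :: Q).map List.tail).map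
        (domV ((d :: D).map fun d => (d.1.tail, d.2))))) T) :
    Ev procs I [enc (q :: Q), enc (d :: D)] pDom.body (enc ((q :: Q).map (domV (d :: D))))
      (T + 50 * ((q :: Q).length + (d :: D).length)) := by
  have hm : ((q :: Q).map List.tail).map (domV ((d :: D).map fun d => (d.1.tail, d.2))) =
      (q :: Q).map (domV (d :: D)) := by
    rw [List.map_map]
    refine List.map_congr_left fun x hx => ?_
    obtain ⟨us, rfl, -⟩ := shape_zero (hQ x hx)
    exact (domV_nil_bits _ ws hD us).symm
  rw [hm] at ih
  obtain ⟨us, hq, -⟩ := shape_zero (hQ q (by simp))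
  have hq0 : Ev procs I [enc (q :: Q), enc (d :: D)] (.car (.v 0)) (enc q) 2 :=
    Ev.head (x := q) (l := Q) (Ev.v rfl)
  have hq1 : Ev procs I [enc (q :: Q), enc (d :: D)] (.car (.car (.v 0))) (enc ([] : Bits)) 3 := by
    rw [hq] at hq0 ⊢
    exact hq0.head
  refine (Ev.ifL (Ev.v (x := enc (q :: Q)) rfl) (by simp) fun _ _ _ =>
    Ev.ifL (Ev.v (x := enc (d :: D)) rfl) (by simp) fun _ _ _ =>
      Ev.ifL (l := q) hq0 (by simp [hq]) fun _ _ _ =>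
      Ev.ifL (l := ([] : Bits)) hq1 (fun _ =>
        Ev.letE (Ev.map List.tail 2 (Ev.v (x := enc (q :: Q)) rfl) fun acc x hx => ?_)
        (Ev.letE (Ev.map (fun d => (d.1.tail, d.2)) 6 (Ev.v (x := enc (d :: D)) rfl)
          fun acc x hx => ?_)
        (Ev.call (p := iDom) (xs := [2, 3]) rfl rfl rfl ih))) (by simp)).mono ?_
  · obtain ⟨us, rfl, -⟩ := shape_zero (hQ x hx)
    exact Ev.tail (x := ([] : Bits)) (l := us) Ev.ix0
  · obtain ⟨us, h1, -⟩ := shape_zero (hD x hx)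
    obtain ⟨y, z⟩ := x
    simp only at h1
    subst h1
    exact ((Ev.tail (x := ([] : Bits)) (l := us) (Ev.fst (x := (_, z)) Ev.ix0)).prod
      (Ev.snd (x := (([] : Bits) :: us, z)) Ev.ix0)).mono (by simp)
  · simp only [List.length_cons, List.length_nil]
    omega

theorem length_filter_add {α : Type} (f : α → Bool) (l : List α) :
    (l.filter fun x => !f x).length + (l.filter f).length = l.length := by
  induction l with
  | nil => rfl
  | cons a l ih => cases h : f a <;> simp [h] <;> omega

theorem ev_bit {env : List Val} {e : Ex} {q : List Bits} {w : ℕ} {ws : List ℕ} {T : ℕ}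
    (h : Ev procs I env e (enc q) T) (hq : q.map List.length = (w + 1) :: ws) :
    Ev procs I env (.car (.car e)) (enc (bit q)) (T + 2) := by
  obtain ⟨b, u, us, rfl, -⟩ := shape_succ hq
  exact h.head.head

theorem ev_strip {env : List Val} {e : Ex} {q : List Bits} {w : ℕ} {ws : List ℕ} {T : ℕ}
    (h : Ev procs I env e (enc q) T) (hq : q.map List.length = (w + 1) :: ws) :
    Ev procs I env (.cons (.cdr (.car e)) (.cdr e)) (enc (strip q)) (2 * T + 4) := by
  obtain ⟨b, u, us, rfl, -⟩ := shape_succ hq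
  exact (h.head.tail.cons h.tail).mono (by omega)

theorem ev_tail {env : List Val} {e : Ex} {q : List Bits} {w : ℕ} {ws : List ℕ} {T : ℕ}
    (h : Ev procs I env e (enc q) T) (hq : q.map List.length = w :: ws) :
    Ev procs I env (.cdr e) (enc q.tail) (T + 1) := by
  obtain ⟨u, us, rfl, -⟩ := shape_cons hq
  exact h.tail

theorem shape_strip {q : List Bits} {w : ℕ} {ws : List ℕ}
    (hq : q.map List.length = (w + 1) :: ws) : (strip q).map List.length = w :: ws := by
  obtain ⟨b, u, us, rfl, h1, h2⟩ := shape_succ hq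
  simp [strip, h1, h2]

theorem shape_tail {q : List Bits} {w : ℕ} {ws : List ℕ}
    (hq : q.map List.length = w :: ws) : q.tail.map List.length = ws := by
  obtain ⟨u, us, rfl, h1, h2⟩ := shape_cons hq
  simpa using h2

set_option maxHeartbeats 2000000 in
-- One step of the recursion. Queries and data are split by the first bit of the first key. The
-- queries with bit 0 see only the data with bit 0. A query with bit 1 gets the maximum of two
-- answers, one from the data with bit 1 and one, with the first key deleted, from the data with bit
-- 0.
theorem ev_dom_bits (V : ℕ) (q : List Bits) (Q : List (List Bits)) (d : List Bits × Bits)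
    (D : List (List Bits × Bits)) (w : ℕ) (ws : List ℕ) (T₀ T₁ T₂ : ℕ)
    (hQ : ∀ x ∈ q :: Q, x.map List.length = (w + 1) :: ws)
    (hD : ∀ x ∈ d :: D, x.1.map List.length = (w + 1) :: ws) (hV : ∀ x ∈ d :: D, x.2.length ≤ V)
    (ih0 : Ev procs I [enc (((q :: Q).filter fun x => !bit x).map strip),
      enc (((d :: D).filter fun d => !bit d.1).map fun d => (strip d.1, d.2))]
      pDom.body (enc ((((q :: Q).filter fun x => !bit x).map strip).map
        (domV (((d :: D).filter fun d => !bit d.1).map fun d => (strip d.1, d.2))))) T₀)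
    (ih1 : Ev procs I [enc (((q :: Q).filter bit).map strip),
      enc (((d :: D).filter fun d => bit d.1).map fun d => (strip d.1, d.2))]
      pDom.body (enc ((((q :: Q).filter bit).map strip).map
        (domV (((d :: D).filter fun d => bit d.1).map fun d => (strip d.1, d.2))))) T₁)
    (ih2 : Ev procs I [enc (((q :: Q).filter bit).map List.tail),
      enc (((d :: D).filter fun d => !bit d.1).map fun d => (d.1.tail, d.2))]
      pDom.body (enc ((((q :: Q).filter bit).map List.tail).map
        (domV (((d :: D).filter fun d => !bit d.1).map fun d => (d.1.tail, d.2))))) T₂) :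
    Ev procs I [enc (q :: Q), enc (d :: D)] pDom.body (enc ((q :: Q).map (domV (d :: D))))
      (T₀ + T₁ + T₂ + 400 * (V + 1) * ((q :: Q).length + (d :: D).length)) := by
  set L := q :: Q with hL
  set M := d :: D with hM
  set M0 := (M.filter fun d => !bit d.1).map fun d => (strip d.1, d.2) with hM0
  set M1 := (M.filter fun d => bit d.1).map fun d => (strip d.1, d.2) with hM1
  set M2 := (M.filter fun d => !bit d.1).map fun d => (d.1.tail, d.2) with hM2
  set L0 := L.filter fun x => !bit x with hL0
  set L1 := L.filter bit with hL1
  have r0 : (L0.map strip).map (domV M0) = L0.map (domV M) := by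
    rw [List.map_map]
    refine List.map_congr_left fun x hx => ?_
    obtain ⟨hx, hb⟩ := List.mem_filter.1 hx
    obtain ⟨b, u, us, rfl, -⟩ := shape_succ (hQ x hx)
    simp only [bit, Bool.not_eq_true'] at hb
    subst hb
    exact (domV_false M w ws hD u us).symm
  rw [r0] at ih0
  have hzip : Ev procs I [enc L, enc M, enc (L0.map strip), enc (L1.map strip),
      enc (L1.map List.tail), enc M0, enc M1, enc M2, enc (L0.map (domV M)),
      enc ((L1.map strip).map (domV M1)), enc ((L1.map List.tail).map (domV M2))]
      (zipE (.v 9) (.v 10) (lets [zipY, .v 12] (.call iMaxB [14, 13])))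
      (enc (L1.map (domV M))) (L1.length * (30 * V + 62) + 10) := by
    have hz : List.zipWith max ((L1.map strip).map (domV M1)) ((L1.map List.tail).map (domV M2)) =
        L1.map (domV M) := by
      rw [List.map_map, List.map_map, List.zipWith_map, List.zipWith_self]
      refine List.map_congr_left fun x hx => ?_
      obtain ⟨hx, hb⟩ := List.mem_filter.1 hx
      obtain ⟨b, u, us, rfl, -⟩ := shape_succ (hQ x hx)
      simp only [bit] at hb
      subst hb
      exact (domV_true M w ws hD u us).symm
    rw [← hz]
    refine (Ev.zip max (30 * V + 50) (Ev.v rfl) (Ev.v rfl) (by simp) ?_).mono (by simp only [List.length_map, Nat.add_assoc, Nat.reduceAdd]; omega)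
    intro acc x hx y hy l'
    obtain ⟨x', hx', rfl⟩ := List.mem_map.1 hx
    have hlen : (domV M1 x').length ≤ V := domV_length _ _ _ (by
      simp only [hM1, List.forall_mem_map, List.mem_filter, and_imp]
      exact fun d hd _ => hV d hd)
    exact (Ev.letE (Ev.head (x := y) (l := l') (Ev.car (y := acc) Ev.ix1))
      (Ev.letE (Ev.v (x := enc (domV M1 x')) rfl)
      (Ev.call (p := iMaxB) (xs := [14, 13]) rfl rfl rfl (ev_maxB _ y)))).mono (by simp; omega)
  have hfold := Ev.foldP (P := procs) (I := I) (env := [enc L, enc M, enc (L0.map strip),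
      enc (L1.map strip), enc (L1.map List.tail), enc M0, enc M1, enc M2, enc (L0.map (domV M)),
      enc ((L1.map strip).map (domV M1)), enc ((L1.map List.tail).map (domV M2)),
      enc (L1.map (domV M))]) (e := .v 0) (i := .cons (.nat 0) (.cons (.v 8) (.v 11))) (l := L)
    (b := (.ifz (.car (.car (.ix 0)))
        (.cons (.cons (.car (.car (.cdr (.ix 1)))) (.car (.ix 1)))
          (.cons (.cdr (.car (.cdr (.ix 1)))) (.cdr (.cdr (.ix 1)))))
        (.cons (.cons (.car (.cdr (.cdr (.ix 1)))) (.car (.ix 1)))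
          (.cons (.car (.cdr (.ix 1))) (.cdr (.cdr (.cdr (.ix 1))))))))
    -- Invariant of the merge: the answers so far in reverse order, and the answers still to come
    -- for queries with bit 0 and with bit 1.
    (fun l₁ => enc ((l₁.map (domV M)).reverse,
      ((L.drop l₁.length).filter fun x => !bit x).map (domV M),
      ((L.drop l₁.length).filter bit).map (domV M))) (fun _ => 30) (Ev.v rfl)
    ((Ev.nil (α := Bits)).prod ((Ev.v (x := enc (L0.map (domV M))) rfl).prod
      (Ev.v (x := enc (L1.map (domV M))) rfl))) (by
        intro l₁ x l₂ h
        have e1 : L.drop l₁.length = x :: l₂ := by rw [h]; simp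
        have e2 : L.drop (l₁ ++ [x]).length = l₂ := by rw [h]; simp
        rw [e1, e2, List.map_append, List.reverse_append]
        refine (Ev.ifB (U := 24) (ev_bit Ev.ix0 (hQ x (by rw [h]; simp))) (fun hb => ?_)
          fun hb => ?_).mono (by simp)
        · simp only [List.filter_cons, hb]
          set p : List Bits × List Bits × List Bits := ((l₁.map (domV M)).reverse,
            domV M x :: ((l₂.filter fun x => !bit x).map (domV M)), (l₂.filter bit).map (domV M))
          have hp : Ev procs I ([enc L, enc M, enc (L0.map strip),
            enc (L1.map strip), enc (L1.map List.tail), enc M0, enc M1, enc M2,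
            enc (L0.map (domV M)), enc ((L1.map strip).map (domV M1)),
            enc ((L1.map List.tail).map (domV M2)), enc (L1.map (domV M))] ++ [enc p, enc x])
            (.ix 1) (enc p) 1 := Ev.ix1
          exact ((hp.snd.fst.head.cons hp.fst).prod (hp.snd.fst.tail.prod hp.snd.snd)).mono
            (by omega)
        · simp only [List.filter_cons, hb]
          set p : List Bits × List Bits × List Bits := ((l₁.map (domV M)).reverse,
            ((l₂.filter fun x => !bit x).map (domV M)), domV M x :: (l₂.filter bit).map (domV M))
          have hp : Ev procs I ([enc L, enc M, enc (L0.map strip),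
            enc (L1.map strip), enc (L1.map List.tail), enc M0, enc M1, enc M2,
            enc (L0.map (domV M)), enc ((L1.map strip).map (domV M1)),
            enc ((L1.map List.tail).map (domV M2)), enc (L1.map (domV M))] ++ [enc p, enc x])
            (.ix 1) (enc p) 1 := Ev.ix1
          exact ((hp.snd.snd.head.cons hp.fst).prod (hp.snd.fst.prod hp.snd.snd.tail)).mono
            (by omega))
  have hres := (Ev.fst hfold).rev
  simp only [List.reverse_reverse] at hres
  have hq0 : Ev procs I [enc L, enc M] (.car (.v 0)) (enc q) 2 :=
    Ev.head (x := q) (l := Q) (Ev.v rfl)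
  obtain ⟨b0, u0, us0, hq, -⟩ := shape_succ (hQ q (by simp [hL]))
  have hq1 : Ev procs I [enc L, enc M] (.car (.car (.v 0))) (enc (b0 :: u0)) 3 := by
    rw [hq] at hq0
    exact hq0.head
  have nb : ∀ (env : List Val) (acc : Val), ∀ x ∈ L,
      Ev procs I (env ++ [acc, enc x]) (notE (.car (.car (.ix 0)))) (enc (!bit x)) 5 :=
    fun env acc x hx => (ev_bit Ev.ix0 (hQ x hx)).not
  have pb : ∀ (env : List Val) (acc : Val), ∀ x ∈ L,
      Ev procs I (env ++ [acc, enc x]) (.car (.car (.ix 0))) (enc (bit x)) 5 :=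
    fun env acc x hx => (ev_bit Ev.ix0 (hQ x hx)).mono (by omega)
  have nd : ∀ (env : List Val) (acc : Val), ∀ x ∈ M,
      Ev procs I (env ++ [acc, enc x]) (notE (.car (.car (.car (.ix 0))))) (enc (!bit x.1)) 6 :=
    fun env acc x hx => (ev_bit (Ev.fst Ev.ix0) (hD x hx)).not
  have pd : ∀ (env : List Val) (acc : Val), ∀ x ∈ M,
      Ev procs I (env ++ [acc, enc x]) (.car (.car (.car (.ix 0)))) (enc (bit x.1)) 6 :=
    fun env acc x hx => (ev_bit (Ev.fst Ev.ix0) (hD x hx)).mono (by omega)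
  have hsQ : ∀ x, x ∈ L0 ∨ x ∈ L1 → x.map List.length = (w + 1) :: ws := by
    rintro x (h | h) <;> exact hQ x (List.mem_of_mem_filter h)
  have hsD : ∀ f : (List Bits × Bits) → Bool, ∀ x ∈ M.filter f,
      x.1.map List.length = (w + 1) :: ws := fun f x hx => hD x (List.mem_of_mem_filter hx)
  refine (Ev.ifL (Ev.v (x := enc L) rfl) (by simp [hL]) fun _ _ _ =>
    Ev.ifL (Ev.v (x := enc M) rfl) (by simp [hM]) fun _ _ _ =>
      Ev.ifL (l := q) hq0 (by simp [hq]) fun _ _ _ => Ev.ifL hq1 (by simp) fun _ _ _ =>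
    Ev.letE (Ev.map strip 6 (Ev.filter (fun x => !bit x) 5 (Ev.v (x := enc L) rfl) (nb _))
      fun acc x hx => (ev_strip Ev.ix0 (hsQ x (Or.inl hx))).mono (by simp)) <|
    Ev.letE (Ev.map strip 6 (Ev.filter bit 5 (Ev.v (x := enc L) rfl) (pb _))
      fun acc x hx => (ev_strip Ev.ix0 (hsQ x (Or.inr hx))).mono (by simp)) <|
    Ev.letE (Ev.map List.tail 6 (Ev.filter bit 5 (Ev.v (x := enc L) rfl) (pb _))
      fun acc x hx => (ev_tail Ev.ix0 (hsQ x (Or.inr hx))).mono (by simp)) <|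
    Ev.letE (Ev.map (fun d : List Bits × Bits => (strip d.1, d.2)) 11
      (Ev.filter (fun x : List Bits × Bits => !bit x.1) 6 (Ev.v (x := enc M) rfl) (nd _))
      fun acc x hx => ((ev_strip (Ev.fst Ev.ix0) (hsD _ x hx)).prod (Ev.snd Ev.ix0)).mono
        (by simp)) <|
    Ev.letE (Ev.map (fun d : List Bits × Bits => (strip d.1, d.2)) 11
      (Ev.filter (fun x : List Bits × Bits => bit x.1) 6 (Ev.v (x := enc M) rfl) (pd _))
      fun acc x hx => ((ev_strip (Ev.fst Ev.ix0) (hsD _ x hx)).prod (Ev.snd Ev.ix0)).mono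
        (by simp)) <|
    Ev.letE (Ev.map (fun d : List Bits × Bits => (d.1.tail, d.2)) 11
      (Ev.filter (fun x : List Bits × Bits => !bit x.1) 6 (Ev.v (x := enc M) rfl) (nd _))
      fun acc x hx => ((ev_tail (Ev.fst Ev.ix0) (hsD _ x hx)).prod (Ev.snd Ev.ix0)).mono
        (by simp)) <|
    Ev.letE (Ev.call (p := iDom) (xs := [2, 5]) rfl rfl rfl ih0) <|
    Ev.letE (Ev.call (p := iDom) (xs := [3, 6]) rfl rfl rfl ih1) <|
    Ev.letE (Ev.call (p := iDom) (xs := [4, 7]) rfl rfl rfl ih2) <|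
    Ev.letE hzip hres).mono ?_
  rw [sum_map_const]
  have l1 := length_filter_add bit L
  have l2 := length_filter_add (fun d : List Bits × Bits => bit d.1) M
  have l3 : 1 ≤ L.length := by simp [hL]
  have l8 := l1
  rw [← hL0, ← hL1] at l8
  have l4 : L1.length * (30 * V + 62) ≤ L.length * (30 * V + 62) :=
    Nat.mul_le_mul_right _ (by omega)
  have l5 : 400 * (V + 1) * (L.length + M.length) = 370 * (V + 1) * L.length + 30 * V * L.length
    + 30 * L.length + 400 * V * M.length + 400 * M.length := by ring
  have l6 : L.length * (30 * V + 62) = 30 * V * L.length + 62 * L.length := by ring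
  have l7 : 370 * L.length ≤ 370 * (V + 1) * L.length := Nat.mul_le_mul_right _ (by omega)
  simp only [List.length_cons, List.length_nil, List.length_reverse, List.length_map]
  omega

/-- Here `a` and `b` count the queries with first bit 0 and 1, and `c` and `d` the data. The
subproblems `(a, c)` and `(b, d)` are disjoint and share the budget `G₁`; the subproblem `(b, c)`
has one key less and pays `G₂`. -/
theorem ev_dom_bound (a b c d V G₁ G₂ : ℕ) (h : 1 ≤ a + b + c + d) :
    (500 * (V + 1) * (a + c) * G₁ + 20) + (500 * (V + 1) * (b + d) * G₁ + 20) +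
      (500 * (V + 1) * (b + c) * G₂ + 20) + 400 * (V + 1) * (a + b + (c + d)) ≤
      500 * (V + 1) * (a + b + (c + d)) * (G₁ + (G₂ + 1)) + 20 := by
  have h1 : 500 * (V + 1) * (b + c) * G₂ ≤ 500 * (V + 1) * (a + b + (c + d)) * G₂ :=
    Nat.mul_le_mul_right _ (Nat.mul_le_mul_left _ (by omega))
  have h2 : 100 ≤ 100 * (V + 1) * (a + b + (c + d)) := by
    rw [Nat.mul_assoc]
    exact Nat.le_mul_of_pos_right _ (Nat.mul_pos (by omega) (by omega))
  have h3 : 500 * (V + 1) * (a + b + (c + d)) * (G₁ + (G₂ + 1)) =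
      500 * (V + 1) * (a + c) * G₁ + 500 * (V + 1) * (b + d) * G₁ +
      500 * (V + 1) * (a + b + (c + d)) * G₂ + 400 * (V + 1) * (a + b + (c + d)) +
      100 * (V + 1) * (a + b + (c + d)) := by ring
  omega

/-- Induction on the list of keys, and on the width of the first key. Two of the three subproblems
partition queries and data, so together they cost `domG (w :: ws)` per item; the third one costs at
most `domG ws` per item. This is the recurrence that `domG` solves. -/
theorem ev_dom (V : ℕ) (ws : List ℕ) : ∀ (Q : List (List Bits)) (D : List (List Bits × Bits)),
    (∀ q ∈ Q, q.map List.length = ws) → (∀ d ∈ D, d.1.map List.length = ws) →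
    (∀ d ∈ D, d.2.length ≤ V) →
    Ev procs I [enc Q, enc D] pDom.body (enc (Q.map (domV D)))
      (500 * (V + 1) * (Q.length + D.length) * domG ws + 20) := by
  have triv : ∀ (G : ℕ), 1 ≤ G → ∀ (Q : List (List Bits)) (D : List (List Bits × Bits)),
      (Q ≠ [] → D ≠ [] → Ev procs I [enc Q, enc D] pDom.body (enc (Q.map (domV D)))
        (500 * (V + 1) * (Q.length + D.length) * G + 20)) →
      Ev procs I [enc Q, enc D] pDom.body (enc (Q.map (domV D)))
        (500 * (V + 1) * (Q.length + D.length) * G + 20) := by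
    intro G hG Q D h
    by_cases hQ : Q = []
    · subst hQ; exact (ev_dom_nil_left D).mono (by omega)
    by_cases hD : D = []
    · subst hD
      refine (ev_dom_nil_right Q).mono ?_
      have : 8 * Q.length ≤ 500 * (V + 1) * (Q.length + ([] : List (List Bits × Bits)).length) * G :=
        le_trans (Nat.mul_le_mul (by omega) (by simp)) (Nat.le_mul_of_pos_right _ hG)
      omega
    · exact h hQ hD
  induction ws with
  | nil =>
    intro Q D hQ hD hV
    refine triv _ (by simp [domG]) Q D fun hQ0 hD0 => ?_
    obtain ⟨q, Q, rfl⟩ := List.exists_cons_of_ne_nil hQ0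
    obtain ⟨d, D, rfl⟩ := List.exists_cons_of_ne_nil hD0
    refine (ev_dom_no_keys V q Q d D hQ hD hV).mono ?_
    simp only [domG, Nat.mul_one]
    exact le_trans (Nat.mul_le_mul_right _ (Nat.mul_le_mul_right _ (by omega)))
      (Nat.le_add_right _ _)
  | cons w ws ihw =>
    induction w with
    | zero =>
      intro Q D hQ hD hV
      refine triv _ (Nat.mul_pos (by omega) (by omega)) Q D fun hQ0 hD0 => ?_
      obtain ⟨q, Q, rfl⟩ := List.exists_cons_of_ne_nil hQ0
      obtain ⟨d, D, rfl⟩ := List.exists_cons_of_ne_nil hD0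
      refine (ev_dom_no_bits q Q d D ws _ hQ hD (ihw _ _ ?_ ?_ ?_)).mono ?_
      · simpa only [List.forall_mem_map] using fun x hx => shape_tail (hQ x hx)
      · simpa only [List.forall_mem_map] using fun x hx => shape_tail (hD x hx)
      · simpa only [List.forall_mem_map] using hV
      · simp only [List.length_map, Nat.zero_add, Nat.one_mul]
        have h2 : 50 * ((q :: Q).length + (d :: D).length) ≤
            500 * (V + 1) * ((q :: Q).length + (d :: D).length) :=
          Nat.mul_le_mul_right _ (by omega)
        rw [Nat.mul_add _ (domG ws) 1, Nat.mul_one]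
        omega
    | succ w ih =>
      intro Q D hQ hD hV
      refine triv _ (Nat.mul_pos (by omega) (by omega)) Q D fun hQ0 hD0 => ?_
      obtain ⟨q, Q, rfl⟩ := List.exists_cons_of_ne_nil hQ0
      obtain ⟨d, D, rfl⟩ := List.exists_cons_of_ne_nil hD0
      refine (ev_dom_bits V q Q d D w ws _ _ _ hQ hD hV (ih _ _ ?_ ?_ ?_) (ih _ _ ?_ ?_ ?_)
        (ihw _ _ ?_ ?_ ?_)).mono ?_
      · simpa only [List.forall_mem_map] using
          fun x hx => shape_strip (hQ x (List.mem_of_mem_filter hx))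
      · simpa only [List.forall_mem_map] using
          fun x hx => shape_strip (hD x (List.mem_of_mem_filter hx))
      · simpa only [List.forall_mem_map] using fun x hx => hV x (List.mem_of_mem_filter hx)
      · simpa only [List.forall_mem_map] using
          fun x hx => shape_strip (hQ x (List.mem_of_mem_filter hx))
      · simpa only [List.forall_mem_map] using
          fun x hx => shape_strip (hD x (List.mem_of_mem_filter hx))
      · simpa only [List.forall_mem_map] using fun x hx => hV x (List.mem_of_mem_filter hx)
      · simpa only [List.forall_mem_map] using
          fun x hx => shape_tail (hQ x (List.mem_of_mem_filter hx))
      · simpa only [List.forall_mem_map] using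
          fun x hx => shape_tail (hD x (List.mem_of_mem_filter hx))
      · simpa only [List.forall_mem_map] using fun x hx => hV x (List.mem_of_mem_filter hx)
      · simp only [List.length_map]
        have l1 := length_filter_add bit (q :: Q)
        have l2 := length_filter_add (fun d : List Bits × Bits => bit d.1) (d :: D)
        have l3 : 1 ≤ (q :: Q).length := by simp
        have hG : (w + 1 + 1) * (domG ws + 1) = domG (w :: ws) + (domG ws + 1) := by
          simp only [domG]; ring
        change _ ≤ 500 * (V + 1) * ((q :: Q).length + (d :: D).length) *
          ((w + 1 + 1) * (domG ws + 1)) + 20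
        rw [hG, ← l1, ← l2]
        exact ev_dom_bound _ _ _ _ V _ _ (by omega)

end procedures

/-! ### Propagation along the layers, and the vectors of the tests. -/

section procedures

variable {I : Input}

theorem ev_rX {env : List Val} {e : Ex} {r : Rec} {T : ℕ} (h : Ev procs I env e (enc r) T) :
    Ev procs I env (rX e) (enc r.X) (T + 1) :=
  Ev.fst (x := (r.X, r.Y, r.xs, r.y, r.qk, r.dk)) h

theorem ev_rY {env : List Val} {e : Ex} {r : Rec} {T : ℕ} (h : Ev procs I env e (enc r) T) :
    Ev procs I env (rY e) (enc r.Y) (T + 2) :=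
  Ev.fst (Ev.snd (x := (r.X, r.Y, r.xs, r.y, r.qk, r.dk)) h)

theorem ev_rxs {env : List Val} {e : Ex} {r : Rec} {T : ℕ} (h : Ev procs I env e (enc r) T) :
    Ev procs I env (rxs e) (enc r.xs) (T + 3) :=
  Ev.fst (Ev.snd (Ev.snd (x := (r.X, r.Y, r.xs, r.y, r.qk, r.dk)) h))

theorem ev_ry {env : List Val} {e : Ex} {r : Rec} {T : ℕ} (h : Ev procs I env e (enc r) T) :
    Ev procs I env (ry e) (enc r.y) (T + 4) :=
  Ev.fst (Ev.snd (Ev.snd (Ev.snd (x := (r.X, r.Y, r.xs, r.y, r.qk, r.dk)) h)))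

theorem ev_rqk {env : List Val} {e : Ex} {r : Rec} {T : ℕ} (h : Ev procs I env e (enc r) T) :
    Ev procs I env (rqk e) (enc r.qk) (T + 5) :=
  Ev.fst (Ev.snd (Ev.snd (Ev.snd (Ev.snd (x := (r.X, r.Y, r.xs, r.y, r.qk, r.dk)) h))))

theorem ev_rdk {env : List Val} {e : Ex} {r : Rec} {T : ℕ} (h : Ev procs I env e (enc r) T) :
    Ev procs I env (rdk e) (enc r.dk) (T + 5) :=
  Ev.snd (Ev.snd (Ev.snd (Ev.snd (Ev.snd (x := (r.X, r.Y, r.xs, r.y, r.qk, r.dk)) h))))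

/-- The widths of the keys of a record. -/
def Rec.Shape (ks : List ℕ) (r : Rec) : Prop :=
  r.qk.map List.length = ks ∧ r.dk.map List.length = ks

/-- Propagate values from one layer to the next one. -/
def stepV (acc : List (Rec × Bits)) (l : List Rec) : List (Rec × Bits) :=
  l.map fun b => (b, domV (acc.map fun a => (a.1.dk, a.2)) b.qk)

/-- Propagate values along layers. -/
def propV (acc : List (Rec × Bits)) (ls : List (List Rec)) : List (Rec × Bits) :=
  ls.foldl stepV acc

theorem length_stepV (acc : List (Rec × Bits)) (l : List Rec) :
    (stepV acc l).length = l.length := by simp [stepV]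

/-- The cost of one step of the propagation, per record. -/
def propK (V : ℕ) (ks : List ℕ) : ℕ := 500 * (V + 1) * domG ks + 60

theorem ev_stepV (V N : ℕ) (ks : List ℕ) (a₀ a₁ : Val) (acc : List (Rec × Bits)) (l : List Rec)
    (hs : ∀ r ∈ l, r.Shape ks) (hs' : ∀ a ∈ acc, a.1.Shape ks) (hV : ∀ a ∈ acc, a.2.length ≤ V)
    (hN : l.length ≤ N) (hN' : acc.length ≤ N) :
    Ev procs I [a₀, a₁, enc acc, enc l] (lets [mapE (.v 3) (rqk (.ix 0)),
      mapE (.v 2) (.cons (rdk (.car (.ix 0))) (.cdr (.ix 0))),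
      .call iDom [4, 5]] (zipE (.v 3) (.v 6) (.cons (.ix 0) zipY))) (enc (stepV acc l))
      (2 * N * propK V ks + 60) := by
  have hd := ev_dom (I := I) V ks (l.map Rec.qk) (acc.map fun a => (a.1.dk, a.2))
    (by simpa only [List.forall_mem_map] using fun r hr => (hs r hr).1)
    (by simpa only [List.forall_mem_map] using fun a h => (hs' a h).2)
    (by simpa only [List.forall_mem_map] using hV)
  have hz : List.zipWith (fun (b : Rec) (v : Bits) => (b, v)) l ((l.map Rec.qk).map
      (domV (acc.map fun a => (a.1.dk, a.2)))) = stepV acc l := by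
    rw [List.map_map, List.zipWith_map_right, List.zipWith_self]
    rfl
  rw [← hz]
  refine (Ev.letE (Ev.map Rec.qk 6 (Ev.v (x := enc l) rfl) fun _ _ _ => ev_rqk Ev.ix0) <|
    Ev.letE (Ev.map (fun a : Rec × Bits => (a.1.dk, a.2)) 10 (Ev.v (x := enc acc) rfl)
      fun _ _ _ => (ev_rdk (Ev.fst Ev.ix0)).prod (Ev.snd Ev.ix0)) <|
    Ev.letE (Ev.call (p := iDom) (xs := [4, 5]) rfl rfl rfl hd) <|
    Ev.zip (fun (b : Rec) (v : Bits) => (b, v)) 5 (Ev.v rfl) (Ev.v rfl) (by simp)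
      fun acc' x _ y _ l' => (Ev.ix0.prod (Ev.head (x := y) (l := l') (Ev.car (y := acc')
        Ev.ix1)))).mono ?_
  simp only [List.length_map, List.length_cons, List.length_nil, propK]
  have h1 : 500 * (V + 1) * (l.length + acc.length) * domG ks ≤
      500 * (V + 1) * (2 * N) * domG ks :=
    Nat.mul_le_mul_right _ (Nat.mul_le_mul_left _ (by omega))
  have h2 : 2 * N * (500 * (V + 1) * domG ks + 60) = 500 * (V + 1) * (2 * N) * domG ks + 120 * N := by
    ring
  omega

theorem propV_snoc (acc : List (Rec × Bits)) (ls : List (List Rec)) (l : List Rec) :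
    propV acc (ls ++ [l]) = stepV (propV acc ls) l := by simp [propV]

theorem propV_inv (V N : ℕ) (ks : List ℕ) (acc : List (Rec × Bits)) (ls : List (List Rec))
    (hs : ∀ l ∈ ls, ∀ r ∈ l, r.Shape ks) (hs' : ∀ a ∈ acc, a.1.Shape ks)
    (hV : ∀ a ∈ acc, a.2.length ≤ V) (hN : ∀ l ∈ ls, l.length ≤ N) (hN' : acc.length ≤ N) :
    (∀ a ∈ propV acc ls, a.1.Shape ks) ∧ (∀ a ∈ propV acc ls, a.2.length ≤ V) ∧
      (propV acc ls).length ≤ N := by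
  induction ls using List.reverseRecOn with
  | nil => exact ⟨hs', hV, hN'⟩
  | append_singleton ls l ih =>
    obtain ⟨h1, h2, h3⟩ := ih (fun l hl => hs l (by simp [hl])) (fun l hl => hN l (by simp [hl]))
    rw [propV_snoc]
    refine ⟨?_, ?_, ?_⟩
    · simp only [stepV, List.forall_mem_map]
      exact hs l (by simp)
    · simp only [stepV, List.forall_mem_map]
      intro r hr
      refine domV_length _ _ _ ?_
      simpa only [List.forall_mem_map] using h2
    · rw [length_stepV]
      exact hN l (by simp)

theorem ev_prop (V N : ℕ) (ks : List ℕ) (acc : List (Rec × Bits)) (ls : List (List Rec))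
    (hs : ∀ l ∈ ls, ∀ r ∈ l, r.Shape ks) (hs' : ∀ a ∈ acc, a.1.Shape ks)
    (hV : ∀ a ∈ acc, a.2.length ≤ V) (hN : ∀ l ∈ ls, l.length ≤ N) (hN' : acc.length ≤ N) :
    Ev procs I [enc acc, enc ls] pProp.body (enc (propV acc ls))
      (ls.length * (2 * N * propK V ks + 61) + 3) := by
  refine (Ev.foldP (l := ls) (fun l₁ => enc (propV acc l₁)) (fun _ => 2 * N * propK V ks + 60)
    (Ev.v rfl) (Ev.v rfl) fun l₁ x l₂ h => ?_).mono
      (by rw [sum_map_const, Nat.add_assoc (2 * N * propK V ks)]; omega)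
  rw [propV_snoc]
  obtain ⟨h1, h2, h3⟩ := propV_inv V N ks acc l₁ (fun l hl => hs l (by simp [h, hl])) hs' hV
    (fun l hl => hN l (by simp [h, hl])) hN'
  exact ev_stepV V N ks _ _ _ _ (hs x (by simp [h])) h1 h2 (hN x (by simp [h])) h3

/-- A chunk of the rank of a record. -/
def Rec.col (l : ℕ) (r : Rec) : Bits := r.xs.getD l []

theorem ev_col (l : ℕ) (r : Rec) (h : l < r.xs.length) :
    Ev procs I [enc l, enc r] pCol.body (enc (r.col l)) (15 * l + 30) := by
  have h1 := List.drop_eq_getElem_cons h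
  have h2 := ev_drop (I := I) l r.xs
  rw [h1] at h2
  have h3 : r.col l = r.xs[l] := by simp [Rec.col, h]
  rw [h3]
  exact (Ev.letE (ev_rxs (Ev.v rfl)) (Ev.letE (Ev.call (p := iDrop) (xs := [0, 2]) rfl rfl rfl h2)
    (Ev.head (x := r.xs[l]) (l := r.xs.drop (l + 1)) (Ev.v rfl)))).mono (by simp; omega)

theorem ev_colEq (c : Bits) (l : ℕ) (r : Rec) (h : l < r.xs.length) (V : ℕ) (hc : c.length ≤ V)
    (hr : (r.col l).length ≤ V) :
    Ev procs I [enc c, enc l, enc r] pColEq.body (enc (decide (r.col l = c)))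
      (15 * l + 60 * V + 130) := by
  have h1 : (!decide (r.col l < c) && !decide (c < r.col l)) = decide (r.col l = c) := by
    rw [Bool.eq_iff_iff]
    simp only [Bool.and_eq_true, Bool.not_eq_true', decide_eq_false_iff_not, not_lt,
      decide_eq_true_eq]
    exact ⟨fun h => le_antisymm h.2 h.1, fun h => ⟨h.ge, h.le⟩⟩
  rw [← h1]
  exact (Ev.letE (Ev.call (p := iCol) (xs := [1, 2]) rfl rfl rfl (ev_col l r h)) <|
    Ev.letE (Ev.call (p := iLtB) (xs := [3, 0]) rfl rfl rfl (ev_ltB (r.col l) c)) <|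
    Ev.letE (Ev.call (p := iLtB) (xs := [0, 3]) rfl rfl rfl (ev_ltB c (r.col l))) <|
    (Ev.not (Ev.v rfl)).and (Ev.not (Ev.v rfl))).mono (by simp; omega)

/-- A test: a layer, a cell and a direction. -/
abbrev LinkTest := ℕ × ℕ × ℕ × Bool

/-- Can a record be linked to the cell of a test, judging by its cell and its chunk? -/
def qual (r : Rec) (τ : LinkTest) (c : Bits) (l : ℕ) : Bool :=
  !decide (τ.2.1 + 1 < r.X) && (!decide (r.X + 1 < τ.2.1) &&
  ((!decide (τ.2.1 < r.X) || decide (r.col l < c)) &&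
  ((!decide (r.X < τ.2.1) || decide (c < r.col l)) &&
  (!decide (τ.2.2.1 + 1 < r.Y) && (!decide (r.Y + 1 < τ.2.2.1) &&
  ((!decide (τ.2.2.1 < r.Y) || τ.2.2.2) && (!decide (r.Y < τ.2.2.1) || !τ.2.2.2)))))))

theorem ev_qual (r : Rec) (τ : LinkTest) (c : Bits) (l : ℕ) (h : l < r.xs.length) (V : ℕ)
    (hc : c.length ≤ V) (hr : (r.col l).length ≤ V) :
    Ev procs I [enc r, enc τ, enc c, enc l] pQual.body (enc (qual r τ c l))
      (15 * l + 60 * V + 300) := by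
  refine (Ev.letE (Ev.call (p := iCol) (xs := [3, 0]) rfl rfl rfl (ev_col l r h)) <|
    Ev.letE (Ev.call (p := iLtB) (xs := [4, 2]) rfl rfl rfl (ev_ltB (r.col l) c)) <|
    Ev.letE (Ev.call (p := iLtB) (xs := [2, 4]) rfl rfl rfl (ev_ltB c (r.col l))) <|
    Ev.letE (ev_rX (Ev.v rfl)) <| Ev.letE (ev_rY (Ev.v rfl)) <|
    Ev.letE (Ev.fst (Ev.snd (x := τ) (Ev.v rfl))) <|
    Ev.letE (Ev.fst (Ev.snd (Ev.snd (x := τ) (Ev.v rfl)))) <|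
    Ev.letE (Ev.snd (Ev.snd (Ev.snd (x := τ) (Ev.v rfl)))) <|
    ((Ev.lt (Ev.succ (Ev.v rfl)) (Ev.v rfl)).not.and <|
    (Ev.lt (Ev.succ (Ev.v rfl)) (Ev.v rfl)).not.and <|
    ((Ev.lt (Ev.v rfl) (Ev.v rfl)).not.or (Ev.v rfl)).and <|
    ((Ev.lt (Ev.v rfl) (Ev.v rfl)).not.or (Ev.v rfl)).and <|
    (Ev.lt (Ev.succ (Ev.v rfl)) (Ev.v rfl)).not.and <|
    (Ev.lt (Ev.succ (Ev.v rfl)) (Ev.v rfl)).not.and <|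
    ((Ev.lt (Ev.v rfl) (Ev.v rfl)).not.or (Ev.v rfl)).and <|
    ((Ev.lt (Ev.v rfl) (Ev.v rfl)).not.or (Ev.not (Ev.v rfl))))).mono ?_
  simp
  omega

/-- The value of a record in the direction of a test. -/
def Rec.val (sg : Bool) (r : Rec) : Bits := if sg then r.y else compl r.y

/-- Replace the empty string. -/
def pad (z u : Bits) : Bits := if u = [] then z else u

theorem ev_pad {env : List Val} {a b : Ex} {z u : Bits} {T U : ℕ}
    (ha : Ev procs I env a (enc u) T) (hb : Ev procs I env b (enc z) U) :
    Ev procs I env (.ifz a b a) (enc (pad z u)) (T + (U + T) + 1) := by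
  refine Ev.ifL ha (fun h => ?_) fun x l' h => ?_
  · simpa [pad, h] using hb.mono (by omega)
  · have : pad z u = u := by simp [pad, h]
    rw [this]
    exact ha.mono (by omega)

/-- Extend the vectors of the records of the first layer. -/
def testF (τ : LinkTest) (l : List Rec) (ls : List (List Rec)) (z : Bits)
    (A : List (Rec × List Bits)) : List (Rec × List Bits) :=
  List.zipWith (fun a b => (a.1, pad z b.2 :: a.2)) A
    (propV (l.map fun r => (r, if r.X = τ.2.1 ∧ r.Y = τ.2.2.1 then r.val τ.2.2.2 else [])) ls)

/-- Extend the vectors of the records of the last layer. -/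
def testG (τ : LinkTest) (l : List Rec) (ls : List (List Rec)) (c : Bits) (lev : ℕ) (z : Bits)
    (B : List (Rec × List Bits)) : List (Rec × List Bits) :=
  List.zipWith (fun a b => (a.1, compl (pad z b.2) :: a.2)) B
    (propV (l.map fun r => (r, if qual r τ c lev then r.val (!τ.2.2.2) else [])) ls)

theorem length_val (sg : Bool) (r : Rec) : (r.val sg).length = r.y.length := by
  unfold Rec.val compl; split <;> simp

/-- Propagation ends with the records of the last list in their given order. This alignment allows
the new values to be zipped with the existing vectors. -/
theorem map_fst_propV (acc : List (Rec × Bits)) (ls : List (List Rec)) :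
    (propV acc ls).map Prod.fst = ((acc.map Prod.fst) :: ls).getLast (by simp) := by
  induction ls generalizing acc with
  | nil => rfl
  | cons l ls ih =>
    have h := ih (stepV acc l)
    have h2 : (stepV acc l).map Prod.fst = l := by simp [stepV, Function.comp_def]
    rw [h2] at h
    rw [List.getLast_cons (by simp)]
    exact h

theorem length_propV (acc : List (Rec × Bits)) (ls : List (List Rec)) :
    (propV acc ls).length = (((acc.map Prod.fst) :: ls).getLast (by simp)).length := by
  rw [← map_fst_propV, List.length_map]

theorem ev_testF (V N : ℕ) (ks : List ℕ) (τ : LinkTest) (s : List (List Rec)) (z : Bits)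
    (A : List (Rec × List Bits)) (l : List Rec) (ls : List (List Rec))
    (hl : (s.take (τ.1 + 1)).reverse = l :: ls) (hs : ∀ l ∈ s, ∀ r ∈ l, r.Shape ks)
    (hV : ∀ l ∈ s, ∀ r ∈ l, r.y.length ≤ V) (hN : ∀ l ∈ s, l.length ≤ N)
    (hA : A.length = ((l :: ls).getLast (by simp)).length) :
    Ev procs I [enc τ, enc s, enc z, enc A] pTestF.body (enc (testF τ l ls z A))
      (s.length * (2 * N * propK V ks + 61) + 30 * τ.1 + N * (10 * V + 120) + 150) := by
  have hmem : ∀ x ∈ l :: ls, x ∈ s := fun x hx => by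
    rw [← hl, List.mem_reverse] at hx
    exact List.mem_of_mem_take hx
  have hlen : (l :: ls).length ≤ s.length := by
    rw [← hl]; simp
  have hl0 := hN l (hmem l (by simp))
  have hA' : A.length ≤ N := by rw [hA]; exact hN _ (hmem _ (List.getLast_mem _))
  have e1 := ev_revTake (I := I) (τ.1 + 1) s
  rw [hl] at e1
  have hp := ev_prop (I := I) V N ks
    (l.map fun r => (r, if r.X = τ.2.1 ∧ r.Y = τ.2.2.1 then r.val τ.2.2.2 else [])) ls
    (fun x hx r hr => hs x (hmem x (by simp [hx])) r hr)
    (by simpa only [List.forall_mem_map] using fun r hr => hs l (hmem l (by simp)) r hr)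
    (by
      simp only [List.forall_mem_map]
      intro r hr
      split
      · rw [length_val]; exact hV l (hmem l (by simp)) r hr
      · simp)
    (fun x hx => hN x (hmem x (by simp [hx]))) (by simpa using hl0)
  refine (Ev.letE (Ev.succ (Ev.fst (x := τ) (Ev.v rfl))) <|
    Ev.letE (Ev.call (p := iRevTake) (xs := [4, 1]) rfl rfl rfl e1) <|
    Ev.letE (Ev.fst (Ev.snd (x := τ) (Ev.v rfl))) <|
    Ev.letE (Ev.fst (Ev.snd (Ev.snd (x := τ) (Ev.v rfl)))) <|
    Ev.letE (Ev.snd (Ev.snd (Ev.snd (x := τ) (Ev.v rfl)))) <|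
    Ev.letE (Ev.map (fun r : Rec => (r, if r.X = τ.2.1 ∧ r.Y = τ.2.2.1 then r.val τ.2.2.2 else []))
      (10 * V + 60) (Ev.head (x := l) (l := ls) (Ev.v rfl)) fun acc r hr => ?_) <|
    Ev.letE (Ev.tail (x := l) (l := ls) (Ev.v rfl)) <|
    Ev.letE (Ev.call (p := iProp) (xs := [9, 10]) rfl rfl rfl hp) <|
    (Ev.zip (fun (a : Rec × List Bits) (b : Rec × Bits) => (a.1, pad z b.2 :: a.2)) 25
      (Ev.v (x := enc A) rfl) (Ev.v rfl)
      (by rw [length_propV, hA]; congr 2; simp [Function.comp_def]) fun acc a _ b _ l' => ?_)).mono ?_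
  · have hr' := hV l (hmem l (by simp)) r hr
    have hx : ∀ env : List Val, Ev procs I (env ++ [acc, enc r]) (.ix 0) (enc r) 1 :=
      fun env => Ev.ix0
    refine ((hx _).prod (Ev.ifB (U := 10 * V + 13) ((Ev.eq (ev_rX (hx _)) (Ev.v rfl)).and
      (Ev.eq (ev_rY (hx _)) (Ev.v rfl))) (fun h => ?_) fun h => ?_)).mono (by omega)
    · rw [← Bool.decide_and, decide_eq_false_iff_not] at h
      rw [if_neg h]
      exact Ev.nil.mono (by omega)
    · rw [← Bool.decide_and, decide_eq_true_eq] at h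
      rw [if_pos h]
      refine (Ev.ifB (U := 10 * V + 9) (Ev.v (x := enc τ.2.2.2) rfl) (fun h => ?_) fun h => ?_).mono
        (by omega)
      · simp only [Rec.val, h]
        exact (ev_ry (hx _)).compl.mono (by omega)
      · simp only [Rec.val, h]
        exact (ev_ry (hx _)).mono (by omega)
  · have hy : ∀ env : List Val, Ev procs I (env ++ [.pair (enc (b :: l')) acc, enc a]) zipY (enc b) 3 :=
      fun env => Ev.head (x := b) (l := l') (Ev.car (y := acc) Ev.ix1)
    exact ((Ev.fst Ev.ix0).prod ((ev_pad (Ev.snd (hy _)) (Ev.v rfl)).cons (Ev.snd Ev.ix0))).mono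
      (by omega)
  · have h1 : ls.length * (2 * N * propK V ks + 61) ≤ s.length * (2 * N * propK V ks + 61) :=
      Nat.mul_le_mul_right _ (by simp at hlen; omega)
    have h2 : l.length * (10 * V + 67) ≤ N * (10 * V + 67) := Nat.mul_le_mul_right _ hl0
    have h3 : N * (10 * V + 120) = N * (10 * V + 67) + N * 53 := by ring
    simp only [List.length_cons, List.length_nil, Nat.add_assoc, Nat.reduceAdd] at *
    omega

theorem ev_testG (V N : ℕ) (ks : List ℕ) (τ : LinkTest) (t : List (List Rec)) (c : Bits) (lev : ℕ)
    (z : Bits) (B : List (Rec × List Bits)) (l : List Rec) (ls : List (List Rec))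
    (hl : t.drop (τ.1 + 1) = l :: ls) (hs : ∀ l ∈ t, ∀ r ∈ l, r.Shape ks)
    (hV : ∀ l ∈ t, ∀ r ∈ l, r.y.length ≤ V) (hN : ∀ l ∈ t, l.length ≤ N)
    (hB : B.length = ((l :: ls).getLast (by simp)).length)
    (hlev : ∀ l ∈ t, ∀ r ∈ l, lev < r.xs.length) (hc : c.length ≤ V)
    (hcol : ∀ l ∈ t, ∀ r ∈ l, (r.col lev).length ≤ V) (hz : z.length ≤ V) :
    Ev procs I [enc τ, enc t, enc c, enc lev, enc z, enc B] pTestG.body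
      (enc (testG τ l ls c lev z B))
      (t.length * (2 * N * propK V ks + 61) + 30 * τ.1 + N * (80 * V + 15 * lev + 450) + 150) := by
  have hmem : ∀ x ∈ l :: ls, x ∈ t := fun x hx => by
    rw [← hl] at hx
    exact List.mem_of_mem_drop hx
  have hlen : (l :: ls).length ≤ t.length := by
    rw [← hl]; simp
  have hl0 := hN l (hmem l (by simp))
  have hB' : B.length ≤ N := by rw [hB]; exact hN _ (hmem _ (List.getLast_mem _))
  have e1 := ev_drop (I := I) (τ.1 + 1) t
  rw [hl] at e1
  have hacc : ∀ a ∈ l.map fun r => (r, if qual r τ c lev then r.val (!τ.2.2.2) else []),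
      a.2.length ≤ V := by
    simp only [List.forall_mem_map]
    intro r hr
    split
    · rw [length_val]; exact hV l (hmem l (by simp)) r hr
    · simp
  have hshape : ∀ a ∈ l.map fun r => (r, if qual r τ c lev then r.val (!τ.2.2.2) else []),
      a.1.Shape ks := by
    simpa only [List.forall_mem_map] using fun r hr => hs l (hmem l (by simp)) r hr
  have hsh : ∀ x ∈ ls, ∀ r ∈ x, r.Shape ks := fun x hx r hr => hs x (hmem x (by simp [hx])) r hr
  have hNN : ∀ x ∈ ls, x.length ≤ N := fun x hx => hN x (hmem x (by simp [hx]))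
  have hp := ev_prop (I := I) V N ks _ ls hsh hshape hacc hNN (by simpa using hl0)
  have hinv := propV_inv V N ks _ ls hsh hshape hacc hNN (by simpa using hl0)
  refine (Ev.letE (Ev.succ (Ev.fst (x := τ) (Ev.v rfl))) <|
    Ev.letE (Ev.call (p := iDrop) (xs := [6, 1]) rfl rfl rfl e1) <|
    Ev.letE (Ev.snd (Ev.snd (Ev.snd (x := τ) (Ev.v rfl)))) <|
    Ev.letE (Ev.map (fun r : Rec => (r, if qual r τ c lev then r.val (!τ.2.2.2) else []))
      (70 * V + 15 * lev + 340) (Ev.head (x := l) (l := ls) (Ev.v rfl)) fun acc r hr => ?_) <|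
    Ev.letE (Ev.tail (x := l) (l := ls) (Ev.v rfl)) <|
    Ev.letE (Ev.call (p := iProp) (xs := [9, 10]) rfl rfl rfl hp) <|
    (Ev.zip (fun (a : Rec × List Bits) (b : Rec × Bits) => (a.1, compl (pad z b.2) :: a.2))
      (10 * V + 35) (Ev.v (x := enc B) rfl) (Ev.v rfl)
      (by rw [length_propV, hB]; congr 2; simp [Function.comp_def]) fun acc a _ b hb l' => ?_)).mono ?_
  · have hr' := hV l (hmem l (by simp)) r hr
    have hx : ∀ env : List Val, Ev procs I (env ++ [acc, enc r]) (.ix 0) (enc r) 1 :=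
      fun env => Ev.ix0
    have hq := ev_qual (I := I) r τ c lev (hlev l (hmem l (by simp)) r hr) V hc
      (hcol l (hmem l (by simp)) r hr)
    refine ((hx _).prod (Ev.letE (Ev.call (p := iQual) (xs := [10, 0, 2, 3]) rfl rfl rfl hq)
      (Ev.ifB (U := 10 * V + 13) (Ev.v rfl) (fun h => ?_) fun h => ?_))).mono (by simp; omega)
    · simp only [h]
      exact Ev.nil.mono (by omega)
    · simp only [h]
      refine (Ev.ifB (U := 10 * V + 9) (Ev.v (x := enc τ.2.2.2) rfl) (fun h => ?_) fun h => ?_).mono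
        (by omega)
      · simp only [Rec.val, h]
        exact (ev_ry (r := r) (Ev.v rfl)).mono (by omega)
      · simp only [Rec.val, h]
        exact (ev_ry (r := r) (Ev.v rfl)).compl.mono (by omega)
  · have hy : ∀ env : List Val, Ev procs I (env ++ [.pair (enc (b :: l')) acc, enc a]) zipY (enc b) 3 :=
      fun env => Ev.head (x := b) (l := l') (Ev.car (y := acc) Ev.ix1)
    have hpl : (pad z b.2).length ≤ V := by
      have := hinv.2.1 b hb
      unfold pad
      split <;> omega
    exact ((Ev.fst Ev.ix0).prod ((ev_pad (Ev.snd (hy _)) (Ev.v rfl)).compl.cons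
      (Ev.snd Ev.ix0))).mono (by omega)
  · have h1 : ls.length * (2 * N * propK V ks + 61) ≤ t.length * (2 * N * propK V ks + 61) :=
      Nat.mul_le_mul_right _ (by simp at hlen; omega)
    have h2 : l.length * (70 * V + (15 * lev + 347)) ≤ N * (70 * V + (15 * lev + 347)) :=
      Nat.mul_le_mul_right _ hl0
    have h4 : B.length * (10 * V + 47) ≤ N * (10 * V + 47) := Nat.mul_le_mul_right _ hB'
    have h3 : N * (80 * V + (15 * lev + 450)) =
      N * (70 * V + (15 * lev + 347)) + N * (10 * V + 47) + N * 56 := by ring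
    simp only [List.length_cons, List.length_nil, Nat.add_assoc, Nat.reduceAdd] at *
    omega

theorem ev_keep {γ : Type} [Enc γ] (c : Bits) (lev V : ℕ) (A : List (Rec × γ))
    (hlev : ∀ a ∈ A, lev < a.1.xs.length) (hc : c.length ≤ V)
    (hcol : ∀ a ∈ A, (a.1.col lev).length ≤ V) :
    Ev procs I [enc c, enc lev, enc A] pKeep.body
      (enc (A.filter fun a => decide (a.1.col lev = c)))
      (A.length * (15 * lev + 60 * V + 150) + 10) := by
  refine (Ev.filter (fun a : Rec × γ => decide (a.1.col lev = c)) (15 * lev + 60 * V + 140)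
    (Ev.v rfl) fun acc a ha => ?_).mono ?_
  · exact (Ev.letE (Ev.fst (x := a) (Ev.v rfl)) (Ev.call (p := iColEq) (xs := [0, 1, 5]) rfl rfl rfl
      (ev_colEq c lev a.1 (hlev a ha) V hc (hcol a ha)))).mono (by simp; omega)
  · simp only [Nat.add_assoc, Nat.reduceAdd, Nat.mul_add]; omega

theorem ev_omit {γ : Type} [Enc γ] (c : Bits) (lev V : ℕ) (A : List (Rec × γ))
    (hlev : ∀ a ∈ A, lev < a.1.xs.length) (hc : c.length ≤ V)
    (hcol : ∀ a ∈ A, (a.1.col lev).length ≤ V) :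
    Ev procs I [enc c, enc lev, enc A] pOmit.body
      (enc (A.filter fun a => !decide (a.1.col lev = c)))
      (A.length * (15 * lev + 60 * V + 150) + 10) := by
  refine (Ev.filter (fun a : Rec × γ => !decide (a.1.col lev = c)) (15 * lev + 60 * V + 141)
    (Ev.v rfl) fun acc a ha => ?_).mono ?_
  · exact (Ev.letE (Ev.fst (x := a) (Ev.v rfl)) (Ev.call (p := iColEq) (xs := [0, 1, 5]) rfl rfl rfl
      (ev_colEq c lev a.1 (hlev a ha) V hc (hcol a ha)))).not.mono (by simp; omega)
  · simp only [Nat.add_assoc, Nat.reduceAdd, Nat.mul_add]; omega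

theorem ev_keepRec (c : Bits) (lev V : ℕ) (A : List Rec)
    (hlev : ∀ a ∈ A, lev < a.xs.length) (hc : c.length ≤ V)
    (hcol : ∀ a ∈ A, (a.col lev).length ≤ V) :
    Ev procs I [enc c, enc lev, enc A] pKeepRec.body
      (enc (A.filter fun a => decide (a.col lev = c)))
      (A.length * (15 * lev + 60 * V + 150) + 10) := by
  refine (Ev.filter (fun a : Rec => decide (a.col lev = c)) (15 * lev + 60 * V + 140)
    (Ev.v rfl) fun acc a ha => ?_).mono ?_
  · exact (Ev.call (p := iColEq) (xs := [0, 1, 4]) rfl rfl rfl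
      (ev_colEq c lev a (hlev a ha) V hc (hcol a ha))).mono (by simp)
  · simp only [Nat.add_assoc, Nat.reduceAdd, Nat.mul_add]; omega

/-- A loop that looks for an element with a given property. -/
theorem Ev.any {P : List Proc} {env : List Val} {α : Type} [Enc α] {e b : Ex} {l : List α} {T : ℕ}
    (f : α → Bool) (c : ℕ) (h : Ev P I env e (enc l) T)
    (hb : ∀ acc : Bool, ∀ x ∈ l, Ev P I (env ++ [enc acc, enc x]) b (enc (acc || f x)) c) :
    Ev P I env (.fold e (.nat 0) b) (enc (l.any f)) (T + l.length * (c + 1) + 2) := by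
  have h1 : ∀ b : Bool, l.foldl (fun acc x => acc || f x) b = (b || l.any f) := by
    clear h hb
    induction l with
    | nil => simp
    | cons x l ih => intro b; simp [ih, Bool.or_assoc]
  have := Ev.foldU (fun acc x => acc || f x) false c h Ev.ff hb
  rw [h1] at this
  exact this.mono (by omega)

/-- The existence of a dominated pair is itself a dominance query. Every record of `A` becomes a
datum with the nonempty value `[true]`, and the answer to a record of `B` is nonempty iff it
dominates some datum. -/
theorem ev_check (h : ℕ) (w : ℕ) (A B : List (Rec × List Bits))
    (hA : ∀ a ∈ A, a.2.map List.length = List.replicate h w)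
    (hB : ∀ a ∈ B, a.2.map List.length = List.replicate h w) :
    Ev procs I [enc A, enc B] pCheck.body
      (enc (B.any fun b => A.any fun a => keysLE a.2 b.2))
      ((A.length + B.length) * (1000 * domG (List.replicate h w) + 50) + 100) := by
  have hd := ev_dom (I := I) 1 (List.replicate h w) (B.map Prod.snd)
    (A.map fun a => (a.2, [true])) (by simpa only [List.forall_mem_map] using hB)
    (by simpa only [List.forall_mem_map] using hA) (by simp only [List.forall_mem_map]; simp)
  have hany : (B.any fun b => A.any fun a => keysLE a.2 b.2) =
      ((B.map Prod.snd).map (domV (A.map fun a => (a.2, [true])))).any fun u => !u.isEmpty := by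
    rw [Bool.eq_iff_iff]
    simp only [List.any_eq_true, List.mem_map, exists_exists_and_eq_and, Bool.not_eq_true',
      List.isEmpty_eq_false_iff]
    refine exists_congr fun b => and_congr_right fun hb => ?_
    constructor
    · rintro ⟨a, ha, h1⟩ h2
      have := (domV_le_iff (A.map fun a => (a.2, [true])) b.2 []).1 h2.le (a.2, [true])
        (List.mem_map_of_mem ha) h1
      exact absurd (le_antisymm this (nil_le_bits _)) (by simp)
    · intro h1
      rcases domV_mem (A.map fun a => (a.2, [true])) b.2 with h2 | ⟨d, hd, h3, h4⟩
      · exact absurd h2 h1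
      · obtain ⟨a, ha, rfl⟩ := List.mem_map.1 hd
        exact ⟨a, ha, h3⟩
  rw [hany]
  refine (Ev.letE (Ev.map Prod.snd 2 (Ev.v (x := enc B) rfl) fun _ _ _ => Ev.snd Ev.ix0) <|
    Ev.letE (Ev.map (fun a : Rec × List Bits => (a.2, [true])) 6 (Ev.v (x := enc A) rfl)
      fun _ _ _ => (Ev.snd Ev.ix0).prod (Ev.tt.cons Ev.nil)) <|
    Ev.letE (Ev.call (p := iDom) (xs := [2, 3]) rfl rfl rfl hd) <|
    (Ev.any (fun u : Bits => !u.isEmpty) 5 (Ev.v rfl) fun acc x _ => ?_)).mono ?_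
  · refine (Ev.ifL (U := 1) (l := x) Ev.ix0 (fun h => ?_) fun _ _ h => ?_).mono (by omega)
    · subst h; simp only [List.isEmpty_nil, Bool.not_true, Bool.or_false]; exact Ev.ix1
    · subst h; simpa using Ev.tt
  · simp only [List.length_map, List.length_cons, List.length_nil]
    have : 500 * (1 + 1) * (B.length + A.length) * domG (List.replicate h w) =
      (A.length + B.length) * (1000 * domG (List.replicate h w)) := by ring
    rw [this, Nat.mul_add (A.length + B.length)]
    omega

end procedures

/-! ### Chains of records -/

/-- Do the keys of two records say that their squares meet? -/
def linked (p q : Rec) : Bool := keysLE p.dk q.qk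

/-- There is a chain of linked records from `a` to `b` along the layers. -/
def Con : List (List Rec) → Rec → Rec → Prop
  | [], _, _ => False
  | [l], a, b => a ∈ l ∧ a = b
  | l :: l' :: ls, a, b => a ∈ l ∧ ∃ q, linked a q = true ∧ Con (l' :: ls) q b

theorem con_cons {l : List Rec} {ls : List (List Rec)} (h : ls ≠ []) {a b : Rec} :
    Con (l :: ls) a b ↔ a ∈ l ∧ ∃ q, linked a q = true ∧ Con ls q b := by
  obtain ⟨l', ls, rfl⟩ := List.exists_cons_of_ne_nil h
  rfl

theorem Con.ne_nil {ls : List (List Rec)} {a b : Rec} (h : Con ls a b) : ls ≠ [] := by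
  rintro rfl
  exact h

theorem Con.mem_head {l : List Rec} {ls : List (List Rec)} {a b : Rec} (h : Con (l :: ls) a b) :
    a ∈ l := by
  cases ls with
  | nil => exact h.1
  | cons _ _ => exact h.1

theorem Con.mem_getLast {ls : List (List Rec)} {a b : Rec} (h : Con ls a b) :
    b ∈ ls.getLast h.ne_nil := by
  induction ls generalizing a with
  | nil => exact h.elim
  | cons l ls ih =>
    cases ls with
    | nil => exact h.2 ▸ h.1
    | cons l' ls =>
      obtain ⟨-, q, -, h2⟩ := h
      rw [List.getLast_cons (by simp)]
      exact ih h2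

theorem con_append {ls ls' : List (List Rec)} (h : ls ≠ []) (h' : ls' ≠ []) {a b : Rec} :
    Con (ls ++ ls') a b ↔ ∃ p q, Con ls a p ∧ linked p q = true ∧ Con ls' q b := by
  induction ls generalizing a with
  | nil => exact absurd rfl h
  | cons l ls ih =>
    rw [List.cons_append, con_cons (by simp [h'])]
    rcases eq_or_ne ls [] with rfl | hls
    · simp only [List.nil_append, Con]
      constructor
      · rintro ⟨h1, q, h2, h3⟩
        exact ⟨a, q, ⟨h1, rfl⟩, h2, h3⟩
      · rintro ⟨p, q, ⟨h1, rfl⟩, h2, h3⟩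
        exact ⟨h1, q, h2, h3⟩
    · simp only [ih hls, con_cons hls]
      constructor
      · rintro ⟨h1, r, h2, p, q, h3, h4, h5⟩
        exact ⟨p, q, ⟨h1, r, h2, h3⟩, h4, h5⟩
      · rintro ⟨p, q, ⟨h1, r, h2, h3⟩, h4, h5⟩
        exact ⟨h1, r, h2, p, q, h3, h4, h5⟩

theorem Con.mono {s t : List (List Rec)} (h : List.Forall₂ (fun l l' => ∀ r ∈ l, r ∈ l') s t)
    {a b : Rec} (hc : Con s a b) : Con t a b := by
  induction h generalizing a with
  | nil => exact hc
  | @cons l l' s t h1 h2 ih =>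
    cases h2 with
    | nil => exact ⟨h1 _ hc.1, hc.2⟩
    | cons h3 h4 =>
      obtain ⟨h5, q, h6, h7⟩ := hc
      exact ⟨h1 _ h5, q, h6, ih h7⟩

/-- The values for the first layer are propagated backwards, from the layer of the test to the first
one. Symmetry of the links makes this legitimate. -/
theorem con_reverse {R : Rec → Prop} (hsym : ∀ p q, R p → R q → linked p q = true →
    linked q p = true) {ls : List (List Rec)} (hR : ∀ l ∈ ls, ∀ r ∈ l, R r) {a b : Rec}
    (h : Con ls a b) : Con ls.reverse b a := by
  induction ls generalizing a with
  | nil => exact h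
  | cons l ls ih =>
    cases ls with
    | nil => exact ⟨h.2 ▸ h.1, h.2.symm⟩
    | cons l' ls =>
      obtain ⟨h1, q, h2, h3⟩ := h
      rw [List.reverse_cons, con_append (by simp) (by simp)]
      exact ⟨q, a, ih (fun l hl => hR l (by simp [hl])) h3,
        hsym _ _ (hR l (by simp) _ h1) (hR l' (by simp) _ h3.mem_head) h2, h1, rfl⟩

theorem con_reverse_iff {R : Rec → Prop} (hsym : ∀ p q, R p → R q → linked p q = true →
    linked q p = true) {ls : List (List Rec)} (hR : ∀ l ∈ ls, ∀ r ∈ l, R r) {a b : Rec} :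
    Con ls.reverse b a ↔ Con ls a b := by
  refine ⟨fun h => ?_, con_reverse hsym hR⟩
  have := con_reverse hsym (ls := ls.reverse) (by simpa using hR) h
  rwa [List.reverse_reverse] at this

/-- Propagation computes, for every record of the last layer, the maximum of the values of the
records of the first layer that are joined to it. -/
theorem propV_spec (f : Rec → Bits) (l : List Rec) (ls : List (List Rec)) :
    ∃ g : Rec → Bits, propV (l.map fun r => (r, f r)) ls =
      ((l :: ls).getLast (by simp)).map (fun b => (b, g b)) ∧
      ∀ b ∈ (l :: ls).getLast (by simp), (g b = [] ∨ ∃ a ∈ l, g b = f a) ∧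
        ∀ u, g b ≤ u ↔ ∀ a ∈ l, Con (l :: ls) a b → f a ≤ u := by
  induction ls generalizing l f with
  | nil =>
    refine ⟨f, rfl, fun b hb => ⟨Or.inr ⟨b, hb, rfl⟩, fun u => ⟨?_, fun h => h b hb ⟨hb, rfl⟩⟩⟩⟩
    rintro h a - ⟨-, rfl⟩
    exact h
  | cons l' ls ih =>
    -- The values after one step. A maximum over chains is a maximum, over the second record of the
    -- chain, of maxima over its predecessors.
    set f' : Rec → Bits := fun b => domV ((l.map fun r => (r, f r)).map fun a => (a.1.dk, a.2)) b.qk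
      with hf'
    obtain ⟨g, h1, h2⟩ := ih f' l'
    refine ⟨g, ?_, fun b hb => ?_⟩
    · rw [List.getLast_cons (by simp), ← h1]
      rfl
    · rw [List.getLast_cons (by simp)] at hb
      have hle : ∀ q u, f' q ≤ u ↔ ∀ a ∈ l, linked a q = true → f a ≤ u := by
        intro q u
        rw [hf']
        simp only [domV_le_iff, List.map_map, List.forall_mem_map]
        rfl
      obtain ⟨h3, h4⟩ := h2 b hb
      refine ⟨?_, fun u => ?_⟩
      · rcases h3 with h3 | ⟨q, hq, h3⟩
        · exact Or.inl h3
        · rw [h3, hf']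
          rcases domV_mem ((l.map fun r => (r, f r)).map fun a => (a.1.dk, a.2)) q.qk with
            h5 | ⟨d, hd, h6, h7⟩
          · exact Or.inl h5
          · rw [List.map_map] at hd
            obtain ⟨a, ha, rfl⟩ := List.mem_map.1 hd
            exact Or.inr ⟨a, ha, h7⟩
      · rw [h4]
        constructor
        · rintro h a ha ⟨-, q, hq, hc⟩
          exact (hle q u).1 (h q hc.mem_head hc) a ha hq
        · intro h q hq hc
          rw [hle]
          exact fun a ha haq => h a ha ⟨ha, q, haq, hc⟩

/-! ### Bit strings of equal length -/

/-- Complements turn maxima into minima, so one dominance routine serves for both. Equal lengths are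
needed: the empty string is its own complement and lies below everything. -/
theorem compl_le_compl {u v : Bits} (h : u.length = v.length) : compl u ≤ compl v ↔ v ≤ u := by
  induction u generalizing v with
  | nil =>
    have : v = [] := List.length_eq_zero_iff.1 h.symm
    simp [this]
  | cons a u ih =>
    cases v with
    | nil => simp at h
    | cons b v =>
      have := ih (v := v) (by simpa using h)
      unfold compl at this ⊢
      rw [List.map_cons, List.map_cons, cons_le_cons_bits, cons_le_cons_bits, this]
      cases a <;> cases b <;> simp

theorem compl_compl (u : Bits) : compl (compl u) = u := by
  simp [compl, Function.comp_def]

theorem length_compl (u : Bits) : (compl u).length = u.length := by simp [compl]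

theorem le_compl_iff {u v : Bits} (h : u.length = v.length) : u ≤ compl v ↔ v ≤ compl u := by
  have := compl_le_compl (u := compl u) (v := v) (by rw [length_compl, h])
  rwa [compl_compl] at this

theorem replicate_false_le (u : Bits) (w : ℕ) (h : u.length = w) : List.replicate w false ≤ u := by
  induction u generalizing w with
  | nil => subst h; simp
  | cons a u ih =>
    subst h
    rw [List.length_cons, List.replicate_succ, cons_le_cons_bits]
    cases a <;> simp [ih]

theorem append_lt_append_of_lt {u v : Bits} (h : u.length = v.length) (hlt : u < v) (r r' : Bits) :
    u ++ r < v ++ r' := by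
  induction u generalizing v with
  | nil =>
    have : v = [] := List.length_eq_zero_iff.1 h.symm
    subst this
    exact absurd hlt (lt_irrefl _)
  | cons a u ih =>
    cases v with
    | nil => simp at h
    | cons b v =>
      rw [List.cons_lt_cons_iff] at hlt
      rw [List.cons_append, List.cons_append, List.cons_lt_cons_iff]
      rcases hlt with h1 | ⟨h1, h2⟩
      · exact Or.inl h1
      · exact Or.inr ⟨h1, ih (by simpa using h) h2⟩

theorem append_lt_append_left_bits (p : Bits) {u v : Bits} (h : u < v) : p ++ u < p ++ v := by
  induction p with
  | nil => exact h
  | cons a p ih => rw [List.cons_append, List.cons_append, List.cons_lt_cons_iff]; exact Or.inr ⟨rfl, ih⟩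

/-- Replacing the empty string by zeros changes no comparison with strings of full length, and it
gives all vectors keys of the same width, as the dominance routine requires. -/
theorem pad_le_iff {w : ℕ} {v u : Bits} (hu : u.length = w) :
    pad (List.replicate w false) v ≤ u ↔ v ≤ u := by
  unfold pad
  split
  · next h => subst h; simp [nil_le_bits, replicate_false_le u w hu]
  · rfl

/-! ### Records in general position -/

/-- The geometric meaning of links. -/
def Near (p q : Rec) : Prop :=
  (q.X ≤ p.X + 1 ∧ p.X ≤ q.X + 1 ∧ (p.X < q.X → q.xs.flatten ≤ p.xs.flatten) ∧
    (q.X < p.X → p.xs.flatten ≤ q.xs.flatten)) ∧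
  (q.Y ≤ p.Y + 1 ∧ p.Y ≤ q.Y + 1 ∧ (p.Y < q.Y → q.y ≤ p.y) ∧ (q.Y < p.Y → p.y ≤ q.y))

theorem Near.symm {p q : Rec} (h : Near p q) : Near q p :=
  ⟨⟨h.1.2.1, h.1.1, h.1.2.2.2, h.1.2.2.1⟩, ⟨h.2.2.1, h.2.1, h.2.2.2.2, h.2.2.2.1⟩⟩

/-- A family of records with `D` chunks of length `k`, ranks of length `w`, cells below `m` and keys
of widths `ks`, in which different records have different ranks. -/
structure Good (R : Rec → Prop) (w m k D : ℕ) (ks : List ℕ) : Prop where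
  y_len : ∀ r, R r → r.y.length = w
  xs_len : ∀ r, R r → r.xs.length = D
  chunk_len : ∀ r, R r → ∀ c ∈ r.xs, c.length = k
  shape : ∀ r, R r → r.Shape ks
  X_lt : ∀ r, R r → r.X < m
  Y_lt : ∀ r, R r → r.Y < m
  linked_iff : ∀ p q, R p → R q → (linked p q = true ↔ Near p q)
  xs_inj : ∀ p q, R p → R q → p.xs = q.xs → p = q
  y_inj : ∀ p q, R p → R q → p.y = q.y → p = q

variable {R : Rec → Prop} {w m k D : ℕ} {ks : List ℕ}

theorem Good.symm (hG : Good R w m k D ks) (p q : Rec) (hp : R p) (hq : R q)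
    (h : linked p q = true) : linked q p = true :=
  (hG.linked_iff _ _ hq hp).2 ((hG.linked_iff _ _ hp hq).1 h).symm

theorem Good.col_len (hG : Good R w m k D ks) {r : Rec} (hr : R r) {lev : ℕ} (h : lev < D) :
    (r.col lev).length = k := by
  have h1 : lev < r.xs.length := by rw [hG.xs_len r hr]; exact h
  have h2 : r.col lev = r.xs[lev] := by simp [Rec.col, h1]
  rw [h2]
  exact hG.chunk_len r hr _ (List.getElem_mem h1)

/-- All chunks have the same length, so the order of two ranks is decided by the first chunk in
which they differ. -/
theorem Good.flatten_lt (hG : Good R w m k D ks) {p q : Rec} (hp : R p) (hq : R q) {lev : ℕ}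
    (h : lev < D) (hpre : p.xs.take lev = q.xs.take lev) (hlt : p.col lev < q.col lev) :
    p.xs.flatten < q.xs.flatten := by
  have key : ∀ r, R r → r.xs.flatten =
      (r.xs.take lev).flatten ++ (r.col lev ++ (r.xs.drop (lev + 1)).flatten) := by
    intro r hr
    have h1 : lev < r.xs.length := by rw [hG.xs_len r hr]; exact h
    have h2 : r.col lev = r.xs[lev] := by simp [Rec.col, h1]
    rw [h2, ← List.flatten_cons, ← List.drop_eq_getElem_cons h1, ← List.flatten_append,
      List.take_append_drop]
  rw [key p hp, key q hq, hpre]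
  refine append_lt_append_left_bits _ (append_lt_append_of_lt ?_ hlt _ _)
  rw [hG.col_len hp h, hG.col_len hq h]

/-- Compared with `Near`, first ranks are replaced by single chunks, and second ranks by the
direction in which the test is going to compare them. -/
theorem qual_iff (r : Rec) (τ : LinkTest) (c : Bits) (l : ℕ) : qual r τ c l = true ↔
    (r.X ≤ τ.2.1 + 1 ∧ τ.2.1 ≤ r.X + 1 ∧ (τ.2.1 < r.X → r.col l < c) ∧
      (r.X < τ.2.1 → c < r.col l)) ∧
    (r.Y ≤ τ.2.2.1 + 1 ∧ τ.2.2.1 ≤ r.Y + 1 ∧ (τ.2.2.1 < r.Y → τ.2.2.2 = true) ∧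
      (r.Y < τ.2.2.1 → τ.2.2.2 = false)) := by
  simp only [qual, Bool.and_eq_true, Bool.or_eq_true, Bool.not_eq_true', decide_eq_false_iff_not,
    decide_eq_true_eq, not_lt, imp_iff_not_or, and_assoc]

/-- A link from the child node of column `c` to the outside is found by a test. -/
theorem Good.exists_test (hG : Good R w m k D ks) {p q : Rec} (hp : R p) (hq : R q) {lev : ℕ}
    (h : lev < D) (hpre : p.xs.take lev = q.xs.take lev) (hne : q.col lev ≠ p.col lev)
    (hpq : linked p q = true) (i : ℕ) :
    ∃ sg, qual q (i, p.X, p.Y, sg) (p.col lev) lev = true ∧ ¬ p.val sg ≤ q.val sg := by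
  obtain ⟨⟨h1, h2, h3, h4⟩, h5, h6, h7, h8⟩ := (hG.linked_iff _ _ hp hq).1 hpq
  have hy : q.y ≠ p.y := fun he => hne (by rw [hG.y_inj _ _ hq hp he])
  -- The direction is the one in which the value of `p` exceeds that of `q`. Since the second ranks
  -- differ there is exactly one, and for neighbouring rows it is the one that the link demands.
  refine ⟨decide (q.y < p.y), (qual_iff _ _ _ _).2 ⟨⟨h1, h2, fun hX => ?_, fun hX => ?_⟩, h5, h6,
    fun hY => ?_, fun hY => ?_⟩, ?_⟩
  · refine lt_of_le_of_ne (not_lt.1 fun hlt => ?_) hne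
    exact absurd (hG.flatten_lt hp hq h hpre hlt) (not_lt.2 (h3 hX))
  · refine lt_of_le_of_ne (not_lt.1 fun hlt => ?_) hne.symm
    exact absurd (hG.flatten_lt hq hp h hpre.symm hlt) (not_lt.2 (h4 hX))
  · exact decide_eq_true (lt_of_le_of_ne (h7 hY) hy)
  · exact decide_eq_false (not_lt.2 (h8 hY))
  · by_cases hlt : q.y < p.y
    · simp [Rec.val, hlt]
    · simp only [Rec.val, hlt, decide_false, Bool.false_eq_true, if_false]
      rw [compl_le_compl (by rw [hG.y_len _ hp, hG.y_len _ hq])]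
      exact fun hle => hy (le_antisymm hle (not_lt.1 hlt))

/-- What a test finds is a link. -/
theorem Good.linked_of_test (hG : Good R w m k D ks) {p q : Rec} (hp : R p) (hq : R q) {lev : ℕ}
    (h : lev < D) (hpre : p.xs.take lev = q.xs.take lev) {i : ℕ} {sg : Bool}
    (hqual : qual q (i, p.X, p.Y, sg) (p.col lev) lev = true) (hval : ¬ p.val sg ≤ q.val sg) :
    linked p q = true := by
  obtain ⟨⟨h1, h2, h3, h4⟩, h5, h6, h7, h8⟩ := (qual_iff _ _ _ _).1 hqual
  refine (hG.linked_iff _ _ hp hq).2 ⟨⟨h1, h2, fun hX => ?_, fun hX => ?_⟩, h5, h6, fun hY => ?_,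
    fun hY => ?_⟩
  · exact (hG.flatten_lt hq hp h hpre.symm (h3 hX)).le
  · exact (hG.flatten_lt hp hq h hpre (h4 hX)).le
  · have : sg = true := h7 hY
    subst this
    simp only [Rec.val, if_true, not_le] at hval
    exact hval.le
  · have : sg = false := h8 hY
    subst this
    simp only [Rec.val, Bool.false_eq_true, if_false] at hval
    rw [compl_le_compl (by rw [hG.y_len _ hp, hG.y_len _ hq]), not_le] at hval
    exact hval.le

/-- The layers restricted to a column. -/
def restrict (c : Bits) (lev : ℕ) (t : List (List Rec)) : List (List Rec) :=
  t.map fun l => l.filter fun r => decide (r.col lev = c)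

theorem restrict_sub (c : Bits) (lev : ℕ) (t : List (List Rec)) :
    List.Forall₂ (fun l l' => ∀ r ∈ l, r ∈ l') (restrict c lev t) t := by
  unfold restrict
  rw [List.forall₂_map_left_iff, List.forall₂_same]
  exact fun l _ r hr => List.mem_of_mem_filter hr

/-- A chain either stays in the child node of its first record, or there is a first link that leaves
it. -/
theorem con_split (c : Bits) (lev : ℕ) (t : List (List Rec)) {a b : Rec} (h : Con t a b)
    (ha : a.col lev = c) : Con (restrict c lev t) a b ∨
      ∃ i p q, i + 1 < t.length ∧ Con ((restrict c lev t).take (i + 1)) a p ∧ linked p q = true ∧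
        q.col lev ≠ c ∧ Con (t.drop (i + 1)) q b := by
  induction t generalizing a with
  | nil => exact h.elim
  | cons l t ih =>
    have hal : a ∈ l.filter fun r => decide (r.col lev = c) := by
      simp [h.mem_head, ha]
    cases t with
    | nil => exact Or.inl ⟨hal, h.2⟩
    | cons l' t =>
      obtain ⟨h1, q, h2, h3⟩ := h
      by_cases hq : q.col lev = c
      · rcases ih h3 hq with h4 | ⟨i, p, r, hi, h4, h5, h6, h7⟩
        · exact Or.inl ⟨hal, q, h2, h4⟩
        · refine Or.inr ⟨i + 1, p, r, by simpa using hi, ?_, h5, h6, h7⟩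
          exact ⟨hal, q, h2, h4⟩
      · exact Or.inr ⟨0, a, q, by simp, ⟨hal, rfl⟩, h2, hq, h3⟩

theorem con_take_drop {t : List (List Rec)} {i : ℕ} {a b p q : Rec}
    (h1 : Con (t.take (i + 1)) a p) (h2 : linked p q = true) (h3 : Con (t.drop (i + 1)) q b) :
    Con t a b := by
  rw [← List.take_append_drop (i + 1) t]
  exact (con_append h1.ne_nil h3.ne_nil).2 ⟨p, q, h1, h2, h3⟩

/-- A test finds no link from the chains that start in `a` to the chains that end in `b`. -/
def TestOK (t : List (List Rec)) (c : Bits) (lev : ℕ) (τ : LinkTest) (a b : Rec) : Prop :=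
  ∀ p q, p.X = τ.2.1 → p.Y = τ.2.2.1 → Con ((restrict c lev t).take (τ.1 + 1)) a p →
    qual q τ c lev = true → Con (t.drop (τ.1 + 1)) q b → p.val τ.2.2.2 ≤ q.val τ.2.2.2

theorem Con.exists_mem_right {t : List (List Rec)} {a b : Rec} (h : Con t a b) :
    ∃ l ∈ t, b ∈ l := ⟨_, List.getLast_mem h.ne_nil, h.mem_getLast⟩

theorem Con.exists_mem_left {t : List (List Rec)} {a b : Rec} (h : Con t a b) :
    ∃ l ∈ t, a ∈ l := by
  obtain ⟨l, ls, rfl⟩ := List.exists_cons_of_ne_nil h.ne_nil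
  exact ⟨l, by simp, h.mem_head⟩

/-- If there is a chain, `con_split` gives a chain inside the child or a first leaving link, and
`Good.exists_test` provides a test that detects this link. Conversely, whatever a test detects is a
link by `Good.linked_of_test`, and it completes a chain from `a` to `b`. -/
theorem Good.not_con_iff (hG : Good R w m k D ks) {t : List (List Rec)}
    (hR : ∀ l ∈ t, ∀ r ∈ l, R r) {lev : ℕ} (hlev : lev < D) {pre : List Bits}
    (hpre : ∀ l ∈ t, ∀ r ∈ l, r.xs.take lev = pre) {tests : List LinkTest}
    (htests : ∀ τ : LinkTest, τ ∈ tests ↔ τ.1 + 1 < t.length ∧ τ.2.1 < m ∧ τ.2.2.1 < m)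
    {c : Bits} {a b : Rec} (ha : a.col lev = c) :
    ¬ Con t a b ↔ ¬ Con (restrict c lev t) a b ∧ ∀ τ ∈ tests, TestOK t c lev τ a b := by
  have hmem : ∀ {i : ℕ} {p : Rec}, Con ((restrict c lev t).take (i + 1)) a p →
      p.col lev = c ∧ ∃ l ∈ t, p ∈ l := by
    intro i p h1
    obtain ⟨l, hl, hpl⟩ := h1.exists_mem_right
    obtain ⟨l', hl', rfl⟩ := List.mem_map.1 (List.mem_of_mem_take hl)
    simp only [List.mem_filter, decide_eq_true_eq] at hpl
    exact ⟨hpl.2, l', hl', hpl.1⟩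
  have hmem' : ∀ {i : ℕ} {q : Rec}, Con (t.drop (i + 1)) q b → ∃ l ∈ t, q ∈ l := by
    intro i q h1
    obtain ⟨l, hl, hpl⟩ := h1.exists_mem_left
    exact ⟨l, List.mem_of_mem_drop hl, hpl⟩
  constructor
  · refine fun h => ⟨fun h1 => h (h1.mono (restrict_sub c lev t)), fun τ hτ p q h1 h2 h3 h4 h5 => ?_⟩
    by_contra hval
    obtain ⟨h6, l, hl, hpl⟩ := hmem h3
    obtain ⟨l', hl', hql⟩ := hmem' h5
    obtain ⟨i, X, Y, sg⟩ := τ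
    simp only at h1 h2
    subst h1 h2
    rw [← h6] at h4
    have h7 := hG.linked_of_test (hR l hl p hpl) (hR l' hl' q hql) hlev
      ((hpre l hl p hpl).trans (hpre l' hl' q hql).symm) h4 hval
    refine h (con_take_drop (h3.mono ?_) h7 h5)
    exact (List.forall₂_take _ (restrict_sub c lev t))
  · rintro ⟨h1, h2⟩ h
    rcases con_split c lev t h ha with h3 | ⟨i, p, q, hi, h3, h4, h5, h6⟩
    · exact h1 h3
    · obtain ⟨h7, l, hl, hpl⟩ := hmem h3
      obtain ⟨l', hl', hql⟩ := hmem' h6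
      obtain ⟨sg, h8, h9⟩ := hG.exists_test (hR l hl p hpl) (hR l' hl' q hql) hlev
        ((hpre l hl p hpl).trans (hpre l' hl' q hql).symm) (by rw [h7]; exact h5) h4 i
      rw [h7] at h8
      exact h9 (h2 (i, p.X, p.Y, sg) ((htests _).2 ⟨hi, hG.X_lt p (hR l hl p hpl),
        hG.Y_lt p (hR l hl p hpl)⟩) p q rfl rfl h3 h8 h6)

/-! ### The search tree -/

variable {R : Rec → Prop} {w m k D : ℕ} {ks : List ℕ}

theorem zipWith_map_fst {β γ : Type} (f : Rec × β → Bits → γ) (g : Rec → Bits) (A : List (Rec × β))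
    (l : List Rec) (h : A.map Prod.fst = l) :
    List.zipWith (fun a (b : Rec × Bits) => f a b.2) A (l.map fun b => (b, g b)) =
      A.map fun a => f a (g a.1) := by
  subst h
  rw [List.map_map, List.zipWith_map_right, List.zipWith_self]
  rfl

/-- `F` is described by its upper bounds of full length rather than as a maximum. This includes the
case that no suitable record is reached, when the value is the zero string. -/
theorem Good.testF_spec (hG : Good R w m k D ks) {s : List (List Rec)}
    (hR : ∀ l ∈ s, ∀ r ∈ l, R r) (τ : LinkTest) (l : List Rec) (ls : List (List Rec))
    (hl : (s.take (τ.1 + 1)).reverse = l :: ls) (A : List (Rec × List Bits))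
    (hA : A.map Prod.fst = (l :: ls).getLast (by simp)) :
    ∃ F : Rec → Bits, testF τ l ls (List.replicate w false) A = A.map (fun a => (a.1, F a.1 :: a.2)) ∧
      ∀ a ∈ A, (F a.1).length = w ∧ ∀ u, u.length = w → (F a.1 ≤ u ↔ ∀ p, p.X = τ.2.1 →
        p.Y = τ.2.2.1 → Con (s.take (τ.1 + 1)) a.1 p → p.val τ.2.2.2 ≤ u) := by
  obtain ⟨g, h1, h2⟩ := propV_spec
    (fun r => if r.X = τ.2.1 ∧ r.Y = τ.2.2.1 then r.val τ.2.2.2 else []) l ls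
  have hR' : ∀ x ∈ s.take (τ.1 + 1), ∀ r ∈ x, R r := fun x hx => hR x (List.mem_of_mem_take hx)
  have hRl : ∀ r ∈ l, R r := hR' l (by rw [← List.mem_reverse, hl]; simp)
  refine ⟨fun r => pad (List.replicate w false) (g r), ?_, fun a ha => ?_⟩
  · rw [testF, h1]
    exact zipWith_map_fst (fun a v => (a.1, pad (List.replicate w false) v :: a.2)) g A _ hA
  · obtain ⟨h3, h4⟩ := h2 a.1 (by rw [← hA]; exact List.mem_map_of_mem ha)
    refine ⟨?_, fun u hu => ?_⟩
    · change (pad (List.replicate w false) (g a.1)).length = w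
      unfold pad
      split
      · simp
      · next hne =>
        rcases h3 with h3 | ⟨p, hp, h3⟩
        · exact absurd h3 hne
        · rw [h3] at hne ⊢
          split at hne
          · next h => rw [if_pos h, length_val, hG.y_len p (hRl p hp)]
          · exact absurd rfl hne
    · rw [pad_le_iff hu, h4]
      have hc : ∀ p, Con (l :: ls) p a.1 ↔ Con (s.take (τ.1 + 1)) a.1 p := fun p => by
        rw [← hl]
        exact con_reverse_iff hG.symm hR'
      constructor
      · intro h p hX hY hp
        have hp' := (hc p).2 hp
        have := h p hp'.mem_head hp'
        rwa [if_pos ⟨hX, hY⟩] at this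
      · intro h p _ hp
        split
        · next hXY => exact h p hXY.1 hXY.2 ((hc p).1 hp)
        · exact nil_le_bits u

/-- The minimum is the complement of a maximum of complements, described by its lower bounds. If no
admissible record reaches `b`, the value consists of ones and the test holds trivially. -/
theorem Good.testG_spec (hG : Good R w m k D ks) {t : List (List Rec)}
    (hR : ∀ l ∈ t, ∀ r ∈ l, R r) (τ : LinkTest) (l : List Rec) (ls : List (List Rec))
    (hl : t.drop (τ.1 + 1) = l :: ls) (c : Bits) (lev : ℕ) (B : List (Rec × List Bits))
    (hB : B.map Prod.fst = (l :: ls).getLast (by simp)) :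
    ∃ G : Rec → Bits,
      testG τ l ls c lev (List.replicate w false) B = B.map (fun b => (b.1, G b.1 :: b.2)) ∧
      ∀ b ∈ B, (G b.1).length = w ∧ ∀ u, u.length = w → (u ≤ G b.1 ↔ ∀ q,
        qual q τ c lev = true → Con (t.drop (τ.1 + 1)) q b.1 → u ≤ q.val τ.2.2.2) := by
  obtain ⟨g, h1, h2⟩ := propV_spec (fun r => if qual r τ c lev then r.val (!τ.2.2.2) else []) l ls
  have hR' : ∀ x ∈ t.drop (τ.1 + 1), ∀ r ∈ x, R r := fun x hx => hR x (List.mem_of_mem_drop hx)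
  have hRl : ∀ r ∈ l, R r := hR' l (by rw [hl]; simp)
  refine ⟨fun r => compl (pad (List.replicate w false) (g r)), ?_, fun b hb => ?_⟩
  · rw [testG, h1]
    exact zipWith_map_fst (fun a v => (a.1, compl (pad (List.replicate w false) v) :: a.2)) g B _ hB
  · obtain ⟨h3, h4⟩ := h2 b.1 (by rw [← hB]; exact List.mem_map_of_mem hb)
    have hlen : (pad (List.replicate w false) (g b.1)).length = w := by
      unfold pad
      split
      · simp
      · next hne =>
        rcases h3 with h3 | ⟨p, hp, h3⟩
        · exact absurd h3 hne
        · rw [h3] at hne ⊢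
          split at hne
          · next h => rw [if_pos h, length_val, hG.y_len p (hRl p hp)]
          · exact absurd rfl hne
    refine ⟨by rw [length_compl, hlen], fun u hu => ?_⟩
    rw [le_compl_iff (by rw [hu, hlen]), pad_le_iff (by rw [length_compl, hu]), h4]
    have hv : ∀ q, R q → (q.val (!τ.2.2.2) ≤ compl u ↔ u ≤ q.val τ.2.2.2) := by
      intro q hq
      rw [le_compl_iff (by rw [length_val, hG.y_len q hq, hu])]
      have : compl (q.val (!τ.2.2.2)) = q.val τ.2.2.2 := by
        unfold Rec.val
        cases τ.2.2.2 <;> simp [compl_compl]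
      rw [this]
    rw [hl]
    constructor
    · intro h q hq hc
      have := h q hc.mem_head hc
      rw [if_pos hq] at this
      exact (hv q (hRl q hc.mem_head)).1 this
    · intro h q hql hc
      split
      · next hq => exact (hv q (hRl q hql)).2 (h q hq hc)
      · exact nil_le_bits _

/-- The case of the empty list makes the function total, here and in `stepG`. It does not arise for
a nonempty node and a test whose layer is not the last one. -/
def stepF (s : List (List Rec)) (z : Bits) (A : List (Rec × List Bits)) (τ : LinkTest) :
    List (Rec × List Bits) :=
  match (s.take (τ.1 + 1)).reverse with
  | [] => A
  | l :: ls => testF τ l ls z A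

def stepG (t : List (List Rec)) (c : Bits) (lev : ℕ) (z : Bits) (B : List (Rec × List Bits))
    (τ : LinkTest) : List (Rec × List Bits) :=
  match t.drop (τ.1 + 1) with
  | [] => B
  | l :: ls => testG τ l ls c lev z B

theorem take_reverse_eq {t : List (List Rec)} (t₀ : List Rec) (i : ℕ) :
    ∃ l ls, (((t₀ :: t).take (i + 1)).reverse = l :: ls) ∧
      ∀ h : l :: ls ≠ [], (l :: ls).getLast h = t₀ := by
  have hne : ((t₀ :: t).take (i + 1)).reverse ≠ [] := by simp
  obtain ⟨l, ls, h⟩ := List.exists_cons_of_ne_nil hne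
  refine ⟨l, ls, h, fun h' => ?_⟩
  simp only [← h]
  simp

theorem drop_eq {t : List (List Rec)} (i : ℕ) (hi : i + 1 < t.length) (ht : t ≠ []) :
    ∃ l ls, t.drop (i + 1) = l :: ls ∧ ∀ h : l :: ls ≠ [], (l :: ls).getLast h = t.getLast ht := by
  have hne : t.drop (i + 1) ≠ [] := by simpa using hi
  obtain ⟨l, ls, h⟩ := List.exists_cons_of_ne_nil hne
  refine ⟨l, ls, h, fun h' => ?_⟩
  simp only [← h]
  rw [List.getLast_drop]

theorem restrict_mem {c : Bits} {lev : ℕ} {t : List (List Rec)} {P : Rec → Prop}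
    (h : ∀ l ∈ t, ∀ r ∈ l, P r) : ∀ l ∈ restrict c lev t, ∀ r ∈ l, P r := by
  intro l hl r hr
  obtain ⟨l', hl', rfl⟩ := List.mem_map.1 hl
  exact h l' hl' r (List.mem_of_mem_filter hr)

/-- Induction on the tests from the right, because each step of the fold puts its coordinate in
front. The new coordinates are functions of the record alone, so they combine with whatever vectors
the records already carry. -/
theorem Good.tests_spec (hG : Good R w m k D ks) {t₀ : List Rec} {t : List (List Rec)}
    (hR : ∀ l ∈ t₀ :: t, ∀ r ∈ l, R r) (c : Bits) (lev : ℕ) (A B : List (Rec × List Bits))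
    (hA : A.map Prod.fst = t₀.filter fun r => decide (r.col lev = c))
    (hB : B.map Prod.fst = (t₀ :: t).getLast (by simp)) (tests : List LinkTest)
    (htests : ∀ τ ∈ tests, τ.1 + 1 < (t₀ :: t).length) :
    ∃ F G : Rec → List Bits,
      tests.foldl (stepF (restrict c lev (t₀ :: t)) (List.replicate w false)) A =
        A.map (fun a => (a.1, F a.1 ++ a.2)) ∧
      tests.foldl (stepG (t₀ :: t) c lev (List.replicate w false)) B =
        B.map (fun b => (b.1, G b.1 ++ b.2)) ∧
      (∀ a ∈ A, (F a.1).map List.length = List.replicate tests.length w) ∧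
      (∀ b ∈ B, (G b.1).map List.length = List.replicate tests.length w) ∧
      ∀ a ∈ A, ∀ b ∈ B, keysLE (F a.1 ++ a.2) (G b.1 ++ b.2) = true ↔
        (∀ τ ∈ tests, TestOK (t₀ :: t) c lev τ a.1 b.1) ∧ keysLE a.2 b.2 = true := by
  induction tests using List.reverseRecOn with
  | nil => exact ⟨fun _ => [], fun _ => [], by simp, by simp, by simp, by simp, by simp⟩
  | append_singleton tests τ ih =>
    obtain ⟨F, G, h1, h2, h3, h4, h5⟩ := ih fun τ hτ => htests τ (by simp [hτ])
    obtain ⟨l, ls, hl, hlast⟩ := take_reverse_eq (t := restrict c lev t)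
      (t₀.filter fun r => decide (r.col lev = c)) τ.1
    obtain ⟨l', ls', hl', hlast'⟩ := drop_eq τ.1 (htests τ (by simp)) (List.cons_ne_nil t₀ t)
    obtain ⟨f, h6, h7⟩ := hG.testF_spec (s := restrict c lev (t₀ :: t)) (restrict_mem hR) τ l ls hl
      (A.map fun a => (a.1, F a.1 ++ a.2)) (by
        rw [hlast, ← hA, List.map_map]; rfl)
    obtain ⟨g, h8, h9⟩ := hG.testG_spec hR τ l' ls' hl' c lev
      (B.map fun b => (b.1, G b.1 ++ b.2)) (by
        rw [hlast', ← hB, List.map_map]; rfl)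
    have hlF : ((restrict c lev (t₀ :: t)).take (τ.1 + 1)).reverse = l :: ls := hl
    simp only [List.forall_mem_map] at h7 h9
    refine ⟨fun r => f r :: F r, fun r => g r :: G r, ?_, ?_, ?_, ?_, ?_⟩
    · rw [List.foldl_append, h1]
      simp only [List.foldl_cons, List.foldl_nil, stepF, hlF]
      rw [h6, List.map_map]
      rfl
    · rw [List.foldl_append, h2]
      simp only [List.foldl_cons, List.foldl_nil, stepG, hl']
      rw [h8, List.map_map]
      rfl
    · intro a ha
      simp [h3 a ha, (h7 a ha).1, List.replicate_succ]
    · intro b hb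
      simp [h4 b hb, (h9 b hb).1, List.replicate_succ]
    · intro a ha b hb
      simp only [List.cons_append, keysLE, Bool.and_eq_true, decide_eq_true_eq, h5 a ha b hb]
      -- A maximum is at most a minimum iff every member of the first family is at most every member
      -- of the second one, which is `TestOK`.
      have h10 : f a.1 ≤ g b.1 ↔ TestOK (t₀ :: t) c lev τ a.1 b.1 := by
        rw [(h7 a ha).2 _ (h9 b hb).1]
        constructor
        · intro h p q hX hY hp hq hqb
          have hpR : R p := by
            obtain ⟨x, hx, hpx⟩ := hp.exists_mem_right
            exact restrict_mem hR x (List.mem_of_mem_take hx) p hpx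
          exact ((h9 b hb).2 _ (by rw [length_val, hG.y_len p hpR])).1 (h p hX hY hp) q hq hqb
        · intro h p hX hY hp
          have hpR : R p := by
            obtain ⟨x, hx, hpx⟩ := hp.exists_mem_right
            exact restrict_mem hR x (List.mem_of_mem_take hx) p hpx
          exact ((h9 b hb).2 _ (by rw [length_val, hG.y_len p hpR])).2
            fun q hq hqb => h p q hX hY hp hq hqb
      rw [h10]
      simp only [List.mem_append, List.mem_singleton]
      constructor
      · rintro ⟨h11, h12, h13⟩
        refine ⟨?_, h13⟩
        rintro σ (hσ | rfl)
        · exact h12 σ hσ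
        · exact h11
      · rintro ⟨h11, h12⟩
        exact ⟨h11 τ (Or.inr rfl), fun σ hσ => h11 σ (Or.inl hσ), h12⟩

/-- Is there a pair whose vectors are in the dominance relation, but that is not joined by a
chain? -/
def BadPair (t : List (List Rec)) (A B : List (Rec × List Bits)) : Prop :=
  ∃ a ∈ A, ∃ b ∈ B, keysLE a.2 b.2 = true ∧ ¬ Con t a.1 b.1

/-- One step of the search. -/
theorem Good.badPair_iff (hG : Good R w m k D ks) {t₀ : List Rec} {t : List (List Rec)}
    (hR : ∀ l ∈ t₀ :: t, ∀ r ∈ l, R r) {lev : ℕ} (hlev : lev < D) {pre : List Bits}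
    (hpre : ∀ l ∈ t₀ :: t, ∀ r ∈ l, r.xs.take lev = pre) {tests : List LinkTest}
    (htests : ∀ τ : LinkTest, τ ∈ tests ↔ τ.1 + 1 < (t₀ :: t).length ∧ τ.2.1 < m ∧ τ.2.2.1 < m)
    {c : Bits} {A B : List (Rec × List Bits)} {F G : Rec → List Bits}
    (hFG : ∀ a ∈ A.filter (fun a => decide (a.1.col lev = c)), ∀ b ∈ B,
      keysLE (F a.1 ++ a.2) (G b.1 ++ b.2) = true ↔
        (∀ τ ∈ tests, TestOK (t₀ :: t) c lev τ a.1 b.1) ∧ keysLE a.2 b.2 = true) :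
    BadPair (t₀ :: t) A B ↔
      (∃ b ∈ (B.map fun b => (b.1, G b.1 ++ b.2)).filter (fun b => !decide (b.1.col lev = c)),
        ∃ a ∈ (A.filter fun a => decide (a.1.col lev = c)).map fun a => (a.1, F a.1 ++ a.2),
        keysLE a.2 b.2 = true) ∨
      BadPair (restrict c lev (t₀ :: t))
        ((A.filter fun a => decide (a.1.col lev = c)).map fun a => (a.1, F a.1 ++ a.2))
        ((B.map fun b => (b.1, G b.1 ++ b.2)).filter fun b => decide (b.1.col lev = c)) ∨
      BadPair (t₀ :: t) (A.filter fun a => !decide (a.1.col lev = c)) B := by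
  -- For `a` in column `c`, extending the vectors trades the absence of a chain in the node for the
  -- absence of a chain in the child.
  have key : ∀ a ∈ A, a.1.col lev = c → ∀ b ∈ B, (keysLE a.2 b.2 = true ∧ ¬ Con (t₀ :: t) a.1 b.1 ↔
      keysLE (F a.1 ++ a.2) (G b.1 ++ b.2) = true ∧ ¬ Con (restrict c lev (t₀ :: t)) a.1 b.1) := by
    intro a ha hac b hb
    rw [hFG a (by simp [ha, hac]) b hb, hG.not_con_iff hR hlev hpre htests hac]
    tauto
  -- A chain in the child ends in the child, so for `b` outside the column dominance alone decides.
  have hout : ∀ a b : Rec, Con (restrict c lev (t₀ :: t)) a b → b.col lev = c := by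
    intro a b h
    obtain ⟨l, hl, hb⟩ := h.exists_mem_right
    obtain ⟨l', hl', rfl⟩ := List.mem_map.1 hl
    simpa using (List.mem_filter.1 hb).2
  constructor
  · rintro ⟨a, ha, b, hb, h⟩
    by_cases hac : a.1.col lev = c
    · have h' := (key a ha hac b hb).1 h
      have ham : (a.1, F a.1 ++ a.2) ∈ (A.filter fun a => decide (a.1.col lev = c)).map
          fun a => (a.1, F a.1 ++ a.2) := List.mem_map.2 ⟨a, by simp [ha, hac], rfl⟩
      have hbm : (b.1, G b.1 ++ b.2) ∈ B.map fun b => (b.1, G b.1 ++ b.2) :=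
        List.mem_map.2 ⟨b, hb, rfl⟩
      by_cases hbc : b.1.col lev = c
      · exact Or.inr (Or.inl ⟨_, ham, _, List.mem_filter.2 ⟨hbm, by simpa using hbc⟩, h'⟩)
      · exact Or.inl ⟨_, List.mem_filter.2 ⟨hbm, by simpa using hbc⟩, _, ham, h'.1⟩
    · exact Or.inr (Or.inr ⟨a, by simp [ha, hac], b, hb, h⟩)
  · rintro (⟨b, hb, a, ha, h⟩ | ⟨a, ha, b, hb, h⟩ | ⟨a, ha, b, hb, h⟩)
    · obtain ⟨hb, hbc⟩ := List.mem_filter.1 hb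
      obtain ⟨b, hb', rfl⟩ := List.mem_map.1 hb
      obtain ⟨a, ha', rfl⟩ := List.mem_map.1 ha
      obtain ⟨ha, hac⟩ := List.mem_filter.1 ha'
      simp only [Bool.not_eq_true', decide_eq_false_iff_not, decide_eq_true_eq] at hbc hac
      exact ⟨a, ha, b, hb', (key a ha hac b hb').2 ⟨h, fun hc => hbc (hout _ _ hc)⟩⟩
    · obtain ⟨hb, hbc⟩ := List.mem_filter.1 hb
      obtain ⟨b, hb', rfl⟩ := List.mem_map.1 hb
      obtain ⟨a, ha', rfl⟩ := List.mem_map.1 ha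
      obtain ⟨ha, hac⟩ := List.mem_filter.1 ha'
      simp only [decide_eq_true_eq] at hac
      exact ⟨a, ha, b, hb', (key a ha hac b hb').2 h⟩
    · exact ⟨a, List.mem_of_mem_filter ha, b, hb, h⟩

/-! ### Evaluation of the search -/

/-- The total number of records of a node. -/
def tot (t : List (List Rec)) : ℕ := (t.map List.length).sum

/-- The number of records of a node in given columns. -/
def cnt (S : Finset Bits) (lev : ℕ) (t : List (List Rec)) : ℕ :=
  (t.map fun l => (l.filter fun r => decide (r.col lev ∈ S)).length).sum

theorem cnt_le_tot (S : Finset Bits) (lev : ℕ) (t : List (List Rec)) : cnt S lev t ≤ tot t :=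
  List.sum_le_sum fun l _ => List.length_filter_le _ l

theorem length_le_tot {l : List Rec} {t : List (List Rec)} (h : l ∈ t) : l.length ≤ tot t :=
  List.le_sum_of_mem (List.mem_map_of_mem h)

/-- Treating column `c` moves its records from the columns still to come to the child. The cost of
the child is charged to exactly these records. -/
theorem cnt_erase {S : Finset Bits} {c : Bits} (hc : c ∈ S) (lev : ℕ) (t : List (List Rec)) :
    cnt S lev t = cnt (S.erase c) lev t + tot (restrict c lev t) := by
  have h : ∀ l : List Rec, (l.filter fun r => decide (r.col lev ∈ S)).length =
      (l.filter fun r => decide (r.col lev ∈ S.erase c)).length +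
        (l.filter fun r => decide (r.col lev = c)).length := by
    intro l
    induction l with
    | nil => rfl
    | cons r l ih =>
      by_cases h1 : r.col lev = c
      · simp [h1, hc] at ih ⊢; omega
      · by_cases h2 : r.col lev ∈ S
        · simp [h1, h2] at ih ⊢; omega
        · simp [h1, h2] at ih ⊢; omega
  simp only [cnt, tot, restrict, List.map_map, Function.comp_def]
  rw [← List.sum_map_add]
  congr 1
  exact List.map_congr_left fun l _ => h l

/-- The strings of length at most `k`. -/
def strs : ℕ → Finset Bits
  | 0 => {[]}
  | k + 1 => insert [] ((strs k).image (List.cons true) ∪ (strs k).image (List.cons false))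

theorem mem_strs {k : ℕ} {u : Bits} (h : u.length ≤ k) : u ∈ strs k := by
  induction k generalizing u with
  | zero => simp [strs, List.length_eq_zero_iff.1 (Nat.le_zero.1 h)]
  | succ k ih =>
    cases u with
    | nil => simp [strs]
    | cons b u =>
      have := ih (u := u) (by simpa using h)
      cases b <;> simp [strs, this]

theorem card_strs (k : ℕ) : (strs k).card + 1 ≤ 2 ^ (k + 1) := by
  induction k with
  | zero => simp [strs]
  | succ k ih =>
    have h1 := Finset.card_insert_le ([] : Bits)
      ((strs k).image (List.cons true) ∪ (strs k).image (List.cons false))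
    have h2 := Finset.card_union_le ((strs k).image (List.cons true))
      ((strs k).image (List.cons false))
    have h3 := Finset.card_image_le (s := strs k) (f := List.cons true)
    have h4 := Finset.card_image_le (s := strs k) (f := List.cons false)
    rw [pow_succ]
    simp only [strs]
    omega

theorem domG_replicate_mono {a b w : ℕ} (h : a ≤ b) :
    domG (List.replicate a w) ≤ domG (List.replicate b w) := by
  induction h with
  | refl => exact le_rfl
  | @step b _ ih =>
    rw [List.replicate_succ]
    refine ih.trans ?_
    change _ ≤ (w + 1) * (domG (List.replicate b w) + 1)
    nlinarith [Nat.zero_le (w * (domG (List.replicate b w) + 1))]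

/-- The costs of a step of the search, per record. -/
def costF (V n₁ : ℕ) (ks : List ℕ) : ℕ := n₁ * (2 * propK V ks + 61) + 30 * n₁ + 10 * V + 270
def costG (V n₁ D : ℕ) (ks : List ℕ) : ℕ :=
  n₁ * (2 * propK V ks + 61) + 30 * n₁ + 80 * V + 15 * D + 600
def costStep (V n₁ D H w : ℕ) (ks : List ℕ) : ℕ :=
  1000 + 15 * D + 4 * (15 * D + 60 * V + 150) + n₁ * (15 * D + 60 * V + 200) +
    H * (costF V n₁ ks + costG V n₁ D ks + 20) +
    2 * (1000 * domG (List.replicate (H * D) w) + 50)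

section procedures

variable {I : Input} {R : Rec → Prop} {w m k D : ℕ} {ks : List ℕ}

theorem Good.ev_foldF (hG : Good R w m k D ks) {t₀ : List Rec} {t : List (List Rec)}
    (hR : ∀ l ∈ t₀ :: t, ∀ r ∈ l, R r) (c : Bits) (lev : ℕ) (A : List (Rec × List Bits))
    (hA : A.map Prod.fst = t₀.filter fun r => decide (r.col lev = c)) (tests : List LinkTest)
    (htests : ∀ τ ∈ tests, τ.1 + 1 < (t₀ :: t).length) (V M : ℕ) (hV : w ≤ V)
    (hM : tot (t₀ :: t) ≤ M) (hM1 : 1 ≤ M) (e₀ e₁ e₂ e₃ e₄ e₇ e₈ e₉ : Val) :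
    Ev procs I [e₀, e₁, e₂, e₃, e₄, enc tests, enc (List.replicate w false), e₇, e₈, enc A, e₉,
      enc (restrict c lev (t₀ :: t))] (.fold (.v 5) (.v 9) (.call iTestF [13, 11, 6, 12]))
      (enc (tests.foldl (stepF (restrict c lev (t₀ :: t)) (List.replicate w false)) A))
      (tests.length * (M * costF V (t₀ :: t).length ks + 6) + 3) := by
  refine (Ev.foldP (l := tests)
    (fun l₁ => enc (l₁.foldl (stepF (restrict c lev (t₀ :: t)) (List.replicate w false)) A))
    (fun _ => M * costF V (t₀ :: t).length ks + 5) (Ev.v rfl) (Ev.v rfl)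
    fun l₁ τ l₂ h => ?_).mono (by rw [sum_map_const, Nat.add_assoc (M * _)]; omega)
  -- Only the vectors of the first layer are wanted here; the other side is fed with empty vectors.
  obtain ⟨F, -, h1, -⟩ := hG.tests_spec hR c lev A
    (((t₀ :: t).getLast (by simp)).map fun r => (r, [])) hA (by simp [Function.comp_def]) l₁
    fun τ hτ => htests τ (by simp [h, hτ])
  obtain ⟨l, ls, hl, hlast⟩ := take_reverse_eq (t := restrict c lev t)
    (t₀.filter fun r => decide (r.col lev = c)) τ.1
  have hτ := htests τ (by simp [h])
  rw [List.foldl_append, h1]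
  have hs : (l₁ ++ [τ]).length = l₁.length + 1 := by simp
  have hlF : ((restrict c lev (t₀ :: t)).take (τ.1 + 1)).reverse = l :: ls := hl
  simp only [List.foldl_cons, List.foldl_nil, stepF, hlF]
  have hR' : ∀ x ∈ restrict c lev (t₀ :: t), ∀ r ∈ x, R r := restrict_mem hR
  have hN : ∀ x ∈ restrict c lev (t₀ :: t), x.length ≤ M := by
    intro x hx
    obtain ⟨x', hx', rfl⟩ := List.mem_map.1 hx
    exact (List.length_filter_le _ _).trans ((length_le_tot hx').trans hM)
  have hcall := ev_testF (I := I) V M ks τ (restrict c lev (t₀ :: t)) (List.replicate w false)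
    (A.map fun a => (a.1, F a.1 ++ a.2)) l ls hl (fun x hx r hr => hG.shape r (hR' x hx r hr))
    (fun x hx r hr => (hG.y_len r (hR' x hx r hr)).trans_le hV) hN (by
      rw [hlast, ← hA]; simp)
  refine (Ev.call (p := iTestF) (xs := [13, 11, 6, 12]) rfl rfl rfl hcall).mono ?_
  have h2 : (restrict c lev (t₀ :: t)).length = (t₀ :: t).length := by simp [restrict]
  rw [h2]
  generalize (t₀ :: t).length = n at hτ ⊢
  have h3 : n * (2 * M * propK V ks + 61) ≤ M * (n * (2 * propK V ks + 61)) := by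
    have : 2 * M * propK V ks + 61 ≤ M * (2 * propK V ks + 61) := by nlinarith
    calc _ ≤ n * (M * (2 * propK V ks + 61)) := Nat.mul_le_mul_left _ this
      _ = _ := by ring
  have h4 : 30 * τ.1 + 150 ≤ M * (30 * n + 150) :=
    le_trans (by omega) (Nat.le_mul_of_pos_left _ hM1)
  have h5 : M * costF V n ks = M * (n * (2 * propK V ks + 61)) + M * (30 * n + 150) +
    M * (10 * V + 120) := by unfold costF; ring
  simp only [List.length_cons, List.length_nil]
  omega

theorem Good.ev_foldG (hG : Good R w m k D ks) {t₀ : List Rec} {t : List (List Rec)}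
    (hR : ∀ l ∈ t₀ :: t, ∀ r ∈ l, R r) (c : Bits) {lev : ℕ} (hlev : lev < D)
    (B : List (Rec × List Bits)) (hB : B.map Prod.fst = (t₀ :: t).getLast (by simp))
    (tests : List LinkTest) (htests : ∀ τ ∈ tests, τ.1 + 1 < (t₀ :: t).length) (V M : ℕ)
    (hV : w ≤ V) (hV' : k ≤ V) (hc : c.length = k)
    (hM : tot (t₀ :: t) ≤ M) (hM1 : 1 ≤ M) (e₂ e₄ e₇ e₉ e₁₀ e₁₁ e₁₂ : Val) :
    Ev procs I [enc lev, enc (t₀ :: t), e₂, enc B, e₄, enc tests, enc (List.replicate w false), e₇,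
      enc c, e₉, e₁₀, e₁₁, e₁₂] (.fold (.v 5) (.v 3) (.call iTestG [14, 1, 8, 0, 6, 13]))
      (enc (tests.foldl (stepG (t₀ :: t) c lev (List.replicate w false)) B))
      (tests.length * (M * costG V (t₀ :: t).length D ks + 8) + 3) := by
  refine (Ev.foldP (l := tests)
    (fun l₁ => enc (l₁.foldl (stepG (t₀ :: t) c lev (List.replicate w false)) B))
    (fun _ => M * costG V (t₀ :: t).length D ks + 7) (Ev.v rfl) (Ev.v rfl)
    fun l₁ τ l₂ h => ?_).mono (by rw [sum_map_const, Nat.add_assoc (M * _)]; omega)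
  obtain ⟨-, G, -, h1, -⟩ := hG.tests_spec hR c lev
    ((t₀.filter fun r : Rec => decide (r.col lev = c)).map fun r => ((r, []) : Rec × List Bits)) B
    (by simp [Function.comp_def]) hB l₁ fun τ hτ => htests τ (by simp [h, hτ])
  have hτ := htests τ (by simp [h])
  obtain ⟨l, ls, hl, hlast⟩ := drop_eq τ.1 hτ (List.cons_ne_nil t₀ t)
  rw [List.foldl_append, h1]
  simp only [List.foldl_cons, List.foldl_nil, stepG, hl]
  have hcall := ev_testG (I := I) V M ks τ (t₀ :: t) c lev (List.replicate w false)
    (B.map fun b => (b.1, G b.1 ++ b.2)) l ls hl (fun x hx r hr => hG.shape r (hR x hx r hr))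
    (fun x hx r hr => (hG.y_len r (hR x hx r hr)).trans_le hV)
    (fun x hx => (length_le_tot hx).trans hM) (by rw [hlast, ← hB]; simp)
    (fun x hx r hr => by rw [hG.xs_len r (hR x hx r hr)]; exact hlev) (hc.trans_le hV')
    (fun x hx r hr => (hG.col_len (hR x hx r hr) hlev).trans_le hV') (by simpa using hV)
  refine (Ev.call (p := iTestG) (xs := [14, 1, 8, 0, 6, 13]) rfl rfl rfl hcall).mono ?_
  generalize (t₀ :: t).length = n at hτ ⊢
  have h3 : n * (2 * M * propK V ks + 61) ≤ M * (n * (2 * propK V ks + 61)) := by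
    have : 2 * M * propK V ks + 61 ≤ M * (2 * propK V ks + 61) := by nlinarith
    calc _ ≤ n * (M * (2 * propK V ks + 61)) := Nat.mul_le_mul_left _ this
      _ = _ := by ring
  have h4 : 30 * τ.1 + 150 ≤ M * (30 * n + 150) :=
    le_trans (by omega) (Nat.le_mul_of_pos_left _ hM1)
  have h6 : M * (80 * V + 15 * lev + 450) ≤ M * (80 * V + 15 * D + 450) :=
    Nat.mul_le_mul_left _ (by omega)
  have h5 : M * costG V n D ks = M * (n * (2 * propK V ks + 61)) + M * (30 * n + 150) +
    M * (80 * V + 15 * D + 450) := by unfold costG; ring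
  simp only [List.length_cons, List.length_nil]
  omega

/-- The arithmetic of one step of the search. The work on one column is at most `W` per record of
the node. The child, with `ms` records, is paid by its own records, and the other `S - 1` columns by
the rest of the budget. `X` stands for the cost of comparing a column and `M` for the size of the
node. -/
theorem ev_tree_bound (a b a' b' n M H X D lev cF cG cC cN P d cs ms S : ℕ) (hM : 1 ≤ M)
    (ha : a ≤ M) (hb : b ≤ M) (ha' : a' ≤ M) (hb' : b' ≤ M) (hlev : lev < D) (hS : 1 ≤ S)
    (hcs : cs ≤ ms) {W child rest : ℕ} (hchild : child ≤ P * ms + P * d * cs + 10)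
    (hrest : rest ≤ W * (S - 1) * M + P * (d + 1) * cN + 10)
    (hW : W = 1000 + 15 * D + 4 * X + n * (X + 50) + H * (cF + cG + 20) + 2 * cC) :
    2 * (a * X) + 2 * (b * X) + n * (M * X + 21) + H * (M * cF + 6) + H * (M * cG + 8) +
      (a' + b') * cC + 15 * lev + child + rest + 600 ≤
      W * S * M + P * (d + 1) * (cN + ms) + 10 := by
  have f1 : a * X ≤ M * X := Nat.mul_le_mul_right _ ha
  have f2 : b * X ≤ M * X := Nat.mul_le_mul_right _ hb
  have f3 : n * (M * X + 21) ≤ M * (n * (X + 50)) := by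
    calc _ ≤ n * (M * (X + 50)) := Nat.mul_le_mul_left _ (by nlinarith)
      _ = _ := by ring
  have f4 : H * (M * cF + 6) + H * (M * cG + 8) ≤ M * (H * (cF + cG + 20)) := by
    calc _ = H * (M * cF + M * cG + 14) := by ring
      _ ≤ H * (M * (cF + cG + 20)) := Nat.mul_le_mul_left _ (by nlinarith)
      _ = _ := by ring
  have f5 : (a' + b') * cC ≤ M * (2 * cC) := by
    calc _ ≤ (M + M) * cC := Nat.mul_le_mul_right _ (by omega)
      _ = _ := by ring
  have f6 : 15 * lev + 1000 ≤ M * (1000 + 15 * D) :=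
    le_trans (by omega) (Nat.le_mul_of_pos_left _ hM)
  have f7 : M * W = M * (1000 + 15 * D) + 4 * (M * X) + M * (n * (X + 50)) +
    M * (H * (cF + cG + 20)) + M * (2 * cC) := by rw [hW]; ring
  have f8 : W * S * M = W * (S - 1) * M + M * W := by
    obtain ⟨S, rfl⟩ : ∃ S', S = S' + 1 := ⟨S - 1, by omega⟩
    simp only [Nat.add_sub_cancel]; ring
  have f9 : P * d * cs ≤ P * d * ms := Nat.mul_le_mul_left _ hcs
  have f10 : P * (d + 1) * (cN + ms) = P * (d + 1) * cN + (P * ms + P * d * ms) := by ring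
  omega

set_option maxHeartbeats 1600000 in
-- Induction on the number `d` of levels left and, within a node, on the number of columns `S` still
-- to be treated. A call pays `costStep` per record of the node for each of these columns. The
-- children are disjoint, and each of them pays for at most `2 ^ (k + 1)` columns per level, so the
-- levels below cost `costStep * 2 ^ (k + 1)` per level for every record in a column of `S`.
theorem Good.ev_tree (hG : Good R w m k D ks) (n : ℕ) (tests : List LinkTest)
    (htests : ∀ τ : LinkTest, τ ∈ tests ↔ τ.1 + 1 < n ∧ τ.2.1 < m ∧ τ.2.2.1 < m) (V : ℕ)
    (hV : w ≤ V) (hV' : k ≤ V) (d : ℕ) : ∀ (lev : ℕ), lev + d = D →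
    ∀ (t₀ : List Rec) (t : List (List Rec)), (t₀ :: t).length = n →
    (∀ l ∈ t₀ :: t, ∀ r ∈ l, R r) → ∀ pre : List Bits,
    (∀ l ∈ t₀ :: t, ∀ r ∈ l, r.xs.take lev = pre) →
    (∀ a ∈ t₀, ∀ b ∈ (t₀ :: t).getLast (by simp), a ≠ b) → ∀ B : List (Rec × List Bits),
    B.map Prod.fst = (t₀ :: t).getLast (by simp) →
    (∀ b ∈ B, b.2.map List.length = List.replicate (tests.length * lev) w) →
    ∀ (s : ℕ) (S : Finset Bits), S.card = s → ∀ A : List (Rec × List Bits),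
    (A.map Prod.fst = t₀.filter fun r => decide (r.col lev ∈ S)) →
    (∀ a ∈ A, a.2.map List.length = List.replicate (tests.length * lev) w) →
    ∀ z : Bool, (z = true ↔ BadPair (t₀ :: t) A B) →
    Ev procs I [enc lev, enc (t₀ :: t), enc A, enc B, enc D, enc tests,
      enc (List.replicate w false)] pTree.body (enc z)
      (costStep V n D tests.length w ks * s * tot (t₀ :: t) +
        costStep V n D tests.length w ks * 2 ^ (k + 1) * d * cnt S lev (t₀ :: t) + 10) := by
  have hnil : ∀ (t : List (List Rec)) (A B : List (Rec × List Bits)), A = [] → ¬ BadPair t A B := by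
    rintro t A B rfl ⟨a, ha, -⟩
    simp at ha
  induction d with
  | zero =>
    intro lev hd t₀ t hn hR pre hpre hdis B hB hBs s S hs A hA hAs z hz
    -- At the bottom all records of the node have the same chunks, so by injectivity there is only
    -- one record. But the first and the last layer have no record in common.
    have hz' : z = false := by
      rw [← Bool.not_eq_true, hz]
      rintro ⟨a, ha, b, hb, -⟩
      have ha' : a.1 ∈ t₀ := by
        have := List.mem_map_of_mem (f := Prod.fst) ha
        rw [hA] at this
        exact List.mem_of_mem_filter this
      have hb' := List.mem_map_of_mem (f := Prod.fst) hb
      rw [hB] at hb'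
      have hl := List.getLast_mem (List.cons_ne_nil t₀ t)
      have h1 := hR t₀ (by simp) a.1 ha'
      have h2 := hR _ hl b.1 hb'
      refine hdis a.1 ha' b.1 hb' (hG.xs_inj _ _ h1 h2 ?_)
      have h3 := hpre t₀ (by simp) a.1 ha'
      have h4 := hpre _ hl b.1 hb'
      rw [List.take_of_length_le (by rw [hG.xs_len _ h1]; omega)] at h3
      rw [List.take_of_length_le (by rw [hG.xs_len _ h2]; omega)] at h4
      rw [h3, h4]
    subst hz'
    refine (Ev.ifL (U := 5) (Ev.v (x := enc A) rfl) (fun _ => Ev.ff.mono (by omega)) fun _ _ _ =>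
      Ev.ifB (Ev.lt (Ev.v (x := enc lev) rfl) (Ev.v (x := enc D) rfl)) (fun _ => Ev.ff)
        fun h => ?_).mono (by omega)
    rw [decide_eq_true_eq] at h
    omega
  | succ d ihd =>
    intro lev hd t₀ t hn hR pre hpre hdis B hB hBs s
    have hlev : lev < D := by omega
    induction s with
    | zero =>
      intro S hs A hA hAs z hz
      have hA0 : A = [] := by
        rw [Finset.card_eq_zero] at hs
        subst hs
        simpa using hA
      have hz' : z = false := by
        rw [← Bool.not_eq_true, hz]; exact hnil _ _ _ hA0
      subst hA0 hz'
      exact (Ev.ifL (U := 1) (Ev.v (x := enc ([] : List (Rec × List Bits))) rfl) (fun _ => Ev.ff)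
        (by simp)).mono (by omega)
    | succ s ihs =>
      intro S hs A hA hAs z hz
      rcases A with _ | ⟨a₀, A₀⟩
      · have hz' : z = false := by
          rw [← Bool.not_eq_true, hz]; exact hnil _ _ _ rfl
        subst hz'
        exact (Ev.ifL (U := 1) (Ev.v (x := enc ([] : List (Rec × List Bits))) rfl) (fun _ => Ev.ff)
          (by simp)).mono (by omega)
      set A := a₀ :: A₀ with hAdef
      set c := a₀.1.col lev with hc
      set T := t₀ :: t with hT
      set s₀ := t₀.filter (fun r => decide (r.col lev = c)) with hs₀
      have hmemA : ∀ a ∈ A, a.1 ∈ t₀ ∧ a.1.col lev ∈ S := by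
        intro a ha
        have := List.mem_map_of_mem (f := Prod.fst) ha
        rw [hA] at this
        simpa using this
      have hmemB : ∀ b ∈ B, ∃ l ∈ T, b.1 ∈ l := by
        intro b hb
        have := List.mem_map_of_mem (f := Prod.fst) hb
        rw [hB] at this
        exact ⟨_, List.getLast_mem _, this⟩
      have hRA : ∀ a ∈ A, R a.1 := fun a ha => hR t₀ (by simp [hT]) _ (hmemA a ha).1
      have hRB : ∀ b ∈ B, R b.1 := fun b hb => by
        obtain ⟨l, hl, h⟩ := hmemB b hb
        exact hR l hl _ h
      have hcS : c ∈ S := (hmemA a₀ (by simp [hAdef])).2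
      have hclen : c.length = k := hG.col_len (hRA a₀ (by simp [hAdef])) hlev
      set M := tot T with hM
      have hlast : T.getLast (by simp [hT]) ∈ T := List.getLast_mem _
      have hAM : A.length ≤ M := by
        have h1 := congrArg List.length hA
        rw [List.length_map] at h1
        rw [h1]
        exact (List.length_filter_le _ _).trans (length_le_tot (by simp [hT]))
      have hBM : B.length ≤ M := by
        have h1 := congrArg List.length hB
        rw [List.length_map] at h1
        rw [h1]
        exact length_le_tot hlast
      have hM1 : 1 ≤ M := le_trans (by simp [hAdef]) hAM
      set Ac := A.filter (fun a => decide (a.1.col lev = c)) with hAc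
      set Ao := A.filter (fun a => !decide (a.1.col lev = c)) with hAo
      have hAcf : Ac.map Prod.fst = s₀ := by
        have h1 : Ac.map Prod.fst = (A.map Prod.fst).filter fun r => decide (r.col lev = c) := by
          rw [List.filter_map]; rfl
        rw [h1, hA, List.filter_filter, hs₀]
        refine List.filter_congr fun r _ => ?_
        by_cases h : r.col lev = c <;> simp [h, hcS]
      have hAof : Ao.map Prod.fst = t₀.filter fun r => decide (r.col lev ∈ S.erase c) := by
        have h1 : Ao.map Prod.fst = (A.map Prod.fst).filter fun r => !decide (r.col lev = c) := by
          rw [List.filter_map]; rfl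
        rw [h1, hA, List.filter_filter]
        refine List.filter_congr fun r _ => ?_
        by_cases h : r.col lev = c <;> simp [h]
      have htests' : ∀ τ ∈ tests, τ.1 + 1 < T.length := fun τ hτ => by
        rw [hn]; exact ((htests τ).1 hτ).1
      obtain ⟨F, G, hF, hGG, hFs, hGs, hFG⟩ := hG.tests_spec hR c lev Ac B hAcf hB tests htests'
      set A' := Ac.map (fun a => (a.1, F a.1 ++ a.2)) with hA'
      set B' := B.map (fun b => (b.1, G b.1 ++ b.2)) with hB'
      set Bo := B'.filter (fun b => !decide (b.1.col lev = c)) with hBo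
      set Bc := B'.filter (fun b => decide (b.1.col lev = c)) with hBc
      have hstep := hG.badPair_iff hR hlev hpre (tests := tests) (by rw [hn]; exact htests) hFG
      have shape' : ∀ u v : List Bits, u.map List.length = List.replicate tests.length w →
          v.map List.length = List.replicate (tests.length * lev) w →
          (u ++ v).map List.length = List.replicate (tests.length * (lev + 1)) w := by
        intro u v hu hv
        rw [List.map_append, hu, hv, ← List.replicate_add]
        congr 1
        ring
      have hA's : ∀ a ∈ A', a.2.map List.length = List.replicate (tests.length * (lev + 1)) w := by
        simp only [hA', List.forall_mem_map]
        exact fun a ha => shape' _ _ (hFs a ha) (hAs a (List.mem_of_mem_filter ha))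
      have hB's : ∀ b ∈ B', b.2.map List.length = List.replicate (tests.length * (lev + 1)) w := by
        simp only [hB', List.forall_mem_map]
        exact fun b hb => shape' _ _ (hGs b hb) (hBs b hb)
      have hA'f : A'.map Prod.fst = s₀ := by
        rw [hA', List.map_map, ← hAcf]; rfl
      have hBcf : Bc.map Prod.fst = (restrict c lev T).getLast (by simp [restrict, hT]) := by
        have h1 : Bc.map Prod.fst = (B'.map Prod.fst).filter fun r => decide (r.col lev = c) := by
          rw [List.filter_map]; rfl
        have h2 : B'.map Prod.fst = B.map Prod.fst := by rw [hB', List.map_map]; rfl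
        rw [h1, h2, hB]
        simp only [restrict]
        rw [List.getLast_map]
      have hres : restrict c lev T = s₀ :: restrict c lev t := rfl
      have hA'S : A'.map Prod.fst = s₀.filter fun r => decide (r.col (lev + 1) ∈ strs k) := by
        rw [hA'f, eq_comm, List.filter_eq_self]
        intro r hr
        have hr' := hR t₀ (by simp [hT]) r (List.mem_of_mem_filter hr)
        refine decide_eq_true (mem_strs ?_)
        rcases Nat.lt_or_ge (lev + 1) D with h | h
        · exact (hG.col_len hr' h).le
        -- Past the last chunk the column is the default value `[]`. This is why `strs k` also
        -- contains strings shorter than `k`.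
        · have : r.col (lev + 1) = [] := by
            have := hG.xs_len r hr'
            simp [Rec.col, List.getElem?_eq_none (l := r.xs) (i := lev + 1) (by omega)]
          simp [this]
      have hpre' : ∀ l ∈ restrict c lev T, ∀ r ∈ l, r.xs.take (lev + 1) = pre ++ [c] := by
        intro l hl r hr
        obtain ⟨l', hl', rfl⟩ := List.mem_map.1 hl
        obtain ⟨hr1, hr2⟩ := List.mem_filter.1 hr
        have hr3 : lev < r.xs.length := by rw [hG.xs_len r (hR l' hl' r hr1)]; exact hlev
        have h2 : r.col lev = r.xs[lev] := by simp [Rec.col, hr3]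
        rw [List.take_succ_eq_append_getElem hr3, hpre l' hl' r hr1, ← h2]
        simpa using hr2
      have hdis' : ∀ a ∈ s₀, ∀ b ∈ (s₀ :: restrict c lev t).getLast (by simp), a ≠ b := by
        intro a ha b hb
        have h1 := hdis a (List.mem_of_mem_filter ha)
        have h2 : (s₀ :: restrict c lev t).getLast (by simp) =
            (T.getLast (by simp [hT])).filter (fun r => decide (r.col lev = c)) := by
          exact List.getLast_map (f := fun l : List Rec => l.filter fun r => decide (r.col lev = c))
            (l := T) (by simp [hT])
        rw [h2] at hb
        exact h1 b (List.mem_of_mem_filter hb)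
      -- The induction hypotheses are stated for the Boolean that tells the truth about bad pairs,
      -- so they apply before it is known which of the calls is made.
      obtain ⟨zc, hzc⟩ : ∃ zc : Bool, zc = true ↔ BadPair (restrict c lev T) A' Bc :=
        ⟨@decide (BadPair (restrict c lev T) A' Bc) (Classical.dec _), by simp⟩
      obtain ⟨zo, hzo⟩ : ∃ zo : Bool, zo = true ↔ BadPair T Ao B :=
        ⟨@decide (BadPair T Ao B) (Classical.dec _), by simp⟩
      have echild := ihd (lev + 1) (by omega) s₀ (restrict c lev t)
        (by rw [← hres, ← hn]; simp [restrict]) (by rw [← hres]; exact restrict_mem hR) (pre ++ [c])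
        (by rw [← hres]; exact hpre') hdis' Bc hBcf
        (fun b hb => hB's b (List.mem_of_mem_filter hb)) _ (strs k) rfl A' hA'S hA's zc
        (by rw [← hres]; exact hzc)
      have erest := ihs (S.erase c) (by rw [Finset.card_erase_of_mem hcS, hs]; rfl) Ao hAof
        (fun a ha => hAs a (List.mem_of_mem_filter ha)) zo hzo
      rw [← hres] at echild
      set W := costStep V n D tests.length w ks with hW
      set X := 15 * D + 60 * V + 150 with hX
      set chk := Bo.any fun b => A'.any fun a => keysLE a.2 b.2 with hchk
      -- The three alternatives of `badPair_iff`: a pair found by the dominance check, a bad pair of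
      -- the child, a bad pair whose first record is in another column.
      have hz' : z = (chk || (zc || zo)) := by
        rw [Bool.eq_iff_iff, hz, hstep, Bool.or_eq_true, Bool.or_eq_true, hzc, hzo, hchk]
        simp only [List.any_eq_true]
        rfl
      rw [hz']
      have hxs : ∀ r, R r → lev < r.xs.length := fun r hr => by rw [hG.xs_len r hr]; exact hlev
      have hcl : ∀ r, R r → (r.col lev).length ≤ V := fun r hr =>
        (hG.col_len hr hlev).trans_le hV'
      have hRB' : ∀ b ∈ B', R b.1 := by simpa only [hB', List.forall_mem_map] using hRB
      have hcV : c.length ≤ V := hclen.trans_le hV'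
      have hB'l : B'.length = B.length := by rw [hB', List.length_map]
      have eK := ev_keep (I := I) c lev V A (fun a ha => hxs _ (hRA a ha)) hcV
        fun a ha => hcl _ (hRA a ha)
      have eO := ev_omit (I := I) c lev V A (fun a ha => hxs _ (hRA a ha)) hcV
        fun a ha => hcl _ (hRA a ha)
      have eK' := ev_keep (I := I) c lev V B' (fun a ha => hxs _ (hRB' a ha)) hcV
        fun a ha => hcl _ (hRB' a ha)
      have eO' := ev_omit (I := I) c lev V B' (fun a ha => hxs _ (hRB' a ha)) hcV
        fun a ha => hcl _ (hRB' a ha)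
      have eL : ∀ l ∈ T, Ev procs I [enc c, enc lev, enc l] pKeepRec.body
          (enc (l.filter fun r => decide (r.col lev = c))) (M * X + 10) := fun l hl =>
        (ev_keepRec c lev V l (fun r hr => hxs _ (hR l hl r hr)) hcV
          fun r hr => hcl _ (hR l hl r hr)).mono (Nat.add_le_add_right (Nat.mul_le_mul
            (length_le_tot hl) (by omega)) _)
      have eF := hG.ev_foldF (I := I) hR c lev Ac hAcf tests htests' V M hV le_rfl hM1
      rw [hF, hn] at eF
      have eG := hG.ev_foldG (I := I) hR c hlev B hB tests htests' V M hV hV' hclen le_rfl hM1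
      rw [hGG, hn] at eG
      have eC := ev_check (I := I) (tests.length * (lev + 1)) w A' Bo hA's
        fun b hb => hB's b (List.mem_of_mem_filter hb)
      have e0 : Ev procs I [enc lev, enc T, enc A, enc B, enc D, enc tests,
        enc (List.replicate w false)] (.car (.car (.v 2))) (enc a₀.1) 3 :=
        Ev.fst (Ev.head (x := a₀) (l := A₀) (Ev.v rfl))
      have eCol := ev_col (I := I) lev a₀.1 (hxs _ (hRA a₀ (by simp [hAdef])))
      have eMap : ∀ env : List Val, env.length = 11 → env[1]? = some (enc T) →
          env[8]? = some (enc c) → env[0]? = some (enc lev) →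
          Ev procs I env (mapE (.v 1) (.call iKeepRec [8, 0, 12])) (enc (restrict c lev T))
            (1 + n * (M * X + 14 + 7) + 4) := by
        intro env h1 h2 h3 h4
        rw [← hn]
        refine Ev.map (fun l : List Rec => l.filter fun r => decide (r.col lev = c)) (M * X + 14)
          (Ev.v h2) fun acc l hl => ?_
        refine (Ev.call (p := iKeepRec) (xs := [8, 0, 12]) rfl rfl ?_ (eL l hl)).mono le_rfl
        have h5 : (env ++ [acc, enc l])[8]? = some (enc c) := by
          rw [List.getElem?_append_left (by omega), h3]
        have h6 : (env ++ [acc, enc l])[0]? = some (enc lev) := by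
          rw [List.getElem?_append_left (by omega), h4]
        have h7 : (env ++ [acc, enc l])[12]? = some (enc l) := by
          rw [List.getElem?_append_right (by omega), h1]; rfl
        simp only [List.map_cons, List.map_nil, h5, h6, h7]
      generalize hcc : W * (strs k).card * tot (restrict c lev T) + W * 2 ^ (k + 1) * d *
        cnt (strs k) (lev + 1) (restrict c lev T) + 10 = cc at echild
      generalize hrc : W * s * M + W * 2 ^ (k + 1) * (d + 1) * cnt (S.erase c) lev T + 10 = rc
        at erest
      have hAne : A ≠ [] := by simp [hAdef]
      refine Ev.mono (T := 2 * (A.length * X) + 2 * (B.length * X) + n * (M * X + 21) +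
                tests.length * (M * costF V n ks + 6) + tests.length * (M * costG V n D ks + 8) +
                (A'.length + Bo.length) * (1000 * domG (List.replicate (tests.length * D) w) + 50) +
                15 * lev + cc + rc + 600) ?_ ?_
      refine (Ev.ifL (Ev.v (x := enc A) rfl) (fun h => absurd h hAne) fun _ _ _ =>
        Ev.ifB (Ev.lt (Ev.v (x := enc lev) rfl) (Ev.v (x := enc D) rfl))
          (fun h => absurd hlev (by simpa using h)) fun _ =>
        Ev.letE e0 <| Ev.letE (Ev.call (p := iCol) (xs := [0, 7]) rfl rfl rfl eCol) <|
        Ev.letE (Ev.call (p := iKeep) (xs := [8, 0, 2]) rfl rfl rfl eK) <|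
        Ev.letE (Ev.call (p := iOmit) (xs := [8, 0, 2]) rfl rfl rfl eO) <|
        Ev.letE (eMap _ rfl rfl rfl rfl) <|
        Ev.letE (eF _ _ _ _ _ _ _ _) <| Ev.letE (eG _ _ _ _ _ _ _) <|
        Ev.letE (Ev.call (p := iOmit) (xs := [8, 0, 13]) rfl rfl rfl eO') <|
        Ev.letE (Ev.call (p := iCheck) (xs := [12, 14]) rfl rfl rfl eC) <|
        Ev.ifB (z := chk) (U := B'.length * (15 * lev + 60 * V + 150) + cc + rc + 50) (Ev.v rfl)
          (fun h => ?_) (fun h => ?_)).mono ?_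
      · rw [h, Bool.false_or]
        refine (Ev.letE (Ev.call (p := iKeep) (xs := [8, 0, 13]) rfl rfl rfl eK') <|
          Ev.letE (Ev.succ (Ev.v rfl)) <|
          Ev.letE (Ev.call (p := iTree) (xs := [17, 11, 12, 16, 4, 5, 6]) rfl rfl rfl echild) <|
          Ev.ifB (z := zc) (U := rc + 8) (Ev.v rfl) (fun h2 => ?_) (fun h2 => ?_)).mono (by simp; omega)
        · rw [h2, Bool.false_or]
          exact Ev.call (p := iTree) (xs := [0, 1, 10, 3, 4, 5, 6]) rfl rfl rfl erest
        · rw [h2, Bool.true_or]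
          exact Ev.tt.mono (by omega)
      · rw [h, Bool.true_or]
        exact Ev.tt.mono (by omega)
      · have g1 : A.length * (15 * lev + 60 * V + 150) ≤ A.length * X :=
          Nat.mul_le_mul_left _ (by omega)
        have g2 : B.length * (15 * lev + 60 * V + 150) ≤ B.length * X :=
          Nat.mul_le_mul_left _ (by omega)
        have g3 : (A'.length + Bo.length) *
            (1000 * domG (List.replicate (tests.length * (lev + 1)) w) + 50) ≤
            (A'.length + Bo.length) * (1000 * domG (List.replicate (tests.length * D) w) + 50) :=
          Nat.mul_le_mul_left _ (Nat.add_le_add_right (Nat.mul_le_mul_left _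
            (domG_replicate_mono (Nat.mul_le_mul_left _ hlev))) _)
        have g4 : M * X + 14 + 7 = M * X + 21 := rfl
        simp only [List.length_cons, List.length_nil, hB'l, g4]
        omega
      · rw [cnt_erase hcS lev T, ← hcc, ← hrc]
        refine ev_tree_bound A.length B.length A'.length Bo.length n M tests.length X D lev
          (costF V n ks) (costG V n D ks) (1000 * domG (List.replicate (tests.length * D) w) + 50)
          (cnt (S.erase c) lev T) (W * 2 ^ (k + 1)) d
          (cnt (strs k) (lev + 1) (restrict c lev T)) (tot (restrict c lev T)) (s + 1) hM1 hAM hBM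
          ?_ ?_ hlev (by omega) (cnt_le_tot _ _ _) ?_ (by simp) ?_
        · rw [hA', List.length_map]
          exact (List.length_filter_le _ _).trans hAM
        · exact (List.length_filter_le _ _).trans (hB'l.trans_le hBM)
        · have := card_strs k
          have h1 : W * (strs k).card * tot (restrict c lev T) ≤
              W * 2 ^ (k + 1) * tot (restrict c lev T) :=
            Nat.mul_le_mul_right _ (Nat.mul_le_mul_left _ (by omega))
          omega
        · rw [hW, costStep, hX]

end procedures

/-! ### Brute force, and the construction of a record from its ranks. -/

theorem con_head_iff {l l' : List Rec} {ls : List (List Rec)} {a b : Rec} (h : a ∈ l ↔ a ∈ l') :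
    Con (l :: ls) a b ↔ Con (l' :: ls) a b := by
  cases ls with
  | nil => simp only [Con, h]
  | cons l₂ ls => simp only [Con, h]

/-- Is some record of the last layer not reached from `a`? -/
def missed (ls : List (List Rec)) (a : Rec) : Bool :=
  (propV [(a, [true])] ls).any fun x => x.2.isEmpty

/-- If the nonempty value `[true]` is propagated from `a` alone, the records of the last layer that
end up with the empty value are those not joined to `a`. -/
theorem missed_iff {l : List Rec} {ls : List (List Rec)} (hls : ls ≠ []) {a : Rec} (ha : a ∈ l) :
    missed ls a = true ↔ ∃ b ∈ ls.getLast hls, ¬ Con (l :: ls) a b := by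
  obtain ⟨g, h1, h2⟩ := propV_spec (fun _ => [true]) [a] ls
  have hlast : ([a] :: ls).getLast (by simp) = ls.getLast hls := List.getLast_cons hls
  rw [hlast] at h1 h2
  simp only [List.map_cons, List.map_nil] at h1
  simp only [missed, h1, List.any_map, List.any_eq_true, Function.comp_apply, List.isEmpty_iff]
  refine exists_congr fun b => and_congr_right fun hb => ?_
  have h3 := (h2 b hb).2 []
  have h4 : g b ≤ [] ↔ g b = [] :=
    ⟨fun h => le_antisymm h (nil_le_bits _), fun h => h ▸ le_rfl⟩
  have h5 : ¬ ([true] : Bits) ≤ [] := by simp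
  rw [← h4, h3, ← con_head_iff (l := [a]) (l' := l) (by simp [ha])]
  simp [h5]

section procedures

variable {I : Input}

theorem ev_brute (N : ℕ) (ks : List ℕ) (l : List Rec) (ls : List (List Rec))
    (hs : ∀ l' ∈ l :: ls, ∀ r ∈ l', r.Shape ks) (hN : ∀ l' ∈ l :: ls, l'.length ≤ N) :
    Ev procs I [enc l, enc ls] pBrute.body (enc (l.any (missed ls)))
      (N * (ls.length * (2 * N * propK 1 ks + 61) + 10 * N + 60) + 10) := by
  refine (Ev.any (missed ls) (ls.length * (2 * N * propK 1 ks + 61) + 10 * N + 40)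
    (Ev.v rfl) fun acc a ha => ?_).mono ?_
  · have hN1 : 1 ≤ N := (List.length_pos_of_mem ha).trans_le (hN l (by simp))
    have hp := ev_prop (I := I) 1 N ks [(a, [true])] ls (fun l' h => hs l' (by simp [h]))
      (by simpa using hs l (by simp) a ha) (by simp) (fun l' h => hN l' (by simp [h]))
      (by simpa using hN1)
    have hlen := (propV_inv 1 N ks [(a, [true])] ls (fun l' h => hs l' (by simp [h]))
      (by simpa using hs l (by simp) a ha) (by simp) (fun l' h => hN l' (by simp [h]))
      (by simpa using hN1)).2.2
    refine (Ev.ifB (U := ls.length * (2 * N * propK 1 ks + 61) + 10 * N + 30)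
      (Ev.v (x := enc acc) rfl) (fun h => ?_) (fun h => ?_)).mono (by omega)
    · rw [h, Bool.false_or]
      refine (Ev.letE (Ev.cons (x := ((a, [true]) : Rec × Bits)) (y := [])
        (Ev.prod (Ev.v rfl) (Ev.cons (x := true) (y := []) Ev.tt Ev.nil)) Ev.nil)
        (Ev.letE (Ev.call (p := iProp) (xs := [4, 1]) rfl rfl rfl hp)
        (Ev.any (fun x : Rec × Bits => x.2.isEmpty) 6 (Ev.v rfl) fun acc x hx => ?_))).mono ?_
      · refine (Ev.ifL (α := Bool) (l := x.2) (U := 1) (Ev.snd (x := x) Ev.ix0) (fun h => ?_)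
          (fun _ _ h => ?_)).mono (by omega)
        · rw [h, List.isEmpty_nil, Bool.or_true]; exact Ev.tt
        · rw [h, List.isEmpty_cons, Bool.or_false]; exact Ev.ix1
      · simp only [List.length_cons, List.length_nil]
        omega
    · rw [h]
      exact Ev.tt.mono (by omega)
  · have := hN l (by simp)
    have := Nat.mul_le_mul_right (ls.length * (2 * N * propK 1 ks + 61) + 10 * N + 41) this
    have e : N * (ls.length * (2 * N * propK 1 ks + 61) + 10 * N + 60) =
      N * (ls.length * (2 * N * propK 1 ks + 61) + 10 * N + 41) + N * 19 := by ring
    rw [e]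
    refine le_trans (Nat.add_le_add_right (Nat.add_le_add_left this 1) 2) (by omega)

/-- The keys of one axis, as a query and as a datum. -/
def axis (m X : ℕ) (u : Bits) : (Bits × Bits) × Bits × Bits :=
  ((unary m (X + 2) ++ u, compl (unary m X ++ u)),
    (unary m (X + 1) ++ u, compl (unary m (X + 1) ++ u)))

theorem ev_axis (m X : ℕ) (u : Bits) :
    Ev procs I [enc m, enc X, enc u] pAxis.body (enc (axis m X u))
      (150 * m + 30 * u.length + 150) := by
  refine (Ev.letE (Ev.succ (Ev.v (x := enc X) rfl)) (Ev.letE (Ev.succ (Ev.v (x := enc (X + 1)) rfl))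
    (Ev.letE (Ev.call (p := iUnary) (xs := [0, 3]) rfl rfl rfl (ev_unary m (X + 1)))
    (Ev.letE (Ev.append (x := unary m (X + 1)) (y := u) (Ev.v rfl) (Ev.v rfl))
    (Ev.letE (Ev.call (p := iUnary) (xs := [0, 4]) rfl rfl rfl (ev_unary m (X + 2)))
    (Ev.letE (Ev.append (x := unary m (X + 2)) (y := u) (Ev.v rfl) (Ev.v rfl))
    (Ev.letE (Ev.call (p := iUnary) (xs := [0, 1]) rfl rfl rfl (ev_unary m X))
    (Ev.letE (Ev.append (x := unary m X) (y := u) (Ev.v rfl) (Ev.v rfl))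
    (Ev.prod (x := (unary m (X + 2) ++ u, compl (unary m X ++ u)))
      (y := (unary m (X + 1) ++ u, compl (unary m (X + 1) ++ u)))
      (Ev.prod (Ev.v rfl) (Ev.compl (Ev.v rfl))) (Ev.prod (Ev.v rfl)
        (Ev.compl (Ev.v rfl)))))))))))).mono ?_
  simp only [List.length_append, length_unary, List.length_cons, List.length_nil]
  omega

/-- Fractional part and cell in the first coordinate, layer, cell and fractional part in the second
coordinate. -/
abbrev Item := ℝ × ℕ × ℕ × ℕ × ℝ

/-- An item with its first rank, tagged for sorting, and with its second rank. -/
abbrev Ranked := (ℝ × ℕ × Item × Bits) × Bits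

def Ranked.item (z : Ranked) : Item := z.1.2.2.1
def Ranked.xb (z : Ranked) : Bits := z.1.2.2.2
def Ranked.yb (z : Ranked) : Bits := z.2

/-- Each axis contributes two keys to `p.dk ≤ q.qk`: the plain one says that `p` is at most one unit
above `q`, and the complemented one that it is at most one unit below. The cell `Y` is read off the
tag by which the item was sorted the second time; it agrees with the one in the item, by `yItem`. -/
def mkRec (D k m : ℕ) (z : Ranked) : Rec where
  X := z.item.2.1
  Y := z.1.2.1
  xs := chunk D k z.xb
  y := z.yb
  qk := [(axis m z.item.2.1 z.xb).1.1, (axis m z.item.2.1 z.xb).1.2, (axis m z.1.2.1 z.yb).1.1,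
    (axis m z.1.2.1 z.yb).1.2]
  dk := [(axis m z.item.2.1 z.xb).2.1, (axis m z.item.2.1 z.xb).2.2, (axis m z.1.2.1 z.yb).2.1,
    (axis m z.1.2.1 z.yb).2.2]

theorem ev_mkRec (D k m : ℕ) (z : Ranked) :
    Ev procs I [enc z, enc D, enc k, enc m] pMkRec.body
      (enc ((z.item.2.2.1, mkRec D k m z) : ℕ × Rec))
      (300 * m + 30 * z.xb.length + 30 * z.yb.length + D * (35 * k + 60) + 600) := by
  set ax := axis m z.item.2.1 z.xb with hx
  set ay := axis m z.1.2.1 z.yb with hy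
  have hres : Ev procs I [enc z, enc D, enc k, enc m, enc z.1, enc z.1.2.1, enc z.1.2.2,
      enc z.item.2.1, enc z.xb, enc z.yb, enc ax, enc ay, enc (chunk D k z.xb)]
      (.cons (.car (.cdr (.cdr (.car (.v 6))))) (.cons (.v 7) (.cons (.v 5) (.cons (.v 12)
        (.cons (.v 9) (.cons
          (.cons (.car (.car (.v 10))) (.cons (.cdr (.car (.v 10)))
            (.cons (.car (.car (.v 11))) (.cons (.cdr (.car (.v 11))) (.nat 0)))))
          (.cons (.car (.cdr (.v 10))) (.cons (.cdr (.cdr (.v 10)))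
            (.cons (.car (.cdr (.v 11))) (.cons (.cdr (.cdr (.v 11))) (.nat 0)))))))))))
      (enc ((z.item.2.2.1, mkRec D k m z) : ℕ × Rec)) 100 := by
    have h6 := Ev.v (P := procs) (I := I) (j := 6) (x := enc z.1.2.2) (env := [enc z, enc D, enc k,
      enc m, enc z.1, enc z.1.2.1, enc z.1.2.2, enc z.item.2.1, enc z.xb, enc z.yb, enc ax, enc ay,
      enc (chunk D k z.xb)]) rfl
    have h10 := Ev.v (P := procs) (I := I) (j := 10) (x := enc ax) (env := [enc z, enc D, enc k,
      enc m, enc z.1, enc z.1.2.1, enc z.1.2.2, enc z.item.2.1, enc z.xb, enc z.yb, enc ax, enc ay,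
      enc (chunk D k z.xb)]) rfl
    have h11 := Ev.v (P := procs) (I := I) (j := 11) (x := enc ay) (env := [enc z, enc D, enc k,
      enc m, enc z.1, enc z.1.2.1, enc z.1.2.2, enc z.item.2.1, enc z.xb, enc z.yb, enc ax, enc ay,
      enc (chunk D k z.xb)]) rfl
    have hq := h10.fst.fst.cons (h10.fst.snd.cons (h11.fst.fst.cons (h11.fst.snd.cons
      (Ev.nil (α := Bits)))))
    have hd := h10.snd.fst.cons (h10.snd.snd.cons (h11.snd.fst.cons (h11.snd.snd.cons
      (Ev.nil (α := Bits)))))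
    have h := Ev.prod h6.fst.snd.snd.fst ((Ev.v (x := enc z.item.2.1) (j := 7) rfl).prod
      ((Ev.v (x := enc z.1.2.1) (j := 5) rfl).prod ((Ev.v (x := enc (chunk D k z.xb)) (j := 12)
        rfl).prod ((Ev.v (x := enc z.yb) (j := 9) rfl).prod (hq.prod hd)))))
    exact h.mono (by omega)
  refine (Ev.letE (Ev.fst (x := z) (Ev.v rfl)) (Ev.letE (Ev.fst (x := z.1.2)
    (Ev.snd (x := z.1) (Ev.v rfl))) (Ev.letE (Ev.snd (x := z.1.2) (Ev.snd (x := z.1) (Ev.v rfl)))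
    (Ev.letE (Ev.fst (x := z.item.2) (Ev.snd (x := z.item) (Ev.fst (x := z.1.2.2) (Ev.v rfl))))
    (Ev.letE (Ev.snd (x := z.1.2.2) (Ev.v rfl)) (Ev.letE (Ev.snd (x := z) (Ev.v rfl))
    (Ev.letE (Ev.call (p := iAxis) (xs := [3, 7, 8]) rfl rfl rfl (ev_axis m z.item.2.1 z.xb))
    (Ev.letE (Ev.call (p := iAxis) (xs := [3, 5, 9]) rfl rfl rfl (ev_axis m z.1.2.1 z.yb))
    (Ev.letE (Ev.call (p := iChunk) (xs := [1, 2, 8]) rfl rfl rfl (ev_chunk D k z.xb))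
    hres))))))))).mono ?_
  simp only [List.length_cons, List.length_nil]
  omega

end procedures

/-! ### Ranks -/

/-- The number with given binary digits. -/
def bval : Bits → ℕ
  | [] => 0
  | b :: u => (if b then 2 ^ u.length else 0) + bval u

theorem bval_lt (u : Bits) : bval u < 2 ^ u.length := by
  induction u with
  | nil => simp [bval]
  | cons b u ih => simp only [bval, List.length_cons, pow_succ]; split <;> omega

theorem lt_of_bval_lt {u v : Bits} (h : u.length = v.length) (hlt : bval u < bval v) : u < v := by
  induction u generalizing v with
  | nil => cases v with
    | nil => simp [bval] at hlt
    | cons b v => simp at h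
  | cons a u ih =>
    cases v with
    | nil => simp at h
    | cons b v =>
      simp only [List.length_cons, Nat.add_right_cancel_iff] at h
      have h1 := bval_lt u
      have h2 := bval_lt v
      rw [List.cons_lt_cons_iff]
      cases a <;> cases b <;> simp only [bval, h, if_true, if_false, Bool.false_eq_true] at hlt h1
      · exact Or.inr ⟨rfl, ih h (by omega)⟩
      · exact Or.inl (by simp)
      · omega
      · exact Or.inr ⟨rfl, ih h (by omega)⟩

theorem bval_inc (u : Bits) : ((inc u).1 = true → bval u + 1 = 2 ^ u.length ∧ bval (inc u).2 = 0) ∧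
    ((inc u).1 = false → bval (inc u).2 = bval u + 1) := by
  induction u with
  | nil => simp [inc, bval]
  | cons b u ih =>
    have hl := length_inc u
    cases hi : (inc u).1 <;> cases b <;> simp_all [inc, bval, pow_succ] <;> omega

theorem bval_replicate (w : ℕ) : bval (List.replicate w false) = 0 := by
  induction w with
  | zero => rfl
  | succ w ih => simp [List.replicate_succ, bval, ih]

section assign

variable {α : Type}

theorem assign_fst (l : List α) (u : Bits) : (assign l u).map Prod.fst = l := by
  induction l generalizing u with
  | nil => rfl
  | cons a l ih => simp [assign, ih]

/-- The assigned strings count upwards from `u`. As long as there is no overflow they increase along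
the list, while the order of the list itself is preserved. -/
theorem assign_spec {r : α → α → Prop} (l : List α) (u : Bits)
    (h : bval u + l.length ≤ 2 ^ u.length) (hr : l.Pairwise r) :
    (∀ e ∈ assign l u, e.2.length = u.length ∧ bval u ≤ bval e.2) ∧
      (assign l u).Pairwise fun a b => r a.1 b.1 ∧ a.2 < b.2 := by
  induction l generalizing u with
  | nil => simp [assign]
  | cons a l ih =>
    rw [List.pairwise_cons] at hr
    simp only [List.length_cons] at h
    -- At the last element the increment may overflow, but its result is not used.
    rcases l with _ | ⟨b, l⟩
    · simp [assign]
    have hi : (inc u).1 = false := by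
      by_contra hc
      have := ((bval_inc u).1 (by simpa using hc)).1
      simp only [List.length_cons] at h
      omega
    have hv := (bval_inc u).2 hi
    obtain ⟨h1, h2⟩ := ih (inc u).2 (by rw [hv, length_inc]; omega) hr.2
    rw [length_inc] at h1
    rw [assign]
    refine ⟨?_, List.pairwise_cons.2 ⟨fun e he => ⟨hr.1 _ ?_, ?_⟩, h2⟩⟩
    · simp only [List.forall_mem_cons, le_refl, and_self, true_and]
      exact fun e he => ⟨(h1 e he).1, by have := (h1 e he).2; omega⟩
    · rw [← assign_fst (b :: l) (inc u).2]
      exact List.mem_map_of_mem he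
    · exact lt_of_bval_lt (h1 e he).1.symm (by have := (h1 e he).2; dsimp only; omega)

end assign

/-- `L` lists the items of `l` with ranks of length `w`. -/
structure IsRanking {π : Type} (w : ℕ) (l : List (ℝ × ℕ × π)) (L : List ((ℝ × ℕ × π) × Bits)) :
    Prop where
  perm : (L.map Prod.fst).Perm l
  len : ∀ e ∈ L, e.2.length = w
  nodup : L.Nodup
  inj : ∀ a ∈ L, ∀ b ∈ L, a.2 = b.2 → a = b
  lt : ∀ a ∈ L, ∀ b ∈ L, itemLe b.1 a.1 = false → a.2 < b.2

theorem isRanking_assign {π : Type} {w : ℕ} {l l' : List (ℝ × ℕ × π)} (hp : l'.Perm l)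
    (hs : l'.Pairwise fun a b => itemLe a b = true) (hw : l.length ≤ 2 ^ w) :
    IsRanking w l (assign l' (List.replicate w false)).reverse := by
  obtain ⟨h1, h2⟩ := assign_spec l' (List.replicate w false)
    (by rw [bval_replicate, List.length_replicate, hp.length_eq]; omega) hs
  rw [List.length_replicate] at h1
  set L := assign l' (List.replicate w false) with hL
  have key : ∀ a ∈ L, ∀ b ∈ L, (a.2 = b.2 → a = b) ∧ (itemLe b.1 a.1 = false → a.2 < b.2) ∧
      (itemLe a.1 b.1 = false → b.2 < a.2) := by
    have hirr : ∀ a : ℝ × ℕ × π, itemLe a a = true := fun a => (itemLe_iff a a).2 (by simp)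
    -- Along the list the strings increase and the items are sorted, which settles every pair in
    -- both orders.
    refine List.Pairwise.forall_of_forall_of_flip (R := fun a b : (ℝ × ℕ × π) × Bits =>
      (a.2 = b.2 → a = b) ∧ (itemLe b.1 a.1 = false → a.2 < b.2) ∧
        (itemLe a.1 b.1 = false → b.2 < a.2)) ?_ ?_ ?_
    · intro a _
      simp [hirr]
    · refine h2.imp ?_
      rintro a b ⟨h, h'⟩
      exact ⟨fun e => absurd h' (e ▸ lt_irrefl _), fun _ => h', fun h'' => by simp [h] at h''⟩
    · refine h2.imp ?_
      rintro a b ⟨h, h'⟩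
      exact ⟨fun e => absurd h' (e ▸ lt_irrefl _), fun h'' => by simp [h] at h'', fun _ => h'⟩
  refine ⟨?_, fun e he => (h1 e (List.mem_reverse.1 he)).1, ?_, ?_, ?_⟩
  · rw [List.map_reverse, assign_fst]
    exact (List.reverse_perm _).trans hp
  · rw [List.nodup_reverse]
    exact h2.imp fun h e => by rw [e] at h; exact lt_irrefl _ h.2
  · exact fun a ha b hb => (key a (by simpa using ha) b (by simpa using hb)).1
  · exact fun a ha b hb => (key a (by simpa using ha) b (by simpa using hb)).2.1

/-- The item to be sorted by its second coordinate. -/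
def yItem (e : Item × Bits) : ℝ × ℕ × Item × Bits := (e.1.2.2.2.2, e.1.2.2.2.1, e)

section procedures

variable {I : Input}

theorem ev_rank {π : Type} [Enc π] (w : ℕ) (l : List (ℝ × ℕ × π)) (hw : l.length ≤ 2 ^ w) :
    ∃ (l' : List (ℝ × ℕ × π)) (L : List ((ℝ × ℕ × π) × Bits)), IsRanking w l L ∧
      Ev procs I [enc l] pSort.body (enc l') (150 * l.length * (Nat.clog 2 l.length + 1) + 10) ∧
      Ev procs I [enc l', enc (List.replicate w false)] pAssign.body (enc L)
        (l.length * (30 * w + 50) + 20) := by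
  obtain ⟨l', h1, h2, h3⟩ := ev_sort (I := I) l.length l rfl
  refine ⟨l', _, isRanking_assign h1 h2 hw, h3, (ev_assign l' _).mono ?_⟩
  rw [h1.length_eq, List.length_replicate]

/-- Two rounds of sorting: by the first fractional part, and then, with the first rank carried
along, by the second one. -/
theorem ev_recs (D k w m : ℕ) (l : List Item) (hw : l.length ≤ 2 ^ w) :
    ∃ (L : List (Item × Bits)) (Z : List Ranked), IsRanking w l L ∧ IsRanking w (L.map yItem) Z ∧
      Ev procs I [enc l, enc D, enc k, enc w, enc m] pRecs.body
        (enc (Z.map fun z => ((z.item.2.2.1, mkRec D k m z) : ℕ × Rec)))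
        (l.length * (300 * Nat.clog 2 l.length + 120 * w + 300 * m + D * (35 * k + 60) + 1200) +
          20 * w + 150) := by
  obtain ⟨l₁, L, hL, e1, e2⟩ := ev_rank (I := I) w l hw
  have hlen : L.length = l.length := by simpa using hL.perm.length_eq
  obtain ⟨l₂, Z, hZ, e3, e4⟩ := ev_rank (I := I) w (L.map yItem) (by simpa [hlen] using hw)
  have hlen2 : Z.length = l.length := by simpa [hlen] using hZ.perm.length_eq
  refine ⟨L, Z, hL, hZ, ?_⟩
  have hxb : ∀ z : Ranked, z ∈ Z → z.xb.length = w := by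
    intro z hz
    have : z.1 ∈ L.map yItem := hZ.perm.mem_iff.1 (List.mem_map_of_mem hz)
    obtain ⟨e, he, h⟩ := List.mem_map.1 this
    rw [Ranked.xb, ← h]
    exact hL.len e he
  refine (Ev.letE (Ev.call (p := iZeros) (xs := [3]) rfl rfl rfl (ev_zeros w))
    (Ev.letE (Ev.call (p := iSort) (xs := [0]) rfl rfl rfl e1)
    (Ev.letE (Ev.call (p := iAssign) (xs := [6, 5]) rfl rfl rfl e2)
    (Ev.letE (Ev.map (l := L) yItem 20 (Ev.v rfl) fun acc e _ => ?_)
    (Ev.letE (Ev.call (p := iSort) (xs := [8]) rfl rfl rfl e3)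
    (Ev.letE (Ev.call (p := iAssign) (xs := [9, 5]) rfl rfl rfl e4)
    (Ev.map (l := Z) (fun z : Ranked => ((z.item.2.2.1, mkRec D k m z) : ℕ × Rec))
      (300 * m + 60 * w + D * (35 * k + 60) + 610) (Ev.v rfl) fun acc z hz => 
      (Ev.call (p := iMkRec) (xs := [12, 1, 2, 4]) rfl rfl rfl (ev_mkRec D k m z)).mono ?_))))))
      ).mono ?_
  · have h : Ev procs I ([enc l, enc D, enc k, enc w, enc m] ++ [enc (List.replicate w false)] ++
      [enc l₁] ++ [enc L] ++ [acc, enc e]) (.ix 0) (enc e) 1 := Ev.ix0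
    exact (Ev.prod (x := e.1.2.2.2.2) (y := (e.1.2.2.2.1, e)) h.fst.snd.snd.snd.snd
      (Ev.prod h.fst.snd.snd.snd.fst h)).mono (by omega)
  · have := hZ.len z hz
    have := hxb z hz
    simp only [Ranked.yb, List.length_cons, List.length_nil]
    simp only [Ranked.xb] at this ⊢
    omega
  · simp only [List.length_map, hlen, hlen2, List.length_cons, List.length_nil]
    set N := l.length
    set c := Nat.clog 2 N
    ring_nf
    omega

/-! ### The layers of records and the list of all tests. -/

theorem foldl_cons_map {α β : Type} (f : α → β) (l : List α) (l' : List β) :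
    l.foldl (fun acc x => f x :: acc) l' = (l.map f).reverse ++ l' := by
  induction l generalizing l' with
  | nil => simp
  | cons x l ih => simp [ih]

/-- The layers of a list of records tagged with their layers. -/
def lays (out : List (ℕ × Rec)) (n : ℕ) : List (List Rec) :=
  (List.range n).map fun j => (out.filter fun x => decide (x.1 = j)).map Prod.snd

theorem ev_lays (out : List (ℕ × Rec)) (n : ℕ) :
    Ev procs I [enc out, enc n] pLays.body (enc (lays out n))
      (n * (40 * out.length + 50) + 30) := by
  have := Ev.letE (Ev.call (p := iIota) (xs := [1]) rfl rfl rfl (ev_iota (I := I) n))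
    (Ev.foldU (P := procs) (I := I) (env := [enc out, enc n] ++ [enc (List.range n).reverse])
      (e := .v 2) (i := .nat 0)
      (b := .cons (mapE (filterE (.v 0) (eqE (.car (.ix 0)) (.v 4))) (.cdr (.ix 0))) (.v 3))
      (l := (List.range n).reverse)
      (fun (acc : List (List Rec)) j => ((out.filter fun x => decide (x.1 = j)).map Prod.snd) :: acc)
      [] (40 * out.length + 20) (Ev.v rfl) Ev.nil fun acc j _ => by
        have h := Ev.filter (P := procs) (I := I) (env := [enc out, enc n] ++
          [enc (List.range n).reverse] ++ [enc acc, enc j]) (e := .v 0)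
          (b := eqE (.car (.ix 0)) (.v 4)) (l := out) (fun x => decide (x.1 = j)) 14 (Ev.v rfl)
          fun _ x _ => (Ev.eq (Ev.fst (x := x) Ev.ix0) (Ev.v (x := enc j) rfl)).mono (by omega)
        have hle := List.length_filter_le (fun x : ℕ × Rec => decide (x.1 = j)) out
        exact (Ev.cons (Ev.map Prod.snd 2 h fun _ x _ => Ev.snd (x := x) Ev.ix0)
          (Ev.v rfl)).mono (by omega))
  rw [foldl_cons_map, List.append_nil, ← List.map_reverse, List.reverse_reverse] at this
  refine this.mono ?_
  simp only [List.length_reverse, List.length_range, List.length_cons, List.length_nil]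
  ring_nf
  omega

/-- All tests: a layer, a cell and a direction. -/
def allTests (n m : ℕ) : List LinkTest :=
  (List.range n).flatMap fun i => (List.range m).flatMap fun X => (List.range m).flatMap fun Y =>
    [(i, X, Y, true), (i, X, Y, false)]

theorem mem_allTests {n m : ℕ} {τ : LinkTest} :
    τ ∈ allTests n m ↔ τ.1 < n ∧ τ.2.1 < m ∧ τ.2.2.1 < m := by
  obtain ⟨i, X, Y, sg⟩ := τ
  cases sg <;> simp [allTests]

theorem length_allTests (n m : ℕ) : (allTests n m).length = n * (m * (m * 2)) := by
  simp [allTests, List.length_flatMap]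

theorem foldl_append_flatMap {α β : Type} (g : α → List β) (l : List α) (b : List β) :
    l.foldl (fun acc x => g x ++ acc) b = l.reverse.flatMap g ++ b := by
  induction l generalizing b with
  | nil => simp
  | cons x l ih => simp [ih]

theorem ev_tests (n m : ℕ) :
    Ev procs I [enc n, enc m] pTests.body (enc (allTests n m))
      (n * (m * (m * 20 + 10) + 30) + 50 * m + 100) := by
  have h := Ev.letE (Ev.call (p := iIota) (xs := [0]) rfl rfl rfl (ev_iota (I := I) n))
    (Ev.letE (Ev.call (p := iIota) (xs := [1]) rfl rfl rfl (ev_iota (I := I) m))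
    (Ev.foldU (P := procs) (I := I) (env := [enc n, enc m] ++ [enc (List.range n).reverse] ++
      [enc (List.range m).reverse]) (e := .v 2) (i := .nat 0) (l := (List.range n).reverse)
      (b := .fold (.v 3) (.v 4) (.fold (.v 3) (.v 6)
        (.cons (.cons (.v 5) (.cons (.v 7) (.cons (.v 9) (.nat 1))))
        (.cons (.cons (.v 5) (.cons (.v 7) (.cons (.v 9) (.nat 0)))) (.v 8)))))
      (fun (acc : List LinkTest) i => (List.range m).reverse.foldl (fun acc X =>
        (List.range m).reverse.foldl (fun acc Y => [(i, X, Y, true), (i, X, Y, false)] ++ acc) acc)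
        acc) [] _ (Ev.v rfl) Ev.nil fun acc i _ =>
        Ev.foldU _ _ (m * 18 + 3) (Ev.v (x := enc (List.range m).reverse) rfl) (Ev.v rfl)
          fun acc X _ => (Ev.foldU (l := (List.range m).reverse) _ acc 17 (Ev.v rfl) (Ev.v rfl)
            fun acc Y _ => Ev.cons (x := ((i, X, Y, true) : LinkTest)) (y := (i, X, Y, false) :: acc)
              (Ev.prod (Ev.v rfl) (Ev.prod (Ev.v rfl) (Ev.prod (Ev.v rfl) Ev.tt)))
              (Ev.cons (Ev.prod (Ev.v rfl) (Ev.prod (Ev.v rfl) (Ev.prod (Ev.v rfl) Ev.ff)))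
                (Ev.v rfl))).mono (by simp; omega)))
  simp only [foldl_append_flatMap, List.reverse_reverse, List.append_nil] at h
  refine h.mono ?_
  simp only [List.length_reverse, List.length_range, List.length_cons, List.length_nil]
  ring_nf
  omega

end procedures

/-! ### Keys express nearness, and the records are in general position. -/

theorem unary_append_le {m X X' : ℕ} {u u' : Bits} (hX : X ≤ m) (hX' : X' ≤ m) :
    unary m X ++ u ≤ unary m X' ++ u' ↔ X < X' ∨ X = X' ∧ u ≤ u' := by
  induction m generalizing X X' with
  | zero =>
    obtain rfl : X = 0 := by omega
    obtain rfl : X' = 0 := by omega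
    simp [unary]
  | succ m ih =>
    simp only [unary, List.cons_append, cons_le_cons_bits]
    rcases Nat.eq_zero_or_pos X with rfl | h <;> rcases Nat.eq_zero_or_pos X' with rfl | h'
    · simpa using ih (X := 0) (X' := 0) (by omega) (by omega)
    · simp [h', h'.ne', Bool.lt_iff]
    · simp [h.ne']
    · have := ih (X := X - 1) (X' := X' - 1) (by omega) (by omega)
      simp only [h.ne', h'.ne', ne_eq, not_false_eq_true, decide_true, lt_irrefl, false_or, true_and,
        this]
      refine or_congr (by omega) (and_congr_left fun _ => by omega)

/-- A unary code followed by a rank orders lexicographically, by cell and then by rank. Shifting the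
cell of the query by one more than that of the datum turns this order into the condition of lying at
most one unit above. -/
theorem axis_le_left {m X X' : ℕ} {u u' : Bits} (hX : X + 2 ≤ m) (hX' : X' + 2 ≤ m) :
    (axis m X u).2.1 ≤ (axis m X' u').1.1 ↔ X ≤ X' ∨ X = X' + 1 ∧ u ≤ u' := by
  rw [axis, axis, unary_append_le (by omega) (by omega)]
  refine or_congr (by omega) (and_congr_left fun _ => by omega)

theorem axis_le_right {m X X' : ℕ} {u u' : Bits} (hX : X + 2 ≤ m) (hX' : X' + 2 ≤ m)
    (h : u.length = u'.length) :
    (axis m X u).2.2 ≤ (axis m X' u').1.2 ↔ X' ≤ X ∨ X' = X + 1 ∧ u' ≤ u := by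
  rw [axis, axis, compl_le_compl (by simp [length_unary, h]), unary_append_le (by omega) (by omega)]
  refine or_congr (by omega) (and_congr_left fun _ => by omega)

theorem chunk_spec (D k : ℕ) (u : Bits) (h : u.length = D * k) :
    (chunk D k u).flatten = u ∧ (chunk D k u).length = D ∧ ∀ c ∈ chunk D k u, c.length = k := by
  induction D generalizing u with
  | zero => simp_all [chunk]
  | succ D ih =>
    rw [Nat.succ_mul] at h
    obtain ⟨h1, h2, h3⟩ := ih (u.drop k) (by rw [List.length_drop]; omega)
    refine ⟨by simp [chunk, h1], by simp [chunk, h2], ?_⟩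
    simp only [chunk, List.forall_mem_cons, List.length_take]
    exact ⟨by omega, h3⟩

/-- The squares of two items intersect. -/
def ItemNear (p q : Item) : Prop :=
  (q.2.1 ≤ p.2.1 + 1 ∧ p.2.1 ≤ q.2.1 + 1 ∧ (p.2.1 < q.2.1 → q.1 ≤ p.1) ∧
    (q.2.1 < p.2.1 → p.1 ≤ q.1)) ∧
  (q.2.2.2.1 ≤ p.2.2.2.1 + 1 ∧ p.2.2.2.1 ≤ q.2.2.2.1 + 1 ∧
    (p.2.2.2.1 < q.2.2.2.1 → q.2.2.2.2 ≤ p.2.2.2.2) ∧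
    (q.2.2.2.1 < p.2.2.2.1 → p.2.2.2.2 ≤ q.2.2.2.2))

/-- Items are ordered by fractional part and, for equal parts, with the higher cell first. So if `b`
is in a higher cell than `a`, a tie of the fractional parts puts `b` before `a`, as the weak
inequality demands, although all ranks are distinct. -/
theorem IsRanking.le_iff {π : Type} {w : ℕ} {l : List (ℝ × ℕ × π)} {L : List ((ℝ × ℕ × π) × Bits)}
    (h : IsRanking w l L) {a b : (ℝ × ℕ × π) × Bits} (ha : a ∈ L) (hb : b ∈ L)
    (hlt : a.1.2.1 < b.1.2.1) : b.2 ≤ a.2 ↔ b.1.1 ≤ a.1.1 := by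
  constructor
  · contrapose!
    intro hf
    refine h.lt a ha b hb ?_
    rw [Bool.eq_false_iff, ne_eq, itemLe_iff]
    rintro (h1 | ⟨h1, -⟩) <;> linarith
  · intro hf
    refine (h.lt b hb a ha ?_).le
    rw [Bool.eq_false_iff, ne_eq, itemLe_iff]
    rintro (h1 | ⟨-, h1⟩)
    · linarith
    · omega

section good

variable {w k D m : ℕ} {l : List Item} {L : List (Item × Bits)} {Z : List Ranked}

theorem ranked_spec (hL : IsRanking w l L) (hZ : IsRanking w (L.map yItem) Z) {z : Ranked}
    (hz : z ∈ Z) : (z.item, z.xb) ∈ L ∧ z.item ∈ l ∧ z.1 = yItem (z.item, z.xb) ∧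
      z.xb.length = w ∧ z.yb.length = w := by
  have : z.1 ∈ L.map yItem := hZ.perm.mem_iff.1 (List.mem_map_of_mem hz)
  obtain ⟨e, he, h⟩ := List.mem_map.1 this
  have h1 : (z.item, z.xb) = e := by simp [Ranked.item, Ranked.xb, ← h, yItem]
  rw [h1]
  refine ⟨he, ?_, h.symm, ?_, hZ.len z hz⟩
  · have := hL.perm.mem_iff.1 (List.mem_map_of_mem he)
    rwa [← h1] at this
  · have := hL.len e he
    rwa [← h1] at this

theorem exists_ranked (hL : IsRanking w l L) (hZ : IsRanking w (L.map yItem) Z) {p : Item}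
    (hp : p ∈ l) : ∃ z ∈ Z, z.item = p := by
  obtain ⟨e, he, rfl⟩ := List.mem_map.1 (hL.perm.mem_iff.2 hp)
  obtain ⟨z, hz, h⟩ := List.mem_map.1 (hZ.perm.mem_iff.2 (List.mem_map_of_mem (f := yItem) he))
  exact ⟨z, hz, by rw [Ranked.item, h]; rfl⟩

theorem near_mkRec (hL : IsRanking w l L) (hZ : IsRanking w (L.map yItem) Z) (hw : w = D * k)
    {p q : Ranked} (hp : p ∈ Z) (hq : q ∈ Z) :
    Near (mkRec D k m p) (mkRec D k m q) ↔ ItemNear p.item q.item := by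
  obtain ⟨p1, -, p3, p4, -⟩ := ranked_spec hL hZ hp
  obtain ⟨q1, -, q3, q4, -⟩ := ranked_spec hL hZ hq
  have ep := (chunk_spec D k p.xb (by omega)).1
  have eq := (chunk_spec D k q.xb (by omega)).1
  have hpY : p.1.2.1 = p.item.2.2.2.1 := by rw [p3]; rfl
  have hqY : q.1.2.1 = q.item.2.2.2.1 := by rw [q3]; rfl
  have hpf : p.1.1 = p.item.2.2.2.2 := by rw [p3]; rfl
  have hqf : q.1.1 = q.item.2.2.2.2 := by rw [q3]; rfl
  simp only [Near, ItemNear, mkRec, ep, eq]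
  rw [hpY, hqY, ← hpf, ← hqf]
  refine and_congr (and_congr_right fun _ => and_congr_right fun _ => and_congr ?_ ?_)
    (and_congr_right fun _ => and_congr_right fun _ => and_congr ?_ ?_)
  · exact imp_congr_right fun h => hL.le_iff p1 q1 h
  · exact imp_congr_right fun h => hL.le_iff q1 p1 h
  · exact imp_congr_right fun h => hZ.le_iff hp hq (by rw [hpY, hqY]; exact h)
  · exact imp_congr_right fun h => hZ.le_iff hq hp (by rw [hpY, hqY]; exact h)

/-- Unary codes of length `m` must accommodate `X + 2`, so cells are below `m - 1`. Ranks belong to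
entries of the list, not to points: two entries with the same coordinates still give different
records. -/
theorem good_mkRec (hL : IsRanking w l L) (hZ : IsRanking w (L.map yItem) Z) (hw : w = D * k)
    (hm : ∀ p ∈ l, p.2.1 + 2 ≤ m ∧ p.2.2.2.1 + 2 ≤ m) :
    Good (fun r => ∃ z ∈ Z, r = mkRec D k m z) w (m - 1) k D (List.replicate 4 (m + w)) where
  y_len := by
    rintro _ ⟨z, hz, rfl⟩
    exact hZ.len z hz
  xs_len := by
    rintro _ ⟨z, hz, rfl⟩
    exact (chunk_spec D k z.xb ((ranked_spec hL hZ hz).2.2.2.1.trans hw)).2.1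
  chunk_len := by
    rintro _ ⟨z, hz, rfl⟩
    exact (chunk_spec D k z.xb ((ranked_spec hL hZ hz).2.2.2.1.trans hw)).2.2
  shape := by
    rintro _ ⟨z, hz, rfl⟩
    obtain ⟨-, -, -, h4, h5⟩ := ranked_spec hL hZ hz
    simp [Rec.Shape, mkRec, axis, length_unary, length_compl, h4, h5, List.replicate]
  X_lt := by
    rintro _ ⟨z, hz, rfl⟩
    have := hm _ (ranked_spec hL hZ hz).2.1
    simp only [mkRec]
    omega
  Y_lt := by
    rintro _ ⟨z, hz, rfl⟩
    have := hm _ (ranked_spec hL hZ hz).2.1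
    have h : z.1.2.1 = z.item.2.2.2.1 := by rw [(ranked_spec hL hZ hz).2.2.1]; rfl
    simp only [mkRec, h]
    omega
  linked_iff := by
    rintro _ _ ⟨p, hp, rfl⟩ ⟨q, hq, rfl⟩
    obtain ⟨-, p2, p3, p4, p5⟩ := ranked_spec hL hZ hp
    obtain ⟨-, q2, q3, q4, q5⟩ := ranked_spec hL hZ hq
    have ep := (chunk_spec D k p.xb (by omega)).1
    have eq := (chunk_spec D k q.xb (by omega)).1
    have hpY : p.1.2.1 = p.item.2.2.2.1 := by rw [p3]; rfl
    have hqY : q.1.2.1 = q.item.2.2.2.1 := by rw [q3]; rfl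
    have mp := hm _ p2
    have mq := hm _ q2
    rw [← hpY] at mp
    rw [← hqY] at mq
    simp only [linked, mkRec, keysLE, Bool.and_eq_true, decide_eq_true_eq, and_true, Near, ep, eq]
    rw [axis_le_left mp.1 mq.1, axis_le_left mp.2 mq.2, axis_le_right mp.1 mq.1 (by omega),
      axis_le_right mp.2 mq.2 (by omega)]
    have key : ∀ (X X' : ℕ) (u v : Bits), ((X ≤ X' ∨ X = X' + 1 ∧ u ≤ v) ∧
        (X' ≤ X ∨ X' = X + 1 ∧ v ≤ u)) ↔
        (X' ≤ X + 1 ∧ X ≤ X' + 1 ∧ (X < X' → v ≤ u) ∧ (X' < X → u ≤ v)) := by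
      intro X X' u v
      constructor
      · rintro ⟨h1 | ⟨h1, h2⟩, h3 | ⟨h3, h4⟩⟩
        · exact ⟨by omega, by omega, fun h => by omega, fun h => by omega⟩
        · exact ⟨by omega, by omega, fun _ => h4, fun h => by omega⟩
        · exact ⟨by omega, by omega, fun h => by omega, fun _ => h2⟩
        · omega
      · rintro ⟨h1, h2, h3, h4⟩
        rcases lt_trichotomy X X' with h | h | h
        · exact ⟨Or.inl h.le, Or.inr ⟨by omega, h3 h⟩⟩
        · exact ⟨Or.inl h.le, Or.inl h.ge⟩
        · exact ⟨Or.inr ⟨by omega, h4 h⟩, Or.inl h.le⟩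
    rw [← key, ← key, and_assoc]
  xs_inj := by
    rintro _ _ ⟨p, hp, rfl⟩ ⟨q, hq, rfl⟩ h
    obtain ⟨p1, -, p3, p4, -⟩ := ranked_spec hL hZ hp
    obtain ⟨q1, -, q3, q4, -⟩ := ranked_spec hL hZ hq
    have ep := (chunk_spec D k p.xb (by omega)).1
    have eq := (chunk_spec D k q.xb (by omega)).1
    have hb : p.xb = q.xb := by
      rw [← ep, ← eq]
      exact congrArg List.flatten h
    have he := hL.inj _ p1 _ q1 hb
    -- The tag for the second sorting contains the first rank, so distinct elements of `L` have
    -- distinct tags.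
    have hnd : (Z.map Prod.fst).Nodup := by
      refine hZ.perm.nodup_iff.2 (hL.nodup.map ?_)
      intro e e' h
      exact congrArg (fun x => x.2.2) h
    have : p.1 = q.1 := by rw [p3, q3, he]
    rw [List.inj_on_of_nodup_map hnd hp hq this]
  y_inj := by
    rintro _ _ ⟨p, hp, rfl⟩ ⟨q, hq, rfl⟩ h
    rw [hZ.inj p hp q hq h]

end good

/-! ### Chains of records and chains of items. -/

theorem con_iff_fun {ls : List (List Rec)} (h : ls ≠ []) {a b : Rec} : Con ls a b ↔
    ∃ f : ℕ → Rec, f 0 = a ∧ f (ls.length - 1) = b ∧ (∀ i, (hi : i < ls.length) → f i ∈ ls[i]) ∧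
      ∀ i, i + 1 < ls.length → linked (f i) (f (i + 1)) = true := by
  induction ls generalizing a with
  | nil => simp at h
  | cons l ls ih =>
    rcases ls with _ | ⟨l', ls⟩
    · simp only [Con, List.length_singleton, Nat.sub_self]
      constructor
      · rintro ⟨h1, rfl⟩
        exact ⟨fun _ => a, rfl, rfl, fun i hi => by simpa [show i = 0 by omega] using h1,
          fun i hi => by omega⟩
      · rintro ⟨f, rfl, rfl, h1, -⟩
        exact ⟨h1 0 (by omega), rfl⟩
    · rw [Con]
      constructor
      · rintro ⟨h1, q, h2, h3⟩
        obtain ⟨f, rfl, rfl, f3, f4⟩ := (ih (by simp)).1 h3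
        refine ⟨fun i => i.casesOn a f, rfl, by simp, fun i hi => ?_, fun i hi => ?_⟩
        · cases i with
          | zero => exact h1
          | succ i => exact f3 i (by simpa using hi)
        · cases i with
          | zero => exact h2
          | succ i => exact f4 i (by simpa using hi)
      · rintro ⟨f, rfl, rfl, f3, f4⟩
        refine ⟨f3 0 (by simp), f 1, f4 0 (by simp), (ih (by simp)).2
          ⟨fun i => f (i + 1), rfl, by simp, fun i hi => ?_, fun i hi => ?_⟩⟩
        · exact f3 (i + 1) (by simpa using hi)
        · exact f4 (i + 1) (by simpa using hi)

/-- There is a chain of items from `p` to `q`, one in each layer. -/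
def ItemChain (l : List Item) (n : ℕ) (p q : Item) : Prop :=
  ∃ f : ℕ → Item, f 0 = p ∧ f n = q ∧ (∀ i ≤ n, f i ∈ l ∧ (f i).2.2.1 = i) ∧
    ∀ i < n, ItemNear (f i) (f (i + 1))

/-- Some item of the first layer and some item of the last layer are not joined by a chain. -/
def Unchained (l : List Item) (n : ℕ) : Prop :=
  ∃ p ∈ l, ∃ q ∈ l, p.2.2.1 = 0 ∧ q.2.2.1 = n ∧ ¬ ItemChain l n p q

theorem length_lays (out : List (ℕ × Rec)) (n : ℕ) : (lays out n).length = n := by simp [lays]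

theorem tot_lays_le (out : List (ℕ × Rec)) (n : ℕ) : tot (lays out n) ≤ out.length := by
  have h : ∀ n, tot (lays out n) = (out.filter fun x => decide (x.1 < n)).length := by
    intro n
    induction n with
    | zero => simp [tot, lays]
    | succ n ih =>
      have : tot (lays out (n + 1)) = tot (lays out n) +
          (out.filter fun x => decide (x.1 = n)).length := by
        simp [tot, lays, List.range_succ]
      rw [this, ih]
      clear this ih
      induction out with
      | nil => rfl
      | cons x out ih =>
        simp only [List.filter_cons, decide_eq_true_eq]
        split_ifs <;> (try simp only [List.length_cons]) <;> omega
  rw [h]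
  exact List.length_filter_le _ _

section layers

variable {w k D m : ℕ} {l : List Item} {L : List (Item × Bits)} {Z : List Ranked}

/-- The layers of records. -/
def recLays (D k m : ℕ) (Z : List Ranked) (n : ℕ) : List (List Rec) :=
  lays (Z.map fun z => (z.item.2.2.1, mkRec D k m z)) n

theorem mem_recLays {n i : ℕ} (hi : i < (recLays D k m Z n).length) {r : Rec} :
    r ∈ (recLays D k m Z n)[i] ↔ ∃ z ∈ Z, z.item.2.2.1 = i ∧ r = mkRec D k m z := by
  simp only [recLays, lays, List.getElem_map, List.getElem_range, List.mem_map, List.mem_filter,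
    decide_eq_true_eq]
  constructor
  · rintro ⟨_, ⟨⟨z, hz, rfl⟩, h⟩, rfl⟩
    exact ⟨z, hz, h, rfl⟩
  · rintro ⟨z, hz, h, rfl⟩
    exact ⟨_, ⟨⟨z, hz, rfl⟩, h⟩, rfl⟩

theorem recLays_spec (n : ℕ) : ∀ l ∈ recLays D k m Z n, ∀ r ∈ l, ∃ z ∈ Z, r = mkRec D k m z := by
  intro l hl r hr
  obtain ⟨i, hi, rfl⟩ := List.getElem_of_mem hl
  obtain ⟨z, hz, -, h⟩ := (mem_recLays hi).1 hr
  exact ⟨z, hz, h⟩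

theorem con_recLays_iff (hL : IsRanking w l L) (hZ : IsRanking w (L.map yItem) Z) (hw : w = D * k)
    (hm : ∀ p ∈ l, p.2.1 + 2 ≤ m ∧ p.2.2.2.1 + 2 ≤ m) {n : ℕ} (hn : 0 < n) {p q : Ranked}
    (hp : p ∈ Z) (hq : q ∈ Z) (hp0 : p.item.2.2.1 = 0) (hqn : q.item.2.2.1 = n) :
    Con (recLays D k m Z (n + 1)) (mkRec D k m p) (mkRec D k m q) ↔ ItemChain l n p.item q.item := by
  have hlen : (recLays D k m Z (n + 1)).length = n + 1 := length_lays _ _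
  have hG := good_mkRec (m := m) hL hZ hw hm
  rw [con_iff_fun (by rw [← List.length_pos_iff, hlen]; omega)]
  simp only [hlen, Nat.add_sub_cancel]
  constructor
  · rintro ⟨f, f1, f2, f3, f4⟩
    have hex : ∀ i, ∃ z : Ranked, i ≤ n → z ∈ Z ∧ z.item.2.2.1 = i ∧ f i = mkRec D k m z ∧
        (i = 0 → z = p) ∧ (i = n → z = q) := by
      intro i
      by_cases hi : i ≤ n
      · rcases Nat.eq_zero_or_pos i with rfl | h0
        · exact ⟨p, fun _ => ⟨hp, hp0, f1, fun _ => rfl, fun h => by omega⟩⟩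
        · rcases eq_or_ne i n with rfl | h1
          · exact ⟨q, fun _ => ⟨hq, hqn, f2, fun h => by omega, fun _ => rfl⟩⟩
          · obtain ⟨z, hz, h2, h3⟩ := (mem_recLays (by rw [hlen]; omega)).1 (f3 i (by omega))
            exact ⟨z, fun _ => ⟨hz, h2, h3, fun h => by omega, fun h => by omega⟩⟩
      · exact ⟨p, fun h => absurd h hi⟩
    choose g hg using hex
    refine ⟨fun i => (g i).item, congrArg Ranked.item ((hg 0 (by omega)).2.2.2.1 rfl),
      congrArg Ranked.item ((hg n le_rfl).2.2.2.2 rfl), fun i hi => ⟨(ranked_spec hL hZ (hg i hi).1).2.1,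
      (hg i hi).2.1⟩, fun i hi => ?_⟩
    obtain ⟨a1, -, a3, -⟩ := hg i hi.le
    obtain ⟨b1, -, b3, -⟩ := hg (i + 1) hi
    have := f4 i (by omega)
    rw [a3, b3, hG.linked_iff _ _ ⟨_, a1, rfl⟩ ⟨_, b1, rfl⟩, near_mkRec hL hZ hw a1 b1] at this
    exact this
  · rintro ⟨f, f1, f2, f3, f4⟩
    -- An item that occurs several times has several records, so the representatives at both ends
    -- are prescribed.
    have hex : ∀ i, ∃ z : Ranked, i ≤ n → z ∈ Z ∧ z.item = f i ∧ (i = 0 → z = p) ∧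
        (i = n → z = q) := by
      intro i
      by_cases hi : i ≤ n
      · rcases Nat.eq_zero_or_pos i with rfl | h0
        · exact ⟨p, fun _ => ⟨hp, f1.symm, fun _ => rfl, fun h => by omega⟩⟩
        · rcases eq_or_ne i n with rfl | h1
          · exact ⟨q, fun _ => ⟨hq, f2.symm, fun h => by omega, fun _ => rfl⟩⟩
          · obtain ⟨z, hz, h⟩ := exists_ranked hL hZ (f3 i hi).1
            exact ⟨z, fun _ => ⟨hz, h, fun h => by omega, fun h => by omega⟩⟩
      · exact ⟨p, fun h => absurd h hi⟩
    choose g hg using hex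
    refine ⟨fun i => mkRec D k m (g i), congrArg (mkRec D k m) ((hg 0 (by omega)).2.2.1 rfl),
      congrArg (mkRec D k m) ((hg n le_rfl).2.2.2 rfl), fun i hi => (mem_recLays _).2 ⟨g i, (hg i (by omega)).1, ?_, rfl⟩,
      fun i hi => ?_⟩
    · rw [(hg i (by omega)).2.1, (f3 i (by omega)).2]
    · obtain ⟨a1, a2, -⟩ := hg i (by omega)
      obtain ⟨b1, b2, -⟩ := hg (i + 1) (by omega)
      rw [hG.linked_iff _ _ ⟨_, a1, rfl⟩ ⟨_, b1, rfl⟩, near_mkRec hL hZ hw a1 b1, a2, b2]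
      exact f4 i (by omega)

theorem unchained_iff (hL : IsRanking w l L) (hZ : IsRanking w (L.map yItem) Z) (hw : w = D * k)
    (hm : ∀ p ∈ l, p.2.1 + 2 ≤ m ∧ p.2.2.2.1 + 2 ≤ m) {n : ℕ} (hn : 0 < n) {t₀ : List Rec}
    {t : List (List Rec)} (ht : recLays D k m Z (n + 1) = t₀ :: t) :
    (∃ a ∈ t₀, ∃ b ∈ (t₀ :: t).getLast (by simp), ¬ Con (t₀ :: t) a b) ↔ Unchained l n := by
  have hlen : (recLays D k m Z (n + 1)).length = n + 1 := length_lays _ _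
  have h0 : ∀ r, r ∈ t₀ ↔ ∃ z ∈ Z, z.item.2.2.1 = 0 ∧ r = mkRec D k m z := fun r => by
    rw [← mem_recLays (n := n + 1) (by omega)]
    simp only [ht, List.getElem_cons_zero]
  have h1 : ∀ r, r ∈ (t₀ :: t).getLast (by simp) ↔ ∃ z ∈ Z, z.item.2.2.1 = n ∧
      r = mkRec D k m z := fun r => by
    rw [← mem_recLays (n := n + 1) (by omega)]
    simp only [ht, List.getLast_eq_getElem]
    have : (t₀ :: t).length = n + 1 := by rw [← ht, hlen]
    simp only [this, Nat.add_sub_cancel]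
  constructor
  · rintro ⟨a, ha, b, hb, h⟩
    obtain ⟨p, hp, hp0, rfl⟩ := (h0 a).1 ha
    obtain ⟨q, hq, hqn, rfl⟩ := (h1 b).1 hb
    rw [← ht, con_recLays_iff hL hZ hw hm hn hp hq hp0 hqn] at h
    exact ⟨_, (ranked_spec hL hZ hp).2.1, _, (ranked_spec hL hZ hq).2.1, hp0, hqn, h⟩
  · rintro ⟨p, hp, q, hq, hp0, hqn, h⟩
    obtain ⟨x, hx, rfl⟩ := exists_ranked hL hZ hp
    obtain ⟨y, hy, rfl⟩ := exists_ranked hL hZ hq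
    refine ⟨_, (h0 _).2 ⟨x, hx, hp0, rfl⟩, _, (h1 _).2 ⟨y, hy, hqn, rfl⟩, ?_⟩
    rwa [← ht, con_recLays_iff hL hZ hw hm hn hx hy hp0 hqn]

/-- A record has a unique second rank, hence comes from a single ranked item, and this item has only
one layer. This is what empties the leaves of the search tree. -/
theorem recLays_ne (hZ : IsRanking w (L.map yItem) Z) {n : ℕ} (hn : 0 < n)
    {t₀ : List Rec} {t : List (List Rec)} (ht : recLays D k m Z (n + 1) = t₀ :: t) :
    ∀ a ∈ t₀, ∀ b ∈ (t₀ :: t).getLast (by simp), a ≠ b := by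
  have hlen : (recLays D k m Z (n + 1)).length = n + 1 := length_lays _ _
  intro a ha b hb hab
  have h0 : a ∈ (recLays D k m Z (n + 1))[0] := by simpa only [ht, List.getElem_cons_zero] using ha
  have h1 : b ∈ (recLays D k m Z (n + 1))[n] := by
    have : (t₀ :: t).length = n + 1 := by rw [← ht, hlen]
    simp only [ht]
    simp only [List.getLast_eq_getElem, this, Nat.add_sub_cancel] at hb
    exact hb
  obtain ⟨p, hp, hp0, rfl⟩ := (mem_recLays _).1 h0
  obtain ⟨q, hq, hqn, rfl⟩ := (mem_recLays _).1 h1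
  have := hZ.inj p hp q hq (congrArg Rec.y hab)
  subst this
  omega

end layers

/-! ### The window, and the items of the points in it. -/

/-- Is a point in the window `[lx, hx] × [ly, hy]`? -/
noncomputable def inside (lx hx ly hy : ℝ) (p : ℝ × ℝ) : Bool :=
  !decide (p.1 < lx) && (!decide (hx < p.1) && (!decide (p.2 < ly) && !decide (hy < p.2)))

theorem inside_iff {lx hx ly hy : ℝ} {p : ℝ × ℝ} : inside lx hx ly hy p = true ↔
    lx ≤ p.1 ∧ p.1 ≤ hx ∧ ly ≤ p.2 ∧ p.2 ≤ hy := by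
  simp [inside]

/-- The item of a point, for cells that start at `(lx, ly)`. -/
noncomputable def itemOf (lx ly : ℝ) (i : ℕ) (p : ℝ × ℝ) : Item :=
  (p.1 - lx - ⌊p.1 - lx⌋₊, ⌊p.1 - lx⌋₊, i, ⌊p.2 - ly⌋₊, p.2 - ly - ⌊p.2 - ly⌋₊)

/-- The items of the points of a layer that are in the window. -/
noncomputable def layerItems (lx hx ly hy : ℝ) (l : List Item) (i : ℕ) (ps : List (ℝ × ℝ)) :
    List Item :=
  ps.foldl (fun acc p => if inside lx hx ly hy p then itemOf lx ly i p :: acc else acc) l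

/-- The items of the points of all layers that are in the window. -/
noncomputable def itemsOf (lx hx ly hy : ℝ) (s : ℕ × List Item) (ls : List (List (ℝ × ℝ))) :
    ℕ × List Item :=
  ls.foldl (fun s ps => (s.1 + 1, layerItems lx hx ly hy s.2 s.1 ps)) s

theorem mem_layerItems {lx hx ly hy : ℝ} {l : List Item} {i : ℕ} {ps : List (ℝ × ℝ)} {x : Item} :
    x ∈ layerItems lx hx ly hy l i ps ↔
      x ∈ l ∨ ∃ p ∈ ps, inside lx hx ly hy p = true ∧ x = itemOf lx ly i p := by
  induction ps generalizing l with
  | nil => simp [layerItems]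
  | cons p ps ih =>
    have h : layerItems lx hx ly hy l i (p :: ps) = layerItems lx hx ly hy
      (if inside lx hx ly hy p then itemOf lx ly i p :: l else l) i ps := rfl
    rw [h, ih]
    by_cases hp : inside lx hx ly hy p = true <;> simp [hp]
    tauto

theorem length_layerItems (lx hx ly hy : ℝ) (l : List Item) (i : ℕ) (ps : List (ℝ × ℝ)) :
    (layerItems lx hx ly hy l i ps).length ≤ l.length + ps.length := by
  induction ps generalizing l with
  | nil => simp [layerItems]
  | cons p ps ih =>
    have h : layerItems lx hx ly hy l i (p :: ps) = layerItems lx hx ly hy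
      (if inside lx hx ly hy p then itemOf lx ly i p :: l else l) i ps := rfl
    rw [h]
    refine (ih _).trans ?_
    split <;> simp <;> omega

theorem mem_itemsOf {lx hx ly hy : ℝ} {s : ℕ × List Item} {ls : List (List (ℝ × ℝ))} {x : Item} :
    x ∈ (itemsOf lx hx ly hy s ls).2 ↔ x ∈ s.2 ∨ ∃ j, ∃ p ∈ ls.getD j [],
      inside lx hx ly hy p = true ∧ x = itemOf lx ly (s.1 + j) p := by
  induction ls generalizing s with
  | nil => simp [itemsOf]
  | cons ps ls ih =>
    have h : itemsOf lx hx ly hy s (ps :: ls) =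
      itemsOf lx hx ly hy (s.1 + 1, layerItems lx hx ly hy s.2 s.1 ps) ls := rfl
    rw [h, ih, mem_layerItems, or_assoc]
    refine or_congr_right ?_
    constructor
    · rintro (⟨p, h1, h2⟩ | ⟨j, p, h1, h2⟩)
      · exact ⟨0, p, by simpa using h1, by simpa using h2⟩
      · exact ⟨j + 1, p, by simpa using h1, by simpa [Nat.add_assoc, Nat.add_comm 1] using h2⟩
    · rintro ⟨_ | j, p, h1, h2⟩
      · exact Or.inl ⟨p, by simpa using h1, by simpa using h2⟩
      · exact Or.inr ⟨j, p, by simpa using h1, by simpa [Nat.add_assoc, Nat.add_comm 1] using h2⟩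

theorem length_itemsOf (lx hx ly hy : ℝ) (s : ℕ × List Item) (ls : List (List (ℝ × ℝ))) :
    (itemsOf lx hx ly hy s ls).2.length ≤ s.2.length + (ls.map List.length).sum := by
  induction ls generalizing s with
  | nil => simp [itemsOf]
  | cons ps ls ih =>
    have h : itemsOf lx hx ly hy s (ps :: ls) =
      itemsOf lx hx ly hy (s.1 + 1, layerItems lx hx ly hy s.2 s.1 ps) ls := rfl
    rw [h]
    have := length_layerItems lx hx ly hy s.2 s.1 ps
    have := ih (s.1 + 1, layerItems lx hx ly hy s.2 s.1 ps)
    simp only [List.map_cons, List.sum_cons] at this ⊢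
    omega

theorem foldl_getLast {α : Type} (l : List α) (h : l ≠ []) (b : α) :
    l.foldl (fun _ x => x) b = l.getLast h := by
  induction l generalizing b with
  | nil => simp at h
  | cons a l ih =>
    cases l with
    | nil => rfl
    | cons a' l => exact (ih (by simp) a).trans (List.getLast_cons (by simp)).symm

section procedures

variable {I : Input}

theorem ev_inside (p : ℝ × ℝ) (lx hx ly hy : ℝ) :
    Ev procs I [enc p, enc lx, enc hx, enc ly, enc hy] pInside.body
      (enc (inside lx hx ly hy p)) 40 := by
  have h : Ev procs I [enc p, enc lx, enc hx, enc ly, enc hy] (.v 0) (enc p) 1 := Ev.v rfl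
  exact ((h.fst.rlt (Ev.v rfl)).not.and (((Ev.v rfl).rlt h.fst).not.and
    ((h.snd.rlt (Ev.v rfl)).not.and ((Ev.v rfl).rlt h.snd).not))).mono (by omega)

/-- In the absence of a floor operation the integral part is found by raising `l` in unit steps.
Inside the window `O(Δ)` steps suffice. -/
theorem ev_fl (K : ℕ) (x l : ℝ) (X : ℕ) (hl : l ≤ x) (hK : ⌊x - l⌋₊ = K) :
    Ev procs I [enc x, enc l, enc X] pFl.body
      (enc ((x - l - ⌊x - l⌋₊, X + ⌊x - l⌋₊) : ℝ × ℕ)) (30 * K + 20) := by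
  induction K generalizing l X with
  | zero =>
    have h1 := Nat.lt_floor_add_one (x - l)
    rw [hK] at h1 ⊢
    refine (Ev.ifB (U := 10) ((Ev.v (x := enc x) rfl).rlt ((Ev.v (x := enc l) rfl).add Ev.one))
      (fun h => ?_) (fun _ => ?_)).mono (by omega)
    · rw [decide_eq_false_iff_not] at h
      push_cast at h1
      linarith
    · have := Ev.prod ((Ev.v (P := procs) (I := I) (env := [enc x, enc l, enc X]) (x := enc x)
        (j := 0) rfl).sub (Ev.v (x := enc l) (j := 1) rfl)) (Ev.v (x := enc X) (j := 2) rfl)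
      simpa using this.mono (by omega)
  | succ K ih =>
    have h1 : (1 : ℝ) ≤ x - l := by
      have := Nat.floor_le (sub_nonneg.2 hl)
      rw [hK] at this
      push_cast at this
      have : (0 : ℝ) ≤ K := Nat.cast_nonneg K
      linarith
    have h2 : x - (l + 1) = x - l - 1 := by ring
    have h3 : ⌊x - (l + 1)⌋₊ = K := by
      rw [h2, Nat.floor_sub_one, hK]
      rfl
    have := ih (l + 1) (X + 1) (by linarith) h3
    have e : ((x - (l + 1) - ⌊x - (l + 1)⌋₊, X + 1 + ⌊x - (l + 1)⌋₊) : ℝ × ℕ) =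
        (x - l - ⌊x - l⌋₊, X + ⌊x - l⌋₊) := by
      rw [h3, hK]
      refine Prod.ext ?_ ?_
      · push_cast; ring
      · simp only []; omega
    rw [e] at this
    refine (Ev.ifB ((Ev.v (x := enc x) rfl).rlt ((Ev.v (x := enc l) rfl).add Ev.one))
      (fun _ => Ev.letE ((Ev.v (x := enc l) rfl).add Ev.one) (Ev.letE
        (Ev.succ (Ev.v (x := enc X) rfl)) (Ev.call (p := iFl) (xs := [0, 3, 4]) rfl rfl rfl this)))
      (fun h => ?_)).mono ?_
    · rw [decide_eq_true_eq] at h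
      linarith
    · simp only [List.length_cons, List.length_nil]
      omega

theorem ev_item (K i : ℕ) (p : ℝ × ℝ) (lx hx ly hy : ℝ) (hp : inside lx hx ly hy p = true)
    (hx' : hx ≤ lx + K) (hy' : hy ≤ ly + K) :
    Ev procs I [enc i, enc p, enc lx, enc ly] pItem.body (enc (itemOf lx ly i p))
      (60 * K + 100) := by
  obtain ⟨h1, h2, h3, h4⟩ := inside_iff.1 hp
  have k1 : ⌊p.1 - lx⌋₊ ≤ K := Nat.floor_le_of_le (by linarith)
  have k2 : ⌊p.2 - ly⌋₊ ≤ K := Nat.floor_le_of_le (by linarith)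
  have e1 := ev_fl (I := I) _ p.1 lx 0 h1 rfl
  have e2 := ev_fl (I := I) _ p.2 ly 0 h3 rfl
  rw [Nat.zero_add] at e1 e2
  refine (Ev.letE (Ev.fst (x := p) (Ev.v rfl)) (Ev.letE (Ev.snd (x := p) (Ev.v rfl))
    (Ev.letE (Ev.nat 0) (Ev.letE (Ev.call (p := iFl) (xs := [4, 2, 6]) rfl rfl rfl e1)
    (Ev.letE (Ev.call (p := iFl) (xs := [5, 3, 6]) rfl rfl rfl e2)
    ((Ev.fst (x := ((_, _) : ℝ × ℕ)) (Ev.v (j := 7) rfl)).prod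
      ((Ev.snd (x := ((_, _) : ℝ × ℕ)) (Ev.v (j := 7) rfl)).prod ((Ev.v (j := 0) rfl).prod
        ((Ev.snd (x := ((_, _) : ℝ × ℕ)) (Ev.v (j := 8) rfl)).prod
          (Ev.fst (x := ((_, _) : ℝ × ℕ)) (Ev.v (j := 8) rfl))))))))))).mono ?_
  simp only [List.length_cons, List.length_nil]
  omega

theorem ev_items (K : ℕ) (ls : List (List (ℝ × ℝ))) (lx hx ly hy : ℝ)
    (hx' : hx ≤ lx + K) (hy' : hy ≤ ly + K) :
    Ev procs I [enc ls, enc lx, enc hx, enc ly, enc hy] pItems.body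
      (enc (itemsOf lx hx ly hy (0, []) ls).2)
      ((ls.map List.length).sum * (60 * K + 200) + ls.length * 20 + 20) := by
  refine (Ev.snd (x := itemsOf lx hx ly hy (0, []) ls) (Ev.fold (β := ℕ × List Item)
    (fun s ps => (s.1 + 1, layerItems lx hx ly hy s.2 s.1 ps)) (0, [])
    (fun ps => ps.length * (60 * K + 200) + 10) (Ev.v rfl) ((Ev.nat 0).prod Ev.nil)
    fun s ps _ => ?_)).mono ?_
  · have hs : Ev procs I [enc ls, enc lx, enc hx, enc ly, enc hy, enc s, enc ps] (.v 5) (enc s) 1 :=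
      Ev.v rfl
    refine (Ev.prod (y := layerItems lx hx ly hy s.2 s.1 ps) hs.fst.succ (Ev.foldU
      (fun acc p => if inside lx hx ly hy p then itemOf lx ly s.1 p :: acc else acc) s.2
      (60 * K + 180) (Ev.v rfl) hs.snd fun acc p hp => ?_)).mono (by
        have : ps.length * (60 * K + 180 + 1) ≤ ps.length * (60 * K + 200) :=
          Nat.mul_le_mul_left _ (by omega)
        omega)
    refine (Ev.letE (Ev.call (p := iInside) (xs := [8, 1, 2, 3, 4]) rfl rfl rfl
      (ev_inside p lx hx ly hy)) (Ev.ifB (U := 60 * K + 120)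
      (Ev.v (x := enc (inside lx hx ly hy p)) rfl) (fun h => ?_) (fun h => ?_))).mono (by
        simp only [List.length_cons, List.length_nil]; omega)
    · rw [h]
      exact (Ev.v (x := enc acc) rfl).mono (by omega)
    · rw [if_pos h]
      exact (Ev.letE (Ev.fst (x := s) (Ev.v rfl)) (Ev.letE
        (Ev.call (p := iItem) (xs := [10, 8, 1, 3]) rfl rfl rfl
          (ev_item K s.1 p lx hx ly hy h hx' hy')) (Ev.cons (Ev.v rfl) (Ev.v rfl)))).mono (by
            simp only [List.length_cons, List.length_nil]; omega)
  · have : (ls.map fun ps => ps.length * (60 * K + 200) + 10 + 1).sum =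
        (ls.map List.length).sum * (60 * K + 200) + ls.length * 11 := by
      clear hx' hy'
      induction ls with
      | nil => simp
      | cons ps ls ih => simp only [List.map_cons, List.sum_cons, List.length_cons, ih]; ring
    omega

theorem ev_anyOut (ps : List (ℝ × ℝ)) (lx hx ly hy : ℝ) :
    Ev procs I [enc ps, enc lx, enc hx, enc ly, enc hy] pAnyOut.body
      (enc (ps.any fun p => !inside lx hx ly hy p)) (ps.length * 60 + 10) := by
  refine (Ev.any (fun p => !inside lx hx ly hy p) 50 (Ev.v rfl) fun acc p _ => ?_).mono (by omega)
  refine (Ev.letE (Ev.call (p := iInside) (xs := [6, 1, 2, 3, 4]) rfl rfl rfl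
    (ev_inside p lx hx ly hy)) (Ev.ifB (U := 1) (Ev.v (x := enc (inside lx hx ly hy p)) rfl)
      (fun h => ?_) (fun h => ?_))).mono (by simp)
  · rw [h]
    simpa using Ev.tt
  · rw [h]
    exact Ev.v (by simp)

theorem ev_addR (k : ℕ) (x : ℝ) :
    Ev procs I [enc k, enc x] pAddR.body (enc (x + k)) (15 * k + 10) := by
  induction k generalizing x with
  | zero =>
    exact (Ev.ifN (U := 1) (Ev.v (x := enc 0) rfl) (fun _ => Ev.v (by simp)) (by simp)).mono
      (by simp)
  | succ k ih =>
    have := ih (x + 1)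
    rw [show x + 1 + (k : ℝ) = x + ((k + 1 : ℕ) : ℝ) by push_cast; ring] at this
    exact (Ev.ifN (Ev.v (x := enc (k + 1)) rfl) (by simp) fun _ =>
      Ev.letE (Ev.pred (Ev.v (x := enc (k + 1)) rfl)) (Ev.letE ((Ev.v (x := enc x) rfl).add Ev.one)
        (Ev.call (p := iAddR) (xs := [2, 3]) rfl rfl rfl this))).mono (by simp; omega)

theorem ev_subR (k : ℕ) (x : ℝ) :
    Ev procs I [enc k, enc x] pSubR.body (enc (x - k)) (15 * k + 10) := by
  induction k generalizing x with
  | zero =>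
    exact (Ev.ifN (U := 1) (Ev.v (x := enc 0) rfl) (fun _ => Ev.v (by simp)) (by simp)).mono
      (by simp)
  | succ k ih =>
    have := ih (x - 1)
    rw [show x - 1 - (k : ℝ) = x - ((k + 1 : ℕ) : ℝ) by push_cast; ring] at this
    exact (Ev.ifN (Ev.v (x := enc (k + 1)) rfl) (by simp) fun _ =>
      Ev.letE (Ev.pred (Ev.v (x := enc (k + 1)) rfl)) (Ev.letE ((Ev.v (x := enc x) rfl).sub Ev.one)
        (Ev.call (p := iSubR) (xs := [2, 3]) rfl rfl rfl this))).mono (by simp; omega)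

theorem ev_last {α : Type} [Enc α] {env : List Val} {e : Ex} {ls : List (List α)} (h : ls ≠ [])
    {T : ℕ} (he : Ev procs I env e (enc ls) T) :
    Ev procs I env (.fold e (.nat 0) (.ix 0)) (enc (ls.getLast h)) (T + 2 * ls.length + 2) := by
  rw [← foldl_getLast ls h []]
  exact (Ev.foldU (fun _ x => x) [] 1 he Ev.nil fun acc x _ => Ev.ix0).mono (by omega)

end procedures

/-! ### Choice of the parameters, and the decision procedure for items. -/

section search

variable {I : Input} {w k D m : ℕ} {l : List Item} {L : List (Item × Bits)} {Z : List Ranked}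

theorem length_ranked (hL : IsRanking w l L) (hZ : IsRanking w (L.map yItem) Z) :
    Z.length = l.length := by
  have h1 := hL.perm.length_eq
  have h2 := hZ.perm.length_eq
  simp only [List.length_map] at h1 h2
  omega

theorem tot_recLays_le (hL : IsRanking w l L) (hZ : IsRanking w (L.map yItem) Z) (n : ℕ) :
    tot (recLays D k m Z n) ≤ l.length := by
  refine (tot_lays_le _ _).trans ?_
  rw [List.length_map, length_ranked hL hZ]

/-- The search tree decides the chain problem. -/
theorem ev_search (hL : IsRanking w l L) (hZ : IsRanking w (L.map yItem) Z) (hw : w = D * k)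
    (hD : 0 < D) (hm : ∀ p ∈ l, p.2.1 + 2 ≤ m + 1 ∧ p.2.2.2.1 + 2 ≤ m + 1) {n : ℕ} (hn : 0 < n)
    {t₀ : List Rec} {t : List (List Rec)} (ht : recLays D k (m + 1) Z (n + 1) = t₀ :: t) :
    ∃ z : Bool, (z = true ↔ Unchained l n) ∧
      Ev procs I [enc 0, enc (t₀ :: t), enc (t₀.map fun r => ((r, []) : Rec × List Bits)),
        enc (((t₀ :: t).getLast (by simp)).map fun r => ((r, []) : Rec × List Bits)), enc D,
        enc (allTests n m), enc (List.replicate w false)] pTree.body (enc z)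
        (costStep w (n + 1) D (n * (m * (m * 2))) w (List.replicate 4 (m + 1 + w)) * 2 ^ (k + 1) *
          l.length * (D + 1) + 10) := by
  have hG := good_mkRec (m := m + 1) hL hZ hw hm
  rw [Nat.add_sub_cancel] at hG
  have hlen : (t₀ :: t).length = n + 1 := by rw [← ht]; exact length_lays _ _
  have hR : ∀ l ∈ t₀ :: t, ∀ r ∈ l, ∃ z ∈ Z, r = mkRec D k (m + 1) z := by
    rw [← ht]; exact recLays_spec _
  have htot : tot (t₀ :: t) ≤ l.length := by rw [← ht]; exact tot_recLays_le hL hZ _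
  have hcnt := cnt_le_tot (strs k) 0 (t₀ :: t)
  have hkw : k ≤ w := by rw [hw]; exact Nat.le_mul_of_pos_left k hD
  classical
  refine ⟨decide (Unchained l n), by simp, ?_⟩
  -- At the root the prefix is empty, all columns are still to be treated and the vectors are empty,
  -- so a bad pair is just a pair without a chain.
  have h := hG.ev_tree (I := I) (n + 1) (allTests n m)
    (fun τ => by rw [mem_allTests]; omega) w le_rfl hkw D 0 (Nat.zero_add D) t₀ t hlen hR []
    (by simp) (recLays_ne hZ hn ht) (((t₀ :: t).getLast (by simp)).map fun r => (r, []))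
    (by simp [Function.comp_def]) (by simp) _ (strs k) rfl (t₀.map fun r => (r, []))
    (by
      rw [List.map_map]
      simp only [Function.comp_def, List.map_id']
      refine (List.filter_eq_self.2 fun r hr => ?_).symm
      rw [decide_eq_true_eq]
      exact mem_strs (hG.col_len (hR t₀ (by simp) r hr) hD).le)
    (by simp) (decide (Unchained l n)) (by
      rw [decide_eq_true_eq, ← unchained_iff hL hZ hw hm hn ht, BadPair]
      simp only [List.mem_map, exists_exists_and_eq_and, keysLE, true_and])
  refine h.mono ?_
  rw [length_allTests]
  have hs : (strs k).card ≤ 2 ^ (k + 1) := by have := card_strs k; omega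
  set W := costStep w (n + 1) D (n * (m * (m * 2))) w (List.replicate 4 (m + 1 + w))
  calc _ ≤ W * 2 ^ (k + 1) * l.length + W * 2 ^ (k + 1) * D * l.length + 10 := by gcongr; omega
    _ = _ := by ring

/-- Brute force decides the chain problem. -/
theorem ev_bruteSearch (hL : IsRanking w l L) (hZ : IsRanking w (L.map yItem) Z) (hw : w = D * k)
    (hm : ∀ p ∈ l, p.2.1 + 2 ≤ m ∧ p.2.2.2.1 + 2 ≤ m) {n : ℕ} (hn : 0 < n)
    {t₀ : List Rec} {t : List (List Rec)} (ht : recLays D k m Z (n + 1) = t₀ :: t) :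
    ∃ z : Bool, (z = true ↔ Unchained l n) ∧
      Ev procs I [enc t₀, enc t] pBrute.body (enc z)
        (l.length * (n * (2 * l.length * propK 1 (List.replicate 4 (m + w)) + 61) +
          10 * l.length + 60) + 10) := by
  have hG := good_mkRec (m := m) hL hZ hw hm
  have hlen : (t₀ :: t).length = n + 1 := by rw [← ht]; exact length_lays _ _
  have hR : ∀ l ∈ t₀ :: t, ∀ r ∈ l, ∃ z ∈ Z, r = mkRec D k m z := by
    rw [← ht]; exact recLays_spec _
  have htot : tot (t₀ :: t) ≤ l.length := by rw [← ht]; exact tot_recLays_le hL hZ _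
  have hne : t ≠ [] := by rintro rfl; simp at hlen; omega
  refine ⟨t₀.any (missed t), ?_, ?_⟩
  · rw [← unchained_iff hL hZ hw hm hn ht, List.any_eq_true]
    refine exists_congr fun a => and_congr_right fun ha => ?_
    rw [missed_iff hne ha, List.getLast_cons hne]
  · have h := ev_brute (I := I) l.length (List.replicate 4 (m + w)) t₀ t
      (fun l' hl' r hr => hG.shape r (hR l' hl' r hr)) (fun l' hl' => (length_le_tot hl').trans htot)
    have : t.length = n := by simpa using hlen
    rwa [this] at h

/-- The logarithm, as the program computes it. -/
def lgN (N : ℕ) : ℕ := Nat.clog 2 N + 1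

/-- Up to constants, the logarithm of the factor by which each level of the tree raises the cost of
dominance: `O(n³)` tests, each with a key of `O(log N)` bits. -/
def parQ (n N : ℕ) : ℕ := n * n * n * lgN (lgN N)

/-- The number of levels of the search tree. -/
def parD (n N : ℕ) : ℕ := Nat.sqrt (lgN N / parQ n N)

/-- With zero levels brute force is used; the ranks are still cut, into a single chunk. -/
def parD' (n N : ℕ) : ℕ := if parD n N = 0 then 1 else parD n N

/-- The length of the chunks. -/
def parK (n N : ℕ) : ℕ := (lgN N) ⌈/⌉ (parD' n N)

def costBrute (n N w : ℕ) : ℕ :=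
  N * (n * (2 * N * propK 1 (List.replicate 4 (6 * n + 2 + w)) + 61) + 10 * N + 60)

def costTree (n N D k w : ℕ) : ℕ :=
  costStep w (n + 1) D (n * ((6 * n + 1) * ((6 * n + 1) * 2))) w
    (List.replicate 4 (6 * n + 1 + 1 + w)) * 2 ^ (k + 1) * N * (D + 1)

/-- The cost of everything but the search itself. -/
def costPrep (n N : ℕ) : ℕ :=
  80 * N + 120 * lgN N + 15 * (n * n) + 15 * (n * n * n) + 105 * n + 15 * parQ n N +
    35 * lgN (lgN N) + (parD n N + 1) * (300 * lgN N + 100 * parQ n N + 300) +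
    (parK n N + 1) * (15 * (parD' n N * parK n N) + 35 * parK n N + 100) +
    15 * (parD' n N * parK n N) + 35 * parK n N +
    N * (300 * Nat.clog 2 N + 120 * (parD' n N * parK n N) + 300 * (6 * n + 2) +
      parD' n N * (35 * parK n N + 60) + 1200) + 40 * (parD' n N * parK n N) +
    (n + 1) * (40 * N + 70) + 40 * N +
    n * ((6 * n + 1) * ((6 * n + 1) * 20 + 10) + 30) + 50 * (6 * n + 1) + 1000

def costDecide (n N : ℕ) : ℕ :=
  costPrep n N + (if parD n N = 0 then costBrute n N (parD' n N * parK n N) else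
    costTree n N (parD n N) (parK n N) (parD' n N * parK n N))

theorem le_two_pow_lgN (N : ℕ) : N ≤ 2 ^ lgN N := by
  have := Nat.le_pow_clog (b := 2) (by norm_num) N
  rw [lgN, pow_succ]
  omega

set_option maxHeartbeats 1000000 in
theorem ev_decide (n : ℕ) (hn : 0 < n) (l : List Item)
    (hl : ∀ p ∈ l, p.2.1 ≤ 6 * n ∧ p.2.2.2.1 ≤ 6 * n) :
    ∃ z : Bool, (z = true ↔ Unchained l n) ∧ Ev procs I [enc n, enc (6 * n), enc l] pDecide.body
      (enc z) (costDecide n l.length) := by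
  obtain ⟨N, hN⟩ : ∃ N, N = l.length := ⟨_, rfl⟩
  rw [← hN]
  obtain ⟨lg, hlg⟩ : ∃ x, x = lgN N := ⟨_, rfl⟩
  obtain ⟨ll, hll⟩ : ∃ x, x = lgN lg := ⟨_, rfl⟩
  obtain ⟨q, hq⟩ : ∃ x, x = n * n * n * ll := ⟨_, rfl⟩
  have hq' : q = parQ n N := by rw [hq, hll, hlg, parQ]
  obtain ⟨d, hd⟩ : ∃ x, x = Nat.sqrt (lg / q) := ⟨_, rfl⟩
  have hd' : d = parD n N := by rw [hd, hq', hlg, parD]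
  obtain ⟨e, he⟩ : ∃ x, x = if d = 0 then 1 else d := ⟨_, rfl⟩
  have he' : e = parD' n N := by rw [he, hd', parD']
  have he0 : 0 < e := by rw [he]; split <;> omega
  obtain ⟨k, hk⟩ : ∃ x, x = lg ⌈/⌉ e := ⟨_, rfl⟩
  have hk' : k = parK n N := by rw [hk, he', hlg, parK]
  have hkj : ∀ j, k ≤ j ↔ lg ≤ e * j := fun j => by rw [hk, ceilDiv_le_iff_le_mul he0]
  obtain ⟨w, hw⟩ : ∃ x, x = e * k := ⟨_, rfl⟩
  have hlw : lg ≤ w := by rw [hw]; exact (hkj k).1 le_rfl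
  have hq0 : 0 < q := by
    rw [hq, hll]; exact Nat.mul_pos (by positivity) (by simp [lgN])
  have c1 := ev_lg (I := I) N l hN.symm
  rw [← hN, show Nat.clog 2 N + 1 = lg from hlg.symm] at c1
  have c2 := ev_lg (I := I) lg (List.range lg).reverse (by simp)
  rw [List.length_reverse, List.length_range, show Nat.clog 2 lg + 1 = ll from hll.symm] at c2
  have c3 := ev_findD (I := I) 0 q lg hq0 (Nat.zero_le _)
  rw [← hd] at c3
  have c4 := ev_findK (I := I) 0 e lg k hkj (Nat.zero_le _)
  have c7 := ev_mul (I := I) (n * n * n) ll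
  rw [← hq] at c7
  have c8 := ev_mul (I := I) e k
  rw [← hw] at c8
  have c9 : Ev procs I [enc n, enc (6 * n), enc l, enc lg, enc (List.range lg).reverse, enc ll,
      enc (n * n), enc (n * n * n), enc q, enc 0, enc d] (.ifz (.v 10) (.nat 1) (.v 10)) (enc e) 3 :=
    Ev.ifN (U := 1) (Ev.v (x := enc d) rfl) (fun h => by rw [he, if_pos h]; exact Ev.nat 1)
      (fun h => by rw [he, if_neg h]; exact Ev.v rfl)
  have hNw : l.length ≤ 2 ^ w :=
    (le_two_pow_lgN _).trans (Nat.pow_le_pow_right (by norm_num) (by rw [← hN, ← hlg]; exact hlw))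
  obtain ⟨L, Z, hL, hZ, c5⟩ := ev_recs (I := I) e k w (6 * n + 2) l hNw
  rw [← hN] at c5
  have hZl : Z.length = N := by rw [length_ranked hL hZ, hN]
  set out : List (ℕ × Rec) := Z.map fun z => (z.item.2.2.1, mkRec e k (6 * n + 2) z) with hout
  have c6 := ev_lays (I := I) out (n + 1)
  rw [show out.length = N by rw [hout, List.length_map, hZl]] at c6
  have hlays : lays out (n + 1) = recLays e k (6 * n + 2) Z (n + 1) := rfl
  have hlen : (recLays e k (6 * n + 2) Z (n + 1)).length = n + 1 := length_lays _ _
  have htot := tot_recLays_le (D := e) (k := k) (m := 6 * n + 2) hL hZ (n + 1)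
  rcases ht : recLays e k (6 * n + 2) Z (n + 1) with _ | ⟨t₀, t⟩
  · rw [ht] at hlen; simp at hlen
  rw [hlays, ht] at c6
  rw [ht] at hlen htot
  have hm : ∀ p ∈ l, p.2.1 + 2 ≤ 6 * n + 2 ∧ p.2.2.2.1 + 2 ≤ 6 * n + 2 := fun p hp => by
    have := hl p hp; omega
  obtain ⟨z, hz, T, hT, hfin⟩ : ∃ z : Bool, (z = true ↔ Unchained l n) ∧ ∃ T,
      T ≤ 40 * N + 20 * w + n * ((6 * n + 1) * ((6 * n + 1) * 20 + 10) + 30) + 50 * (6 * n + 1) +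
        8 * n + 300 + (if d = 0 then costBrute n N w else costTree n N d k w) ∧
      Ev procs I [enc n, enc (6 * n), enc l, enc lg, enc (List.range lg).reverse, enc ll,
        enc (n * n), enc (n * n * n), enc q, enc 0, enc d, enc e, enc k, enc w, enc (6 * n + 2),
        enc out, enc (n + 1), enc (t₀ :: t), enc t₀, enc t] (.ifz (.v 10) (.call iBrute [18, 19])
        (lets [.fold (.v 17) (.nat 0) (.ix 0), mapE (.v 18) (.cons (.ix 0) (.nat 0)),
          mapE (.v 20) (.cons (.ix 0) (.nat 0)), .succ (.v 1), .call iTests [0, 23],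
          .call iZeros [13]] (.call iTree [9, 17, 21, 22, 10, 24, 25]))) (enc z) T := by
    by_cases hd0 : d = 0
    · obtain ⟨z, hz, h⟩ := ev_bruteSearch (I := I) hL hZ hw hm hn ht
      refine ⟨z, hz, _, ?_, Ev.ifN (Ev.v (x := enc d) rfl)
        (fun _ => Ev.call (p := iBrute) (xs := [18, 19]) rfl rfl rfl h) (fun h => absurd hd0 h)⟩
      rw [if_pos hd0, costBrute, ← hN]
      simp only [List.length_cons, List.length_nil]
      omega
    · have hed : e = d := by rw [he, if_neg hd0]
      rw [hed] at hw ht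
      obtain ⟨z, hz, h⟩ := ev_search (I := I) (m := 6 * n + 1) hL hZ hw (by omega) hm hn ht
      have hlast : ((t₀ :: t).getLast (by simp)).length ≤ N := by
        rw [hN]; exact (length_le_tot (List.getLast_mem _)).trans htot
      have ht0 : t₀.length ≤ N := by
        rw [hN]; exact (length_le_tot (List.mem_cons_self ..)).trans htot
      refine ⟨z, hz, _, ?_, Ev.ifN (Ev.v (x := enc d) rfl) (fun h => absurd h hd0)
        (fun _ => Ev.letE (ev_last (by simp) (Ev.v (x := enc (t₀ :: t)) rfl))
        (Ev.letE (Ev.map (l := t₀) (fun r => ((r, []) : Rec × List Bits)) 3 (Ev.v rfl)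
          fun acc r _ => Ev.ix0.prod (Ev.nil (α := Bits)))
        (Ev.letE (Ev.map (l := (t₀ :: t).getLast (by simp)) (fun r => ((r, []) : Rec × List Bits)) 3
          (Ev.v rfl) fun acc r _ => Ev.ix0.prod (Ev.nil (α := Bits)))
        (Ev.letE (Ev.succ (Ev.v (x := enc (6 * n)) rfl))
        (Ev.letE (Ev.call (p := iTests) (xs := [0, 23]) rfl rfl rfl (ev_tests n (6 * n + 1)))
        (Ev.letE (Ev.call (p := iZeros) (xs := [13]) rfl rfl rfl (ev_zeros w))
        (Ev.call (p := iTree) (xs := [9, 17, 21, 22, 10, 24, 25]) rfl rfl rfl h)))))))⟩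
      rw [if_neg hd0, costTree, ← hN, hlen]
      simp only [List.length_cons, List.length_nil]
      omega
  set fin : Ex := .ifz (.v 10) (.call iBrute [18, 19])
    (lets [.fold (.v 17) (.nat 0) (.ix 0), mapE (.v 18) (.cons (.ix 0) (.nat 0)),
      mapE (.v 20) (.cons (.ix 0) (.nat 0)), .succ (.v 1), .call iTests [0, 23],
      .call iZeros [13]] (.call iTree [9, 17, 21, 22, 10, 24, 25])) with hfindef
  have s3 : Ev procs I [enc n, enc (6 * n), enc l, enc lg, enc (List.range lg).reverse, enc ll,
      enc (n * n), enc (n * n * n), enc q, enc 0, enc d, enc e, enc k, enc w, enc (6 * n + 2)]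
      (lets [.call iRecs [2, 11, 12, 13, 14], .succ (.v 0), .call iLays [15, 16],
        .car (.v 17), .cdr (.v 17)] fin) (enc z) _ :=
    Ev.letE (Ev.call (p := iRecs) (xs := [2, 11, 12, 13, 14]) rfl rfl rfl c5)
    (Ev.letE (Ev.succ (Ev.v (x := enc n) rfl))
    (Ev.letE (Ev.call (p := iLays) (xs := [15, 16]) rfl rfl rfl c6)
    (Ev.letE (Ev.head (x := t₀) (l := t) (Ev.v rfl)) (Ev.letE (Ev.tail (x := t₀) (l := t) (Ev.v rfl))
      hfin))))
  have s2 : Ev procs I [enc n, enc (6 * n), enc l, enc lg, enc (List.range lg).reverse, enc ll,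
      enc (n * n), enc (n * n * n), enc q, enc 0]
      (lets [.call iFindD [9, 8, 3], .ifz (.v 10) (.nat 1) (.v 10), .call iFindK [9, 11, 3],
        .call iMul [11, 12], .succ (.succ (.v 1)), .call iRecs [2, 11, 12, 13, 14], .succ (.v 0),
        .call iLays [15, 16], .car (.v 17), .cdr (.v 17)] fin) (enc z) _ :=
    Ev.letE (Ev.call (p := iFindD) (xs := [9, 8, 3]) rfl rfl rfl c3)
    (Ev.letE c9
    (Ev.letE (Ev.call (p := iFindK) (xs := [9, 11, 3]) rfl rfl rfl c4)
    (Ev.letE (Ev.call (p := iMul) (xs := [11, 12]) rfl rfl rfl c8)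
    (Ev.letE (Ev.succ (Ev.succ (Ev.v (x := enc (6 * n)) rfl))) s3))))
  refine ⟨z, hz, (Ev.letE (Ev.call (p := iLg) (xs := [2]) rfl rfl rfl c1)
    (Ev.letE (Ev.call (p := iIota) (xs := [3]) rfl rfl rfl (ev_iota lg))
    (Ev.letE (Ev.call (p := iLg) (xs := [4]) rfl rfl rfl c2)
    (Ev.letE (Ev.call (p := iMul) (xs := [0, 0]) rfl rfl rfl (ev_mul n n))
    (Ev.letE (Ev.call (p := iMul) (xs := [6, 0]) rfl rfl rfl (ev_mul (n * n) n))
    (Ev.letE (Ev.call (p := iMul) (xs := [7, 5]) rfl rfl rfl c7)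
    (Ev.letE (Ev.nat 0) s2))))))).mono ?_⟩
  rw [costDecide, costPrep, ← hq', ← hd', ← he', ← hk', ← hlg, ← hll, ← hw]
  simp only [List.length_cons, List.length_nil, Nat.sub_zero]
  generalize (if d = 0 then costBrute n N w else costTree n N d k w) = Y at hT ⊢
  generalize (6 * n + 1) * ((6 * n + 1) * 20 + 10) = Y1 at hT ⊢
  have e1 : (n + 1) * (40 * N + 70) = (n + 1) * (40 * N + 50) + 20 * n + 20 := by ring
  omega

end search

/-! ### Geometry of unit squares: coordinates, cells and the window. -/

theorem squaresMeet_iff (p q : ℝ × ℝ) : SquaresMeet p q ↔ |p.1 - q.1| ≤ 1 ∧ |p.2 - q.2| ≤ 1 := by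
  have key : ∀ x y : ℝ, (Set.Icc (x - 1 / 2) (x + 1 / 2) ∩ Set.Icc (y - 1 / 2) (y + 1 / 2)).Nonempty ↔
      |x - y| ≤ 1 := by
    intro x y
    rw [Set.Icc_inter_Icc, Set.nonempty_Icc, sup_le_iff, le_inf_iff, le_inf_iff, abs_le]
    constructor
    · rintro ⟨⟨-, h⟩, h', -⟩; constructor <;> linarith
    · rintro ⟨h, h'⟩; refine ⟨⟨?_, ?_⟩, ?_, ?_⟩ <;> linarith
  rw [SquaresMeet, unitSquare, unitSquare, Set.prod_inter_prod, Set.prod_nonempty_iff, key, key]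

/-- Let `x - l = X + f` and `y - l = Y + g` with integral parts `X`, `Y`. A distance of at most 1
forces `X` and `Y` to differ by at most one. For `Y = X + 1` the difference `y - x` is `1 + g - f`,
so the condition is `g ≤ f`; for `X = Y` it holds automatically. -/
theorem abs_sub_le_one_iff {l x y : ℝ} (hx : l ≤ x) (hy : l ≤ y) : |x - y| ≤ 1 ↔
    (⌊y - l⌋₊ ≤ ⌊x - l⌋₊ + 1 ∧ ⌊x - l⌋₊ ≤ ⌊y - l⌋₊ + 1 ∧
      (⌊x - l⌋₊ < ⌊y - l⌋₊ → y - l - ⌊y - l⌋₊ ≤ x - l - ⌊x - l⌋₊) ∧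
      (⌊y - l⌋₊ < ⌊x - l⌋₊ → x - l - ⌊x - l⌋₊ ≤ y - l - ⌊y - l⌋₊)) := by
  have a1 := Nat.floor_le (sub_nonneg.2 hx)
  have a2 := Nat.lt_floor_add_one (x - l)
  have b1 := Nat.floor_le (sub_nonneg.2 hy)
  have b2 := Nat.lt_floor_add_one (y - l)
  generalize ⌊x - l⌋₊ = X at *
  generalize ⌊y - l⌋₊ = Y at *
  rw [abs_le]
  constructor
  · rintro ⟨h1, h2⟩
    have h3 : Y < X + 2 := by
      have : (Y : ℝ) < (X + 2 : ℕ) := by push_cast; linarith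
      exact_mod_cast this
    have h4 : X < Y + 2 := by
      have : (X : ℝ) < (Y + 2 : ℕ) := by push_cast; linarith
      exact_mod_cast this
    refine ⟨by omega, by omega, fun h => ?_, fun h => ?_⟩
    · obtain rfl : Y = X + 1 := by omega
      push_cast; linarith
    · obtain rfl : X = Y + 1 := by omega
      push_cast; linarith
  · rintro ⟨h1, h2, h3, h4⟩
    rcases lt_trichotomy X Y with h | rfl | h
    · obtain rfl : Y = X + 1 := by omega
      have := h3 h
      push_cast at *
      constructor <;> linarith
    · constructor <;> linarith
    · obtain rfl : X = Y + 1 := by omega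
      have := h4 h
      push_cast at *
      constructor <;> linarith

theorem itemNear_itemOf {lx hx ly hy : ℝ} {p q : ℝ × ℝ} {i j : ℕ}
    (hp : inside lx hx ly hy p = true) (hq : inside lx hx ly hy q = true) :
    ItemNear (itemOf lx ly i p) (itemOf lx ly j q) ↔ SquaresMeet p q := by
  obtain ⟨p1, -, p2, -⟩ := inside_iff.1 hp
  obtain ⟨q1, -, q2, -⟩ := inside_iff.1 hq
  rw [squaresMeet_iff, abs_sub_le_one_iff p1 q1, abs_sub_le_one_iff p2 q2]
  rfl

/-- There is a chain of points from `a` to `b`, one in each layer. -/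
def PointChain (ls : List (List (ℝ × ℝ))) (n : ℕ) (a b : ℝ × ℝ) : Prop :=
  ∃ f : ℕ → ℝ × ℝ, f 0 = a ∧ f n = b ∧ (∀ i ≤ n, f i ∈ ls.getD i []) ∧
    ∀ i < n, SquaresMeet (f i) (f (i + 1))

/-- All points of the first layer and all points of the last layer are joined by chains. -/
def Chained (ls : List (List (ℝ × ℝ))) (n : ℕ) : Prop :=
  ∀ a ∈ ls.getD 0 [], ∀ b ∈ ls.getD n [], PointChain ls n a b

theorem abs_chain_le {f : ℕ → ℝ × ℝ} {n : ℕ} (h : ∀ i < n, SquaresMeet (f i) (f (i + 1))) :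
    ∀ i ≤ n, |(f i).1 - (f 0).1| ≤ i ∧ |(f i).2 - (f 0).2| ≤ i := by
  intro i
  induction i with
  | zero => simp
  | succ i ih =>
    intro hi
    obtain ⟨h1, h2⟩ := ih (by omega)
    obtain ⟨h3, h4⟩ := (squaresMeet_iff _ _).1 (h i hi)
    rw [abs_le] at *
    push_cast
    exact ⟨⟨by linarith, by linarith⟩, abs_le.2 ⟨by linarith, by linarith⟩⟩

theorem PointChain.abs_le {ls : List (List (ℝ × ℝ))} {n : ℕ} {a b : ℝ × ℝ}
    (h : PointChain ls n a b) : |b.1 - a.1| ≤ n ∧ |b.2 - a.2| ≤ n := by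
  obtain ⟨f, rfl, rfl, -, h⟩ := h
  exact abs_chain_le h n le_rfl

/-- Both `a` and `c` are joined to `b`, hence within `n` of it. Two points of the first layer are
compared through a point of the last one, which therefore has to exist. -/
theorem Chained.abs_le {ls : List (List (ℝ × ℝ))} {n : ℕ} (h : Chained ls n) {a b c : ℝ × ℝ}
    (ha : a ∈ ls.getD 0 []) (hb : b ∈ ls.getD n []) (hc : c ∈ ls.getD 0 []) :
    |a.1 - c.1| ≤ 2 * n ∧ |a.2 - c.2| ≤ 2 * n ∧ |b.1 - c.1| ≤ n ∧ |b.2 - c.2| ≤ n := by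
  obtain ⟨h1, h2⟩ := (h a ha b hb).abs_le
  obtain ⟨h3, h4⟩ := (h c hc b hb).abs_le
  refine ⟨?_, ?_, h3, h4⟩ <;> rw [_root_.abs_le] at * <;> constructor <;> linarith

/-- The window around a point. -/
noncomputable def window (n : ℕ) (c : ℝ × ℝ) : ℝ × ℝ → Bool :=
  inside (c.1 - (n + n + n : ℕ)) (c.1 + (n + n + n : ℕ)) (c.2 - (n + n + n : ℕ))
    (c.2 + (n + n + n : ℕ))

noncomputable def windowItems (n : ℕ) (c : ℝ × ℝ) (ls : List (List (ℝ × ℝ))) : List Item :=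
  (itemsOf (c.1 - (n + n + n : ℕ)) (c.1 + (n + n + n : ℕ)) (c.2 - (n + n + n : ℕ))
    (c.2 + (n + n + n : ℕ)) (0, []) ls).2

theorem window_of_abs {n : ℕ} {c p : ℝ × ℝ} (h1 : |p.1 - c.1| ≤ 3 * n) (h2 : |p.2 - c.2| ≤ 3 * n) :
    window n c p = true := by
  rw [abs_le] at h1 h2
  rw [window, inside_iff]
  push_cast
  exact ⟨by linarith, by linarith, by linarith, by linarith⟩

theorem mem_windowItems {n : ℕ} {c : ℝ × ℝ} {ls : List (List (ℝ × ℝ))} {x : Item} :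
    x ∈ windowItems n c ls ↔ ∃ j, ∃ p ∈ ls.getD j [], window n c p = true ∧
      x = itemOf (c.1 - (n + n + n : ℕ)) (c.2 - (n + n + n : ℕ)) j p := by
  rw [windowItems, mem_itemsOf]
  simp [window]

theorem Chained.window {ls : List (List (ℝ × ℝ))} {n : ℕ} (h : Chained ls n) {a b c : ℝ × ℝ}
    (ha : a ∈ ls.getD 0 []) (hb : b ∈ ls.getD n []) (hc : c ∈ ls.getD 0 []) :
    window n c a = true ∧ window n c b = true := by
  obtain ⟨h1, h2, h3, h4⟩ := h.abs_le ha hb hc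
  have : (0 : ℝ) ≤ n := Nat.cast_nonneg n
  exact ⟨window_of_abs (by linarith) (by linarith), window_of_abs (by linarith) (by linarith)⟩

/-- If all pairs are joined, every chain between the end layers stays in the window: its points are
within `n` of its start, which is within `2 * n` of `c`. So discarding the points outside destroys a
chain only if the answer is negative anyway. Conversely, a chain of items comes from a chain of
points. -/
theorem unchained_windowItems {ls : List (List (ℝ × ℝ))} {n : ℕ} (hn : 0 < n) {c : ℝ × ℝ}
    (hc : c ∈ ls.getD 0 []) (h0 : ∀ a ∈ ls.getD 0 [], window n c a = true)
    (h1 : ∀ b ∈ ls.getD n [], window n c b = true) :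
    Unchained (windowItems n c ls) n ↔ ¬ Chained ls n := by
  set lx := c.1 - (n + n + n : ℕ)
  set ly := c.2 - (n + n + n : ℕ)
  constructor
  · rintro ⟨p, hp, q, hq, hp0, hqn, h⟩ hch
    obtain ⟨i, a, ha, -, rfl⟩ := mem_windowItems.1 hp
    obtain ⟨j, b, hb, -, rfl⟩ := mem_windowItems.1 hq
    obtain rfl : i = 0 := hp0
    obtain rfl : j = n := hqn
    obtain ⟨f, f1, f2, f3, f4⟩ := hch a ha b hb
    have hw : ∀ i ≤ j, window j c (f i) = true := by
      intro i hi
      obtain ⟨k1, k2⟩ := abs_chain_le f4 i hi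
      obtain ⟨k3, k4, -, -⟩ := hch.abs_le ha hb hc
      rw [f1] at k1 k2
      have hi' : (i : ℝ) ≤ j := by exact_mod_cast hi
      rw [abs_le] at k1 k2 k3 k4
      exact window_of_abs (abs_le.2 ⟨by linarith, by linarith⟩)
        (abs_le.2 ⟨by linarith, by linarith⟩)
    refine h ⟨fun i => itemOf lx ly i (f i), congrArg _ f1, congrArg _ f2,
      fun i hi => ⟨mem_windowItems.2 ⟨i, f i, f3 i hi, hw i hi, rfl⟩, rfl⟩, fun i hi => ?_⟩
    exact (itemNear_itemOf (hw i hi.le) (hw (i + 1) hi)).2 (f4 i hi)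
  · intro h
    rw [Chained] at h
    push Not at h
    obtain ⟨a, ha, b, hb, h⟩ := h
    refine ⟨itemOf lx ly 0 a, mem_windowItems.2 ⟨0, a, ha, h0 a ha, rfl⟩, itemOf lx ly n b,
      mem_windowItems.2 ⟨n, b, hb, h1 b hb, rfl⟩, rfl, rfl, ?_⟩
    rintro ⟨f, f1, f2, f3, f4⟩
    -- Points are chosen for the items of the chain, with `a` and `b` prescribed at the ends.
    have hex : ∀ i, ∃ p : ℝ × ℝ, i ≤ n → p ∈ ls.getD i [] ∧ window n c p = true ∧
        f i = itemOf lx ly i p ∧ (i = 0 → p = a) ∧ (i = n → p = b) := by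
      intro i
      by_cases hi : i ≤ n
      · rcases Nat.eq_zero_or_pos i with rfl | h2
        · exact ⟨a, fun _ => ⟨ha, h0 a ha, f1, fun _ => rfl, fun h => by omega⟩⟩
        · rcases eq_or_ne i n with rfl | h3
          · exact ⟨b, fun _ => ⟨hb, h1 b hb, f2, fun h => by omega, fun _ => rfl⟩⟩
          · obtain ⟨j, p, hp, hw, he⟩ := mem_windowItems.1 (f3 i hi).1
            obtain rfl : j = i := by rw [← (f3 i hi).2, he]; rfl
            exact ⟨p, fun _ => ⟨hp, hw, he, fun h => by omega, fun h => by omega⟩⟩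
      · exact ⟨a, fun h => absurd h hi⟩
    choose g hg using hex
    refine h ⟨g, (hg 0 (by omega)).2.2.2.1 rfl, (hg n le_rfl).2.2.2.2 rfl,
      fun i hi => (hg i hi).1, fun i hi => ?_⟩
    have := f4 i hi
    rw [(hg i hi.le).2.2.1, (hg (i + 1) hi).2.2.1,
      itemNear_itemOf (hg i hi.le).2.1 (hg (i + 1) hi).2.1] at this
    exact this

/-! ### The chain problem for a list of point sets. -/

section procedures

variable {I : Input}

theorem cell_le_of_mem {n : ℕ} {c : ℝ × ℝ} {ls : List (List (ℝ × ℝ))} :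
    ∀ x ∈ windowItems n c ls, x.2.1 ≤ 6 * n ∧ x.2.2.2.1 ≤ 6 * n := by
  intro x hx
  obtain ⟨j, p, -, hw, rfl⟩ := mem_windowItems.1 hx
  rw [window, inside_iff] at hw
  obtain ⟨h1, h2, h3, h4⟩ := hw
  push_cast at *
  refine ⟨Nat.floor_le_of_le ?_, Nat.floor_le_of_le ?_⟩ <;> push_cast <;> linarith

/-- The cost of solving the chain problem for `S` points, of which `N` are in the window. -/
def costSolve (n S N : ℕ) : ℕ := costDecide n N + S * (360 * n + 400) + 400 * n + 500

set_option maxHeartbeats 1000000 in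
-- An empty first or last layer gives yes, and a point of these layers outside the window gives no,
-- by `Chained.window`. In all other cases the problem is passed on to the items in the window,
-- whose number is `N`.
theorem ev_solve (n : ℕ) (hn : 0 < n) (ls : List (List (ℝ × ℝ))) (hls : ls.length = n + 1) :
    ∃ z : Bool, (z = true ↔ Chained ls n) ∧ ∃ N ≤ (ls.map List.length).sum,
      Ev procs I [enc n, enc ls] pSolve.body (enc z) (costSolve n (ls.map List.length).sum N) := by
  obtain ⟨l0, lr, rfl⟩ : ∃ l0 lr, ls = l0 :: lr := List.exists_cons_of_length_eq_add_one hls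
  have hne : l0 :: lr ≠ [] := by simp
  obtain ⟨ln, hln⟩ : ∃ ln, ln = (l0 :: lr).getLast hne := ⟨_, rfl⟩
  have g0 : (l0 :: lr).getD 0 [] = l0 := rfl
  have gn : (l0 :: lr).getD n [] = ln := by
    have : lr.length = n := by simpa using hls
    rw [hln, List.getLast_eq_getElem, List.getD_eq_getElem?_getD, List.getElem?_eq_getElem
      (by omega)]
    simp [this]
  have hS0 : l0.length ≤ ((l0 :: lr).map List.length).sum := by simp
  have hSn : ln.length ≤ ((l0 :: lr).map List.length).sum := by
    rw [hln]
    exact List.le_sum_of_mem (List.mem_map_of_mem (List.getLast_mem hne))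
  set S := ((l0 :: lr).map List.length).sum with hS
  have e0 : Ev procs I [enc n, enc (l0 :: lr)] (.car (.v 1)) (enc l0) 2 :=
    Ev.head (x := l0) (l := lr) (Ev.v rfl)
  have e1 : Ev procs I [enc n, enc (l0 :: lr), enc l0] (.fold (.v 1) (.nat 0) (.ix 0)) (enc ln)
      (2 * n + 5) := by
    rw [hln]
    exact (ev_last hne (Ev.v rfl)).mono (by omega)
  rcases l0 with _ | ⟨c, l0⟩
  · refine ⟨true, by simp [Chained], 0, by omega, (Ev.letE e0 (Ev.letE e1 (Ev.ifL (U := 1)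
      (Ev.v (x := enc ([] : List (ℝ × ℝ))) rfl) (fun _ => Ev.tt) (by simp)))).mono ?_⟩
    rw [costSolve]; omega
  have hc : c ∈ ((c :: l0) :: lr).getD 0 [] := by simp
  have e2 : Ev procs I [enc n, enc ((c :: l0) :: lr), enc (c :: l0), enc ln] (.v 2)
    (enc (c :: l0)) 1 := Ev.v rfl
  rcases hl : ln with _ | ⟨b, ln'⟩
  · rw [hl] at e1
    refine ⟨true, by rw [Chained, gn, hl]; simp, 0, by omega, (Ev.letE e0 (Ev.letE e1
      (Ev.ifL (Ev.v (x := enc (c :: l0)) rfl) (by simp) fun _ _ _ => (Ev.ifL (U := 1)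
      (Ev.v (x := enc ([] : List (ℝ × ℝ))) rfl) (fun _ => Ev.tt) (by simp))))).mono ?_⟩
    rw [costSolve]; omega
  have hb : b ∈ ((c :: l0) :: lr).getD n [] := by rw [gn, hl]; simp
  set k := n + n + n with hk
  have h6 : k + k = 6 * n := by omega
  have o1 := ev_anyOut (I := I) (c :: l0) (c.1 - k) (c.1 + k) (c.2 - k) (c.2 + k)
  have o2 := ev_anyOut (I := I) ln (c.1 - k) (c.1 + k) (c.2 - k) (c.2 + k)
  have o3 := ev_items (I := I) (6 * n) ((c :: l0) :: lr) (c.1 - k) (c.1 + k) (c.2 - k) (c.2 + k)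
    (by rw [← h6]; push_cast; linarith) (by rw [← h6]; push_cast; linarith)
  have c1 := ev_add (I := I) k k
  rw [h6] at c1
  set z1 : Bool := (c :: l0).any fun p => !inside (c.1 - k) (c.1 + k) (c.2 - k) (c.2 + k) p with hz1
  set z2 : Bool := ln.any fun p => !inside (c.1 - k) (c.1 + k) (c.2 - k) (c.2 + k) p with hz2
  have z1f : z1 = false ↔ ∀ a ∈ ((c :: l0) :: lr).getD 0 [], window n c a = true := by
    rw [hz1, List.any_eq_false]
    simp [window, hk]
  have z2f : z2 = false ↔ ∀ a ∈ ((c :: l0) :: lr).getD n [], window n c a = true := by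
    rw [hz2, List.any_eq_false, gn]
    simp [window, hk]
  set items := windowItems n c ((c :: l0) :: lr) with hitems
  have hN : items.length ≤ S := by
    have := length_itemsOf (c.1 - k) (c.1 + k) (c.2 - k) (c.2 + k) (0, []) ((c :: l0) :: lr)
    rw [List.length_nil, Nat.zero_add] at this
    exact this
  obtain ⟨z, hz, hdec⟩ := ev_decide (I := I) n hn items cell_le_of_mem
  obtain ⟨y, hy, T, hT, hfin⟩ : ∃ y : Bool, (y = true ↔ Chained ((c :: l0) :: lr) n) ∧ ∃ T,
      T ≤ costDecide n items.length + S * (360 * n + 200) + 20 * n + 150 ∧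
      Ev procs I [enc n, enc ((c :: l0) :: lr), enc (c :: l0), enc ln, enc c, enc (n + n), enc k,
        enc (6 * n), enc c.1, enc c.2, enc (c.1 + k), enc (c.1 - k), enc (c.2 + k), enc (c.2 - k),
        enc z1, enc z2] (.ifz (.v 14) (.ifz (.v 15)
        (lets [.call iItems [1, 11, 10, 13, 12], .call iDecide [0, 7, 16]] (notE (.v 17)))
        (.nat 0)) (.nat 0)) (enc y) T := by
    by_cases hb1 : z1 = false
    · by_cases hb2 : z2 = false
      · refine ⟨!z, ?_, _, ?_, Ev.ifB (Ev.v (x := enc z1) rfl) (fun _ => Ev.ifB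
          (Ev.v (x := enc z2) rfl) (fun _ => Ev.letE
          (Ev.call (p := iItems) (xs := [1, 11, 10, 13, 12]) rfl rfl rfl o3)
          (Ev.letE (Ev.call (p := iDecide) (xs := [0, 7, 16]) rfl rfl rfl hdec)
          (Ev.not (Ev.v rfl)))) (fun h => by rw [hb2] at h; simp at h))
          (fun h => by rw [hb1] at h; simp at h)⟩
        · have := unchained_windowItems hn hc (z1f.1 hb1) (z2f.1 hb2)
          rw [← hitems, ← hz] at this
          rw [Bool.not_eq_true', ← not_iff_not, ← this, Bool.not_eq_false]
        · rw [show 60 * (6 * n) + 200 = 360 * n + 200 by ring, hls, ← hS]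
          simp only [List.length_cons, List.length_nil]
          omega
      · refine ⟨false, ?_, _, ?_, Ev.ifB (Ev.v (x := enc z1) rfl) (fun _ => Ev.ifB (U := 1)
          (Ev.v (x := enc z2) rfl) (fun h => absurd h hb2) (fun _ => Ev.ff))
          (fun h => by rw [hb1] at h; simp at h)⟩
        · simp only [Bool.false_eq_true, false_iff]
          exact fun h => hb2 (z2f.2 fun a ha => (h.window hc ha hc).2)
        · omega
    · refine ⟨false, ?_, _, ?_, Ev.ifB (U := 1) (Ev.v (x := enc z1) rfl)
          (fun h => absurd h hb1) (fun _ => Ev.ff)⟩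
      · simp only [Bool.false_eq_true, false_iff]
        exact fun h => hb1 (z1f.2 fun a ha => (h.window ha hb hc).1)
      · omega
  refine ⟨y, hy, _, hN, ?_⟩
  set fin : Ex := .ifz (.v 14) (.ifz (.v 15)
    (lets [.call iItems [1, 11, 10, 13, 12], .call iDecide [0, 7, 16]] (notE (.v 17)))
    (.nat 0)) (.nat 0)
  have s2 : Ev procs I [enc n, enc ((c :: l0) :: lr), enc (c :: l0), enc ln, enc c, enc (n + n),
      enc k, enc (6 * n), enc c.1, enc c.2] (lets [.call iAddR [6, 8], .call iSubR [6, 8],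
        .call iAddR [6, 9], .call iSubR [6, 9], .call iAnyOut [2, 11, 10, 13, 12],
        .call iAnyOut [3, 11, 10, 13, 12]] fin) (enc y) _ :=
    Ev.letE (Ev.call (p := iAddR) (xs := [6, 8]) rfl rfl rfl (ev_addR k c.1))
    (Ev.letE (Ev.call (p := iSubR) (xs := [6, 8]) rfl rfl rfl (ev_subR k c.1))
    (Ev.letE (Ev.call (p := iAddR) (xs := [6, 9]) rfl rfl rfl (ev_addR k c.2))
    (Ev.letE (Ev.call (p := iSubR) (xs := [6, 9]) rfl rfl rfl (ev_subR k c.2))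
    (Ev.letE (Ev.call (p := iAnyOut) (xs := [2, 11, 10, 13, 12]) rfl rfl rfl o1)
    (Ev.letE (Ev.call (p := iAnyOut) (xs := [3, 11, 10, 13, 12]) rfl rfl rfl o2) hfin)))))
  refine (Ev.letE e0 (Ev.letE e1 (Ev.ifL e2 (by simp) fun _ _ _ =>
    Ev.ifL (Ev.v (x := enc ln) rfl) (by simp [hl]) fun _ _ _ =>
    Ev.letE (Ev.head (x := c) (l := l0) (Ev.v rfl))
    (Ev.letE (Ev.call (p := iAdd) (xs := [0, 0]) rfl rfl rfl (ev_add n n))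
    (Ev.letE (Ev.call (p := iAdd) (xs := [5, 0]) rfl rfl rfl (ev_add (n + n) n))
    (Ev.letE (Ev.call (p := iAdd) (xs := [6, 6]) rfl rfl rfl c1)
    (Ev.letE (Ev.fst (x := c) (Ev.v rfl)) (Ev.letE (Ev.snd (x := c) (Ev.v rfl)) s2)))))))).mono ?_
  rw [costSolve]
  have : S * (360 * n + 400) = S * (360 * n + 200) + S * 200 := by ring
  simp only [List.length_cons, List.length_nil] at hS0 ⊢
  omega

end procedures

/-! ### Reading the input. -/

section procedures

variable {I : Input}

theorem ev_adv (m a : ℕ) :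
    Ev procs I [enc m, enc a] pAdv.body (enc (a + 2 * m)) (15 * m + 10) := by
  induction m generalizing a with
  | zero =>
    exact (Ev.ifN (U := 1) (Ev.v (x := enc 0) rfl) (fun _ => Ev.v rfl) (by simp)).mono (by simp)
  | succ m ih =>
    have := ih (a + 1 + 1)
    rw [show a + 1 + 1 + 2 * m = a + 2 * (m + 1) by ring] at this
    exact (Ev.ifN (Ev.v (x := enc (m + 1)) rfl) (by simp) fun _ =>
      Ev.letE (Ev.pred (Ev.v (x := enc (m + 1)) rfl)) (Ev.letE
        (Ev.succ (Ev.succ (Ev.v (x := enc a) rfl)))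
        (Ev.call (p := iAdv) (xs := [2, 3]) rfl rfl rfl this))).mono (by simp; omega)

/-- The input holds the sizes of the point sets, from the address `j` on. -/
def SizesAt (I : Input) (j : ℕ) (ls : List (List (ℝ × ℝ))) : Prop :=
  j + ls.length ≤ I.nInts ∧ ∀ i, (h : i < ls.length) → I.ints (j + i) = ls[i].length

theorem SizesAt.tail {j : ℕ} {l : List (ℝ × ℝ)} {ls : List (List (ℝ × ℝ))}
    (h : SizesAt I j (l :: ls)) : SizesAt I (j + 1) ls :=
  ⟨by have := h.1; simp only [List.length_cons] at this; omega, fun i hi => by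
    have := h.2 (i + 1) (by simpa using hi)
    rwa [show j + (i + 1) = j + 1 + i by omega] at this⟩

/-- The input holds the coordinates of the points, from the address `a` on. -/
def PointsAt (I : Input) (a : ℕ) (ps : List (ℝ × ℝ)) : Prop :=
  a + 2 * ps.length ≤ I.nReals ∧ ∀ i, (h : i < ps.length) →
    I.reals (a + 2 * i) = ps[i].1 ∧ I.reals (a + 2 * i + 1) = ps[i].2

theorem PointsAt.left {a : ℕ} {ps qs : List (ℝ × ℝ)} (h : PointsAt I a (ps ++ qs)) :
    PointsAt I a ps :=
  ⟨by have := h.1; simp only [List.length_append] at this; omega, fun i hi => by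
    have := h.2 i (by simp; omega)
    rwa [List.getElem_append_left hi] at this⟩

theorem PointsAt.right {a : ℕ} {ps qs : List (ℝ × ℝ)} (h : PointsAt I a (ps ++ qs)) :
    PointsAt I (a + 2 * ps.length) qs :=
  ⟨by have := h.1; simp only [List.length_append] at this; omega, fun i hi => by
    have := h.2 (ps.length + i) (by simp; omega)
    rw [List.getElem_append_right (by omega), show a + 2 * (ps.length + i) =
      a + 2 * ps.length + 2 * i by ring] at this
    simpa only [Nat.add_sub_cancel_left] using this⟩

theorem ev_total (ls : List (List (ℝ × ℝ))) (j a : ℕ) (hj : 0 < j) (h : SizesAt I j ls) :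
    Ev procs I [enc ls.length, enc j, enc a] pTotal.body
      (enc (a + 2 * (ls.map List.length).sum))
      (15 * (ls.map List.length).sum + 40 * ls.length + 10) := by
  induction ls generalizing j a with
  | nil =>
    exact (Ev.ifN (U := 1) (Ev.v (x := enc 0) rfl) (fun _ => Ev.v rfl) (by simp)).mono (by simp)
  | cons l ls ih =>
    have hi := Ev.inI (P := procs) (I := I) (env := [enc (ls.length + 1), enc j, enc a,
      enc ls.length, enc (j + 1)]) (e := .v 1) (k := j) (Ev.v rfl) hj (by
        have := h.1; simp only [List.length_cons] at this; omega)
    have h0 : I.ints j = l.length := h.2 0 (by simp)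
    rw [h0] at hi
    have := ih (j + 1) (a + 2 * l.length) (by omega) h.tail
    rw [Nat.add_assoc, ← Nat.mul_add, ← List.sum_cons, ← List.map_cons] at this
    exact (Ev.ifN (Ev.v (x := enc (ls.length + 1)) rfl) (by simp) fun _ =>
      Ev.letE (Ev.pred (Ev.v (x := enc (ls.length + 1)) rfl)) (Ev.letE
        (Ev.succ (Ev.v (x := enc j) rfl)) (Ev.letE hi (Ev.letE
          (Ev.call (p := iAdv) (xs := [5, 2]) rfl rfl rfl (ev_adv l.length a))
        (Ev.call (p := iTotal) (xs := [3, 4, 6]) rfl rfl rfl this))))).mono (by simp; omega)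

theorem ev_read (ps : List (ℝ × ℝ)) (a : ℕ) (h : PointsAt I a ps) :
    Ev procs I [enc ps.length, enc a] pRead.body (enc ps) (30 * ps.length + 10) := by
  induction ps generalizing a with
  | nil =>
    exact (Ev.ifN (U := 1) (Ev.v (x := enc 0) rfl) (fun _ => Ev.nil) (by simp)).mono (by simp)
  | cons p ps ih =>
    have hlen := h.1
    simp only [List.length_cons] at hlen
    obtain ⟨h0, h1⟩ : I.reals a = p.1 ∧ I.reals (a + 1) = p.2 := h.2 0 (by simp)
    have this := ih (a + 1 + 1) (PointsAt.right (ps := [p]) (qs := ps) h)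
    have r0 := Ev.inR (P := procs) (I := I) (env := [enc (ps.length + 1), enc a, enc ps.length,
      enc (a + 1 + 1), enc ps]) (e := .v 1) (k := a) (Ev.v rfl) (by omega)
    have r1 := Ev.inR (P := procs) (I := I) (env := [enc (ps.length + 1), enc a, enc ps.length,
      enc (a + 1 + 1), enc ps]) (e := .succ (.v 1)) (k := a + 1) (Ev.succ (Ev.v rfl)) (by omega)
    rw [h0] at r0
    rw [h1] at r1
    exact (Ev.ifN (Ev.v (x := enc (ps.length + 1)) rfl) (by simp) fun _ =>
      Ev.letE (Ev.pred (Ev.v (x := enc (ps.length + 1)) rfl)) (Ev.letE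
        (Ev.succ (Ev.succ (Ev.v (x := enc a) rfl)))
        (Ev.letE (Ev.call (p := iRead) (xs := [2, 3]) rfl rfl rfl this)
          (Ev.cons (Ev.prod (x := p.1) (y := p.2) r0 r1) (Ev.v rfl))))).mono (by simp; omega)

theorem ev_readAll (ls : List (List (ℝ × ℝ))) (j a : ℕ) (hj : 0 < j) (h : SizesAt I j ls)
    (hp : PointsAt I a ls.flatten) :
    Ev procs I [enc ls.length, enc j, enc a] pReadAll.body (enc ls)
      (45 * (ls.map List.length).sum + 60 * ls.length + 10) := by
  induction ls generalizing j a with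
  | nil =>
    exact (Ev.ifN (U := 1) (Ev.v (x := enc 0) rfl) (fun _ => Ev.nil) (by simp)).mono (by simp)
  | cons l ls ih =>
    have hi := Ev.inI (P := procs) (I := I) (env := [enc (ls.length + 1), enc j, enc a,
      enc ls.length, enc (j + 1)]) (e := .v 1) (k := j) (Ev.v rfl) hj (by
        have := h.1; simp only [List.length_cons] at this; omega)
    have h0 : I.ints j = l.length := h.2 0 (by simp)
    rw [h0] at hi
    rw [List.flatten_cons] at hp
    have := ih (j + 1) (a + 2 * l.length) (by omega) h.tail hp.right
    exact (Ev.ifN (Ev.v (x := enc (ls.length + 1)) rfl) (by simp) fun _ =>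
      Ev.letE (Ev.pred (Ev.v (x := enc (ls.length + 1)) rfl)) (Ev.letE
        (Ev.succ (Ev.v (x := enc j) rfl)) (Ev.letE hi (Ev.letE
          (Ev.call (p := iAdv) (xs := [5, 2]) rfl rfl rfl (ev_adv l.length a))
        (Ev.letE (Ev.call (p := iReadAll) (xs := [3, 4, 6]) rfl rfl rfl this)
        (Ev.letE (Ev.call (p := iRead) (xs := [5, 2]) rfl rfl rfl (ev_read l a hp.left))
          (Ev.cons (x := l) (y := ls) (Ev.v rfl) (Ev.v rfl)))))))).mono (by simp; omega)

theorem ev_repeat {α : Type} [Enc α] (c : ℕ) (x : α) :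
    Ev procs I [enc c, enc x] pRepeat.body (enc (List.replicate c x)) (15 * c + 10) := by
  induction c with
  | zero =>
    exact (Ev.ifN (U := 1) (Ev.v (x := enc 0) rfl) (fun _ => Ev.nil) (by simp)).mono (by simp)
  | succ c ih =>
    exact (Ev.ifN (Ev.v (x := enc (c + 1)) rfl) (by simp) fun _ =>
      Ev.letE (Ev.pred (Ev.v (x := enc (c + 1)) rfl))
        (Ev.letE (Ev.call (p := iRepeat) (xs := [2, 1]) rfl rfl rfl ih)
        (Ev.cons (x := x) (y := List.replicate c x) (Ev.v rfl) (Ev.v rfl)))).mono (by simp; omega)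

end procedures

theorem coords_getD (L : List (ℝ × ℝ)) (i : ℕ) (h : i < L.length) :
    (coords L).getD (2 * i) 0 = L[i].1 ∧ (coords L).getD (2 * i + 1) 0 = L[i].2 := by
  induction L generalizing i with
  | nil => simp at h
  | cons p L ih =>
    have e : coords (p :: L) = p.1 :: p.2 :: coords L := rfl
    cases i with
    | zero => simp [e]
    | succ i => simpa [e, Nat.mul_add] using ih i (by simpa using h)

/-! ### The main programs -/

/-- A command stores no reals, provided that it only calls procedures in `S` and that they store
none. -/
def noStore (S : ℕ → Bool) : Cmd → Bool
  | .skip => true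
  | .instr (.rstore _ _ _) => false
  | .instr _ => true
  | .seq c d => noStore S c && noStore S d
  | .ite _ c d => noStore S c && noStore S d
  | .loop _ c => noStore S c
  | .call p => S p

/-- Before the end of the input is known, the heap pointer may lie among the addresses of the input
reals, and storing a real would overwrite one of them. -/
theorem Exec.rmem_eq {A : Program} {S : ℕ → Bool}
    (hA : ∀ p, S p = true → noStore S (A.getD p .skip) = true) {c : Cmd} {σ τ : State} {t : ℕ}
    (h : Exec A c σ t τ) (hc : noStore S c = true) : τ.rmem = σ.rmem := by
  induction h with
  | skip => rfl
  | instr i σ => cases i <;> simp_all [noStore, Instr.apply]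
  | seq _ _ ih1 ih2 =>
    rw [noStore, Bool.and_eq_true] at hc
    rw [ih2 hc.2, ih1 hc.1]
  | iteTrue _ _ ih =>
    rw [noStore, Bool.and_eq_true] at hc
    exact ih hc.1
  | iteFalse _ _ ih =>
    rw [noStore, Bool.and_eq_true] at hc
    exact ih hc.2
  | loopTrue _ _ _ ih1 ih2 => rw [ih2 hc, ih1 (by simpa [noStore] using hc)]
  | loopFalse => rfl
  | call _ ih => exact ih (hA _ hc)

/-- Reserve the memory up to the value of `e₁`, and evaluate `e₂`, both in an environment that holds
`Δ`, `Δ + 1`, `1` and `Δ + 2`. -/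
def mainCmd (e₁ e₂ : Ex) : Cmd :=
  code [.iload (regE 0) 2 2, .iadd (regE 1) (regE 0) 1, .iconst (regE 2) 1, .iadd (regE 3) (regE 0) 2,
    .istore (regE 3) 2 2]
    (.seq (comp 4 0 e₁) (code [.iconst 2 0, .istore 0 2 2] (comp 4 0 e₂)))

def mainEnv (n : ℕ) : List Val := [enc n, enc (n + 1), enc 1, enc (n + 2)]

/-- Two phases. The heap first starts behind the integers, where allocation of integer cells does no
harm, and `e₁` computes an address `B` beyond the whole input without storing any real. Then the
heap pointer is moved to `B` and `e₂` runs with the whole input in place. In the first phase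
`nReals` is 0, so nothing is claimed about reals there. -/
theorem exec_main {e₁ e₂ : Ex} {n : ℕ} {ints : List ℕ} {reals : List ℝ} {nInts nReals B T₁ T₂ : ℕ}
    {z : Bool} (h0 : ints.getD 0 0 = n) (hn : nInts ≤ n + 2) (hB : nInts ≤ B) (hB' : nReals ≤ B)
    (hB0 : 0 < B) (hs : noStore (fun p => p == iAdv + 1 || p == iTotal + 1) (comp 4 0 e₁) = true)
    (h₁ : Ev procs ⟨(ints.getD · 0), (reals.getD · 0), nInts, 0⟩ (mainEnv n) e₁ (enc B) T₁)
    (h₂ : Ev procs ⟨(ints.getD · 0), (reals.getD · 0), nInts, nReals⟩ (mainEnv n) e₂ (enc z) T₂) :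
    ∃ t τ, Exec (mainCmd e₁ e₂ :: procs.map Proc.comp) (.call 0) (initial ints reals) t τ ∧
      t ≤ 20 * (T₁ + T₂) + 20 ∧ τ.ireg 0 = if z then 1 else 0 := by
  set A : Program := mainCmd e₁ e₂ :: procs.map Proc.comp with hA
  have hI : Implements A procs := by
    intro p pr hp
    rw [hA, List.getD_cons_succ, List.getD_eq_getElem?_getD, List.getElem?_map, hp]
    rfl
  set σ := initial ints reals with hσ
  -- Register 2 is still 0, so the first instruction reads `Δ` from cell 0 before the heap pointer
  -- replaces it.
  set σ₁ : State := List.foldl Instr.apply σ [.iload (regE 0) 2 2, .iadd (regE 1) (regE 0) 1,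
    .iconst (regE 2) 1, .iadd (regE 3) (regE 0) 2, .istore (regE 3) 2 2] with hσ₁
  have m1 : σ₁.imem = Function.update σ.imem 0 (n + 2) := by
    simp [hσ₁, Instr.apply, regE, hσ, initial, ← h0]
  have m2 : σ₁.rmem = σ.rmem := by simp [hσ₁, Instr.apply]
  have m3 : EnvRep σ₁ (mainEnv n) := by
    intro j x hj
    have : j < 4 := (List.getElem?_eq_some_iff.1 hj).1
    interval_cases j <;> simp [mainEnv] at hj <;> subst hj <;>
      simp [Enc.enc, Rep, hσ₁, Instr.apply, regE, hσ, initial, ← h0]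
  have v1 : (⟨(ints.getD · 0), (reals.getD · 0), nInts, 0⟩ : Input).Valid σ₁ := by
    refine ⟨by simp [m1], by simpa [m1] using hn, by simp, fun a ha _ => ?_, fun a ha => ?_⟩
    · rw [m1, Function.update_of_ne ha.ne']; rfl
    · simp at ha
  obtain ⟨t₁, ht₁, h₁⟩ := h₁
  obtain ⟨u₁, τ₁, x₁, k₁, r₁, f₁⟩ := Eval.correct hI h₁ 0 σ₁ v1 m3
  have hr : τ₁.rmem = σ.rmem := by
    rw [← m2]
    refine x₁.rmem_eq (S := fun p => p == iAdv + 1 || p == iTotal + 1) ?_ hs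
    intro p hp
    simp only [Bool.or_eq_true, beq_iff_eq] at hp
    rcases hp with rfl | rfl <;> rfl
  -- Register 2 is the first temporary and may have been used by `e₁`, so it is cleared before it
  -- addresses cell 0 again.
  set σ₂ : State := List.foldl Instr.apply τ₁ [.iconst 2 0, .istore 0 2 2] with hσ₂
  have q1 : σ₂.imem = Function.update τ₁.imem 0 B := by
    have : τ₁.ireg 0 = B := r₁
    simp [hσ₂, Instr.apply, this]
  have q2 : σ₂.rmem = σ.rmem := by simp [hσ₂, Instr.apply, hr]
  have q3 : EnvRep σ₂ (mainEnv n) := by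
    intro j x hj
    have hlt : j < 4 := (List.getElem?_eq_some_iff.1 hj).1
    have h1 := m3 j x hj
    have h2 : σ₂.ireg (regE j) = σ₁.ireg (regE j) := by
      rw [← f₁.env j (by simpa [mainEnv] using hlt)]
      have : regE j ≠ 2 := by simp [regE]
      simp [hσ₂, Instr.apply, this]
    rw [h2]
    interval_cases j <;> simp [mainEnv] at hj <;> subst hj <;> exact h1
  have v2 : (⟨(ints.getD · 0), (reals.getD · 0), nInts, nReals⟩ : Input).Valid σ₂ := by
    refine ⟨by simpa [q1] using hB0, by simpa [q1] using hB, by simpa [q1] using hB',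
      fun a ha h => ?_, fun a ha => ?_⟩
    · rw [q1, Function.update_of_ne ha.ne', f₁.ext.2.1 a ha (by rw [m1]; simpa using h.trans_le hn),
        m1, Function.update_of_ne ha.ne']
      rfl
    · rw [q2]; rfl
  obtain ⟨t₂, ht₂, h₂⟩ := h₂
  obtain ⟨u₂, τ₂, x₂, k₂, r₂, -⟩ := Eval.correct hI h₂ 0 σ₂ v2 q3
  have main : Exec A (mainCmd e₁ e₂) σ (5 + (u₁ + (2 + u₂))) τ₂ :=
    exec_code _ σ (.seq x₁ (exec_code _ τ₁ x₂))
  refine ⟨_, _, Exec.call (A := A) (p := 0) main, by omega, ?_⟩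
  have : τ₂.ireg 0 = if z then 1 else 0 := r₂
  simp [State.afterCall, this]

/-- Compute the end of the input, for point sets. -/
def exTotal : Ex := .call iTotal [1, 2, 3]

/-- Read the point sets and solve the chain problem. -/
def exSolve : Ex := lets [.nat 0, .call iReadAll [1, 2, 4]] (.call iSolve [0, 5])

/-- Compute the end of the input, for squares. -/
def exTotalSquares : Ex := lets [.inI (.v 2), .nat 2] (.call iAdv [4, 5])

/-- Read the centres, repeat them and solve the chain problem. -/
def exSolveSquares : Ex :=
  lets [.nat 0, .inI (.v 2), .call iRead [5, 4], .call iRepeat [1, 6]] (.call iSolve [0, 7])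

/-- The program for the chain problem. -/
def progA : Program := mainCmd exTotal exSolve :: procs.map Proc.comp

/-- The program for diameters. -/
def progB : Program := mainCmd exTotalSquares exSolveSquares :: procs.map Proc.comp

theorem exec_progA {n : ℕ} (hn : 0 < n) (P : Fin (n + 1) → List (ℝ × ℝ)) :
    ∃ z : Bool, (z = true ↔ Chained (List.ofFn P) n) ∧ ∃ N ≤ totalSize P, ∃ t τ,
      Exec progA (.call 0) (pointSetsInput P) t τ ∧
      t ≤ 20 * costSolve n (totalSize P) N + 1500 * totalSize P + 4000 * n + 5000 ∧
      τ.ireg 0 = if z then 1 else 0 := by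
  set ls := List.ofFn P with hls
  have hlen : ls.length = n + 1 := by simp [hls]
  have hS : (ls.map List.length).sum = totalSize P := by
    rw [hls, List.map_ofFn, List.sum_ofFn, totalSize]
    rfl
  set ints := n :: List.ofFn fun i => (P i).length with hints
  set reals := coords ls.flatten with hreals
  have hflat : ls.flatten.length = totalSize P := by rw [List.length_flatten, hS]
  have sizes : ∀ R, SizesAt ⟨(ints.getD · 0), (reals.getD · 0), n + 2, R⟩ 1 ls := by
    refine fun R => ⟨by rw [hlen]; show 1 + (n + 1) ≤ n + 2; omega, fun i hi => ?_⟩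
    show ints.getD (1 + i) 0 = _
    rw [Nat.add_comm, hints, List.getD_cons_succ, List.getD_eq_getElem?_getD,
      List.getElem?_eq_getElem (by simpa [hls] using hi)]
    simp only [hls, List.getElem_ofFn, Option.getD_some]
  have points : PointsAt ⟨(ints.getD · 0), (reals.getD · 0), n + 2, 2 * totalSize P⟩ 0 ls.flatten := by
    refine ⟨by rw [hflat, Nat.zero_add], fun i hi => ?_⟩
    rw [Nat.zero_add]
    exact coords_getD _ i hi
  -- Starting the sum at `n + 2` yields an address beyond both the `n + 2` integers and the `2 *
  -- totalSize P` reals.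
  have e1 := ev_total (I := ⟨(ints.getD · 0), (reals.getD · 0), n + 2, 0⟩) ls 1 (n + 2) (by omega)
    (sizes 0)
  have e2 := ev_readAll ls 1 0 (by omega) (sizes _) points
  obtain ⟨z, hz, N, hN, e3⟩ := ev_solve
    (I := ⟨(ints.getD · 0), (reals.getD · 0), n + 2, 2 * totalSize P⟩) n hn ls hlen
  rw [hS] at e1 e2 hN e3
  rw [hlen] at e1 e2
  obtain ⟨t, τ, h1, h2, h3⟩ := exec_main (e₁ := exTotal) (e₂ := exSolve) (n := n) (ints := ints)
    (reals := reals) (nInts := n + 2) (nReals := 2 * totalSize P) (B := n + 2 + 2 * totalSize P)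
    rfl le_rfl (by omega) (by omega) (by omega) rfl
    (Ev.call (p := iTotal) (xs := [1, 2, 3]) rfl rfl rfl e1)
    (Ev.letE (Ev.nat 0) (Ev.letE (Ev.call (p := iReadAll) (xs := [1, 2, 4]) rfl rfl rfl e2)
      (Ev.call (p := iSolve) (xs := [0, 5]) rfl rfl rfl e3)))
  refine ⟨z, hz, N, hN, t, τ, h1, h2.trans ?_, h3⟩
  simp only [List.length_cons, List.length_nil]
  omega

theorem exec_progB {n : ℕ} (hn : 0 < n) {s : ℕ} (c : Fin s → ℝ × ℝ) :
    ∃ z : Bool, (z = true ↔ Chained (List.replicate (n + 1) (List.ofFn c)) n) ∧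
      ∃ N ≤ (n + 1) * s, ∃ t τ, Exec progB (.call 0) (squaresInput n c) t τ ∧
      t ≤ 20 * costSolve n ((n + 1) * s) N + 1500 * s + 4000 * n + 5000 ∧
      τ.ireg 0 = if z then 1 else 0 := by
  set ps := List.ofFn c with hps
  have hlen : ps.length = s := by simp [hps]
  set ls := List.replicate (n + 1) ps with hls
  have hS : (ls.map List.length).sum = (n + 1) * s := by simp [hls, hlen]
  set reals := coords ps with hreals
  set ints := [n, s] with hints
  have points : PointsAt ⟨(ints.getD · 0), (reals.getD · 0), 2, 2 * s⟩ 0 ps := by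
    refine ⟨by rw [hlen, Nat.zero_add], fun i hi => ?_⟩
    rw [Nat.zero_add]
    exact coords_getD _ i hi
  have e0 := ev_adv (I := ⟨(ints.getD · 0), (reals.getD · 0), 2, 0⟩) s 2
  have e1 := ev_read ps 0 points
  have e2 := ev_repeat (I := ⟨(ints.getD · 0), (reals.getD · 0), 2, 2 * s⟩) (n + 1) ps
  obtain ⟨z, hz, N, hN, e3⟩ := ev_solve
    (I := ⟨(ints.getD · 0), (reals.getD · 0), 2, 2 * s⟩) n hn ls (by simp [hls])
  rw [hS] at hN e3
  rw [hlen] at e1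
  have i1 : ∀ R (env : List Val), env[2]? = some (enc 1) →
      Ev procs ⟨(ints.getD · 0), (reals.getD · 0), 2, R⟩ env (.inI (.v 2)) (enc s) 2 :=
    fun R env h => Ev.inI (k := 1) (Ev.v h) (by omega) (show 1 < 2 by omega)
  obtain ⟨t, τ, h1, h2, h3⟩ := exec_main (e₁ := exTotalSquares) (e₂ := exSolveSquares) (n := n)
    (ints := ints) (reals := reals) (nInts := 2) (nReals := 2 * s) (B := 2 + 2 * s)
    rfl (by omega) (by omega) (by omega) (by omega) rfl
    (Ev.letE (i1 0 _ rfl) (Ev.letE (Ev.nat 2) (Ev.call (p := iAdv) (xs := [4, 5]) rfl rfl rfl e0)))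
    (Ev.letE (Ev.nat 0) (Ev.letE (i1 (2 * s) _ rfl)
      (Ev.letE (Ev.call (p := iRead) (xs := [5, 4]) rfl rfl rfl e1)
      (Ev.letE (Ev.call (p := iRepeat) (xs := [1, 6]) rfl rfl rfl e2)
      (Ev.call (p := iSolve) (xs := [0, 7]) rfl rfl rfl e3)))))
  refine ⟨z, hz, N, hN, t, τ, h1, h2.trans ?_, h3⟩
  simp only [List.length_cons, List.length_nil]
  omega

/-! ### Chains of point sets, and the diameter of the intersection graph. -/

theorem chained_ofFn_iff {n : ℕ} (P : Fin (n + 1) → List (ℝ × ℝ)) :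
    Chained (List.ofFn P) n ↔ AllChained P := by
  have hget : ∀ i (h : i < n + 1), (List.ofFn P).getD i [] = P ⟨i, h⟩ := fun i h => by
    rw [List.getD_eq_getElem?_getD, List.getElem?_eq_getElem (by simpa using h)]
    simp only [List.getElem_ofFn, Option.getD_some]
  have h0 : (List.ofFn P).getD 0 [] = P 0 := hget 0 (by omega)
  have hn : (List.ofFn P).getD n [] = P (Fin.last n) := hget n (by omega)
  rw [Chained, AllChained, h0, hn]
  refine forall₂_congr fun a _ => forall₂_congr fun b _ => ⟨?_, ?_⟩
  · rintro ⟨f, rfl, rfl, f3, f4⟩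
    refine ⟨fun i => f i, rfl, rfl, fun i => ?_, fun i => f4 i i.2⟩
    have := f3 i (by omega)
    rwa [hget i i.2] at this
  · rintro ⟨p, rfl, rfl, p3, p4⟩
    refine ⟨fun i => if h : i < n + 1 then p ⟨i, h⟩ else p 0, rfl, ?_, fun i hi => ?_, fun i hi => ?_⟩
    · simp; rfl
    · rw [hget i (by omega)]
      dsimp only
      rw [dif_pos (show i < n + 1 by omega)]
      exact p3 _
    · dsimp only
      rw [dif_pos (show i < n + 1 by omega), dif_pos (show i + 1 < n + 1 by omega)]
      exact p4 ⟨i, hi⟩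

theorem squaresMeet_self (p : ℝ × ℝ) : SquaresMeet p p := by simp [squaresMeet_iff]

/-- A walk of length at most `n` is prolonged to `n` steps by resting at its end, because every
square meets itself. Conversely, a step that rests costs no distance. -/
theorem edist_le_iff {s : ℕ} (c : Fin s → ℝ × ℝ) (n : ℕ) (u v : Fin s) :
    (unitSquareGraph c).edist u v ≤ n ↔ ∃ f : ℕ → Fin s, f 0 = u ∧ f n = v ∧
      ∀ i < n, SquaresMeet (c (f i)) (c (f (i + 1))) := by
  constructor
  · intro h
    obtain ⟨p, hp⟩ := SimpleGraph.exists_walk_of_edist_ne_top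
      (ne_top_of_le_ne_top (ENat.natCast_ne_top n) h)
    have hpn : p.length ≤ n := by rw [← hp] at h; exact_mod_cast h
    refine ⟨p.getVert, by simp, p.getVert_of_length_le hpn, fun i _ => ?_⟩
    rcases lt_or_ge i p.length with hi | hi
    · exact (p.adj_getVert_succ hi).2
    · rw [p.getVert_of_length_le hi, p.getVert_of_length_le (hi.trans (Nat.le_succ i))]
      exact squaresMeet_self _
  · rintro ⟨f, rfl, rfl, h⟩
    have key : ∀ i ≤ n, (unitSquareGraph c).edist (f 0) (f i) ≤ i := by
      intro i
      induction i with
      | zero => simp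
      | succ i ih =>
        intro hi
        refine (SimpleGraph.edist_triangle (v := f i)).trans ?_
        push_cast
        refine add_le_add (ih (by omega)) (SimpleGraph.edist_le_one_iff_adj_or_eq.2 ?_)
        by_cases he : f i = f (i + 1)
        · exact Or.inr he
        · exact Or.inl ⟨he, h i (by omega)⟩
    exact key n le_rfl

theorem chained_replicate_iff {n s : ℕ} (hn : 0 < n) (c : Fin s → ℝ × ℝ) :
    Chained (List.replicate (n + 1) (List.ofFn c)) n ↔ (unitSquareGraph c).ediam ≤ n := by
  have hget : ∀ i, i < n + 1 → (List.replicate (n + 1) (List.ofFn c)).getD i [] = List.ofFn c :=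
    fun i h => by
      rw [List.getD_eq_getElem?_getD, List.getElem?_eq_getElem (by simpa using h)]
      simp
  rw [SimpleGraph.ediam_le_iff, Chained, hget 0 (by omega), hget n (by omega)]
  simp only [List.mem_ofFn, forall_exists_index, forall_apply_eq_imp_iff]
  refine forall₂_congr fun u v => ?_
  rw [edist_le_iff]
  constructor
  · rintro ⟨f, f1, f2, f3, f4⟩
    -- Different squares may have the same centre, so the indices at both ends are prescribed.
    have hex : ∀ i, ∃ j : Fin s, i ≤ n → c j = f i ∧ (i = 0 → j = u) ∧ (i = n → j = v) := by
      intro i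
      by_cases hi : i ≤ n
      · rcases Nat.eq_zero_or_pos i with rfl | h2
        · exact ⟨u, fun _ => ⟨f1.symm, fun _ => rfl, fun h => by omega⟩⟩
        · rcases eq_or_ne i n with rfl | h3
          · exact ⟨v, fun _ => ⟨f2.symm, fun h => by omega, fun _ => rfl⟩⟩
          · have := f3 i hi
            rw [hget i (by omega), List.mem_ofFn] at this
            obtain ⟨j, hj⟩ := this
            exact ⟨j, fun _ => ⟨hj, fun h => by omega, fun h => by omega⟩⟩
      · exact ⟨u, fun h => absurd h hi⟩
    choose g hg using hex
    refine ⟨g, (hg 0 (by omega)).2.1 rfl, (hg n le_rfl).2.2 rfl, fun i hi => ?_⟩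
    rw [(hg i hi.le).1, (hg (i + 1) hi).1]
    exact f4 i hi
  · rintro ⟨f, rfl, rfl, h⟩
    refine ⟨fun i => c (f i), rfl, rfl, fun i hi => ?_, h⟩
    rw [hget i (by omega)]
    simp

/-! ### The running time -/

/-- The exponent of the running time: up to constants, `√(n³ log N log log N)`. -/
def parG (n N : ℕ) : ℕ := Nat.sqrt (lgN N * parQ n N) + 1

theorem lgN_mono {a b : ℕ} (h : a ≤ b) : lgN a ≤ lgN b :=
  Nat.add_le_add_right (Nat.clog_mono_right 2 h) 1

theorem parG_mono {n a b : ℕ} (h : a ≤ b) : parG n a ≤ parG n b :=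
  Nat.add_le_add_right (Nat.sqrt_le_sqrt (Nat.mul_le_mul (lgN_mono h)
    (Nat.mul_le_mul_left _ (lgN_mono (lgN_mono h))))) 1

/-- With `domG + 1` in place of `domG`, one more key multiplies by at most `w + 2`. -/
theorem domG_replicate_le (h w : ℕ) : domG (List.replicate h w) + 1 ≤ 2 * (w + 2) ^ h := by
  induction h with
  | zero => simp [domG]
  | succ h ih =>
    rw [List.replicate_succ, domG, pow_succ]
    nlinarith [Nat.mul_le_mul_left (w + 2) ih, Nat.zero_le (domG (List.replicate h w))]

theorem domG_four_le {M W : ℕ} (hM : 8 ≤ M) (hW : W ≤ 9 * M) :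
    domG (List.replicate 4 W) ≤ M ^ 10 := by
  have h1 := domG_replicate_le 4 W
  have h2 : (W + 2) ^ 4 ≤ (10 * M) ^ 4 := Nat.pow_le_pow_left (by omega) 4
  have h3 : 2 * (10 * M) ^ 4 ≤ M ^ 10 := by
    calc 2 * (10 * M) ^ 4 ≤ 8 ^ 6 * M ^ 4 := by rw [mul_pow]; omega
      _ ≤ M ^ 6 * M ^ 4 := by gcongr
      _ = M ^ 10 := by ring
  omega

/-- The parameters of the algorithm are at most `M = 2 ^ (3 * parG n N)`. -/
theorem params_le {n : ℕ} (hn : 0 < n) (N : ℕ) :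
    ∃ M, M = 2 ^ (3 * parG n N) ∧ 8 ≤ M ∧ n ≤ M ∧ n * n * n ≤ M ∧ lgN N ≤ M ∧ lgN (lgN N) ≤ M ∧
      parQ n N ≤ M ∧ parD n N ≤ M ∧ parD' n N ≤ M ∧ parK n N ≤ M ∧
      parD' n N * parK n N ≤ 2 * lgN N ∧ parD' n N * parK n N ≤ M := by
  have hL : 1 ≤ lgN N := Nat.le_add_left 1 _
  have hl : 1 ≤ lgN (lgN N) := Nat.le_add_left 1 _
  have hg : lgN N * parQ n N < parG n N * parG n N := Nat.sqrt_lt.1 (Nat.lt_succ_self _)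
  have hB : parG n N < 2 ^ parG n N := Nat.lt_two_pow_self
  have h2 : 2 ≤ 2 ^ parG n N := by
    calc 2 = 2 ^ 1 := rfl
      _ ≤ _ := Nat.pow_le_pow_right (by omega) (Nat.le_add_left 1 _)
  -- Writing `G` for `parG n N`: the product of `lgN N` and `parQ n N` is below `G ^ 2`, so each of
  -- them is at most `B * B`. The third factor `B` of `M` absorbs the factor 2 in the length of the
  -- ranks.
  set B := 2 ^ parG n N
  have hM : 2 ^ (3 * parG n N) = B * B * B := by rw [mul_comm, pow_mul]; ring
  have hn3 : n ≤ n * n * n := by nlinarith [Nat.mul_le_mul hn hn]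
  have hq3 : n * n * n ≤ parQ n N := Nat.le_mul_of_pos_right _ hl
  have hql : lgN (lgN N) ≤ parQ n N := Nat.le_mul_of_pos_left _ (by omega)
  have hqB : parQ n N ≤ B * B := by nlinarith
  have hLB : lgN N ≤ B * B := by nlinarith
  have hDL : parD n N ≤ lgN N := (Nat.sqrt_le_self _).trans (Nat.div_le_self _ _)
  have hD' : 1 ≤ parD' n N ∧ parD' n N ≤ lgN N := by rw [parD']; split <;> omega
  have hkL : parD' n N * parK n N ≤ 2 * lgN N := by
    rw [parK, Nat.ceilDiv_eq_add_pred_div]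
    exact (Nat.mul_div_le _ _).trans (by omega)
  have hk : parK n N ≤ 2 * lgN N := (Nat.le_mul_of_pos_left _ hD'.1).trans hkL
  have hBB : 2 * (B * B) ≤ B * B * B := by nlinarith [Nat.mul_le_mul_left (B * B) h2]
  have h8 : 8 ≤ B * B * B := by nlinarith [Nat.mul_le_mul h2 h2]
  exact ⟨_, rfl, by omega, by omega, by omega, by omega, by omega, by omega, by omega, by omega,
    by omega, hkL, by omega⟩

theorem costPrep_le {n : ℕ} (hn : 0 < n) (N : ℕ) :
    costPrep n N ≤ (N + 1) * 2 ^ (3 * parG n N * 9) := by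
  obtain ⟨M, hM, h8, hn1, hn3, hL, hl, hq, hD, hD', hk, -, hw⟩ := params_le hn N
  have hc : Nat.clog 2 N ≤ M := (Nat.le_succ _).trans hL
  have e : (N + 1) * 2 ^ (3 * parG n N * 9) = (N + 1) * (M ^ 6 * M ^ 3) := by
    rw [pow_mul, ← hM]; ring
  rw [e, costPrep]
  refine le_trans (b := 80 * N + 120 * M + 15 * (M * M) + 15 * M + 105 * M + 15 * M +
    35 * M + (M + 1) * (300 * M + 100 * M + 300) +
    (M + 1) * (15 * M + 35 * M + 100) + 15 * M + 35 * M +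
    N * (300 * M + 120 * M + 300 * (6 * M + 2) + M * (35 * M + 60) + 1200) + 40 * M +
    (M + 1) * (40 * N + 70) + 40 * N +
    M * ((6 * M + 1) * ((6 * M + 1) * 20 + 10) + 30) + 50 * (6 * M + 1) + 1000) (by gcongr) ?_
  have h1 : 1 ≤ M := by omega
  have h2 : M ^ 1 ≤ M ^ 3 := Nat.pow_le_pow_right h1 (by omega)
  have h3 : M ^ 2 ≤ M ^ 3 := Nat.pow_le_pow_right h1 (by omega)
  have h4 : 1 ≤ M ^ 3 := Nat.one_le_pow _ _ h1
  have h5 : 8 ^ 6 ≤ M ^ 6 := Nat.pow_le_pow_left h8 6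
  refine le_trans (b := (N + 1) * (8 ^ 6 * M ^ 3)) ?_ (by gcongr)
  have k2 := Nat.mul_le_mul_left N h2
  have k3 := Nat.mul_le_mul_left N h3
  have k4 := Nat.mul_le_mul_left N h4
  ring_nf at *
  nlinarith

/-- Let `L = lgN N`, `q = parQ n N`, `D = parD n N` and `G = parG n N`, so `L * q < G ^ 2`. If `D =
0`, then `L < q`, hence `L < G` and `N ≤ 2 ^ L ≤ M`, so quadratic time is affordable. Otherwise `D ^
2 * q ≤ L` gives `(D * q) ^ 2 ≤ L * q`, so `D * q ≤ G`; this bounds the cost of dominance with `O(n³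
D)` keys of `O(L)` bits by `2 ^ O(G)`. And `L < (D + 1) ^ 2 * q ≤ 4 * D ^ 2 * q ≤ 4 * G * D` bounds
the length of the chunks by `O(G)`. -/
theorem costSearch_le {n : ℕ} (hn : 0 < n) (N : ℕ) :
    (if parD n N = 0 then costBrute n N (parD' n N * parK n N) else
      costTree n N (parD n N) (parK n N) (parD' n N * parK n N)) ≤
      N * 2 ^ (3 * parG n N * 130) := by
  obtain ⟨M, hM, h8, hn1, hn3, hL, hl, hq, hD, hD', hk, hw2, hw⟩ := params_le hn N
  have hg : lgN N * parQ n N < parG n N * parG n N := Nat.sqrt_lt.1 (Nat.lt_succ_self _)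
  have hL1 : 1 ≤ lgN N := Nat.le_add_left 1 _
  have hl1 : 1 ≤ lgN (lgN N) := Nat.le_add_left 1 _
  have hq0 : 0 < parQ n N := by rw [parQ]; positivity
  have h1 : 1 ≤ M := by omega
  have e : 2 ^ (3 * parG n N * 130) = M ^ 130 := by rw [pow_mul, ← hM]
  rw [e]
  split_ifs with h0
  · have hLq : lgN N < parQ n N := by
      rwa [parD, Nat.sqrt_eq_zero, Nat.div_eq_zero_iff_lt hq0] at h0
    have hLg : lgN N < parG n N := by nlinarith
    have hNM : N ≤ M := (le_two_pow_lgN N).trans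
      (hM ▸ Nat.pow_le_pow_right (by omega) (by omega))
    have hdom := domG_four_le (M := M) (W := 6 * n + 2 + parD' n N * parK n N) h8 (by omega)
    rw [costBrute, propK]
    refine Nat.mul_le_mul_left N ?_
    refine le_trans (b := M * (2 * M * (500 * (1 + 1) * M ^ 10 + 60) + 61) + 10 * M + 60)
      (by gcongr) ?_
    refine le_trans (b := 8 ^ 5 * M ^ 12) ?_ ?_
    · have a1 : M ^ 2 ≤ M ^ 12 := Nat.pow_le_pow_right h1 (by omega)
      have a2 : M ^ 1 ≤ M ^ 12 := Nat.pow_le_pow_right h1 (by omega)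
      have a3 : 1 ≤ M ^ 12 := Nat.one_le_pow _ _ h1
      ring_nf at *
      omega
    · calc 8 ^ 5 * M ^ 12 ≤ M ^ 5 * M ^ 12 := by gcongr
        _ = M ^ 17 := by ring
        _ ≤ _ := Nat.pow_le_pow_right h1 (by omega)
  · have hD1 : 1 ≤ parD n N := Nat.one_le_iff_ne_zero.2 h0
    have hDq : parD n N * parD n N * parQ n N ≤ lgN N :=
      (Nat.le_div_iff_mul_le hq0).1 (Nat.sqrt_le _)
    have hDq' : lgN N < (parD n N + 1) * (parD n N + 1) * parQ n N :=
      (Nat.div_lt_iff_lt_mul hq0).1 (Nat.lt_succ_sqrt _)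
    have hg1 : parD n N * parQ n N ≤ parG n N := by
      refine (Nat.mul_self_lt_mul_self_iff.1 (lt_of_le_of_lt ?_ hg)).le
      calc _ = parD n N * parD n N * parQ n N * parQ n N := by ring
        _ ≤ _ := Nat.mul_le_mul_right _ hDq
    have hk2 : parK n N ≤ 4 * parG n N + 1 := by
      rw [parK, parD', if_neg h0, Nat.ceilDiv_eq_add_pred_div]
      refine Nat.lt_succ_iff.1 ((Nat.div_lt_iff_lt_mul (by omega)).2 ?_)
      have h5 : (parD n N + 1) * (parD n N + 1) ≤ (2 * parD n N) * (2 * parD n N) := by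
        gcongr <;> omega
      have h6 : lgN N < 4 * (parG n N * parD n N) := by
        calc _ < _ := hDq'
          _ ≤ _ := Nat.mul_le_mul_right _ h5
          _ = 4 * (parD n N * parQ n N * parD n N) := by ring
          _ ≤ _ := by gcongr
      have h7 : (4 * parG n N + 1).succ * parD n N =
          4 * (parG n N * parD n N) + 2 * parD n N := by rw [Nat.succ_eq_add_one]; ring
      omega
    -- The exponent is at most `4 * parG n N + 2`, which is at most `6 * parG n N`.
    have h2k : 2 ^ (parK n N + 1) ≤ M ^ 2 := by
      rw [hM, ← pow_mul]
      exact Nat.pow_le_pow_right (by omega) (by have : 1 ≤ parG n N := Nat.le_add_left 1 _; omega)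
    have hdom := domG_four_le (M := M) (W := 6 * n + 1 + 1 + parD' n N * parK n N) h8 (by omega)
    -- The number of tests; 98 is twice the square of 7, from `6 * n + 1 ≤ 7 * n`.
    have hH : n * ((6 * n + 1) * ((6 * n + 1) * 2)) ≤ 98 * (n * n * n) := by
      calc n * ((6 * n + 1) * ((6 * n + 1) * 2)) ≤ n * ((7 * n) * ((7 * n) * 2)) := by
            gcongr <;> omega
        _ = _ := by ring
    have hbig : domG (List.replicate (n * ((6 * n + 1) * ((6 * n + 1) * 2)) * parD n N)
        (parD' n N * parK n N)) ≤ M ^ 99 := by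
      refine (Nat.le_succ _).trans ((domG_replicate_le _ _).trans ?_)
      -- The base of the dominance cost is a power of `2 ^ log log N`, because ranks have at most `2
      -- * lgN N` bits.
      have hb : parD' n N * parK n N + 2 ≤ 2 ^ (3 * lgN (lgN N)) := by
        have := le_two_pow_lgN (lgN N)
        calc parD' n N * parK n N + 2 ≤ 4 * 2 ^ lgN (lgN N) := by omega
          _ = 2 ^ (2 + lgN (lgN N)) := by rw [pow_add]; norm_num
          _ ≤ _ := Nat.pow_le_pow_right (by omega) (by omega)
      have he : 3 * lgN (lgN N) * (n * ((6 * n + 1) * ((6 * n + 1) * 2)) * parD n N) ≤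
          3 * parG n N * 98 := by
        calc _ ≤ 3 * lgN (lgN N) * (98 * (n * n * n) * parD n N) := by gcongr
          _ = 3 * (parD n N * parQ n N) * 98 := by rw [parQ]; ring
          _ ≤ _ := by gcongr
      calc _ ≤ 2 * (2 ^ (3 * lgN (lgN N))) ^ (n * ((6 * n + 1) * ((6 * n + 1) * 2)) * parD n N) := by
            gcongr
        _ ≤ 2 * 2 ^ (3 * parG n N * 98) := by
            rw [← pow_mul]
            exact Nat.mul_le_mul_left _ (Nat.pow_le_pow_right (by omega) he)
        _ = 2 * M ^ 98 := by rw [pow_mul, ← hM]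
        _ ≤ M * M ^ 98 := by gcongr; omega
        _ = M ^ 99 := by ring
    have hstep : costStep (parD' n N * parK n N) (n + 1) (parD n N)
        (n * ((6 * n + 1) * ((6 * n + 1) * 2))) (parD' n N * parK n N)
        (List.replicate 4 (6 * n + 1 + 1 + parD' n N * parK n N)) ≤ M ^ 110 := by
      rw [costStep, costF, costG, propK]
      refine le_trans (b := 1000 + 15 * M + 4 * (15 * M + 60 * M + 150) +
        (M + M) * (15 * M + 60 * M + 200) +
        98 * M * ((M + M) * (2 * (500 * (M + M) * M ^ 10 + 60) + 61) + 30 * (M + M) + 10 * M + 270 +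
          ((M + M) * (2 * (500 * (M + M) * M ^ 10 + 60) + 61) + 30 * (M + M) + 80 * M +
            15 * M + 600) + 20) + 2 * (1000 * M ^ 99 + 50)) ?_ ?_
      · have := hH.trans (Nat.mul_le_mul_left 98 hn3)
        gcongr
      · refine le_trans (b := 8 ^ 7 * M ^ 99) ?_ ?_
        · have p : ∀ i ≤ 99, M ^ i ≤ M ^ 99 := fun i hi => Nat.pow_le_pow_right h1 hi
          have a0 := p 0 (by omega)
          have a1 := p 1 (by omega)
          have a2 := p 2 (by omega)
          have a3 := p 3 (by omega)
          have a4 := p 13 (by omega)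
          ring_nf at *
          omega
        · calc 8 ^ 7 * M ^ 99 ≤ M ^ 7 * M ^ 99 := by gcongr
            _ = M ^ 106 := by ring
            _ ≤ _ := Nat.pow_le_pow_right h1 (by omega)
    rw [costTree]
    calc _ ≤ M ^ 110 * M ^ 2 * N * (M + M) := by gcongr
      _ = N * (2 * M ^ 113) := by ring
      _ ≤ N * (M * M ^ 113) := by gcongr; omega
      _ = N * M ^ 114 := by ring
      _ ≤ _ := Nat.mul_le_mul_left N (Nat.pow_le_pow_right h1 (by omega))

theorem steps_le {n S N t : ℕ} (hn : 0 < n) (hS : 0 < S) (hN : N ≤ S)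
    (ht : t ≤ 20 * costSolve n S N + 1500 * S + 4000 * n + 5000) :
    t ≤ S * 2 ^ (420 * parG n S) := by
  have h1 := (costPrep_le hn N).trans (Nat.mul_le_mul (Nat.add_le_add_right hN 1)
    (Nat.pow_le_pow_right (by omega) (Nat.mul_le_mul_right 9 (Nat.mul_le_mul_left 3 (parG_mono hN)))))
  have h2 := (costSearch_le hn N).trans (Nat.mul_le_mul hN
    (Nat.pow_le_pow_right (by omega) (Nat.mul_le_mul_right 130
      (Nat.mul_le_mul_left 3 (parG_mono hN)))))
  obtain ⟨M, hM, h8, hn1, -⟩ := params_le hn S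
  rw [pow_mul, ← hM] at h1 h2
  rw [costSolve, costDecide] at ht
  -- 420 is three times `6 + 4 + 130`: the search takes `M ^ 130`, the numerical constants are below
  -- `8 ^ 6 ≤ M ^ 6`, and `M ^ 4` is slack.
  have e : 2 ^ (420 * parG n S) = M ^ 6 * (M ^ 4 * M ^ 130) := by
    rw [hM, ← pow_add, ← pow_add, ← pow_mul]; ring_nf
  have h9 : M ^ 9 ≤ M ^ 130 := Nat.pow_le_pow_right (by omega) (by omega)
  have h10 : M ≤ M ^ 130 := Nat.le_self_pow (by omega) M
  generalize M ^ 130 = X at *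
  have k1 : (S + 1) * M ^ 9 ≤ 2 * (S * X) := by nlinarith [Nat.mul_le_mul_left S h9]
  have k2 : S * n ≤ S * X := Nat.mul_le_mul_left S (by omega)
  have k3 : X ≤ S * X := Nat.le_mul_of_pos_left _ hS
  have k4 : S ≤ S * X := Nat.le_mul_of_pos_right _ (by omega)
  have : S * (360 * n + 400) = 360 * (S * n) + 400 * S := by ring
  have : t ≤ 8 ^ 6 * (S * X) := by omega
  rw [e]
  calc t ≤ 8 ^ 6 * (S * X) := this
    _ ≤ M ^ 6 * (S * (M ^ 4 * X)) := by
      gcongr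
      exact Nat.le_mul_of_pos_left _ (by positivity)
    _ = _ := by ring

/-! ### Asymptotics of the running time. -/

theorem one_lt_log {s : ℝ} (hs : 3 ≤ s) : 1 < Real.log s := by
  rw [Real.lt_log_iff_exp_lt (by linarith)]
  linarith [Real.exp_one_lt_d9]

theorem loglog_three_pos : 0 < Real.log (Real.log 3) := Real.log_pos (one_lt_log le_rfl)

theorem loglog_three_le {s : ℝ} (hs : 3 ≤ s) : Real.log (Real.log 3) ≤ Real.log (Real.log s) :=
  Real.log_le_log (by linarith [one_lt_log (le_refl (3 : ℝ))]) (Real.log_le_log (by norm_num) hs)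

theorem lgN_le (N : ℕ) (hN : 1 ≤ N) : (lgN N : ℝ) ≤ 2 * Real.log N + 2 := by
  have hN' : (1 : ℝ) ≤ N := by exact_mod_cast hN
  have h0 := Real.log_nonneg hN'
  have h2 : (0.5 : ℝ) < Real.log 2 := by linarith [Real.log_two_gt_d9]
  have h1 : Real.logb 2 N ≤ 2 * Real.log N := by
    rw [Real.logb, div_le_iff₀ (by linarith)]
    nlinarith
  have h3 : (Nat.clog 2 N : ℝ) < Real.logb 2 N + 1 := by
    rw [← Real.natCeil_logb_natCast 2 N]
    exact Nat.ceil_lt_add_one (Real.logb_nonneg (by norm_num) hN')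
  rw [lgN]
  push_cast
  linarith

/-- For `S ≥ 3` both `log S` and `log log S` are bounded below by positive constants, so additive
constants from rounding can be absorbed into factors. The constant `c` comes from `lgN (lgN S) ≤ 2
(log 4 + log log S) + 2`, where `2 log 4 + 2` is absorbed by means of `log log S ≥ κ`. -/
theorem exists_parG_le : ∃ C : ℝ, 0 < C ∧ ∀ n S : ℕ, 0 < n → 3 ≤ S →
    (parG n S : ℝ) ≤ C * √((n : ℝ) ^ 3 * Real.log S * Real.log (Real.log S)) := by
  have hκ := loglog_three_pos
  set κ := Real.log (Real.log 3)
  have h4 : 0 < Real.log 4 := Real.log_pos (by norm_num)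
  set c := (2 * Real.log 4 + 2) / κ + 2 with hc
  have hc0 : 0 < c := by positivity
  refine ⟨2 * √(4 * c), by positivity, fun n S hn hS => ?_⟩
  have hS' : (3 : ℝ) ≤ S := by exact_mod_cast hS
  have hl := one_lt_log hS'
  have hll := loglog_three_le hS'
  have hL : (lgN S : ℝ) ≤ 4 * Real.log S := by linarith [lgN_le S (by omega)]
  have hL1 : 1 ≤ lgN S := Nat.le_add_left 1 _
  have hl1 : 1 ≤ lgN (lgN S) := Nat.le_add_left 1 _
  have hLL : (lgN (lgN S) : ℝ) ≤ c * Real.log (Real.log S) := by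
    have h1 := lgN_le (lgN S) hL1
    have h2 : Real.log (lgN S) ≤ Real.log 4 + Real.log (Real.log S) := by
      rw [← Real.log_mul (by norm_num) (by linarith)]
      exact Real.log_le_log (by exact_mod_cast hL1) hL
    have h3 : 2 * Real.log 4 + 2 ≤ (2 * Real.log 4 + 2) / κ * Real.log (Real.log S) := by
      rw [div_mul_eq_mul_div, le_div_iff₀ hκ]
      exact mul_le_mul_of_nonneg_left hll (by positivity)
    rw [hc, add_mul]
    linarith
  have hq : 1 ≤ lgN S * parQ n S := Nat.mul_pos hL1 (by rw [parQ]; positivity)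
  have hX : (0 : ℝ) ≤ (n : ℝ) ^ 3 * Real.log S * Real.log (Real.log S) := by
    have : 0 ≤ Real.log (Real.log S) := hκ.le.trans hll
    positivity
  have h1 : ((lgN S * parQ n S : ℕ) : ℝ) ≤
      4 * c * ((n : ℝ) ^ 3 * Real.log S * Real.log (Real.log S)) := by
    rw [parQ]
    push_cast
    calc (lgN S : ℝ) * (n * n * n * lgN (lgN S)) = (n : ℝ) ^ 3 * (lgN S * lgN (lgN S)) := by ring
      _ ≤ (n : ℝ) ^ 3 * (4 * Real.log S * (c * Real.log (Real.log S))) := by gcongr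
      _ = _ := by ring
  have h2 : (1 : ℝ) ≤ √((lgN S * parQ n S : ℕ) : ℝ) :=
    Real.one_le_sqrt.2 (by exact_mod_cast hq)
  have h3 := Real.nat_sqrt_le_real_sqrt (a := lgN S * parQ n S)
  have h4 := Real.sqrt_le_sqrt h1
  rw [Real.sqrt_mul (by positivity)] at h4
  rw [parG]
  push_cast at *
  linarith

/-- The bound on the running time. -/
noncomputable def timeBound (C : ℝ) (n : ℕ) (S : ℕ) : ℝ :=
  S * (2 : ℝ) ^ (C * √((n : ℝ) ^ 3 * Real.log S * Real.log (Real.log S)))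

theorem exists_timeBound : ∃ C : ℝ, 0 < C ∧ ∀ n S N t : ℕ, 0 < n → 3 ≤ S → N ≤ S →
    t ≤ 20 * costSolve n S N + 1500 * S + 4000 * n + 5000 → (t : ℝ) ≤ timeBound C n S := by
  obtain ⟨C, hC, h⟩ := exists_parG_le
  refine ⟨420 * C, by positivity, fun n S N t hn hS hN ht => ?_⟩
  have h1 : (t : ℝ) ≤ S * (2 : ℝ) ^ (420 * parG n S) := by
    exact_mod_cast steps_le hn (by omega) hN ht
  refine h1.trans ?_
  rw [timeBound, ← Real.rpow_natCast]
  push_cast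
  rw [mul_assoc 420 C]
  gcongr
  · norm_num
  · exact h n S hn hS

/-- Multiplying the size by the constant `n + 1` raises its logarithm by at most the factor `a` and
its iterated logarithm by at most the factor `b`. The factor `n + 1` itself is a power of 2 whose
exponent is at most a multiple of `√X`, since `√X ≥ √κ > 0`. -/
theorem exists_timeBound_mul (C : ℝ) (hC : 0 < C) (n : ℕ) (hn : 0 < n) :
    ∃ K : ℝ, ∀ s : ℕ, 3 ≤ s → timeBound C n ((n + 1) * s) ≤ timeBound K n s := by
  have hκ := loglog_three_pos
  set κ := Real.log (Real.log 3) with hκ'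
  have hn' : (1 : ℝ) ≤ n := by exact_mod_cast hn
  have hm : 0 ≤ Real.log (n + 1) := Real.log_nonneg (by linarith)
  set a := 1 + Real.log (n + 1) with ha
  have ha1 : 1 ≤ a := by linarith
  have hla := Real.log_nonneg ha1
  set b := Real.log a / κ + 1 with hb
  have hb0 : 0 < b := by positivity
  have hmb : 0 ≤ Real.logb 2 (n + 1) := Real.logb_nonneg (by norm_num) (by linarith)
  refine ⟨Real.logb 2 (n + 1) / √κ + C * √(a * b), fun s hs => ?_⟩
  have hs' : (3 : ℝ) ≤ s := by exact_mod_cast hs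
  have hl := one_lt_log hs'
  have hll := loglog_three_le hs'
  rw [← hκ'] at hll
  have e : (((n + 1) * s : ℕ) : ℝ) = (n + 1) * s := by push_cast; ring
  have h1 : Real.log (((n + 1) * s : ℕ) : ℝ) ≤ a * Real.log s := by
    rw [e, Real.log_mul (by positivity) (by linarith), ha]
    nlinarith
  have h0 : (1 : ℝ) < Real.log (((n + 1) * s : ℕ) : ℝ) := one_lt_log (by rw [e]; nlinarith)
  have h2 : Real.log (Real.log (((n + 1) * s : ℕ) : ℝ)) ≤ b * Real.log (Real.log s) := by
    have h3 : Real.log a ≤ Real.log a / κ * Real.log (Real.log s) := by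
      rw [div_mul_eq_mul_div, le_div_iff₀ hκ]
      exact mul_le_mul_of_nonneg_left hll hla
    have := Real.log_le_log (by linarith) h1
    rw [Real.log_mul (by linarith) (by linarith)] at this
    rw [hb, add_mul (Real.log a / κ)]
    linarith
  set X := (n : ℝ) ^ 3 * Real.log s * Real.log (Real.log s) with hX
  have hX1 : √κ ≤ √X := by
    refine Real.sqrt_le_sqrt ?_
    have : 1 ≤ (n : ℝ) ^ 3 * Real.log s := one_le_mul_of_one_le_of_one_le (one_le_pow₀ hn') hl.le
    rw [hX]
    nlinarith
  have h3 : √((n : ℝ) ^ 3 * Real.log (((n + 1) * s : ℕ) : ℝ) *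
      Real.log (Real.log (((n + 1) * s : ℕ) : ℝ))) ≤ √(a * b) * √X := by
    rw [← Real.sqrt_mul (by positivity)]
    refine Real.sqrt_le_sqrt ?_
    calc _ ≤ (n : ℝ) ^ 3 * (a * Real.log s) * (b * Real.log (Real.log s)) := by
          gcongr
          exact (Real.log_pos h0).le
      _ = _ := by rw [hX]; ring
  have h4 : Real.logb 2 (n + 1) ≤ Real.logb 2 (n + 1) / √κ * √X := by
    rw [div_mul_eq_mul_div, le_div_iff₀ (Real.sqrt_pos.2 hκ)]
    exact mul_le_mul_of_nonneg_left hX1 hmb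
  have h5 : ((n : ℝ) + 1) = 2 ^ Real.logb 2 ((n : ℝ) + 1) :=
    (Real.rpow_logb (by norm_num) (by norm_num) (by linarith)).symm
  rw [timeBound, timeBound, ← hX, e, ← e]
  calc (((n + 1) * s : ℕ) : ℝ) * (2 : ℝ) ^ (C * √((n : ℝ) ^ 3 * Real.log (((n + 1) * s : ℕ) : ℝ) *
        Real.log (Real.log (((n + 1) * s : ℕ) : ℝ))))
      ≤ (((n + 1) * s : ℕ) : ℝ) * (2 : ℝ) ^ (C * (√(a * b) * √X)) := by gcongr; norm_num
    _ = s * (2 : ℝ) ^ (Real.logb 2 (n + 1) + C * (√(a * b) * √X)) := by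
      rw [Real.rpow_add (by norm_num), ← h5, e]
      ring
    _ ≤ _ := by
      gcongr
      · norm_num
      · linarith

/-- The exponent `o(1)` of the running time. -/
noncomputable def expo (C : ℝ) (n : ℕ) (s : ℕ) : ℝ :=
  C * Real.log 2 * √((n : ℝ) ^ 3 * Real.log s * Real.log (Real.log s)) / Real.log s

theorem timeBound_eq_rpow (C : ℝ) (n : ℕ) {s : ℕ} (hs : 3 ≤ s) :
    timeBound C n s = (s : ℝ) ^ (1 + expo C n s) := by
  have hs' : (3 : ℝ) ≤ s := by exact_mod_cast hs
  have hl := one_lt_log hs'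
  rw [timeBound, expo, Real.rpow_add (by linarith), Real.rpow_one,
    Real.rpow_def_of_pos (by linarith : (0 : ℝ) < s), Real.rpow_def_of_pos (by norm_num : (0 : ℝ) < 2),
    mul_div_cancel₀ _ (by linarith)]
  ring_nf

/-- The exponent is a constant times `√(ρ ^ 3)`, where `ρ` is the quotient of `d n` by `(log n / log
log n) ^ (1 / 3)`. The hypothesis says that `ρ` tends to 0. -/
theorem tendsto_expo (C : ℝ) (d : ℕ → ℕ)
    (h : (fun n : ℕ => (d n : ℝ)) =o[atTop] fun n : ℕ =>
      Real.log (n : ℝ) ^ (1 / 3 : ℝ) / Real.log (Real.log (n : ℝ)) ^ (1 / 3 : ℝ)) :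
    Tendsto (fun n => expo C (d n) n) atTop (𝓝 0) := by
  have h1 : Tendsto (fun n : ℕ => C * Real.log 2 * √(((d n : ℝ) / (Real.log (n : ℝ) ^ (1 / 3 : ℝ) /
      Real.log (Real.log (n : ℝ)) ^ (1 / 3 : ℝ))) ^ 3)) atTop (𝓝 0) := by
    simpa using ((h.tendsto_div_nhds_zero.pow 3).sqrt).const_mul (C * Real.log 2)
  refine h1.congr' ?_
  filter_upwards [eventually_ge_atTop 3] with s hs
  have hs' : (3 : ℝ) ≤ s := by exact_mod_cast hs
  have hl : 0 < Real.log s := by linarith [one_lt_log hs']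
  have hll : 0 < Real.log (Real.log s) := loglog_three_pos.trans_le (loglog_three_le hs')
  have e3 : ∀ x : ℝ, 0 < x → (x ^ (1 / 3 : ℝ)) ^ 3 = x := fun x hx => by
    rw [← Real.rpow_natCast, ← Real.rpow_mul hx.le]
    norm_num
  rw [expo, mul_div_assoc, div_pow, div_pow, e3 _ hl, e3 _ hll]
  congr 1
  have e : (d s : ℝ) ^ 3 * Real.log s * Real.log (Real.log s) =
      (d s : ℝ) ^ 3 / (Real.log s / Real.log (Real.log s)) * Real.log s ^ 2 := by field_simp
  rw [eq_div_iff hl.ne', e, Real.sqrt_mul (by positivity), Real.sqrt_sq hl.le]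

/-- The comparison function is the cube root of `x / log x` at `x = log n`, and this tends to
infinity. -/
theorem const_isLittleO (d : ℕ) :
    (fun _ : ℕ => (d : ℝ)) =o[atTop] fun n : ℕ =>
      Real.log (n : ℝ) ^ (1 / 3 : ℝ) / Real.log (Real.log (n : ℝ)) ^ (1 / 3 : ℝ) := by
  rw [isLittleO_const_left]
  right
  have h1 : Tendsto (fun n : ℕ => Real.log (n : ℝ)) atTop atTop :=
    Real.tendsto_log_atTop.comp tendsto_natCast_atTop_atTop
  have h2 : Tendsto (fun x : ℝ => (x / Real.log x) ^ (1 / 3 : ℝ)) atTop atTop := by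
    refine (tendsto_rpow_atTop (by norm_num)).comp ?_
    have := (Real.isLittleO_log_id_atTop.tendsto_div_nhds_zero)
    have h3 : Tendsto (fun x : ℝ => Real.log x / x) atTop (𝓝[>] 0) := by
      refine tendsto_nhdsWithin_iff.2 ⟨this, ?_⟩
      filter_upwards [eventually_gt_atTop 1] with x hx
      exact div_pos (Real.log_pos hx) (by linarith)
    refine h3.inv_tendsto_nhdsGT_zero.congr fun x => ?_
    simp
  refine tendsto_norm_atTop_atTop.comp ((h2.comp h1).congr' ?_)
  filter_upwards [eventually_ge_atTop 3] with s hs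
  have hs' : (3 : ℝ) ≤ s := by exact_mod_cast hs
  have hl : 0 < Real.log s := by linarith [one_lt_log hs']
  have hll : 0 < Real.log (Real.log s) := loglog_three_pos.trans_le (loglog_three_le hs')
  exact Real.div_rpow hl.le hll.le _

theorem decides_of_exec {A : Program} {σ : State} {Q : Prop} {z : Bool} {t : ℕ} {τ : State}
    (hz : z = true ↔ Q) (h : Exec A (.call 0) σ t τ) (hr : τ.ireg 0 = if z then 1 else 0) :
    Decides A σ Q := by
  refine ⟨t, τ, h, fun hQ => ?_, fun hQ => ?_⟩
  · rw [hr, hz.2 hQ]; rfl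
  · rw [hr, if_neg fun h => hQ (hz.1 h)]

end RealRAM

theorem mainTheorem1 :
    -- one algorithm for the chain problem, for all `Δ ≥ 1` and all point sets
    (∃ A : RealRAM.Program,
      (∀ (Δ : ℕ), 1 ≤ Δ → ∀ P : Fin (Δ + 1) → List (ℝ × ℝ),
        RealRAM.Decides A (RealRAM.pointSetsInput P) (AllChained P)) ∧
      -- time `n * 2 ^ O(√(Δ³ log n log log n))`, with an absolute constant
      (∃ C : ℝ, ∀ Δ : ℕ, 1 ≤ Δ → ∀ n : ℕ, 3 ≤ n →
        ∀ P : Fin (Δ + 1) → List (ℝ × ℝ), totalSize P = n →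
          RealRAM.HaltsWithin A (RealRAM.pointSetsInput P)
            ((n : ℝ) * (2 : ℝ) ^ (C * Real.sqrt
              ((Δ : ℝ) ^ 3 * Real.log (n : ℝ) * Real.log (Real.log (n : ℝ)))))) ∧
      -- for every constant `Δ` this is `n ^ (1 + o(1))`
      (∀ Δ : ℕ, 1 ≤ Δ → ∃ e : ℕ → ℝ, Tendsto e atTop (𝓝 0) ∧ ∀ n : ℕ, 3 ≤ n →
        ∀ P : Fin (Δ + 1) → List (ℝ × ℝ), totalSize P = n →
          RealRAM.HaltsWithin A (RealRAM.pointSetsInput P) ((n : ℝ) ^ (1 + e n))) ∧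
      -- and so it is whenever `Δ = o(log^{1/3} n / log^{1/3} log n)`
      (∀ Δ : ℕ → ℕ,
        ((fun n : ℕ => (Δ n : ℝ)) =o[atTop] fun n : ℕ =>
          Real.log (n : ℝ) ^ (1 / 3 : ℝ) / Real.log (Real.log (n : ℝ)) ^ (1 / 3 : ℝ)) →
        ∃ e : ℕ → ℝ, Tendsto e atTop (𝓝 0) ∧ ∀ n : ℕ, 3 ≤ n → 1 ≤ Δ n →
          ∀ P : Fin (Δ n + 1) → List (ℝ × ℝ), totalSize P = n →
            RealRAM.HaltsWithin A (RealRAM.pointSetsInput P) ((n : ℝ) ^ (1 + e n)))) ∧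
    -- deciding whether a unit-square graph has diameter at most `Δ`, in time `n ^ (1 + o(1))` for
    -- every constant `Δ`
    (∃ B : RealRAM.Program,
      (∀ (Δ : ℕ), 1 ≤ Δ → ∀ (n : ℕ) (c : Fin n → ℝ × ℝ),
        RealRAM.Decides B (RealRAM.squaresInput Δ c)
          ((unitSquareGraph c).ediam ≤ (Δ : ℕ∞))) ∧
      (∀ Δ : ℕ, 1 ≤ Δ → ∃ e : ℕ → ℝ, Tendsto e atTop (𝓝 0) ∧ ∀ n : ℕ, 3 ≤ n →
        ∀ c : Fin n → ℝ × ℝ,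
          RealRAM.HaltsWithin B (RealRAM.squaresInput Δ c) ((n : ℝ) ^ (1 + e n)))) := by
  obtain ⟨C, hC, hT⟩ := RealRAM.exists_timeBound
  have key : ∀ Δ : ℕ, 1 ≤ Δ → ∀ n : ℕ, 3 ≤ n → ∀ P : Fin (Δ + 1) → List (ℝ × ℝ), totalSize P = n →
      RealRAM.HaltsWithin RealRAM.progA (RealRAM.pointSetsInput P) (RealRAM.timeBound C Δ n) := by
    rintro Δ hΔ n hn P rfl
    obtain ⟨z, -, N, hN, t, τ, h1, h2, -⟩ := RealRAM.exec_progA hΔ P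
    exact ⟨t, τ, h1, hT Δ _ N t hΔ hn hN h2⟩
  have key' : ∀ Δ : ℕ → ℕ,
      ((fun n : ℕ => (Δ n : ℝ)) =o[atTop] fun n : ℕ =>
        Real.log (n : ℝ) ^ (1 / 3 : ℝ) / Real.log (Real.log (n : ℝ)) ^ (1 / 3 : ℝ)) →
      ∃ e : ℕ → ℝ, Tendsto e atTop (𝓝 0) ∧ ∀ n : ℕ, 3 ≤ n → 1 ≤ Δ n →
        ∀ P : Fin (Δ n + 1) → List (ℝ × ℝ), totalSize P = n →
          RealRAM.HaltsWithin RealRAM.progA (RealRAM.pointSetsInput P) ((n : ℝ) ^ (1 + e n)) := by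
    refine fun Δ h => ⟨_, RealRAM.tendsto_expo C Δ h, fun n hn hΔ P hP => ?_⟩
    rw [← RealRAM.timeBound_eq_rpow C (Δ n) hn]
    exact key (Δ n) hΔ n hn P hP
  refine ⟨⟨RealRAM.progA, fun Δ hΔ P => ?_, ⟨C, key⟩, fun Δ hΔ => ?_, key'⟩,
    ⟨RealRAM.progB, fun Δ hΔ n c => ?_, fun Δ hΔ => ?_⟩⟩
  · obtain ⟨z, hz, N, hN, t, τ, h1, h2, h3⟩ := RealRAM.exec_progA hΔ P
    exact RealRAM.decides_of_exec (hz.trans (RealRAM.chained_ofFn_iff P)) h1 h3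
  -- A fixed `Δ` is the case of a constant function.
  · obtain ⟨e, he, h⟩ := key' (fun _ => Δ) (RealRAM.const_isLittleO Δ)
    exact ⟨e, he, fun n hn P hP => h n hn hΔ P hP⟩
  · obtain ⟨z, hz, N, hN, t, τ, h1, h2, h3⟩ := RealRAM.exec_progB hΔ c
    exact RealRAM.decides_of_exec (hz.trans (RealRAM.chained_replicate_iff hΔ c)) h1 h3
  -- The program runs the chain algorithm on `Δ + 1` copies of the centres, so the bound at size `(Δ
  -- + 1) * n` is converted into one at size `n`.
  · obtain ⟨K, hK⟩ := RealRAM.exists_timeBound_mul C hC Δ hΔ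
    refine ⟨_, RealRAM.tendsto_expo K (fun _ => Δ) (RealRAM.const_isLittleO Δ), fun n hn c => ?_⟩
    obtain ⟨z, -, N, hN, t, τ, h1, h2, -⟩ := RealRAM.exec_progB hΔ c
    have hS : n ≤ (Δ + 1) * n := Nat.le_mul_of_pos_left _ (by omega)
    refine ⟨t, τ, h1, (hT Δ _ N t hΔ (hn.trans hS) hN (by omega)).trans ?_⟩
    rw [← RealRAM.timeBound_eq_rpow K Δ hn]
    exact hK n hn
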